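/- Let $d\ge 1$, let $a\in L^d(\mathbb R^d;\mathbb R^d)$ with $\operatorname{div} a=0$ in the sense of distributions, and consider the Cauchy problem for the incompressible Navier–Stokes equations $$u_t+u\cdot\nabla_x u-\Delta_x u+\nabla_x\pi=0,\qquad \operatorname{div}_x u=0,\qquad u(\cdot,0)=a .$$ For $0<T<\infty$, a solution in $L^{d+2}(\mathbb R^d\times(0,T))$ is a vector field $u\in L^{d+2}(\mathbb R^d\times(0,T);\mathbb R^d)$ that is divergence free in the sense of distributions and satisfies $$\int_0^T\!\!\int_{\mathbb R^d}\big(u\cdot(\varphi_t+\Delta_x\varphi)+u_iu_j\,\partial_{x_j}\varphi_i\big)\,dx\,dt+\int_{\mathbb R^d}a\cdot\varphi(\cdot,0)\,dx=0$$ (summation over repeated indices) for every smooth vector field $\varphi$ on $\mathbb R^d\times\mathbb R$ with $\operatorname{div}_x\varphi=0$ and with compact support in $\mathbb R^d\times(-\infty,T)$. Write $$\|f\|_{L^q_xL^p_t(0,\delta)}=\big\|\,\|f(\cdot,t)\|_{L^q(\mathbb R^d)}\big\|_{L^p_t(0,\delta)} .$$ For every positive integer $n$ and all $p\in[d+2,\infty]$,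 $q\in[d,d+2]$ with $2/p+d/q=1$ there is $\delta>0$, depending only on $d$, $n$, $q$ and the initial value $a$, such that for every $T\in(0,\infty)$ and every solution $u\in L^{d+2}(\mathbb R^d\times(0,T))$ with initial value $a$ the weak derivatives $\nabla_x^k u$, $0\le k\le n$, exist on $\mathbb R^d\times(0,\delta')$, where $\delta'=\min(\delta,T)$, and $$\sum_{k=0}^{n}\big\|t^{k/2}\nabla_x^k u\big\|_{L^q_xL^p_t(0,\delta')}<\infty .$$ -/

import Mathlib

open MeasureTheory Set
open scoped ENNReal ContDiff

noncomputable section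

namespace NavierStokes

/-- The Euclidean space `ℝ^d`. -/
abbrev E (d : ℕ) : Type := EuclideanSpace ℝ (Fin d)

/-- The space-time strip `(0,T) × ℝ^d`; points of space-time are written `(t, x)`. -/
def strip (d : ℕ) (T : ℝ) : Set (ℝ × E d) := Ioo 0 T ×ˢ univ

/-- The `j`-th coordinate direction of `ℝ^d`, seen in space-time. -/
def dir {d : ℕ} (j : Fin d) : ℝ × E d := (0, EuclideanSpace.single j 1)

/-- The classical spatial partial derivative `∂φ/∂x_j`. -/
def dx {d : ℕ} {F : Type*} [NormedAddCommGroup F] [NormedSpace ℝ F]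
    (j : Fin d) (φ : ℝ × E d → F) (z : ℝ × E d) : F :=
  fderiv ℝ φ z (dir j)

/-- The classical time derivative `∂φ/∂t`. -/
def dt {d : ℕ} {F : Type*} [NormedAddCommGroup F] [NormedSpace ℝ F]
    (φ : ℝ × E d → F) (z : ℝ × E d) : F :=
  fderiv ℝ φ z (1, 0)

/-- The classical spatial Laplacian. -/
def lap {d : ℕ} {F : Type*} [NormedAddCommGroup F] [NormedSpace ℝ F]
    (φ : ℝ × E d → F) (z : ℝ × E d) : F :=
  ∑ j, dx j (dx j φ) z

/-- The classical iterated spatial derivative `∂_{x_{α 0}} ⋯ ∂_{x_{α (k-1)}} φ`. -/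
def dxIter {d : ℕ} {F : Type*} [NormedAddCommGroup F] [NormedSpace ℝ F]
    {k : ℕ} (α : Fin k → Fin d) (φ : ℝ × E d → F) (z : ℝ × E d) : F :=
  iteratedFDeriv ℝ k φ z (fun l => dir (α l))

/-- Smooth compactly supported functions on a normed space `X` whose support lies in `Ω`. -/
structure IsTest {X F : Type*} [NormedAddCommGroup X] [NormedSpace ℝ X]
    [NormedAddCommGroup F] [NormedSpace ℝ F] (Ω : Set X) (φ : X → F) : Prop where
  smooth : ContDiff ℝ ∞ φ
  compact : HasCompactSupport φ
  supp : tsupport φ ⊆ Ω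

/-- `div a = 0` on `ℝ^d` in the sense of distributions. -/
def DivFree {d : ℕ} (a : E d → E d) : Prop :=
  ∀ ψ : E d → ℝ, IsTest univ ψ →
    ∫ x, ∑ j, a x j * fderiv ℝ ψ x (EuclideanSpace.single j 1) = 0

/-- `u ∈ L^{d+2}((0,T) × ℝ^d)` solves the Cauchy problem for the incompressible Navier-Stokes
equations on `(0,T)` with initial value `a`: `div u = 0` in the sense of distributions, and the
momentum equation with `u(·,0) = a` holds weakly, the pressure being eliminated by
divergence-free test fields (which need not vanish at `t = 0`). -/
structure IsSolution {d : ℕ} (T : ℝ) (a : E d → E d) (u : ℝ × E d → E d) : Prop where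
  memLp : MemLp u ((d : ℝ≥0∞) + 2) (volume.restrict (strip d T))
  div_free : ∀ ψ : ℝ × E d → ℝ, IsTest (strip d T) ψ →
    ∫ z in strip d T, ∑ j, u z j * dx j ψ z = 0
  momentum : ∀ φ : ℝ × E d → E d, IsTest (Iio T ×ˢ univ) φ →
    (∀ z, ∑ j, dx j φ z j = 0) →
    (∫ z in strip d T,
        (∑ i, u z i * (dt φ z i + lap φ z i) + ∑ i, ∑ j, u z i * u z j * dx j φ z i))
      + ∫ x, ∑ i, a x i * φ (0, x) i = 0

/-- `k`-th order spatial derivative tensors of a vector field, with the Euclidean norm: the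
component `(α, i)` stands for `∂_{x_{α 0}} ⋯ ∂_{x_{α (k-1)}} u_i`. -/
abbrev Tensor (d k : ℕ) : Type := EuclideanSpace ℝ ((Fin k → Fin d) × Fin d)

/-- `w` is the weak (distributional) spatial derivative `∇_x^k u` on `(0,δ) × ℝ^d`. -/
structure IsWeakGrad {d : ℕ} (δ : ℝ) (k : ℕ) (u : ℝ × E d → E d)
    (w : ℝ × E d → Tensor d k) : Prop where
  locInt : LocallyIntegrableOn w (strip d δ) volume
  eq : ∀ (α : Fin k → Fin d) (i : Fin d) (φ : ℝ × E d → ℝ), IsTest (strip d δ) φ →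
    ∫ z in strip d δ, u z i * dxIter α φ z
      = (-1) ^ k * ∫ z in strip d δ, w z (α, i) * φ z

/-- The mixed norm `‖f‖_{L_x^q(ℝ^d) L_t^p(0,δ)} = ‖ ‖f(t,·)‖_{L_x^q} ‖_{L_t^p(0,δ)}`. -/
def mixedNorm {d : ℕ} {F : Type*} [NormedAddCommGroup F] (q p : ℝ≥0∞) (δ : ℝ)
    (f : ℝ × E d → F) : ℝ≥0∞ :=
  eLpNorm (fun t : ℝ => eLpNorm (fun x : E d => f (t, x)) q volume) p
    (volume.restrict (Ioo 0 δ))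

end NavierStokes

end

noncomputable section

namespace NavierStokes

set_option maxSynthPendingDepth 3

/-! ### Tools for nonnegative integrals: weak-to-strong type, Minkowski, Young. -/

section

/-! The derivatives of a solution `u` are read off from its parabolic translates `v_ζ(t, x) = u(t, x
+ √t ζ)`. Formally, the `k`-th derivative of `ζ ↦ v_ζ` at `ζ = 0` is `t^{k/2} ∇^k u`. It therefore
suffices that `ζ ↦ v_ζ` is `n` times continuously differentiable at `0` with values in a space whose
norm controls every mixed norm in question. Pairing with test functions turns this into weak
derivatives (`weak_derivative_of_smooth_shift`).

Smoothness in `ζ` comes from the mild equation `u = e^{tΔ} a - D(u, u)`. The kernel of the Duhamel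
term `D` contains the Leray projection, and `(-Δ)⁻¹ e^{(t-s)Δ} = ∫_{t-s}^∞ e^{τΔ} dτ`, so it is an
integral over `τ > t - s` of third derivatives of the heat kernel at time `τ`. Shearing all
functions replaces a Gaussian derivative `f((x-y)/√τ)` by `f((x-y)/√τ + ρζ)` with `ρ = (√t -
√s)/√τ`, and `τ > t - s` forces `0 ≤ ρ ≤ 1` (`sqrt_sub_div_mem`, `bOp_shear`); for the heat term `ρ
= 1` (`aOp_shear`). Such a kernel is a fixed positive profile times a bounded symbol, and Gaussian
decay makes the symbol depend smoothly on `ζ` in the sup norm (`symbol_contDiff`). Hence `v_ζ`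
solves a quadratic equation whose coefficients are smooth in `ζ`, and the implicit function theorem
with its local uniqueness shows that `v_ζ` is smooth in `ζ` near `0` (`exists_smooth_solution`,
`exists_mild_solution`).

The equation is solved in `L^{d+2}` of the unit strip with the additional norm `ess sup t^{1/(d+2)}
‖u(t)‖_{L^{d+2}}`. The Oseen operator is bounded on the first part by a Hardy-Littlewood-Sobolev
inequality (`oseenOp_norm_spacetime_le`) and on the second by Young's inequality and a beta integral
(`oseenOp_norm_le`). The second part also makes the right-hand side land in `L^∞_t L^d_x`, so `v_ζ`
is smooth with values in `L^∞_t L^d_x ∩ L^{d+2}`, and interpolation reaches every admissible pair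
`(p, q)` (`mixedNorm_lt_top`). The implicit function theorem is applied near the zero datum, which
is allowed because the norm of the heat flow of `a`, cut off at time `δ`, can be made arbitrarily
small (`heatCut_small`). This is where the lifespan is chosen.

It remains to see that an arbitrary weak solution is the one constructed. Testing with `Δψ e_i -
∇∂_iψ` eliminates the pressure (`IsSolution.scalar_weak`). Inserting translates of `ψ` and averaging
them with Gaussian weights inverts both the heat operator and the extra Laplacian, which gives the
mild equation almost everywhere (`mild_of_weak`). Mild solutions in `L^{d+2}` are unique, by
absorption on short time intervals (`mild_unique`). For `d = 1` a divergence-free field in `L^3`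
vanishes, and that case is separate. -/

theorem lintegral_Ioi_indicator_rpow {a : ℝ} (ha : 0 < a) (x : ℝ≥0∞) :
    ∫⁻ l in Ioi (0 : ℝ), {l : ℝ | ENNReal.ofReal l < x}.indicator
      (fun l => ENNReal.ofReal (a * l ^ (a - 1))) l = x ^ a := by
  have hms : ∀ x : ℝ≥0∞, MeasurableSet {l : ℝ | ENNReal.ofReal l < x} := fun x =>
    measurableSet_lt ENNReal.measurable_ofReal measurable_const
  have key : ∀ r : ℝ, 0 ≤ r → ∫⁻ l in Ioi (0 : ℝ), {l : ℝ | ENNReal.ofReal l < ENNReal.ofReal r}.indicator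
      (fun l => ENNReal.ofReal (a * l ^ (a - 1))) l = ENNReal.ofReal r ^ a := by
    intro r hr
    rw [lintegral_indicator (hms _), Measure.restrict_restrict (hms _)]
    have hset : {l : ℝ | ENNReal.ofReal l < ENNReal.ofReal r} ∩ Ioi 0 = Ioo 0 r := by
      ext l
      simp only [mem_inter_iff, mem_ofPred_eq, mem_Ioi, mem_Ioo]
      constructor
      · rintro ⟨h1, h2⟩
        exact ⟨h2, by
          by_contra hc
          exact absurd h1 (not_lt.2 (ENNReal.ofReal_le_ofReal (not_lt.1 hc)))⟩
      · rintro ⟨h1, h2⟩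
        exact ⟨(ENNReal.ofReal_lt_ofReal_iff (h1.trans h2)).2 h2, h1⟩
    have hint : IntervalIntegrable (fun l : ℝ => a * l ^ (a - 1)) volume 0 r :=
      (intervalIntegral.intervalIntegrable_rpow' (by linarith)).const_mul a
    rw [hset, ← ofReal_integral_eq_lintegral_ofReal]
    · rw [← integral_Ioc_eq_integral_Ioo, ← intervalIntegral.integral_of_le hr,
        intervalIntegral.integral_const_mul, integral_rpow (Or.inl (by linarith)),
        ENNReal.ofReal_rpow_of_nonneg hr ha.le]
      congr 1
      rw [sub_add_cancel, Real.zero_rpow ha.ne']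
      field_simp
      ring
    · rw [intervalIntegrable_iff_integrableOn_Ioo_of_le hr] at hint
      exact hint
    · refine (ae_restrict_mem measurableSet_Ioo).mono fun l hl => ?_
      have := Real.rpow_nonneg hl.1.le (a - 1)
      positivity
  rcases eq_or_ne x ⊤ with rfl | hx
  · rw [ENNReal.top_rpow_of_pos ha]
    refine ENNReal.eq_top_of_forall_nnreal_le fun r => ?_
    have h2 : (r : ℝ≥0∞) = ENNReal.ofReal ((r : ℝ) ^ (1 / a)) ^ a := by
      rw [ENNReal.ofReal_rpow_of_nonneg (by positivity) ha.le, ← Real.rpow_mul r.coe_nonneg, one_div_mul_cancel ha.ne', Real.rpow_one,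
        ENNReal.ofReal_coe_nnreal]
    rw [h2, ← key _ (by positivity)]
    refine lintegral_mono fun l => indicator_le_indicator_of_subset ?_ (fun _ => bot_le) l
    intro l hl
    simp
  · rw [← ENNReal.ofReal_toReal hx]
    exact key _ ENNReal.toReal_nonneg

/-- A weak-type estimate on all levels implies a strong-type estimate. -/
theorem lintegral_rpow_le_of_weak {Z Y : Type*} [MeasurableSpace Z] [MeasurableSpace Y]
    {ν : Measure Z} {κ : Measure Y} [SFinite ν] [SFinite κ] {V : Z → ℝ≥0∞} {f : Y → ℝ≥0∞}
    (hV : Measurable V) (hf : Measurable f) {n β γ c : ℝ} {K : ℝ≥0∞} (hn : 0 < n) (hβ : β < n)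
    (hγ : 0 < γ) (hc : 0 < c)
    (h : ∀ l : ℝ, 0 < l → ν {z | ENNReal.ofReal l < V z} ≤
      K * ENNReal.ofReal (l ^ (-β)) * ∫⁻ y in {y | ENNReal.ofReal (c * l ^ γ) < f y}, f y ∂κ) :
    ∫⁻ z, V z ^ n ∂ν ≤ ENNReal.ofReal (n / (n - β)) * ENNReal.ofReal c⁻¹ ^ ((n - β) / γ) * K *
      ∫⁻ y, f y ^ (1 + (n - β) / γ) ∂κ := by
  have hnβ : 0 < n - β := by linarith
  have hms : MeasurableSet {p : Z × ℝ | ENNReal.ofReal p.2 < V p.1} :=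
    measurableSet_lt (by fun_prop) (by fun_prop)
  have hms2 : MeasurableSet {p : ℝ × Y | ENNReal.ofReal (c * p.1 ^ γ) < f p.2} :=
    measurableSet_lt (by fun_prop) (by fun_prop)
  -- Layer cake for `V`, the weak bound on every level, then Tonelli: for fixed `y` the levels run
  -- up to `(f y / c)^{1/γ}` and contribute the power `(n - β)/γ` of `f y`. Since the hypothesis
  -- integrates `f` only where it is large, no interpolation between two endpoints is needed.
  calc ∫⁻ z, V z ^ n ∂ν
      = ∫⁻ z, (∫⁻ l in Ioi (0 : ℝ), {l : ℝ | ENNReal.ofReal l < V z}.indicator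
        (fun l => ENNReal.ofReal (n * l ^ (n - 1))) l) ∂ν := by
        simp_rw [lintegral_Ioi_indicator_rpow hn]
    _ = ∫⁻ l in Ioi (0 : ℝ), ∫⁻ z, {l : ℝ | ENNReal.ofReal l < V z}.indicator
        (fun l => ENNReal.ofReal (n * l ^ (n - 1))) l ∂ν := by
        apply lintegral_lintegral_swap
        refine Measurable.aemeasurable ?_
        have : (Function.uncurry fun (z : Z) (l : ℝ) => {l : ℝ | ENNReal.ofReal l < V z}.indicator
            (fun l => ENNReal.ofReal (n * l ^ (n - 1))) l) =
            {p : Z × ℝ | ENNReal.ofReal p.2 < V p.1}.indicator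
              (fun p => ENNReal.ofReal (n * p.2 ^ (n - 1))) := by
          ext ⟨z, l⟩; simp [indicator]
        rw [this]
        exact Measurable.indicator (by fun_prop) hms
    _ = ∫⁻ l in Ioi (0 : ℝ), ENNReal.ofReal (n * l ^ (n - 1)) * ν {z | ENNReal.ofReal l < V z} := by
        refine lintegral_congr fun l => ?_
        rw [← lintegral_indicator_const (measurableSet_lt measurable_const hV)]
        refine lintegral_congr fun z => ?_
        simp [indicator]
    _ ≤ ∫⁻ l in Ioi (0 : ℝ), K * ∫⁻ y, f y * (ENNReal.ofReal (n / (n - β)) *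
          {l : ℝ | ENNReal.ofReal (c * l ^ γ) < f y}.indicator
            (fun l => ENNReal.ofReal ((n - β) * l ^ (n - β - 1))) l) ∂κ := by
        refine setLIntegral_mono' measurableSet_Ioi fun l hl => ?_
        have hl : 0 < l := hl
        have hsl : MeasurableSet {y | ENNReal.ofReal (c * l ^ γ) < f y} :=
          measurableSet_lt measurable_const hf
        calc _ ≤ ENNReal.ofReal (n * l ^ (n - 1)) * (K * ENNReal.ofReal (l ^ (-β)) *
              ∫⁻ y in {y | ENNReal.ofReal (c * l ^ γ) < f y}, f y ∂κ) := by gcongr; exact h l hl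
          _ = K * ∫⁻ y in {y | ENNReal.ofReal (c * l ^ γ) < f y},
                ENNReal.ofReal (n / (n - β) * ((n - β) * l ^ (n - β - 1))) * f y ∂κ := by
              rw [lintegral_const_mul _ hf]
              have : n / (n - β) * ((n - β) * l ^ (n - β - 1)) = n * l ^ (n - 1) * l ^ (-β) := by
                rw [mul_assoc n, ← Real.rpow_add hl]
                field_simp
                congr 1; ring
              rw [this, ENNReal.ofReal_mul (by positivity : 0 ≤ n * l ^ (n - 1))]
              ring
          _ = _ := by
              rw [← lintegral_indicator hsl]
              congr 1
              refine lintegral_congr fun y => ?_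
              by_cases hy : ENNReal.ofReal (c * l ^ γ) < f y
              · simp only [indicator, mem_ofPred_eq, hy, if_true]
                rw [ENNReal.ofReal_mul (by positivity)]
                ring
              · simp [indicator, hy]
    _ = K * ∫⁻ l in Ioi (0 : ℝ), ∫⁻ y, f y * (ENNReal.ofReal (n / (n - β)) *
          {l : ℝ | ENNReal.ofReal (c * l ^ γ) < f y}.indicator
            (fun l => ENNReal.ofReal ((n - β) * l ^ (n - β - 1))) l) ∂κ := by
        apply lintegral_const_mul
        refine Measurable.lintegral_prod_right' (f := fun p : ℝ × Y => f p.2 *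
          (ENNReal.ofReal (n / (n - β)) * {l : ℝ | ENNReal.ofReal (c * l ^ γ) < f p.2}.indicator
            (fun l => ENNReal.ofReal ((n - β) * l ^ (n - β - 1))) p.1)) ?_
        refine (hf.comp measurable_snd).mul (Measurable.const_mul ?_ _)
        have := Measurable.indicator (f := fun p : ℝ × Y => ENNReal.ofReal ((n - β) * p.1 ^ (n - β - 1)))
          (by fun_prop) hms2
        convert this using 1
        ext p; simp [indicator]
    _ = K * ∫⁻ y, (∫⁻ l in Ioi (0 : ℝ), f y * (ENNReal.ofReal (n / (n - β)) *
          {l : ℝ | ENNReal.ofReal (c * l ^ γ) < f y}.indicator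
            (fun l => ENNReal.ofReal ((n - β) * l ^ (n - β - 1))) l)) ∂κ := by
        rw [lintegral_lintegral_swap]
        refine Measurable.aemeasurable ?_
        refine Measurable.mul (hf.comp measurable_snd) (Measurable.const_mul ?_ _)
        have := Measurable.indicator (f := fun p : ℝ × Y => ENNReal.ofReal ((n - β) * p.1 ^ (n - β - 1)))
          (by fun_prop) hms2
        convert this using 1
        ext p; simp [indicator]
    _ = K * ∫⁻ y, ENNReal.ofReal (n / (n - β)) * ENNReal.ofReal c⁻¹ ^ ((n - β) / γ) *
          f y ^ (1 + (n - β) / γ) ∂κ := by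
        congr 1
        refine lintegral_congr fun y => ?_
        have hset : {l : ℝ | ENNReal.ofReal (c * l ^ γ) < f y} ∩ Ioi 0 =
            {l : ℝ | ENNReal.ofReal l < (ENNReal.ofReal c⁻¹ * f y) ^ (1 / γ)} ∩ Ioi 0 := by
          ext l
          simp only [mem_inter_iff, mem_ofPred_eq, mem_Ioi, and_congr_left_iff]
          intro hl
          have e1 : ENNReal.ofReal l = (ENNReal.ofReal (l ^ γ)) ^ (1 / γ) := by
            rw [ENNReal.ofReal_rpow_of_nonneg (by positivity) (by positivity), ← Real.rpow_mul hl.le,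
              mul_one_div_cancel hγ.ne', Real.rpow_one]
          rw [e1, ENNReal.rpow_lt_rpow_iff (by positivity), ENNReal.ofReal_mul hc.le,
            ENNReal.ofReal_inv_of_pos hc, mul_comm (ENNReal.ofReal c)⁻¹, ← div_eq_mul_inv,
            ENNReal.lt_div_iff_mul_lt (by simp [hc]) (by simp), mul_comm]
        have hind : ∀ (s t : Set ℝ) (φ : ℝ → ℝ≥0∞), MeasurableSet s → MeasurableSet t →
            s ∩ Ioi 0 = t ∩ Ioi 0 →
            ∫⁻ l in Ioi (0 : ℝ), s.indicator φ l = ∫⁻ l in Ioi (0 : ℝ), t.indicator φ l := by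
          intro s t φ hs ht hst
          rw [lintegral_indicator hs, lintegral_indicator ht, Measure.restrict_restrict hs,
            Measure.restrict_restrict ht, hst]
        have hsm : MeasurableSet {l : ℝ | ENNReal.ofReal (c * l ^ γ) < f y} :=
          measurableSet_lt (by fun_prop) measurable_const
        have hmi : Measurable ({l : ℝ | ENNReal.ofReal (c * l ^ γ) < f y}.indicator
            (fun l => ENNReal.ofReal ((n - β) * l ^ (n - β - 1)))) :=
          Measurable.indicator (by fun_prop) hsm
        rw [lintegral_const_mul _ (hmi.const_mul _), lintegral_const_mul _ hmi,
          hind _ _ _ hsm (measurableSet_lt ENNReal.measurable_ofReal measurable_const) hset,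
          lintegral_Ioi_indicator_rpow hnβ, ← ENNReal.rpow_mul,
          ENNReal.mul_rpow_of_nonneg _ _ (by positivity)]
        have e : 1 / γ * (n - β) = (n - β) / γ := by ring
        have hp : 0 < (n - β) / γ := by positivity
        rw [e]
        have : f y ^ (1 + (n - β) / γ) = f y * f y ^ ((n - β) / γ) := by
          rw [ENNReal.rpow_add_of_nonneg _ _ zero_le_one hp.le, ENNReal.rpow_one]
        rw [this]; ring
    _ = _ := by
        rw [lintegral_const_mul _ (by fun_prop)]
        ring

/-- **Minkowski's integral inequality**. -/
theorem lintegral_minkowski {Z Y : Type*} [MeasurableSpace Z] [MeasurableSpace Y]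
    {ν : Measure Z} {κ : Measure Y} [SigmaFinite ν] [SFinite κ] {F : Y → Z → ℝ≥0∞}
    (hF : Measurable (Function.uncurry F)) {q : ℝ} (hq : 1 ≤ q) :
    (∫⁻ z, (∫⁻ y, F y z ∂κ) ^ q ∂ν) ^ (1 / q) ≤ ∫⁻ y, (∫⁻ z, F y z ^ q ∂ν) ^ (1 / q) ∂κ := by
  have hq0 : 0 < q := by linarith
  rcases eq_or_lt_of_le hq with rfl | hq1
  · simp only [ENNReal.rpow_one, div_one]
    rw [lintegral_lintegral_swap]
    exact (hF.comp measurable_swap).aemeasurable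
  set h : Z → ℝ≥0∞ := fun z => ∫⁻ y, F y z ∂κ with hh
  have hmeas : Measurable h := Measurable.lintegral_prod_right' (f := fun p : Z × Y => F p.2 p.1)
    (hF.comp measurable_swap)
  set R : ℝ≥0∞ := ∫⁻ y, (∫⁻ z, F y z ^ q ∂ν) ^ (1 / q) ∂κ with hR
  -- Truncating in height and in space makes `∫ g^q` finite, which is what allows the division
  -- below.
  let g : ℕ → Z → ℝ≥0∞ := fun n => (spanningSets ν n).indicator fun z => min (h z) n
  have hgm : ∀ n, Measurable (g n) := fun n =>
    (hmeas.min measurable_const).indicator (measurableSet_spanningSets ν n)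
  have hgh : ∀ n z, g n z ≤ h z := fun n z => by
    by_cases hz : z ∈ spanningSets ν n <;> simp [g, hz]
  have hconj : q.HolderConjugate (q / (q - 1)) := Real.HolderConjugate.conjExponent hq1
  have hbound : ∀ n, (∫⁻ z, g n z ^ q ∂ν) ≤ R ^ q := by
    intro n
    have hfin : ∫⁻ z, g n z ^ q ∂ν ≠ ⊤ := by
      have : ∀ z, g n z ^ q ≤ (spanningSets ν n).indicator (fun _ => (n : ℝ≥0∞) ^ q) z := by
        intro z
        by_cases hz : z ∈ spanningSets ν n
        · simp only [g, indicator_of_mem hz]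
          gcongr; exact min_le_right _ _
        · simp [g, hz, hq0]
      refine ne_top_of_le_ne_top ?_ (lintegral_mono this)
      rw [lintegral_indicator_const (measurableSet_spanningSets ν n)]
      exact ENNReal.mul_ne_top (ENNReal.rpow_ne_top_of_nonneg hq0.le (by simp))
        (measure_spanningSets_lt_top ν n).ne
    set G := ∫⁻ z, g n z ^ q ∂ν with hG
    -- Duality in disguise: write `g^q ≤ g^{q-1} h`, exchange the integrals, and apply Hölder in `z`
    -- for each `y`.
    have step : G ≤ G ^ (1 - 1 / q) * R := by
      calc G ≤ ∫⁻ z, g n z ^ (q - 1) * h z ∂ν := by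
            refine lintegral_mono fun z => ?_
            have : g n z ^ q = g n z ^ (q - 1) * g n z := by
              conv_lhs => rw [show q = (q - 1) + 1 by ring]
              rw [ENNReal.rpow_add_of_nonneg _ _ (by linarith) zero_le_one, ENNReal.rpow_one]
            simp only
            rw [this]
            gcongr; exact hgh n z
        _ = ∫⁻ z, ∫⁻ y, g n z ^ (q - 1) * F y z ∂κ ∂ν := by
            refine lintegral_congr fun z => ?_
            rw [lintegral_const_mul]
            exact hF.comp measurable_prodMk_right
        _ = ∫⁻ y, ∫⁻ z, g n z ^ (q - 1) * F y z ∂ν ∂κ := by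
            rw [lintegral_lintegral_swap]
            refine Measurable.aemeasurable ?_
            exact (((hgm n).comp measurable_fst).pow_const _).mul (hF.comp measurable_swap)
        _ ≤ ∫⁻ y, G ^ (1 - 1 / q) * (∫⁻ z, F y z ^ q ∂ν) ^ (1 / q) ∂κ := by
            refine lintegral_mono fun y => ?_
            have := ENNReal.lintegral_mul_le_Lp_mul_Lq ν hconj.symm
              (f := fun z => g n z ^ (q - 1)) (g := F y) ((hgm n).pow_const _).aemeasurable
              (hF.comp measurable_prodMk_left).aemeasurable
            refine this.trans (le_of_eq ?_)
            congr 1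
            rw [hG]
            congr 1
            · refine lintegral_congr fun z => ?_
              rw [← ENNReal.rpow_mul]
              congr 1
              field_simp [(by linarith : q - 1 ≠ 0)]
            · rw [one_div_div]; field_simp
        _ = G ^ (1 - 1 / q) * R := by
            rw [hR, lintegral_const_mul]
            exact Measurable.pow_const (Measurable.lintegral_prod_right'
              (f := fun p : Y × Z => F p.1 p.2 ^ q) (hF.pow_const _)) _
    rcases eq_or_ne G 0 with h0 | h0
    · rw [h0]; exact bot_le
    have e : G = G ^ (1 - 1 / q) * G ^ (1 / q) := by
      rw [← ENNReal.rpow_add _ _ h0 hfin]; simp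
    have hle : G ^ (1 / q) ≤ R := by
      have h1 : G ^ (1 - 1 / q) ≠ 0 := by simp [h0, hfin]
      have h2 : G ^ (1 - 1 / q) ≠ ⊤ := ENNReal.rpow_ne_top_of_nonneg
        (by rw [sub_nonneg, div_le_one hq0]; exact hq) hfin
      rw [e] at step
      rw [← e] at step
      have step' : G ^ (1 - 1 / q) * G ^ (1 / q) ≤ G ^ (1 - 1 / q) * R := e ▸ step
      exact (ENNReal.mul_le_mul_iff_right h1 h2).1 step'
    calc G = (G ^ (1 / q)) ^ q := by rw [← ENNReal.rpow_mul, one_div_mul_cancel hq0.ne', ENNReal.rpow_one]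
      _ ≤ R ^ q := by gcongr
  have hlim : ∫⁻ z, h z ^ q ∂ν = ⨆ n, ∫⁻ z, g n z ^ q ∂ν := by
    rw [← lintegral_iSup (fun n => (hgm n).pow_const q)]
    · refine lintegral_congr fun z => ?_
      refine le_antisymm ?_ (iSup_le fun n => by gcongr; exact hgh n z)
      obtain ⟨n0, hn0⟩ := mem_iUnion.1 ((iUnion_spanningSets ν).symm ▸ mem_univ z)
      have hsup : h z ≤ ⨆ n, g n z := by
        refine le_of_forall_lt fun c hc => ?_
        obtain ⟨m, hm⟩ := ENNReal.exists_nat_gt (ne_top_of_lt hc)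
        refine lt_of_lt_of_le ?_ (le_iSup (fun n => g n z) (max n0 m))
        have : z ∈ spanningSets ν (max n0 m) := monotone_spanningSets ν (le_max_left _ _) hn0
        simp only [g, indicator_of_mem this, lt_min_iff]
        exact ⟨hc, hm.trans_le (by exact_mod_cast le_max_right _ _)⟩
      calc h z ^ q ≤ (⨆ n, g n z) ^ q := by gcongr
        _ = ⨆ n, g n z ^ q := by
            exact (ENNReal.orderIsoRpow q hq0).map_iSup (fun n => g n z)
    · intro i j hij z
      simp only
      gcongr
      by_cases hz : z ∈ spanningSets ν i
      · have hz' := monotone_spanningSets ν hij hz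
        simp only [g, indicator_of_mem hz, indicator_of_mem hz']
        exact min_le_min le_rfl (by exact_mod_cast hij)
      · simp [g, hz]
  rw [hlim]
  calc _ ≤ (R ^ q) ^ (1 / q) := by gcongr; exact iSup_le hbound
    _ = R := by rw [← ENNReal.rpow_mul, mul_one_div_cancel hq0.ne', ENNReal.rpow_one]

/-- **Young's convolution inequality** for nonnegative functions. -/
theorem lintegral_young {G : Type*} [NormedAddCommGroup G] [MeasurableSpace G] [BorelSpace G]
    [SecondCountableTopology G]
    {μ : Measure G} [SFinite μ] [μ.IsAddLeftInvariant] [μ.IsNegInvariant]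
    {k f : G → ℝ≥0∞} (hk : Measurable k) (hf : Measurable f) {p q r : ℝ}
    (hp : 0 < p) (hr : 0 < r) (hpq : p ≤ q) (hrq : r ≤ q) (hpqr : 1 + 1 / q = 1 / p + 1 / r) :
    (∫⁻ x, (∫⁻ y, k (x - y) * f y ∂μ) ^ q ∂μ) ^ (1 / q) ≤
      (∫⁻ x, k x ^ r ∂μ) ^ (1 / r) * (∫⁻ x, f x ^ p ∂μ) ^ (1 / p) := by
  have hq : 0 < q := hp.trans_le hpq
  have e1 : 0 ≤ 1 / r - 1 / q := sub_nonneg.2 (one_div_le_one_div_of_le hr hrq)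
  have e2 : 0 ≤ 1 / p - 1 / q := sub_nonneg.2 (one_div_le_one_div_of_le hp hpq)
  set K := ∫⁻ x, k x ^ r ∂μ
  set Φ := ∫⁻ x, f x ^ p ∂μ
  have hsub : ∀ x, ∫⁻ y, k (x - y) ^ r ∂μ = K := fun x =>
    lintegral_sub_left_eq_self (fun y => k y ^ r) x
  have pw : ∀ x, (∫⁻ y, k (x - y) * f y ∂μ) ^ q ≤
      (∫⁻ y, k (x - y) ^ r * f y ^ p ∂μ) * (K ^ (q / r - 1) * Φ ^ (q / p - 1)) := by
    intro x
    have hkx : Measurable fun y => k (x - y) := hk.comp (by fun_prop)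
    -- Hölder with three factors `k^r f^p`, `k^r`, `f^p` and exponents `1/q`, `1/r - 1/q`, `1/p -
    -- 1/q`; these sum to one exactly by `hpqr`. Only the first factor still couples `x` and `y`
    -- after integration.
    have := ENNReal.lintegral_prod_norm_pow_le (μ := μ) (Finset.univ : Finset (Fin 3))
      (f := ![fun y => k (x - y) ^ r * f y ^ p, fun y => k (x - y) ^ r, fun y => f y ^ p])
      (p := ![1 / q, 1 / r - 1 / q, 1 / p - 1 / q])
      (by
        intro i _
        fin_cases i
        · exact ((hkx.pow_const _).mul (hf.pow_const _)).aemeasurable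
        · exact (hkx.pow_const _).aemeasurable
        · exact (hf.pow_const _).aemeasurable)
      (by simp [Fin.sum_univ_three]; simp at hpqr; linarith)
      (by
        intro i _
        fin_cases i
        · simp; positivity
        · simpa using e1
        · simpa using e2)
    simp only [Fin.prod_univ_three, Matrix.cons_val_zero, Matrix.cons_val_one, Matrix.cons_val] at this
    have hle : ∀ y, k (x - y) * f y ≤ (k (x - y) ^ r * f y ^ p) ^ (1 / q) *
        (k (x - y) ^ r) ^ (1 / r - 1 / q) * (f y ^ p) ^ (1 / p - 1 / q) := by
      intro y
      rw [ENNReal.mul_rpow_of_nonneg _ _ (by positivity)]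
      simp only [← ENNReal.rpow_mul]
      have a1 : k (x - y) ^ (r * (1 / q)) * k (x - y) ^ (r * (1 / r - 1 / q)) = k (x - y) := by
        rw [← ENNReal.rpow_add_of_nonneg _ _ (by positivity) (by positivity)]
        have : r * (1 / q) + r * (1 / r - 1 / q) = 1 := by field_simp; ring
        rw [this, ENNReal.rpow_one]
      have a2 : f y ^ (p * (1 / q)) * f y ^ (p * (1 / p - 1 / q)) = f y := by
        rw [← ENNReal.rpow_add_of_nonneg _ _ (by positivity) (by positivity)]
        have : p * (1 / q) + p * (1 / p - 1 / q) = 1 := by field_simp; ring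
        rw [this, ENNReal.rpow_one]
      refine le_of_eq ?_
      conv_lhs => rw [← a1, ← a2]
      ring
    rw [hsub x] at this
    calc (∫⁻ y, k (x - y) * f y ∂μ) ^ q
        ≤ ((∫⁻ y, k (x - y) ^ r * f y ^ p ∂μ) ^ (1 / q) * K ^ (1 / r - 1 / q) *
            Φ ^ (1 / p - 1 / q)) ^ q := by
          gcongr
          exact (lintegral_mono hle).trans this
      _ = _ := by
          rw [ENNReal.mul_rpow_of_nonneg _ _ hq.le, ENNReal.mul_rpow_of_nonneg _ _ hq.le,
            ← ENNReal.rpow_mul, ← ENNReal.rpow_mul, ← ENNReal.rpow_mul, one_div_mul_cancel hq.ne',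
            ENNReal.rpow_one, mul_assoc]
          congr 3 <;> field_simp
  have hA : ∫⁻ x, ∫⁻ y, k (x - y) ^ r * f y ^ p ∂μ ∂μ = K * Φ := by
    rw [lintegral_lintegral_swap]
    · calc ∫⁻ y, ∫⁻ x, k (x - y) ^ r * f y ^ p ∂μ ∂μ = ∫⁻ y, K * f y ^ p ∂μ := by
            refine lintegral_congr fun y => ?_
            have hm : Measurable fun x => k (x - y) ^ r :=
              (hk.comp (measurable_id.sub_const y)).pow_const _
            rw [lintegral_mul_const _ hm]
            congr 1
            exact lintegral_sub_right_eq_self (fun x => k x ^ r) y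
        _ = _ := lintegral_const_mul _ (hf.pow_const _)
    · refine Measurable.aemeasurable ?_
      exact ((hk.comp (measurable_fst.sub measurable_snd)).pow_const _).mul
        ((hf.comp measurable_snd).pow_const _)
  calc _ ≤ (∫⁻ x, (∫⁻ y, k (x - y) ^ r * f y ^ p ∂μ) * (K ^ (q / r - 1) * Φ ^ (q / p - 1)) ∂μ) ^ (1 / q) := by
        gcongr; exact pw _
    _ = (K ^ (q / r) * Φ ^ (q / p)) ^ (1 / q) := by
        rw [lintegral_mul_const, hA]
        · congr 1
          have hr1 : 0 ≤ q / r - 1 := by rw [sub_nonneg, le_div_iff₀ hr]; linarith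
          have hp1 : 0 ≤ q / p - 1 := by rw [sub_nonneg, le_div_iff₀ hp]; linarith
          have b1 : K ^ (q / r) = K * K ^ (q / r - 1) := by
            conv_lhs => rw [show q / r = 1 + (q / r - 1) by ring]
            rw [ENNReal.rpow_add_of_nonneg _ _ zero_le_one hr1, ENNReal.rpow_one]
          have b2 : Φ ^ (q / p) = Φ * Φ ^ (q / p - 1) := by
            conv_lhs => rw [show q / p = 1 + (q / p - 1) by ring]
            rw [ENNReal.rpow_add_of_nonneg _ _ zero_le_one hp1, ENNReal.rpow_one]
          rw [b1, b2]; ring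
        · exact Measurable.lintegral_prod_right' (f := fun p' : G × G => k (p'.1 - p'.2) ^ r * f p'.2 ^ p)
            (((hk.comp (measurable_fst.sub measurable_snd)).pow_const _).mul
            ((hf.comp measurable_snd).pow_const _))
    _ = _ := by
        rw [ENNReal.mul_rpow_of_nonneg _ _ (by positivity), ← ENNReal.rpow_mul, ← ENNReal.rpow_mul]
        congr 2 <;> field_simp

end

/-! ### Heat and Oseen majorants and their bounds on time slices. -/

section

variable {d : ℕ}

theorem lintegral_Ioo_rpow {e : ℝ} (he : -1 < e) {t : ℝ} (ht : 0 ≤ t) :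
    ∫⁻ s in Ioo 0 t, ENNReal.ofReal (s ^ e) = ENNReal.ofReal (t ^ (e + 1) / (e + 1)) := by
  rw [← ofReal_integral_eq_lintegral_ofReal]
  · rw [← integral_Ioc_eq_integral_Ioo, ← intervalIntegral.integral_of_le ht,
      integral_rpow (Or.inl he), Real.zero_rpow (by linarith), sub_zero]
  · exact (intervalIntegrable_iff_integrableOn_Ioo_of_le ht).1 (intervalIntegral.intervalIntegrable_rpow' he)
  · exact (ae_restrict_mem measurableSet_Ioo).mono fun l hl => Real.rpow_nonneg hl.1.le _

theorem lintegral_Ioi_rpow {e : ℝ} (he : e < -1) {t : ℝ} (ht : 0 < t) :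
    ∫⁻ s in Ioi t, ENNReal.ofReal (s ^ e) = ENNReal.ofReal (t ^ (e + 1) / (-(e + 1))) := by
  rw [← ofReal_integral_eq_lintegral_ofReal]
  · rw [integral_Ioi_rpow_of_lt he ht, neg_div, div_neg]
  · exact integrableOn_Ioi_rpow_of_lt he ht
  · exact (ae_restrict_mem measurableSet_Ioi).mono fun l hl => Real.rpow_nonneg (ht.trans hl).le _

theorem lintegral_Ioo_sub_rpow {e : ℝ} (he : -1 < e) {t : ℝ} (ht : 0 ≤ t) :
    ∫⁻ s in Ioo 0 t, ENNReal.ofReal ((t - s) ^ e) = ENNReal.ofReal (t ^ (e + 1) / (e + 1)) := by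
  rw [← lintegral_Ioo_rpow he ht, ← lintegral_indicator measurableSet_Ioo,
    ← lintegral_indicator measurableSet_Ioo,
    ← lintegral_sub_left_eq_self ((Ioo 0 t).indicator fun s => ENNReal.ofReal (s ^ e)) t]
  refine lintegral_congr fun s => ?_
  simp only [indicator, mem_Ioo, sub_pos, sub_lt_self_iff]
  simp only [and_comm]

/-- An upper bound for Euler's beta integral. -/
theorem lintegral_beta_le {κ b : ℝ} (hκ : 0 ≤ κ) (hκ1 : κ < 1) (hb : 0 ≤ b) (hb1 : b < 1) {t : ℝ}
    (ht : 0 < t) :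
    ∫⁻ s in Ioo 0 t, ENNReal.ofReal ((t - s) ^ (-κ)) * ENNReal.ofReal (s ^ (-b)) ≤
      ENNReal.ofReal ((2 ^ κ / (1 - b) + 2 ^ b / (1 - κ)) * t ^ (1 - κ - b)) := by
  have h2 : 0 < t / 2 := by positivity
  calc _ ≤ ∫⁻ s in Ioo 0 t, (ENNReal.ofReal ((t / 2) ^ (-κ)) * ENNReal.ofReal (s ^ (-b)) +
        ENNReal.ofReal ((t / 2) ^ (-b)) * ENNReal.ofReal ((t - s) ^ (-κ))) := by
        refine setLIntegral_mono' measurableSet_Ioo fun s hs => ?_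
        -- On each half of the interval one of the two factors is at most its value at `t / 2`.
        rcases le_total s (t / 2) with h | h
        · refine le_add_right ?_
          gcongr ENNReal.ofReal ?_ * _
          exact Real.rpow_le_rpow_of_nonpos h2 (by linarith) (by linarith)
        · refine le_add_left ?_
          rw [mul_comm]
          gcongr ENNReal.ofReal ?_ * _
          exact Real.rpow_le_rpow_of_nonpos h2 (by linarith) (by linarith)
    _ = ENNReal.ofReal ((t / 2) ^ (-κ)) * ENNReal.ofReal (t ^ (-b + 1) / (-b + 1)) +
        ENNReal.ofReal ((t / 2) ^ (-b)) * ENNReal.ofReal (t ^ (-κ + 1) / (-κ + 1)) := by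
        rw [lintegral_add_left (by fun_prop), lintegral_const_mul _ (by fun_prop),
          lintegral_const_mul _ (by fun_prop), lintegral_Ioo_rpow (by linarith) ht.le,
          lintegral_Ioo_sub_rpow (by linarith) ht.le]
    _ = _ := by
        have p1 : 0 < 1 - b := by linarith
        have p2 : 0 < 1 - κ := by linarith
        have p3 : 0 < -b + 1 := by linarith
        have p4 : 0 < -κ + 1 := by linarith
        rw [← ENNReal.ofReal_mul (by positivity), ← ENNReal.ofReal_mul (by positivity),
          ← ENNReal.ofReal_add (by positivity) (by positivity)]
        congr 1
        have e1 : (t / 2) ^ (-κ) * t ^ (-b + 1) = 2 ^ κ * t ^ (1 - κ - b) := by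
          rw [Real.div_rpow ht.le (by norm_num), Real.rpow_neg (by norm_num : (0 : ℝ) ≤ 2),
            div_inv_eq_mul, mul_right_comm, ← Real.rpow_add ht, mul_comm]
          congr 2; ring
        have e2 : (t / 2) ^ (-b) * t ^ (-κ + 1) = 2 ^ b * t ^ (1 - κ - b) := by
          rw [Real.div_rpow ht.le (by norm_num), Real.rpow_neg (by norm_num : (0 : ℝ) ≤ 2),
            div_inv_eq_mul, mul_right_comm, ← Real.rpow_add ht, mul_comm]
          congr 2; ring
        rw [← mul_div_assoc, ← mul_div_assoc, e1, e2]
        rw [show -b + 1 = 1 - b by ring, show -κ + 1 = 1 - κ by ring]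
        ring

theorem lintegral_comp_smul_E {f : E d → ℝ≥0∞} (hf : Measurable f) {R : ℝ} (hR : R ≠ 0) :
    ∫⁻ x, f (R • x) = ENNReal.ofReal |(R ^ d)⁻¹| * ∫⁻ x, f x := by
  rw [← lintegral_map hf (measurable_const_smul R), Measure.map_addHaar_smul _ hR,
    lintegral_smul_measure]
  simp

/-- The mass of the profile `(1 + |y|²)^{-b}` on `ℝ^d`. -/
def profileMass (d : ℕ) (b : ℝ) : ℝ≥0∞ := ∫⁻ y : E d, ENNReal.ofReal ((1 + ‖y‖ ^ 2) ^ (-b))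

theorem profileMass_lt_top {b : ℝ} (hb : (d : ℝ) / 2 < b) : profileMass d b < ⊤ := by
  have := (integrable_rpow_neg_one_add_norm_sq (E := E d) (μ := volume) (r := 2 * b)
    (by simp; linarith)).lintegral_lt_top
  simpa [profileMass, neg_div] using this

/-- The substitution `x = √τ y` gives the Jacobian `τ^{d/2}` and the homogeneity factor `τ^{-b}`. -/
theorem lintegral_profile {τ : ℝ} (hτ : 0 < τ) (b : ℝ) :
    ∫⁻ x : E d, ENNReal.ofReal ((τ + ‖x‖ ^ 2) ^ (-b)) =
      ENNReal.ofReal (τ ^ ((d : ℝ) / 2 - b)) * profileMass d b := by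
  have hs : 0 < √τ := Real.sqrt_pos.2 hτ
  have h1 := lintegral_comp_smul_E (d := d) (f := fun x => ENNReal.ofReal ((τ + ‖x‖ ^ 2) ^ (-b)))
    (by fun_prop) hs.ne'
  have h2 : ∀ x : E d, ENNReal.ofReal ((τ + ‖√τ • x‖ ^ 2) ^ (-b)) =
      ENNReal.ofReal (τ ^ (-b)) * ENNReal.ofReal ((1 + ‖x‖ ^ 2) ^ (-b)) := by
    intro x
    rw [← ENNReal.ofReal_mul (by positivity), ← Real.mul_rpow hτ.le (by positivity), norm_smul,
      mul_pow, Real.norm_eq_abs, sq_abs, Real.sq_sqrt hτ.le]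
    congr 2; ring
  simp only [h2] at h1
  rw [lintegral_const_mul _ (by fun_prop)] at h1
  have h3 : ENNReal.ofReal (√τ ^ d) * ENNReal.ofReal |(√τ ^ d)⁻¹| = 1 := by
    rw [← ENNReal.ofReal_mul (by positivity), abs_of_pos (by positivity),
      mul_inv_cancel₀ (by positivity), ENNReal.ofReal_one]
  calc _ = ENNReal.ofReal (√τ ^ d) * (ENNReal.ofReal |(√τ ^ d)⁻¹| *
          ∫⁻ x : E d, ENNReal.ofReal ((τ + ‖x‖ ^ 2) ^ (-b))) := by rw [← mul_assoc, h3, one_mul]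
    _ = _ := by
        rw [← h1, ← mul_assoc, ← ENNReal.ofReal_mul (by positivity)]
        congr 2
        rw [Real.sqrt_eq_rpow, ← Real.rpow_natCast, ← Real.rpow_mul hτ.le, ← Real.rpow_add hτ]
        congr 1; ring

/-- The majorant `τ^{3/2} (τ + |x|²)^{-(d+3)/2}` of the heat kernel. -/
def heatMaj (τ : ℝ) (x : E d) : ℝ≥0∞ :=
  ENNReal.ofReal (τ ^ (3 / 2 : ℝ) * (τ + ‖x‖ ^ 2) ^ (-(((d : ℝ) + 3) / 2)))

/-- The majorant `c (τ + |x|²)^{-(d+1)/2}` of the Oseen kernel, extended by zero to `τ ≤ 0`. -/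
def oseenMaj (z : ℝ × E d) : ℝ≥0∞ :=
  {z : ℝ × E d | 0 < z.1}.indicator
    (fun z => ENNReal.ofReal (2 / ((d : ℝ) + 1) * (z.1 + ‖z.2‖ ^ 2) ^ (-(((d : ℝ) + 1) / 2)))) z

theorem measurableSet_fst_pos : MeasurableSet {z : ℝ × E d | 0 < z.1} :=
  measurableSet_lt measurable_const measurable_fst

@[fun_prop]
theorem measurable_oseenMaj : Measurable (oseenMaj (d := d)) :=
  Measurable.indicator (by fun_prop) measurableSet_fst_pos

@[fun_prop]
theorem measurable_heatMaj : Measurable (fun z : ℝ × E d => heatMaj z.1 z.2) := by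
  unfold heatMaj; fun_prop

/-- The Oseen kernel is an integral over `σ > τ` of third derivatives of the heat kernel at time
`σ`, each dominated by a multiple of `(σ + |x|²)^{-(d+3)/2}`. Integrating this bound produces the
constant `2/(d+1)`, which explains the normalisation of `oseenMaj`. -/
theorem lintegral_kernel_tail {τ : ℝ} (hτ : 0 < τ) (x : E d) :
    ∫⁻ σ in Ioi τ, ENNReal.ofReal ((σ + ‖x‖ ^ 2) ^ (-(((d : ℝ) + 3) / 2))) = oseenMaj (τ, x) := by
  have h := lintegral_Ioi_rpow (e := -(((d : ℝ) + 3) / 2)) (by linarith [(Nat.cast_nonneg d : (0 : ℝ) ≤ d)])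
    (t := τ + ‖x‖ ^ 2) (by positivity)
  have : ∫⁻ σ in Ioi τ, ENNReal.ofReal ((σ + ‖x‖ ^ 2) ^ (-(((d : ℝ) + 3) / 2))) =
      ∫⁻ σ in Ioi (τ + ‖x‖ ^ 2), ENNReal.ofReal (σ ^ (-(((d : ℝ) + 3) / 2))) := by
    rw [← lintegral_indicator measurableSet_Ioi, ← lintegral_indicator measurableSet_Ioi,
      ← lintegral_add_right_eq_self ((Ioi (τ + ‖x‖ ^ 2)).indicator fun σ =>
        ENNReal.ofReal (σ ^ (-(((d : ℝ) + 3) / 2)))) (‖x‖ ^ 2)]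
    refine lintegral_congr fun s => ?_
    simp [indicator]
  rw [this, h, oseenMaj, indicator_of_mem (by exact hτ)]
  congr 1
  have e : -(((d : ℝ) + 3) / 2) + 1 = -(((d : ℝ) + 1) / 2) := by ring
  rw [e]
  field_simp

theorem lintegral_heatMaj_rpow {τ : ℝ} (hτ : 0 < τ) {r : ℝ} (hr : 0 ≤ r) :
    ∫⁻ x : E d, heatMaj τ x ^ r =
      ENNReal.ofReal (τ ^ ((d : ℝ) / 2 - d * r / 2)) * profileMass d (((d : ℝ) + 3) / 2 * r) := by
  have : ∀ x : E d, heatMaj τ x ^ r = ENNReal.ofReal (τ ^ (3 / 2 * r)) *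
      ENNReal.ofReal ((τ + ‖x‖ ^ 2) ^ (-(((d : ℝ) + 3) / 2 * r))) := by
    intro x
    rw [heatMaj, ENNReal.ofReal_rpow_of_nonneg (by positivity) hr, ← ENNReal.ofReal_mul (by positivity),
      Real.mul_rpow (by positivity) (by positivity), ← Real.rpow_mul hτ.le, ← Real.rpow_mul (by positivity),
      neg_mul]
  simp only [this]
  rw [lintegral_const_mul _ (by fun_prop), lintegral_profile hτ, ← mul_assoc, ← ENNReal.ofReal_mul (by positivity),
    ← Real.rpow_add hτ]
  congr 3; ring

theorem lintegral_oseenMaj_rpow {τ : ℝ} (hτ : 0 < τ) {r : ℝ} (hr : 0 ≤ r) :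
    ∫⁻ x : E d, oseenMaj (τ, x) ^ r =
      ENNReal.ofReal ((2 / ((d : ℝ) + 1)) ^ r) * (ENNReal.ofReal (τ ^ ((d : ℝ) / 2 - ((d : ℝ) + 1) * r / 2)) *
        profileMass d (((d : ℝ) + 1) / 2 * r)) := by
  have : ∀ x : E d, oseenMaj (τ, x) ^ r = ENNReal.ofReal ((2 / ((d : ℝ) + 1)) ^ r) *
      ENNReal.ofReal ((τ + ‖x‖ ^ 2) ^ (-(((d : ℝ) + 1) / 2 * r))) := by
    intro x
    rw [oseenMaj, indicator_of_mem (by exact hτ), ENNReal.ofReal_rpow_of_nonneg (by positivity) hr,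
      ← ENNReal.ofReal_mul (by positivity),
      Real.mul_rpow (by positivity) (by positivity), ← Real.rpow_mul (by positivity), neg_mul]
  simp only [this]
  rw [lintegral_const_mul _ (by fun_prop), lintegral_profile hτ]
  congr 5; ring

theorem heatMaj_norm {τ : ℝ} (hτ : 0 < τ) {r : ℝ} (hr : 0 < r) :
    (∫⁻ x : E d, heatMaj τ x ^ r) ^ (1 / r) =
      ENNReal.ofReal (τ ^ (-((d : ℝ) / 2 * (1 - 1 / r)))) *
        profileMass d (((d : ℝ) + 3) / 2 * r) ^ (1 / r) := by
  rw [lintegral_heatMaj_rpow hτ hr.le, ENNReal.mul_rpow_of_nonneg _ _ (by positivity),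
    ENNReal.ofReal_rpow_of_nonneg (by positivity) (by positivity), ← Real.rpow_mul hτ.le]
  congr 3; field_simp; ring

theorem oseenMaj_norm {τ : ℝ} (hτ : 0 < τ) {r : ℝ} (hr : 0 < r) :
    (∫⁻ x : E d, oseenMaj (τ, x) ^ r) ^ (1 / r) =
      ENNReal.ofReal (τ ^ (-(1 / 2 + (d : ℝ) / 2 * (1 - 1 / r)))) *
        (ENNReal.ofReal (2 / ((d : ℝ) + 1)) * profileMass d (((d : ℝ) + 1) / 2 * r) ^ (1 / r)) := by
  rw [lintegral_oseenMaj_rpow hτ hr.le, ENNReal.mul_rpow_of_nonneg _ _ (by positivity),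
    ENNReal.mul_rpow_of_nonneg _ _ (by positivity), ← ENNReal.ofReal_rpow_of_nonneg (by positivity) hr.le,
    ← ENNReal.rpow_mul, mul_one_div_cancel hr.ne', ENNReal.rpow_one,
    ENNReal.ofReal_rpow_of_nonneg (by positivity) (by positivity), ← Real.rpow_mul hτ.le]
  rw [← mul_assoc, ← mul_assoc, mul_comm (ENNReal.ofReal (2 / _))]
  congr 4; field_simp; ring

/-- The heat majorant applied to initial data. -/
def heatOp (a : E d → ℝ≥0∞) (z : ℝ × E d) : ℝ≥0∞ := ∫⁻ y, heatMaj z.1 (z.2 - y) * a y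

/-- The Oseen majorant applied to a space-time function. -/
def oseenOp (f : ℝ × E d → ℝ≥0∞) (z : ℝ × E d) : ℝ≥0∞ := ∫⁻ p, oseenMaj (z - p) * f p

theorem measurable_heatOp {a : E d → ℝ≥0∞} (ha : Measurable a) : Measurable (heatOp a) := by
  refine Measurable.lintegral_prod_right' (f := fun p : (ℝ × E d) × E d =>
    heatMaj p.1.1 (p.1.2 - p.2) * a p.2) ?_
  refine Measurable.mul ?_ (ha.comp measurable_snd)
  exact measurable_heatMaj.comp (measurable_fst.fst.prodMk (measurable_fst.snd.sub measurable_snd))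

theorem measurable_oseenOp {f : ℝ × E d → ℝ≥0∞} (hf : Measurable f) : Measurable (oseenOp f) := by
  refine Measurable.lintegral_prod_right' (f := fun p : (ℝ × E d) × (ℝ × E d) =>
    oseenMaj (p.1 - p.2) * f p.2) ?_
  exact (measurable_oseenMaj.comp (measurable_fst.sub measurable_snd)).mul (hf.comp measurable_snd)

theorem heatOp_norm_le {p q r : ℝ} (hp : 0 < p) (hr : 1 ≤ r) (hpq : p ≤ q) (hrq : r ≤ q)
    (hpqr : 1 + 1 / q = 1 / p + 1 / r) {a : E d → ℝ≥0∞} (ha : Measurable a) {t : ℝ} (ht : 0 < t) :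
    (∫⁻ x, heatOp a (t, x) ^ q) ^ (1 / q) ≤
      ENNReal.ofReal (t ^ (-((d : ℝ) / 2 * (1 - 1 / r)))) *
        profileMass d (((d : ℝ) + 3) / 2 * r) ^ (1 / r) * (∫⁻ x, a x ^ p) ^ (1 / p) := by
  have hm : Measurable fun x : E d => heatMaj t x := measurable_heatMaj.comp measurable_prodMk_left
  have := lintegral_young (μ := (volume : Measure (E d))) hm ha hp (by linarith) hpq hrq hpqr
  rwa [heatMaj_norm ht (by linarith)] at this

/-- Minkowski takes the `L^q` norm inside the time integral, Young bounds the slice at time `s` by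
`(t - s)^{-κ} s^{-b}` with `κ = 1/2 + (d/2)(1 - 1/r)`, and the beta integral finishes. The
conditions `κ < 1` and `b < 1` are integrability at the two ends. -/
theorem oseenOp_norm_le {p q r b : ℝ} (hp : 1 ≤ p) (hr : 1 ≤ r) (hpq : p ≤ q) (hrq : r ≤ q)
    (hpqr : 1 + 1 / q = 1 / p + 1 / r) (hκ : 1 / 2 + (d : ℝ) / 2 * (1 - 1 / r) < 1)
    (hb : 0 ≤ b) (hb1 : b < 1) :
    ∃ C : ℝ≥0∞, C < ⊤ ∧ ∀ (f : ℝ × E d → ℝ≥0∞) (M : ℝ≥0∞), Measurable f →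
      (∀ s ≤ 0, ∀ y, f (s, y) = 0) →
      (∀ᵐ s, (∫⁻ y, f (s, y) ^ p) ^ (1 / p) ≤ ENNReal.ofReal (s ^ (-b)) * M) →
      ∀ t : ℝ, 0 < t → (∫⁻ x, oseenOp f (t, x) ^ q) ^ (1 / q) ≤
        C * ENNReal.ofReal (t ^ (1 - (1 / 2 + (d : ℝ) / 2 * (1 - 1 / r)) - b)) * M := by
  set κ := 1 / 2 + (d : ℝ) / 2 * (1 - 1 / r) with hκdef
  have hr1 : 1 / r ≤ 1 := by rw [div_le_one (by linarith)]; exact hr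
  have hκ0 : 0 ≤ κ := by have : 0 ≤ 1 - 1 / r := by linarith
                         positivity
  set D : ℝ≥0∞ := ENNReal.ofReal (2 / ((d : ℝ) + 1)) * profileMass d (((d : ℝ) + 1) / 2 * r) ^ (1 / r)
    with hD
  have hDfin : D < ⊤ := by
    refine ENNReal.mul_lt_top (by simp) (ENNReal.rpow_lt_top_of_nonneg (by positivity) ?_)
    refine (profileMass_lt_top ?_).ne
    nlinarith [(Nat.cast_nonneg d : (0 : ℝ) ≤ d)]
  refine ⟨D * ENNReal.ofReal (2 ^ κ / (1 - b) + 2 ^ b / (1 - κ)),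
    ENNReal.mul_lt_top hDfin (by simp), ?_⟩
  intro f M hf hf0 hfM t ht
  have hq1 : 1 ≤ q := hp.trans hpq
  have hmeas : Measurable (Function.uncurry fun (s : ℝ) (x : E d) =>
      ∫⁻ y, oseenMaj (t - s, x - y) * f (s, y)) := by
    refine Measurable.lintegral_prod_right' (f := fun p : (ℝ × E d) × E d =>
      oseenMaj (t - p.1.1, p.1.2 - p.2) * f (p.1.1, p.2)) ?_
    refine Measurable.mul ?_ (hf.comp (by fun_prop))
    exact measurable_oseenMaj.comp (by fun_prop)
  -- Causality: the kernel vanishes for `s ≥ t` and the data for `s ≤ 0`.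
  have h1 : ∀ x, oseenOp f (t, x) = ∫⁻ s in Ioo 0 t, ∫⁻ y, oseenMaj (t - s, x - y) * f (s, y) := by
    intro x
    have hm : Measurable fun p : ℝ × E d => oseenMaj ((t, x) - p) * f p :=
      (measurable_oseenMaj.comp (measurable_const.sub measurable_id)).mul hf
    rw [oseenOp, Measure.volume_eq_prod, lintegral_prod _ hm.aemeasurable,
      ← lintegral_indicator measurableSet_Ioo]
    refine lintegral_congr fun s => ?_
    by_cases hs : s ∈ Ioo 0 t
    · simp [indicator, hs]
    · rw [indicator_of_notMem hs]
      refine (lintegral_congr fun y => ?_).trans lintegral_zero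
      by_cases hs0 : s ≤ 0
      · simp [hf0 s hs0]
      · have : t ≤ s := by
          by_contra hc
          exact hs ⟨not_le.1 hs0, not_le.1 hc⟩
        simp [oseenMaj, this]
  simp only [h1]
  calc (∫⁻ x, (∫⁻ s in Ioo 0 t, ∫⁻ y, oseenMaj (t - s, x - y) * f (s, y)) ^ q) ^ (1 / q)
      ≤ ∫⁻ s in Ioo 0 t, (∫⁻ x, (∫⁻ y, oseenMaj (t - s, x - y) * f (s, y)) ^ q) ^ (1 / q) :=
        lintegral_minkowski hmeas hq1
    _ ≤ ∫⁻ s in Ioo 0 t, (ENNReal.ofReal ((t - s) ^ (-κ)) * ENNReal.ofReal (s ^ (-b))) * (D * M) := by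
        refine lintegral_mono_ae ?_
        filter_upwards [ae_restrict_of_ae hfM, ae_restrict_mem measurableSet_Ioo] with s hs hst
        have hm : Measurable fun x : E d => oseenMaj (t - s, x) :=
          measurable_oseenMaj.comp measurable_prodMk_left
        have hy := lintegral_young (μ := (volume : Measure (E d))) hm
          (hf.comp (measurable_prodMk_left (x := s))) (by linarith) (by linarith) hpq hrq hpqr
        rw [oseenMaj_norm (by linarith [hst.2]) (by linarith)] at hy
        calc _ ≤ _ := hy
          _ ≤ ENNReal.ofReal ((t - s) ^ (-κ)) * D * (ENNReal.ofReal (s ^ (-b)) * M) := by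
              gcongr
              exact hs
          _ = _ := by ring
    _ = (∫⁻ s in Ioo 0 t, (ENNReal.ofReal ((t - s) ^ (-κ)) * ENNReal.ofReal (s ^ (-b)))) * (D * M) := by
        rw [lintegral_mul_const]
        fun_prop
    _ ≤ ENNReal.ofReal ((2 ^ κ / (1 - b) + 2 ^ b / (1 - κ)) * t ^ (1 - κ - b)) * (D * M) := by
        gcongr
        exact lintegral_beta_le hκ0 hκ hb hb1 ht
    _ = _ := by
        have p1 : 0 < 1 - b := by linarith
        have p2 : 0 < 1 - κ := by linarith
        rw [ENNReal.ofReal_mul (by positivity)]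
        ring

end

/-! ### Space-time estimates for the two majorants. -/

section

variable {d : ℕ}

instance : (volume : Measure (ℝ × E d)).IsAddHaarMeasure := by
  rw [Measure.volume_eq_prod]; infer_instance

/-- The exponent `d + 2` as a real number. -/
abbrev nR (d : ℕ) : ℝ := (d : ℝ) + 2

/-- The slice at time `s` has mass a constant times `s^{-1/2}`, which is integrable at zero. This
and the next estimate are the two halves of the kernel splitting for the Hardy-Littlewood-Sobolev
inequality. -/
theorem lintegral_oseenMaj_near (d : ℕ) : ∃ C : ℝ, 0 < C ∧ ∀ R : ℝ, 0 < R →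
    ∫⁻ z in {z : ℝ × E d | z.1 < R}, oseenMaj z ≤ ENNReal.ofReal (C * √R) := by
  set D : ℝ≥0∞ := ENNReal.ofReal (2 / ((d : ℝ) + 1)) * profileMass d (((d : ℝ) + 1) / 2 * 1) ^ (1 / (1 : ℝ))
    with hD
  have hDfin : D ≠ ⊤ := by
    refine (ENNReal.mul_lt_top (by simp) (ENNReal.rpow_lt_top_of_nonneg (by positivity) ?_)).ne
    exact (profileMass_lt_top (by linarith)).ne
  refine ⟨2 * (D.toReal + 1), by positivity, fun R hR => ?_⟩
  have hset : MeasurableSet {z : ℝ × E d | z.1 < R} := measurableSet_lt measurable_fst measurable_const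
  rw [← lintegral_indicator hset, Measure.volume_eq_prod,
    lintegral_prod _ (measurable_oseenMaj.indicator hset).aemeasurable]
  have : ∀ s : ℝ, ∫⁻ y : E d, {z : ℝ × E d | z.1 < R}.indicator oseenMaj (s, y) =
      (Ioo 0 R).indicator (fun s => ENNReal.ofReal (s ^ (-(1 / 2 : ℝ))) * D) s := by
    intro s
    by_cases hs : s ∈ Ioo 0 R
    · rw [indicator_of_mem hs]
      have := oseenMaj_norm (d := d) hs.1 zero_lt_one
      simp only [ENNReal.rpow_one, div_one, sub_self, mul_zero, add_zero] at this ⊢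
      rw [hD]
      simp only [ENNReal.rpow_one, div_one]
      rw [← this]
      refine lintegral_congr fun y => ?_
      rw [indicator_of_mem (by exact hs.2)]
    · rw [indicator_of_notMem hs]
      refine (lintegral_congr fun y => ?_).trans lintegral_zero
      rw [mem_Ioo, not_and_or] at hs
      rcases hs with hs | hs <;> simp [oseenMaj, indicator, hs]
  simp only [this]
  rw [lintegral_indicator measurableSet_Ioo, lintegral_mul_const _ (by fun_prop),
    lintegral_Ioo_rpow (by norm_num) hR.le, mul_comm (2 : ℝ), mul_assoc, ENNReal.ofReal_mul (by positivity), mul_comm]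
  gcongr
  · calc D = ENNReal.ofReal D.toReal := (ENNReal.ofReal_toReal hDfin).symm
      _ ≤ _ := ENNReal.ofReal_le_ofReal (by linarith)
  · rw [Real.sqrt_eq_rpow]
    norm_num
    linarith [Real.rpow_nonneg hR.le (1 / 2)]

/-- The exponent `(d+2)/d` is conjugate to `(d+2)/2`, the integrability of `u ⊗ u`. The slice
integrals decay like `τ^e` with `e + 1 = -q/2`, so the tail beyond `R` contributes `R^{-1/2}` after
taking the root. -/
theorem lintegral_oseenMaj_far (hd : 1 ≤ d) : ∃ C : ℝ, 0 < C ∧ ∀ R : ℝ, 0 < R →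
    (∫⁻ z in {z : ℝ × E d | R ≤ z.1}, oseenMaj z ^ (nR d / d)) ^ (1 / (nR d / d)) ≤
      ENNReal.ofReal (C / √R) := by
  have hd0 : (0 : ℝ) < d := by exact_mod_cast hd
  set q : ℝ := nR d / d with hq
  have hq0 : 0 < q := by positivity
  set D : ℝ≥0∞ := ENNReal.ofReal ((2 / ((d : ℝ) + 1)) ^ q) * profileMass d (((d : ℝ) + 1) / 2 * q)
    with hD
  have hDfin : D ≠ ⊤ := by
    refine (ENNReal.mul_lt_top (by simp) (profileMass_lt_top ?_)).ne
    rw [hq]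
    field_simp
    nlinarith
  set e : ℝ := (d : ℝ) / 2 - ((d : ℝ) + 1) * q / 2 with he
  have he1 : e + 1 = -(q / 2) := by
    rw [he, hq]; unfold nR; field_simp; ring
  have hlt : e < -1 := by linarith
  refine ⟨((D.toReal + 1) / (-(e + 1))) ^ (1 / q), by
    have : 0 < -(e + 1) := by linarith
    positivity, fun R hR => ?_⟩
  have hset : MeasurableSet {z : ℝ × E d | R ≤ z.1} := measurableSet_le measurable_const measurable_fst
  have hm : Measurable fun z : ℝ × E d => oseenMaj z ^ q := measurable_oseenMaj.pow_const _
  have key : ∫⁻ z in {z : ℝ × E d | R ≤ z.1}, oseenMaj z ^ q =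
      ENNReal.ofReal (R ^ (e + 1) / (-(e + 1))) * D := by
    rw [← lintegral_indicator hset, Measure.volume_eq_prod,
      lintegral_prod _ (hm.indicator hset).aemeasurable]
    have : ∀ s : ℝ, ∫⁻ y : E d, {z : ℝ × E d | R ≤ z.1}.indicator (fun z => oseenMaj z ^ q) (s, y) =
        (Ici R).indicator (fun s => ENNReal.ofReal (s ^ e) * D) s := by
      intro s
      by_cases hs : s ∈ Ici R
      · rw [indicator_of_mem hs]
        have := lintegral_oseenMaj_rpow (d := d) (hR.trans_le hs) hq0.le
        rw [← he] at this
        calc _ = ∫⁻ y : E d, oseenMaj (s, y) ^ q := by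
              refine lintegral_congr fun y => ?_
              rw [indicator_of_mem (by exact hs)]
          _ = _ := by rw [this, hD]; ring
      · rw [indicator_of_notMem hs]
        refine (lintegral_congr fun y => ?_).trans lintegral_zero
        rw [indicator_of_notMem (by exact hs)]
    simp only [this]
    rw [lintegral_indicator measurableSet_Ici, lintegral_mul_const _ (by fun_prop),
      setLIntegral_congr Ioi_ae_eq_Ici.symm, lintegral_Ioi_rpow hlt hR]
  rw [key, ← ENNReal.ofReal_toReal hDfin]
  have hp : 0 < -(e + 1) := by linarith
  rw [← ENNReal.ofReal_mul (by positivity), ENNReal.ofReal_rpow_of_nonneg (by positivity) (by positivity)]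
  refine ENNReal.ofReal_le_ofReal ?_
  have e3 : (√R)⁻¹ = (R ^ (e + 1)) ^ (1 / q) := by
    rw [he1, ← Real.rpow_mul hR.le, Real.sqrt_eq_rpow, ← Real.rpow_neg hR.le]
    congr 1; field_simp
  rw [div_eq_mul_inv _ (√R), e3, ← Real.mul_rpow (by positivity) (by positivity)]
  refine Real.rpow_le_rpow (by positivity) ?_ (by positivity)
  rw [div_mul_eq_mul_div, div_mul_eq_mul_div]
  gcongr ?_ / _
  rw [mul_comm]
  have hD0 : 0 ≤ D.toReal := ENNReal.toReal_nonneg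
  rw [ENNReal.toReal_ofReal hD0]
  gcongr
  linarith

/-- The Hardy-Littlewood-Sobolev inequality for the Oseen majorant on space-time. -/
theorem oseenOp_norm_spacetime_le (hd : 1 ≤ d) : ∃ C : ℝ≥0∞, C ≠ 0 ∧ C < ⊤ ∧
    ∀ f : ℝ × E d → ℝ≥0∞, Measurable f →
      (∫⁻ z, oseenOp f z ^ nR d) ^ (1 / nR d) ≤ C * (∫⁻ z, f z ^ (nR d / 2)) ^ (2 / nR d) := by
  have hd0 : (0 : ℝ) < d := by exact_mod_cast hd
  obtain ⟨C2, hC2, hnear⟩ := lintegral_oseenMaj_near d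
  obtain ⟨C1, hC1, hfar⟩ := lintegral_oseenMaj_far hd
  set N : ℝ := nR d with hN
  have hNd : N = d + 2 := rfl
  have hN0 : 0 < N := by positivity
  set K0 : ℝ≥0∞ := ENNReal.ofReal (N / (N - 2)) *
    (ENNReal.ofReal (16 * C1 * C2) ^ ((N - 2) / 2) * ENNReal.ofReal (8 * C1 * C2)) with hK0
  -- The summand `1` keeps the constant nonzero, which makes the bound trivial when the right-hand
  -- integral is infinite.
  refine ⟨K0 ^ (1 / N) + 1, by simp, ?_, ?_⟩
  · refine ENNReal.add_lt_top.2 ⟨ENNReal.rpow_lt_top_of_nonneg (by positivity) ?_, ENNReal.one_lt_top⟩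
    refine ENNReal.mul_ne_top (by simp) (ENNReal.mul_ne_top ?_ (by simp))
    exact ENNReal.rpow_ne_top_of_nonneg (by rw [hNd]; simp; positivity) (by simp)
  intro f hf
  set Φ := ∫⁻ z, f z ^ (N / 2) with hΦ
  rcases eq_or_ne Φ ⊤ with htop | htop
  · rw [htop, ENNReal.top_rpow_of_pos (by positivity), ENNReal.mul_top (by simp)]
    exact le_top
  rcases eq_or_ne Φ 0 with h0 | h0
  · have : f =ᵐ[volume] 0 := by
      rw [hΦ, lintegral_eq_zero_iff (hf.pow_const _)] at h0
      filter_upwards [h0] with z hz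
      rcases ENNReal.rpow_eq_zero_iff.1 hz with h | h
      · exact h.1
      · linarith [h.2]
    have hz : ∀ z, oseenOp f z = 0 := by
      intro z
      rw [oseenOp, ← lintegral_zero (μ := (volume : Measure (ℝ × E d)))]
      refine lintegral_congr_ae ?_
      filter_upwards [this] with p hp
      simp [hp]
    simp only [hz]
    rw [ENNReal.zero_rpow_of_pos hN0, lintegral_zero, ENNReal.zero_rpow_of_pos (by positivity)]
    exact bot_le
  set α : ℝ := (Φ ^ (2 / N)).toReal with hα
  have hαfin : Φ ^ (2 / N) ≠ ⊤ := ENNReal.rpow_ne_top_of_nonneg (by positivity) htop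
  have hα0 : 0 < α := ENNReal.toReal_pos (ENNReal.rpow_pos_of_nonneg (pos_iff_ne_zero.2 h0) (by positivity)).ne' hαfin
  have hαe : ENNReal.ofReal α = Φ ^ (2 / N) := ENNReal.ofReal_toReal hαfin
  have weak : ∀ l : ℝ, 0 < l → volume {z : ℝ × E d | ENNReal.ofReal l < oseenOp f z} ≤
      ENNReal.ofReal (8 * C1 * C2 * α) * ENNReal.ofReal (l ^ (-2 : ℝ)) *
        ∫⁻ y in {y | ENNReal.ofReal ((16 * C1 * C2 * α)⁻¹ * l ^ (2 : ℝ)) < f y}, f y := by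
    intro l hl
    -- The kernel is split at time `ρ²` and `f` at height `m`, where `α` is the `L^{(d+2)/2}` norm
    -- of `f`. The values of `ρ` and `m` are such that the far kernel applied to `f` and the near
    -- kernel applied to the height `m` each contribute at most `l/4`. Hence level `l` forces the
    -- near kernel applied to the large part of `f` to reach `l/2`, and Chebyshev applies to its
    -- `L¹` norm.
    set ρ : ℝ := 4 * C1 * α / l with hρ
    have hρ0 : 0 < ρ := by positivity
    set m : ℝ := (16 * C1 * C2 * α)⁻¹ * l ^ (2 : ℝ) with hm
    have hm' : C2 * ρ * m = l / 4 := by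
      rw [hm, hρ, Real.rpow_two]; field_simp; ring
    have hm0 : 0 ≤ m := by positivity
    set H : Set (ℝ × E d) := {y | ENNReal.ofReal m < f y} with hH
    have hHm : MeasurableSet H := measurableSet_lt measurable_const hf
    set B : Set (ℝ × E d) := {z | z.1 < ρ ^ 2} with hB
    have hBm : MeasurableSet B := measurableSet_lt measurable_fst measurable_const
    have hBc : Bᶜ = {z : ℝ × E d | ρ ^ 2 ≤ z.1} := by ext z; simp [hB]
    have hnear' := hnear (ρ ^ 2) (by positivity)
    have hfar' := hfar (ρ ^ 2) (by positivity)
    rw [Real.sqrt_sq hρ0.le] at hnear' hfar'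
    set kn : ℝ × E d → ℝ≥0∞ := B.indicator oseenMaj with hkn
    set kf : ℝ × E d → ℝ≥0∞ := Bᶜ.indicator oseenMaj with hkf
    have hknm : Measurable kn := measurable_oseenMaj.indicator hBm
    have hkfm : Measurable kf := measurable_oseenMaj.indicator hBm.compl
    have hsplit : ∀ z, oseenMaj z = kn z + kf z := fun z => by
      simp only [hkn, hkf]
      by_cases hz : z ∈ B <;> simp [hz]
    have hkn1 : ∫⁻ z, kn z ≤ ENNReal.ofReal (C2 * ρ) := by
      rw [hkn, lintegral_indicator hBm]; exact hnear'
    set q : ℝ := N / d with hq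
    have hq0 : 0 < q := by positivity
    have hconj : q.HolderConjugate (N / 2) := by
      rw [Real.holderConjugate_iff]
      constructor
      · rw [hq, hNd, lt_div_iff₀ hd0]; linarith
      · rw [hq, hNd]; field_simp
    have hkf1 : (∫⁻ z, kf z ^ q) ^ (1 / q) ≤ ENNReal.ofReal (C1 / ρ) := by
      refine le_trans (le_of_eq ?_) hfar'
      congr 1
      rw [← hBc, ← lintegral_indicator hBm.compl]
      refine lintegral_congr fun z => ?_
      simp only [hkf]
      by_cases hz : z ∈ Bᶜ
      · rw [indicator_of_mem hz, indicator_of_mem hz]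
      · rw [indicator_of_notMem hz, indicator_of_notMem hz, ENNReal.zero_rpow_of_pos hq0]
    set g : ℝ × E d → ℝ≥0∞ := fun z => ∫⁻ p, kn (z - p) * H.indicator f p with hg
    have hgm : Measurable g := by
      refine Measurable.lintegral_prod_right' (f := fun p : (ℝ × E d) × (ℝ × E d) =>
        kn (p.1 - p.2) * H.indicator f p.2) ?_
      exact (hknm.comp (measurable_fst.sub measurable_snd)).mul ((hf.indicator hHm).comp measurable_snd)
    have hsubm : ∀ (k : ℝ × E d → ℝ≥0∞), Measurable k → ∀ z, Measurable fun p => k (z - p) :=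
      fun k hk z => hk.comp (measurable_const.sub measurable_id)
    have hbound : ∀ z, oseenOp f z ≤ g z + ENNReal.ofReal (l / 2) := by
      intro z
      have e1 : oseenOp f z ≤ g z + (∫⁻ p, kn (z - p) * ENNReal.ofReal m) + ∫⁻ p, kf (z - p) * f p := by
        have m1 : Measurable fun p => kn (z - p) * H.indicator f p :=
          (hsubm kn hknm z).mul (hf.indicator hHm)
        have m2 : Measurable fun p => kf (z - p) * f p := (hsubm kf hkfm z).mul hf
        simp only [hg, oseenOp]
        rw [← lintegral_add_left m1, ← lintegral_add_right _ m2]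
        refine lintegral_mono fun p => ?_
        simp only
        rw [hsplit, add_mul, ← mul_add]
        gcongr
        by_cases hp : p ∈ H
        · simp [hp]
        · rw [indicator_of_notMem hp, zero_add]
          exact not_lt.1 hp
      have e2 : ∫⁻ p, kn (z - p) * ENNReal.ofReal m ≤ ENNReal.ofReal (l / 4) := by
        rw [lintegral_mul_const _ (hsubm kn hknm z), lintegral_sub_left_eq_self (fun p => kn p) z, ← hm',
          ENNReal.ofReal_mul (by positivity : 0 ≤ C2 * ρ)]
        exact mul_le_mul_left hkn1 _
      have e3 : ∫⁻ p, kf (z - p) * f p ≤ ENNReal.ofReal (l / 4) := by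
        have := ENNReal.lintegral_mul_le_Lp_mul_Lq volume hconj (hsubm kf hkfm z).aemeasurable hf.aemeasurable
        rw [lintegral_sub_left_eq_self (fun p => kf p ^ q) z] at this
        refine this.trans ?_
        have : ENNReal.ofReal (l / 4) = ENNReal.ofReal (C1 / ρ) * ENNReal.ofReal α := by
          rw [← ENNReal.ofReal_mul (by positivity), hρ]
          congr 1; field_simp
        rw [this, hαe, one_div_div (N) 2]
        gcongr
      calc oseenOp f z ≤ g z + ENNReal.ofReal (l / 4) + ENNReal.ofReal (l / 4) :=
            e1.trans (by gcongr)
        _ = _ := by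
            rw [add_assoc, ← ENNReal.ofReal_add (by positivity) (by positivity)]
            congr 2; ring
    have hsub : {z : ℝ × E d | ENNReal.ofReal l < oseenOp f z} ⊆ {z | ENNReal.ofReal (l / 2) ≤ g z} := by
      intro z hz
      by_contra hc
      have hc : g z < ENNReal.ofReal (l / 2) := not_le.1 hc
      have : oseenOp f z ≤ ENNReal.ofReal l := by
        calc _ ≤ _ := hbound z
          _ ≤ ENNReal.ofReal (l / 2) + ENNReal.ofReal (l / 2) := by gcongr
          _ = _ := by rw [← ENNReal.ofReal_add (by positivity) (by positivity)]; congr 1; ring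
      exact absurd hz (not_lt.2 this)
    have hgint : ∫⁻ z, g z ≤ ENNReal.ofReal (C2 * ρ) * ∫⁻ y in H, f y := by
      rw [hg, lintegral_lintegral_swap]
      · rw [← lintegral_indicator hHm]
        calc ∫⁻ p, ∫⁻ z, kn (z - p) * H.indicator f p = ∫⁻ p, (∫⁻ z, kn z) * H.indicator f p := by
              refine lintegral_congr fun p => ?_
              have : Measurable fun z => kn (z - p) := hknm.comp (measurable_id.sub measurable_const)
              rw [lintegral_mul_const _ this, lintegral_sub_right_eq_self (fun z => kn z) p]
          _ = (∫⁻ z, kn z) * ∫⁻ p, H.indicator f p := lintegral_const_mul _ (hf.indicator hHm)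
          _ ≤ _ := by gcongr
      · exact ((hknm.comp (measurable_fst.sub measurable_snd)).mul
          ((hf.indicator hHm).comp measurable_snd)).aemeasurable
    calc volume {z : ℝ × E d | ENNReal.ofReal l < oseenOp f z}
        ≤ volume {z | ENNReal.ofReal (l / 2) ≤ g z} := measure_mono hsub
      _ ≤ (∫⁻ z, g z) / ENNReal.ofReal (l / 2) :=
          meas_ge_le_lintegral_div hgm.aemeasurable (by simpa using hl) (by simp)
      _ ≤ (ENNReal.ofReal (C2 * ρ) * ∫⁻ y in H, f y) / ENNReal.ofReal (l / 2) := by gcongr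
      _ = _ := by
          rw [ENNReal.div_eq_inv_mul, ← mul_assoc, ← ENNReal.ofReal_inv_of_pos (by positivity),
            ← ENNReal.ofReal_mul (by positivity), ← ENNReal.ofReal_mul (by positivity)]
          congr 2
          rw [hρ, Real.rpow_neg hl.le, Real.rpow_two]
          field_simp; ring
  -- With `β = γ = 2` the resulting exponent is `1 + (N - 2)/2 = N/2`, as the inequality requires.
  have strong := lintegral_rpow_le_of_weak (measurable_oseenOp hf) hf (n := N) (β := 2) (γ := 2)
    (c := (16 * C1 * C2 * α)⁻¹) (K := ENNReal.ofReal (8 * C1 * C2 * α)) hN0 (by rw [hNd]; linarith)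
    (by norm_num) (by positivity) weak
  have hexp : 1 + (N - 2) / 2 = N / 2 := by ring
  rw [hexp, inv_inv] at strong
  have hfinal : ∫⁻ z, oseenOp f z ^ N ≤ K0 * Φ ^ (2 : ℝ) := by
    refine strong.trans (le_of_eq ?_)
    rw [ENNReal.ofReal_mul (by positivity : 0 ≤ 16 * C1 * C2), ENNReal.ofReal_mul (by positivity : 0 ≤ 8 * C1 * C2),
      ENNReal.mul_rpow_of_nonneg _ _ (by rw [hNd]; simp; positivity), hK0, hαe, ← ENNReal.rpow_mul]
    have e5 : Φ ^ (2 / N * ((N - 2) / 2)) * Φ ^ (2 / N) = Φ := by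
      rw [← ENNReal.rpow_add _ _ h0 htop]
      have : 2 / N * ((N - 2) / 2) + 2 / N = 1 := by field_simp; ring
      rw [this, ENNReal.rpow_one]
    rw [← hΦ, ENNReal.rpow_two, pow_two]
    generalize Φ ^ (2 / N * ((N - 2) / 2)) = X at e5 ⊢
    generalize Φ ^ (2 / N) = Y at e5 ⊢
    generalize ENNReal.ofReal (16 * C1 * C2) ^ ((N - 2) / 2) = W
    calc _ = ENNReal.ofReal (N / (N - 2)) * (W * ENNReal.ofReal (8 * C1 * C2)) * (X * Y * Φ) := by ring
      _ = _ := by rw [e5]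
  calc _ ≤ (K0 * Φ ^ (2 : ℝ)) ^ (1 / N) := by gcongr
    _ = K0 ^ (1 / N) * Φ ^ (2 / N) := by
        rw [ENNReal.mul_rpow_of_nonneg _ _ (by positivity), ← ENNReal.rpow_mul]
        congr 2; ring
    _ ≤ _ := by gcongr; exact le_self_add

/-- The heat majorant maps `L^d(ℝ^d)` to `L^{d+2}` of space-time. -/
theorem heatOp_norm_spacetime_le (hd : 2 ≤ d) : ∃ C : ℝ≥0∞, C < ⊤ ∧
    ∀ a : E d → ℝ≥0∞, Measurable a → ∫⁻ x, a x ^ (d : ℝ) ≠ ⊤ →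
      ∫⁻ z in {z : ℝ × E d | 0 < z.1}, heatOp a z ^ nR d ≤ C * (∫⁻ x, a x ^ (d : ℝ)) ^ (2 / (d : ℝ)) *
        ∫⁻ x, a x ^ (d : ℝ) := by
  have hd2 : (2 : ℝ) ≤ d := by exact_mod_cast hd
  have hd0 : (0 : ℝ) < d := by linarith
  have hd1 : (0 : ℝ) < d - 1 := by linarith
  set r : ℝ := d / (d - 1) with hr
  have hr0 : 0 < r := by positivity
  have hconj : r.HolderConjugate d := (Real.HolderConjugate.conjExponent (by linarith : (1 : ℝ) < d)).symm
  have hr1 : 1 < r := hconj.lt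
  set D1 : ℝ≥0∞ := profileMass d (((d : ℝ) + 3) / 2 * 1) ^ (1 / (1 : ℝ)) with hD1
  set D2 : ℝ≥0∞ := profileMass d (((d : ℝ) + 3) / 2 * r) ^ (1 / r) with hD2
  have hD1fin : D1 ≠ ⊤ := ENNReal.rpow_ne_top_of_nonneg (by positivity)
    (profileMass_lt_top (by linarith)).ne
  have hD2fin : D2 ≠ ⊤ := ENNReal.rpow_ne_top_of_nonneg (by positivity)
    (profileMass_lt_top (by nlinarith)).ne
  set C1 : ℝ := D1.toReal + 1
  set C2 : ℝ := D2.toReal + 1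
  have hC1 : 0 < C1 := by positivity
  have hC2 : 0 < C2 := by positivity
  have hD1C : D1 ≤ ENNReal.ofReal C1 := by
    rw [← ENNReal.ofReal_toReal hD1fin]; exact ENNReal.ofReal_le_ofReal (by simp [C1])
  have hD2C : D2 ≤ ENNReal.ofReal C2 := by
    rw [← ENNReal.ofReal_toReal hD2fin]; exact ENNReal.ofReal_le_ofReal (by simp [C2])
  set N : ℝ := nR d with hN
  have hNd : N = d + 2 := rfl
  refine ⟨ENNReal.ofReal (N / (N - 3)) * ENNReal.ofReal (2 * C1) ^ ((N - 3) / 1) *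
    ENNReal.ofReal (2 * C1 * C2 ^ 2), ENNReal.mul_lt_top (ENNReal.mul_lt_top (by simp)
      (ENNReal.rpow_lt_top_of_nonneg (by rw [hNd]; linarith) ENNReal.ofReal_ne_top)) (by simp), ?_⟩
  intro a ha hfin
  set Φ := ∫⁻ x, a x ^ (d : ℝ) with hΦ
  have hAfin : Φ ^ (1 / (d : ℝ)) ≠ ⊤ := ENNReal.rpow_ne_top_of_nonneg (by positivity) hfin
  set A : ℝ := (Φ ^ (1 / (d : ℝ))).toReal with hA
  have hA0 : 0 ≤ A := ENNReal.toReal_nonneg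
  have hAe : ENNReal.ofReal A = Φ ^ (1 / (d : ℝ)) := ENNReal.ofReal_toReal hAfin
  have hkm : ∀ t : ℝ, Measurable fun x : E d => heatMaj t x := fun t =>
    measurable_heatMaj.comp measurable_prodMk_left
  have hkm' : ∀ (t : ℝ) (x : E d), Measurable fun y : E d => heatMaj t (x - y) := fun t x =>
    (hkm t).comp (measurable_const.sub measurable_id)
  have hmass : ∀ t : ℝ, 0 < t → ∫⁻ x : E d, heatMaj t x ≤ ENNReal.ofReal C1 := by
    intro t ht
    have := heatMaj_norm (d := d) ht zero_lt_one
    rw [← hD1] at this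
    simp only [ENNReal.rpow_one, div_one, sub_self, mul_zero, neg_zero, Real.rpow_zero, ENNReal.ofReal_one, one_mul] at this
    rw [this]; exact hD1C
  -- Hölder with the exponents `d/(d-1)` and `d`; here `d ≥ 2` is used.
  have hsup : ∀ t : ℝ, 0 < t → ∀ x, heatOp a (t, x) ≤ ENNReal.ofReal (C2 * A / √t) := by
    intro t ht x
    have h1 := ENNReal.lintegral_mul_le_Lp_mul_Lq volume hconj (hkm' t x).aemeasurable ha.aemeasurable
    rw [lintegral_sub_left_eq_self (fun p => heatMaj t p ^ r) x, heatMaj_norm ht hr0, ← hD2, ← hΦ, ← hAe] at h1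
    refine (h1 : heatOp a (t, x) ≤ _).trans ?_
    have e : t ^ (-((d : ℝ) / 2 * (1 - 1 / r))) = (√t)⁻¹ := by
      rw [Real.sqrt_eq_rpow, ← Real.rpow_neg ht.le]
      congr 1; rw [hr]; field_simp; ring
    rw [e]
    calc _ ≤ ENNReal.ofReal (√t)⁻¹ * ENNReal.ofReal C2 * ENNReal.ofReal A := by gcongr
      _ = _ := by
        rw [← ENNReal.ofReal_mul (by positivity), ← ENNReal.ofReal_mul (by positivity)]
        congr 1; ring
  have hposm : MeasurableSet {z : ℝ × E d | 0 < z.1} := measurableSet_fst_pos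
  -- The sup bound confines the level set to times below `t0`, a multiple of `l^{-2}`, and data
  -- below the height `m` contribute at most `l/2`. Chebyshev for the rest, using that the heat
  -- majorant has bounded mass on slices, gives `t0 / l`, hence `l^{-3}`. The resulting power is `1
  -- + (N - 3) = d`.
  have weak : ∀ l : ℝ, 0 < l →
      (volume.restrict {z : ℝ × E d | 0 < z.1}) {z : ℝ × E d | ENNReal.ofReal l < heatOp a z} ≤
      ENNReal.ofReal (2 * C1 * (C2 * A) ^ 2) * ENNReal.ofReal (l ^ (-3 : ℝ)) *
        ∫⁻ y in {y | ENNReal.ofReal ((2 * C1)⁻¹ * l ^ (1 : ℝ)) < a y}, a y := by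
    intro l hl
    set m : ℝ := (2 * C1)⁻¹ * l ^ (1 : ℝ) with hm
    have hm' : C1 * m = l / 2 := by
      rw [hm, Real.rpow_one]; field_simp
    have hm0 : 0 ≤ m := by positivity
    set H : Set (E d) := {y | ENNReal.ofReal m < a y} with hH
    have hHm : MeasurableSet H := measurableSet_lt measurable_const ha
    have haH : Measurable (H.indicator a) := ha.indicator hHm
    set t0 : ℝ := (C2 * A / l) ^ 2 with ht0
    have ht00 : 0 ≤ t0 := by positivity
    have hgm := measurable_heatOp haH
    rw [Measure.restrict_apply (measurableSet_lt measurable_const (measurable_heatOp ha))]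
    have hsub : {z : ℝ × E d | ENNReal.ofReal l < heatOp a z} ∩ {z | 0 < z.1} ⊆
        {z | ENNReal.ofReal (l / 2) ≤ heatOp (H.indicator a) z} ∩ (Ioo 0 t0 ×ˢ univ) := by
      rintro ⟨t, x⟩ ⟨hz, ht⟩
      have ht : 0 < t := ht
      have hz : ENNReal.ofReal l < heatOp a (t, x) := hz
      have e1 : heatOp a (t, x) ≤ heatOp (H.indicator a) (t, x) + ENNReal.ofReal (l / 2) := by
        calc heatOp a (t, x) ≤ ∫⁻ y, (heatMaj t (x - y) * H.indicator a y +
              heatMaj t (x - y) * ENNReal.ofReal m) := by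
              refine lintegral_mono fun y => ?_
              simp only
              rw [← mul_add]
              gcongr
              by_cases hp : y ∈ H
              · simp [hp]
              · rw [indicator_of_notMem hp, zero_add]
                exact not_lt.1 hp
          _ = heatOp (H.indicator a) (t, x) + (∫⁻ y : E d, heatMaj t y) * ENNReal.ofReal m := by
              have m1 : Measurable fun y => heatMaj t (x - y) * H.indicator a y := (hkm' t x).mul haH
              rw [lintegral_add_left m1, lintegral_mul_const _ (hkm' t x),
                lintegral_sub_left_eq_self (fun p => heatMaj t p) x]
              rfl
          _ ≤ _ := by
              rw [← hm', ENNReal.ofReal_mul hC1.le]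
              exact add_le_add_right (mul_le_mul_left (hmass t ht) _) _
      refine ⟨?_, ⟨⟨ht, ?_⟩, trivial⟩⟩
      · by_contra hc
        have hc : heatOp (H.indicator a) (t, x) < ENNReal.ofReal (l / 2) := not_le.1 hc
        have : heatOp a (t, x) ≤ ENNReal.ofReal l := by
          calc _ ≤ _ := e1
            _ ≤ ENNReal.ofReal (l / 2) + ENNReal.ofReal (l / 2) := by gcongr
            _ = _ := by rw [← ENNReal.ofReal_add (by positivity) (by positivity)]; congr 1; ring
        exact absurd hz (not_lt.2 this)
      · have h1 : l < C2 * A / √t := by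
          have := hz.trans_le (hsup t ht x)
          exact (ENNReal.ofReal_lt_ofReal_iff_of_nonneg hl.le).1 this
        have hst : 0 < √t := Real.sqrt_pos.2 ht
        have h2 : √t < C2 * A / l := by
          rw [lt_div_iff₀ hst] at h1
          rw [lt_div_iff₀ hl]; linarith
        calc t = √t ^ 2 := (Real.sq_sqrt ht.le).symm
          _ < t0 := by rw [ht0]; gcongr
    calc _ ≤ volume ({z | ENNReal.ofReal (l / 2) ≤ heatOp (H.indicator a) z} ∩ (Ioo 0 t0 ×ˢ univ)) :=
          measure_mono hsub
      _ = (volume.restrict (Ioo 0 t0 ×ˢ univ)) {z | ENNReal.ofReal (l / 2) ≤ heatOp (H.indicator a) z} := by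
          rw [Measure.restrict_apply (measurableSet_le measurable_const hgm)]
      _ ≤ (∫⁻ z in Ioo 0 t0 ×ˢ univ, heatOp (H.indicator a) z) / ENNReal.ofReal (l / 2) :=
          meas_ge_le_lintegral_div hgm.aemeasurable (by simpa using hl) (by simp)
      _ ≤ (ENNReal.ofReal C1 * (∫⁻ y in H, a y) * ENNReal.ofReal t0) / ENNReal.ofReal (l / 2) := by
          gcongr
          rw [Measure.volume_eq_prod, ← Measure.prod_restrict, Measure.restrict_univ,
            lintegral_prod _ hgm.aemeasurable]
          calc _ ≤ ∫⁻ t in Ioo 0 t0, ENNReal.ofReal C1 * ∫⁻ y in H, a y := by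
                refine setLIntegral_mono' measurableSet_Ioo fun t ht => ?_
                unfold heatOp
                rw [lintegral_lintegral_swap]
                · rw [← lintegral_indicator hHm]
                  calc ∫⁻ y, ∫⁻ x, heatMaj t (x - y) * H.indicator a y =
                        ∫⁻ y, (∫⁻ z : E d, heatMaj t z) * H.indicator a y := by
                        refine lintegral_congr fun y => ?_
                        have : Measurable fun z : E d => heatMaj t (z - y) :=
                          (hkm t).comp (measurable_id.sub measurable_const)
                        rw [lintegral_mul_const _ this, lintegral_sub_right_eq_self (fun z => heatMaj t z) y]
                    _ = (∫⁻ z : E d, heatMaj t z) * ∫⁻ y, H.indicator a y := lintegral_const_mul _ haH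
                    _ ≤ _ := by gcongr; exact hmass t ht.1
                · exact (((hkm t).comp (measurable_fst.sub measurable_snd)).mul
                    (haH.comp measurable_snd)).aemeasurable
            _ = _ := by rw [lintegral_const]; simp
      _ = _ := by
          rw [ENNReal.div_eq_inv_mul, ← ENNReal.ofReal_inv_of_pos (by positivity)]
          have : ∀ x y z w : ℝ≥0∞, x * (y * z * w) = (x * y * w) * z := fun x y z w => by ring
          rw [this, ← ENNReal.ofReal_mul (by positivity), ← ENNReal.ofReal_mul (by positivity),
            ← ENNReal.ofReal_mul (by positivity)]
          congr 2
          rw [ht0, Real.rpow_neg hl.le, show (3 : ℝ) = ((3 : ℕ) : ℝ) by norm_num, Real.rpow_natCast]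
          field_simp
  have strong := lintegral_rpow_le_of_weak (measurable_heatOp ha) ha (n := N) (β := 3) (γ := 1)
    (c := (2 * C1)⁻¹) (K := ENNReal.ofReal (2 * C1 * (C2 * A) ^ 2)) (by rw [hNd]; linarith)
    (by rw [hNd]; linarith) (by norm_num) (by positivity) weak
  have hexp : 1 + (N - 3) / 1 = d := by rw [hNd]; ring
  rw [hexp, inv_inv] at strong
  refine strong.trans (le_of_eq ?_)
  have e7 : ENNReal.ofReal (2 * C1 * (C2 * A) ^ 2) = ENNReal.ofReal (2 * C1 * C2 ^ 2) * Φ ^ (2 / (d : ℝ)) := by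
    rw [show 2 * C1 * (C2 * A) ^ 2 = 2 * C1 * C2 ^ 2 * A ^ 2 by ring, ENNReal.ofReal_mul (by positivity),
      ENNReal.ofReal_pow hA0, hAe, ← ENNReal.rpow_two, ← ENNReal.rpow_mul]
    congr 2; ring
  rw [e7]
  ring

end

/-! ### Extended seminorms and weighted mixed norms on a strip. -/

section

variable {d : ℕ}

/-- An extended seminorm on a normed space whose sublevel sets are closed. -/
structure ExtSeminorm (X : Type*) [NormedAddCommGroup X] [NormedSpace ℝ X] where
  M : X → ℝ≥0∞
  zero : M 0 = 0
  add_le : ∀ x y, M (x + y) ≤ M x + M y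
  smul : ∀ (c : ℝ) x, M (c • x) = ‖c‖ₑ * M x
  closed : ∀ C, IsClosed {x | M x ≤ C}

namespace ExtSeminorm

variable {X : Type*} [NormedAddCommGroup X] [NormedSpace ℝ X] (P : ExtSeminorm X)

/-- The subspace on which an extended seminorm is finite. -/
def dom : Submodule ℝ X where
  carrier := {x | P.M x < ⊤}
  add_mem' hx hy := (P.add_le _ _).trans_lt (ENNReal.add_lt_top.2 ⟨hx, hy⟩)
  zero_mem' := by simp [P.zero]
  smul_mem' c x hx := by
    simp only [mem_ofPred_eq, P.smul]
    exact ENNReal.mul_lt_top (by simp) hx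

/-- The subspace `P.dom` with the norm `‖x‖ + P x`. -/
def Space : Type _ := P.dom

instance : AddCommGroup P.Space := inferInstanceAs (AddCommGroup P.dom)
instance : Module ℝ P.Space := inferInstanceAs (Module ℝ P.dom)

/-- The inclusion of the space of an extended seminorm, as a linear map. -/
def inclₗ : P.Space →ₗ[ℝ] X := P.dom.subtype

theorem inclₗ_injective : Function.Injective P.inclₗ := P.dom.injective_subtype

theorem inclₗ_lt_top (x : P.Space) : P.M (P.inclₗ x) < ⊤ := Subtype.prop (p := fun x => x ∈ P.dom) x

/-- An element of the ambient space with finite seminorm. -/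
def ofDom (x : X) (hx : P.M x < ⊤) : P.Space := ⟨x, hx⟩

instance : Norm P.Space := ⟨fun x => ‖P.inclₗ x‖ + (P.M (P.inclₗ x)).toReal⟩

theorem norm_def (x : P.Space) : ‖x‖ = ‖P.inclₗ x‖ + (P.M (P.inclₗ x)).toReal := rfl

theorem core : NormedSpace.Core ℝ P.Space where
  norm_nonneg x := by rw [norm_def]; positivity
  norm_smul c x := by
    rw [norm_def, norm_def, map_smul, norm_smul, P.smul, ENNReal.toReal_mul]
    simp; ring
  norm_triangle x y := by
    rw [norm_def, norm_def, norm_def, map_add]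
    have h1 := norm_add_le (P.inclₗ x) (P.inclₗ y)
    have h2 : (P.M (P.inclₗ x + P.inclₗ y)).toReal ≤ (P.M (P.inclₗ x)).toReal + (P.M (P.inclₗ y)).toReal := by
      rw [← ENNReal.toReal_add (P.inclₗ_lt_top x).ne (P.inclₗ_lt_top y).ne]
      exact ENNReal.toReal_mono (ENNReal.add_lt_top.2 ⟨P.inclₗ_lt_top x, P.inclₗ_lt_top y⟩).ne (P.add_le _ _)
    linarith
  norm_eq_zero_iff x := by
    rw [norm_def]
    constructor
    · intro h
      have h1 : ‖P.inclₗ x‖ = 0 := by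
        have := norm_nonneg (P.inclₗ x)
        have := ENNReal.toReal_nonneg (a := P.M (P.inclₗ x))
        linarith
      exact P.inclₗ_injective (by rw [map_zero]; exact norm_eq_zero.1 h1)
    · rintro rfl
      simp [P.zero]

instance : NormedAddCommGroup P.Space := NormedAddCommGroup.ofCore P.core
instance : NormedSpace ℝ P.Space := NormedSpace.ofCore P.core

/-- The inclusion of the space of an extended seminorm into the ambient space. -/
def incl : P.Space →L[ℝ] X :=
  P.inclₗ.mkContinuous 1 fun x => by rw [one_mul, norm_def]; simp

@[simp] theorem incl_ofDom (x : X) (hx : P.M x < ⊤) : P.incl (P.ofDom x hx) = x := rfl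

theorem incl_injective : Function.Injective P.incl := P.inclₗ_injective

theorem incl_lt_top (x : P.Space) : P.M (P.incl x) < ⊤ := P.inclₗ_lt_top x

theorem norm_eq (x : P.Space) : ‖x‖ = ‖P.incl x‖ + (P.M (P.incl x)).toReal := rfl

theorem norm_incl_le (x : P.Space) : ‖P.incl x‖ ≤ ‖x‖ := by rw [P.norm_eq x]; simp

theorem M_incl_le (x : P.Space) : P.M (P.incl x) ≤ ENNReal.ofReal ‖x‖ := by
  rw [← ENNReal.ofReal_toReal (P.incl_lt_top x).ne]
  exact ENNReal.ofReal_le_ofReal (by rw [P.norm_eq x]; simp)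

theorem norm_le_of {x : P.Space} {A B : ℝ} (hB : 0 ≤ B) (h1 : ‖P.incl x‖ ≤ A)
    (h2 : P.M (P.incl x) ≤ ENNReal.ofReal B) : ‖x‖ ≤ A + B := by
  rw [P.norm_eq x]
  have := ENNReal.toReal_mono ENNReal.ofReal_ne_top h2
  rw [ENNReal.toReal_ofReal hB] at this
  linarith

/-- A Cauchy sequence converges in the ambient norm. Closedness of the sublevel sets lets `m → ∞` in
the bounds for the seminorm of `u n - u m`, which gives both finiteness at the limit and
convergence. Completeness is what the implicit function theorem needs. -/
instance [CompleteSpace X] : CompleteSpace P.Space := by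
  refine Metric.complete_of_cauchySeq_tendsto fun u hu => ?_
  have hX : CauchySeq fun n => P.incl (u n) := P.incl.uniformContinuous.comp_cauchySeq hu
  obtain ⟨x, hx⟩ := cauchySeq_tendsto_of_complete hX
  have key : ∀ ε : ℝ, 0 < ε → ∃ n0, ∀ n ≥ n0, P.M (P.incl (u n) - x) ≤ ENNReal.ofReal ε := by
    intro ε hε
    obtain ⟨n0, hn0⟩ := Metric.cauchySeq_iff.1 hu ε hε
    refine ⟨n0, fun n hn => ?_⟩
    have hlim : Filter.Tendsto (fun m => P.incl (u n) - P.incl (u m)) Filter.atTop (nhds (P.incl (u n) - x)) :=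
      tendsto_const_nhds.sub hx
    refine (P.closed (ENNReal.ofReal ε)).mem_of_tendsto hlim ?_
    filter_upwards [Filter.eventually_ge_atTop n0] with m hm
    rw [← map_sub]
    refine (P.M_incl_le _).trans (ENNReal.ofReal_le_ofReal ?_)
    rw [← dist_eq_norm]
    exact (hn0 n hn m hm).le
  obtain ⟨n1, hn1⟩ := key 1 zero_lt_one
  have hxfin : P.M x < ⊤ := by
    have h1 : P.M (P.incl (u n1) - x) < ⊤ := (hn1 n1 le_rfl).trans_lt (by simp)
    have h2 : P.M ((-1 : ℝ) • (P.incl (u n1) - x)) < ⊤ := by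
      rw [P.smul]; exact ENNReal.mul_lt_top (by simp) h1
    have : x = P.incl (u n1) + (-1 : ℝ) • (P.incl (u n1) - x) := by simp
    rw [this]
    exact (P.add_le _ _).trans_lt (ENNReal.add_lt_top.2 ⟨P.incl_lt_top _, h2⟩)
  refine ⟨P.ofDom x hxfin, ?_⟩
  rw [tendsto_iff_norm_sub_tendsto_zero]
  rw [Metric.tendsto_atTop]
  intro ε hε
  obtain ⟨n2, hn2⟩ := key (ε / 2) (by positivity)
  obtain ⟨n3, hn3⟩ := Metric.tendsto_atTop.1 hx (ε / 2) (by positivity)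
  refine ⟨max n2 n3, fun n hn => ?_⟩
  have h2 := hn2 n (le_of_max_le_left hn)
  have h3 := hn3 n (le_of_max_le_right hn)
  rw [Real.dist_eq, sub_zero, abs_of_nonneg (norm_nonneg _), P.norm_eq, map_sub, incl_ofDom]
  rw [dist_eq_norm] at h3
  have := ENNReal.toReal_mono ENNReal.ofReal_ne_top h2
  rw [ENNReal.toReal_ofReal (by positivity)] at this
  linarith

end ExtSeminorm

/-- The exponent `d + 2`. -/
abbrev nE (d : ℕ) : ℝ≥0∞ := (d : ℝ≥0∞) + 2

instance : Fact ((1 : ℝ≥0∞) ≤ nE d) := ⟨by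
  calc (1 : ℝ≥0∞) ≤ 2 := by norm_num
    _ ≤ _ := le_add_self⟩

theorem nE_toReal : (nE d).toReal = nR d := by
  rw [ENNReal.toReal_add (by simp) (by simp)]; simp

theorem nE_ne_top : nE d ≠ ⊤ := by simp
theorem nE_ne_zero : nE d ≠ 0 := by simp

/-- Lebesgue measure on the strip. -/
abbrev stripMeasure (d : ℕ) (δ : ℝ) : Measure (ℝ × E d) := volume.restrict (strip d δ)

theorem stripMeasure_eq (δ : ℝ) :
    stripMeasure d δ = (volume.restrict (Ioo 0 δ)).prod (volume : Measure (E d)) := by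
  rw [stripMeasure, strip, Measure.volume_eq_prod, ← Measure.prod_restrict, Measure.restrict_univ]

theorem measurableSet_strip {δ : ℝ} : MeasurableSet (strip d δ) :=
  measurableSet_Ioo.prod MeasurableSet.univ

theorem ae_slice {δ : ℝ} {p : ℝ × E d → Prop} (h : ∀ᵐ z ∂stripMeasure d δ, p z) :
    ∀ᵐ t ∂volume.restrict (Ioo 0 δ), ∀ᵐ x : E d, p (t, x) := by
  rw [stripMeasure_eq] at h
  exact Measure.ae_ae_of_ae_prod h

theorem aestronglyMeasurable_slice {δ : ℝ} {F : Type*} [NormedAddCommGroup F] {f : ℝ × E d → F}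
    (h : AEStronglyMeasurable f (stripMeasure d δ)) :
    ∀ᵐ t ∂volume.restrict (Ioo 0 δ), AEStronglyMeasurable (fun x : E d => f (t, x)) volume := by
  rw [stripMeasure_eq] at h
  exact h.prodMk_left

/-- The weighted mixed norm `ess sup_t t^σ ‖f(t, ·)‖_{L^q}`. -/
def supNorm (σ : ℝ) (q : ℝ≥0∞) (δ : ℝ) (f : ℝ × E d → ℝ) : ℝ≥0∞ :=
  essSup (fun t => ENNReal.ofReal (t ^ σ) * eLpNorm (fun x : E d => f (t, x)) q volume)
    (volume.restrict (Ioo 0 δ))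

theorem supNorm_congr {σ : ℝ} {q : ℝ≥0∞} {δ : ℝ} {f g : ℝ × E d → ℝ}
    (h : f =ᵐ[stripMeasure d δ] g) : supNorm σ q δ f = supNorm σ q δ g := by
  refine essSup_congr_ae ?_
  filter_upwards [ae_slice h] with t ht
  rw [eLpNorm_congr_ae ht]

theorem ae_le_supNorm (σ : ℝ) (q : ℝ≥0∞) (δ : ℝ) (f : ℝ × E d → ℝ) :
    ∀ᵐ t ∂volume.restrict (Ioo 0 δ),
      ENNReal.ofReal (t ^ σ) * eLpNorm (fun x : E d => f (t, x)) q volume ≤ supNorm σ q δ f :=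
  ENNReal.ae_le_essSup _

theorem supNorm_le {σ : ℝ} {q : ℝ≥0∞} {δ : ℝ} {f : ℝ × E d → ℝ} {C : ℝ≥0∞}
    (h : ∀ᵐ t ∂volume.restrict (Ioo 0 δ),
      ENNReal.ofReal (t ^ σ) * eLpNorm (fun x : E d => f (t, x)) q volume ≤ C) :
    supNorm σ q δ f ≤ C := essSup_le_of_ae_le _ h

/-- `L^{d+2}` of the strip. -/
abbrev LpStrip (d : ℕ) (δ : ℝ) : Type := Lp ℝ (nE d) (stripMeasure d δ)

/-- The weighted mixed norm as an extended seminorm on `L^{d+2}` of the strip. -/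
def supSeminorm (d : ℕ) (δ σ : ℝ) (q : ℝ≥0∞) (hq : 1 ≤ q) : ExtSeminorm (LpStrip d δ) where
  M f := supNorm σ q δ f
  zero := by
    rw [supNorm_congr (Lp.coeFn_zero _ _ _)]
    refine le_antisymm (supNorm_le (Filter.Eventually.of_forall fun t => ?_)) bot_le
    simp
  add_le f g := by
    rw [supNorm_congr (Lp.coeFn_add f g)]
    refine supNorm_le ?_
    filter_upwards [ae_le_supNorm σ q δ f, ae_le_supNorm σ q δ g,
      aestronglyMeasurable_slice (Lp.aestronglyMeasurable f),
      aestronglyMeasurable_slice (Lp.aestronglyMeasurable g)] with t h1 h2 h3 h4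
    calc _ ≤ ENNReal.ofReal (t ^ σ) * (eLpNorm (fun x : E d => f (t, x)) q volume +
          eLpNorm (fun x : E d => g (t, x)) q volume) := by
          gcongr
          exact eLpNorm_add_le h3 h4 hq
      _ ≤ _ := by rw [mul_add]; gcongr
  smul c f := by
    rw [supNorm_congr (Lp.coeFn_smul c f)]
    have : ∀ t : ℝ, ENNReal.ofReal (t ^ σ) * eLpNorm (fun x : E d => (c • ⇑f) (t, x)) q volume =
        ‖c‖ₑ * (ENNReal.ofReal (t ^ σ) * eLpNorm (fun x : E d => f (t, x)) q volume) := by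
      intro t
      have := eLpNorm_const_smul c (fun x : E d => f (t, x)) q volume
      simp only [Pi.smul_apply, Pi.smul_def] at this ⊢
      rw [this]; ring
    simp only [supNorm, this]
    exact ENNReal.essSup_const_mul
  closed C := by
    refine IsSeqClosed.isClosed fun u x hu hx => ?_
    -- A subsequence converges almost everywhere, hence on almost every time slice, and Fatou
    -- applies to the slice norms.
    obtain ⟨ns, -, hns⟩ := (tendstoInMeasure_of_tendsto_Lp hx).exists_seq_tendsto_ae
    refine supNorm_le ?_
    have h1 : ∀ᵐ t ∂volume.restrict (Ioo 0 δ), ∀ n,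
        ENNReal.ofReal (t ^ σ) * eLpNorm (fun x : E d => u n (t, x)) q volume ≤ C := by
      rw [ae_all_iff]
      intro n
      filter_upwards [ae_le_supNorm σ q δ (u n)] with t ht
      exact ht.trans (hu n)
    have h2 : ∀ᵐ t ∂volume.restrict (Ioo 0 δ), ∀ n,
        AEStronglyMeasurable (fun x : E d => u n (t, x)) volume := by
      rw [ae_all_iff]
      exact fun n => aestronglyMeasurable_slice (Lp.aestronglyMeasurable (u n))
    filter_upwards [h1, h2, ae_slice hns, ae_restrict_mem measurableSet_Ioo] with t ht1 ht2 ht3 htI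
    have h3 := Lp.eLpNorm_lim_le_liminf_eLpNorm (p := q) (fun n => ht2 (ns n)) _ ht3
    have hpos : 0 < t ^ σ := Real.rpow_pos_of_pos htI.1 σ
    have h4 : ∀ n, eLpNorm (fun x : E d => u n (t, x)) q volume ≤ (ENNReal.ofReal (t ^ σ))⁻¹ * C := by
      intro n
      rw [← ENNReal.mul_le_iff_le_inv (by simpa using hpos) (by simp)]
      exact ht1 n
    rw [ENNReal.mul_le_iff_le_inv (by simpa using hpos) (by simp)]
    refine h3.trans ?_
    refine (Filter.liminf_le_liminf (v := fun _ => (ENNReal.ofReal (t ^ σ))⁻¹ * C)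
      (Filter.Eventually.of_forall fun n => h4 (ns n))).trans ?_
    simp

end

/-! ### Gaussian-type functions and symbols depending smoothly on a shift. -/

section

variable {d : ℕ}

/-- The spatial partial derivative of a function on `ℝ^d`. -/
def pd (j : Fin d) (f : E d → ℝ) (y : E d) : ℝ := fderiv ℝ f y (EuclideanSpace.single j 1)

/-- The heat kernel at time one. -/
def gauss (y : E d) : ℝ := (4 * Real.pi) ^ (-((d : ℝ) / 2)) * Real.exp (-(‖y‖ ^ 2 / 4))

/-- Linear combinations of monomials times the Gaussian. -/
inductive GaussClass : (E d → ℝ) → Prop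
  | gauss : GaussClass gauss
  | coord (j : Fin d) (f : E d → ℝ) : GaussClass f → GaussClass (fun y => y j * f y)
  | add (f g : E d → ℝ) : GaussClass f → GaussClass g → GaussClass (fun y => f y + g y)
  | smul (c : ℝ) (f : E d → ℝ) : GaussClass f → GaussClass (fun y => c * f y)

theorem gauss_contDiff : ContDiff ℝ ∞ (gauss (d := d)) := by
  unfold gauss
  exact contDiff_const.mul ((((contDiff_norm_sq ℝ).div_const 4).neg).exp)

theorem coord_contDiff (j : Fin d) : ContDiff ℝ ∞ (fun y : E d => y j) :=
  (EuclideanSpace.proj j : E d →L[ℝ] ℝ).contDiff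

theorem coord_hasFDerivAt (j : Fin d) (y : E d) :
    HasFDerivAt (fun y : E d => y j) (EuclideanSpace.proj j : E d →L[ℝ] ℝ) y :=
  (EuclideanSpace.proj j : E d →L[ℝ] ℝ).hasFDerivAt

theorem pd_gauss (j : Fin d) (y : E d) : pd j gauss y = -(1 / 2) * (y j * gauss y) := by
  have h1 : HasFDerivAt (fun y : E d => -(‖y‖ ^ 2 / 4)) (-((4 : ℝ)⁻¹ • (2 • innerSL ℝ y))) y := by
    have := (((hasStrictFDerivAt_norm_sq y).hasFDerivAt).const_smul (4 : ℝ)⁻¹).neg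
    refine this.congr_of_eventuallyEq (Filter.Eventually.of_forall fun z => ?_)
    simp [div_eq_inv_mul]
  have h2 := h1.exp.const_mul ((4 * Real.pi) ^ (-((d : ℝ) / 2)))
  unfold pd
  rw [show (gauss : E d → ℝ) = fun y => (4 * Real.pi) ^ (-((d : ℝ) / 2)) * Real.exp (-(‖y‖ ^ 2 / 4)) from rfl,
    h2.fderiv]
  simp [EuclideanSpace.inner_single_right]
  ring

namespace GaussClass

theorem contDiff {f : E d → ℝ} (hf : GaussClass f) : ContDiff ℝ ∞ f := by
  induction hf with
  | gauss => exact gauss_contDiff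
  | coord j f _ ih => exact (coord_contDiff j).mul ih
  | add f g _ _ ihf ihg => exact ihf.add ihg
  | smul c f _ ih => exact contDiff_const.mul ih

theorem differentiable {f : E d → ℝ} (hf : GaussClass f) : Differentiable ℝ f :=
  hf.contDiff.differentiable (by simp)

theorem pd {f : E d → ℝ} (hf : GaussClass f) (j : Fin d) : GaussClass (pd j f) := by
  induction hf with
  | gauss =>
    have : NavierStokes.pd j NavierStokes.gauss = fun y : E d => -(1 / 2) * (y j * NavierStokes.gauss y) :=
      funext (pd_gauss j)
    rw [this]
    exact .smul _ _ (.coord _ _ .gauss)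
  | coord i f hf ih =>
    have : NavierStokes.pd j (fun y => y i * f y) =
        fun y : E d => y i * NavierStokes.pd j f y + (if i = j then 1 else 0) * f y := by
      funext y
      have : HasFDerivAt (fun y => y i * f y) _ y :=
        (coord_hasFDerivAt i y).mul (hf.differentiable y).hasFDerivAt
      simp only [NavierStokes.pd]
      rw [HasFDerivAt.fderiv this]
      simp [mul_comm]
    rw [this]
    exact .add _ _ (.coord _ _ ih) (.smul _ _ hf)
  | add f g hf hg ihf ihg =>
    have : NavierStokes.pd j (fun y => f y + g y) =
        fun y : E d => NavierStokes.pd j f y + NavierStokes.pd j g y := by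
      funext y
      simp only [NavierStokes.pd]
      rw [fderiv_fun_add (hf.differentiable y) (hg.differentiable y)]
      simp
    rw [this]
    exact .add _ _ ihf ihg
  | smul c f hf ih =>
    have : NavierStokes.pd j (fun y => c * f y) = fun y : E d => c * NavierStokes.pd j f y := by
      funext y
      simp only [NavierStokes.pd]
      rw [fderiv_const_mul (hf.differentiable y)]
      simp
    rw [this]
    exact .smul _ _ ih

/-- For the Gaussian, the power series of the exponential gives `(1 + |y|²)^k ≤ 4^k k! exp((1 +
|y|²)/4)`, whose exponential cancels against the Gaussian. A coordinate factor is absorbed by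
raising `k` by one. -/
theorem decay {f : E d → ℝ} (hf : GaussClass f) (k : ℕ) : ∃ C : ℝ, 0 ≤ C ∧ ∀ y, |f y| * (1 + ‖y‖ ^ 2) ^ k ≤ C := by
  induction hf generalizing k with
  | gauss =>
    set c : ℝ := (4 * Real.pi) ^ (-((d : ℝ) / 2))
    have hc : 0 ≤ c := by positivity
    refine ⟨c * (4 ^ k * k.factorial * Real.exp (1 / 4)), by positivity, fun y => ?_⟩
    have h := Real.pow_div_factorial_le_exp ((1 + ‖y‖ ^ 2) / 4) (by positivity) k
    have h0 : 0 ≤ NavierStokes.gauss y := by unfold NavierStokes.gauss; positivity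
    rw [abs_of_nonneg h0]
    have h1 : (1 + ‖y‖ ^ 2) ^ k ≤ 4 ^ k * k.factorial * Real.exp ((1 + ‖y‖ ^ 2) / 4) := by
      rw [div_pow, div_div, div_le_iff₀ (by positivity)] at h
      linarith
    calc NavierStokes.gauss y * (1 + ‖y‖ ^ 2) ^ k
        ≤ c * Real.exp (-(‖y‖ ^ 2 / 4)) * (4 ^ k * k.factorial * Real.exp ((1 + ‖y‖ ^ 2) / 4)) := by
          unfold NavierStokes.gauss
          gcongr
      _ = c * (4 ^ k * k.factorial * (Real.exp (-(‖y‖ ^ 2 / 4)) * Real.exp ((1 + ‖y‖ ^ 2) / 4))) := by ring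
      _ = _ := by rw [← Real.exp_add]; congr 3; ring_nf
  | coord j f _ ih =>
    obtain ⟨C, hC, h⟩ := ih (k + 1)
    refine ⟨C, hC, fun y => le_trans ?_ (h y)⟩
    have h1 : |y j| ≤ 1 + ‖y‖ ^ 2 := by
      have := EuclideanSpace.norm_eq y
      have h2 : |y j| ≤ ‖y‖ := by simpa using PiLp.norm_apply_le y j
      nlinarith [sq_nonneg (‖y‖ - 1)]
    rw [abs_mul, pow_succ]
    calc |y j| * |f y| * (1 + ‖y‖ ^ 2) ^ k ≤ (1 + ‖y‖ ^ 2) * |f y| * (1 + ‖y‖ ^ 2) ^ k := by gcongr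
      _ = _ := by ring
  | add f g _ _ ihf ihg =>
    obtain ⟨C, hC, h⟩ := ihf k
    obtain ⟨D, hD, h'⟩ := ihg k
    refine ⟨C + D, by positivity, fun y => ?_⟩
    calc _ ≤ (|f y| + |g y|) * (1 + ‖y‖ ^ 2) ^ k := by gcongr; exact abs_add_le _ _
      _ ≤ _ := by rw [add_mul]; exact add_le_add (h y) (h' y)
  | smul c f _ ih =>
    obtain ⟨C, hC, h⟩ := ih k
    refine ⟨|c| * C, by positivity, fun y => ?_⟩
    rw [abs_mul, mul_assoc]
    gcongr
    exact h y

end GaussClass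

/-- The reciprocal of the profile. -/
def wt (y : E d) : ℝ := (1 + ‖y‖ ^ 2) ^ (((d : ℝ) + 3) / 2)

theorem wt_pos (y : E d) : 0 < wt y := by unfold wt; positivity

theorem wt_continuous : Continuous (wt (d := d)) := by
  unfold wt
  exact Continuous.rpow_const (by fun_prop) fun y => Or.inl (by positivity)

theorem wt_le (y : E d) : wt y ≤ (1 + ‖y‖ ^ 2) ^ (d + 3) := by
  unfold wt
  rw [← Real.rpow_natCast (1 + ‖y‖ ^ 2) (d + 3)]
  apply Real.rpow_le_rpow_of_exponent_le (by nlinarith [sq_nonneg ‖y‖])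
  push_cast
  linarith [(Nat.cast_nonneg d : (0 : ℝ) ≤ d)]

namespace GaussClass

/-- A shift of length at most `R` changes `1 + |y|²` by a factor of at most `2(1 + R²)`, so decay at
`y + v` is decay at `y`. -/
theorem wt_bound {f : E d → ℝ} (hf : GaussClass f) (R : ℝ) :
    ∃ C : ℝ, 0 ≤ C ∧ ∀ y v, ‖v‖ ≤ R → |f (y + v)| * wt y ≤ C := by
  obtain ⟨C, hC, h⟩ := hf.decay (d + 3)
  refine ⟨C * (2 * (1 + R ^ 2)) ^ (d + 3), by positivity, fun y v hv => ?_⟩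
  have h1 : 1 + ‖y‖ ^ 2 ≤ (1 + ‖y + v‖ ^ 2) * (2 * (1 + R ^ 2)) := by
    have h2 : ‖y‖ ≤ ‖y + v‖ + ‖v‖ := by
      calc ‖y‖ = ‖(y + v) - v‖ := by simp
        _ ≤ _ := norm_sub_le _ _
    have h3 : ‖v‖ ^ 2 ≤ R ^ 2 := by gcongr
    have h4 : ‖y‖ ^ 2 ≤ (‖y + v‖ + ‖v‖) ^ 2 := by gcongr
    nlinarith [sq_nonneg (‖y + v‖ - ‖v‖), mul_nonneg (sq_nonneg ‖y + v‖) (sq_nonneg R)]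
  calc |f (y + v)| * wt y ≤ |f (y + v)| * ((1 + ‖y + v‖ ^ 2) * (2 * (1 + R ^ 2))) ^ (d + 3) := by
        gcongr
        exact (wt_le y).trans (by gcongr)
    _ = (|f (y + v)| * (1 + ‖y + v‖ ^ 2) ^ (d + 3)) * (2 * (1 + R ^ 2)) ^ (d + 3) := by
        rw [mul_pow]; ring
    _ ≤ _ := by gcongr; exact h _

end GaussClass

theorem fderiv_apply_eq_sum (f : E d → ℝ) (x h : E d) : fderiv ℝ f x h = ∑ i, h i * pd i f x := by
  have : h = ∑ i, h i • EuclideanSpace.single i (1 : ℝ) := by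
    ext j; simp [Finset.sum_apply, Pi.single_apply]
  conv_lhs => rw [this]
  simp [pd]

theorem norm_le_sum_of_apply (L : E d →L[ℝ] ℝ) : ‖L‖ ≤ ∑ i, |L (EuclideanSpace.single i 1)| := by
  refine L.opNorm_le_bound (by positivity) fun h => ?_
  have : h = ∑ i, h i • EuclideanSpace.single i (1 : ℝ) := by
    ext j; simp [Finset.sum_apply, Pi.single_apply]
  conv_lhs => rw [this]
  rw [map_sum, Finset.sum_mul]
  refine (norm_sum_le _ _).trans (Finset.sum_le_sum fun i _ => ?_)
  rw [map_smul, norm_smul, mul_comm, Real.norm_eq_abs]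
  gcongr
  simpa using PiLp.norm_apply_le h i

namespace GaussClass

/-- Mean value inequality in the shift for fixed `y`; the weighted bound comes from `wt_bound` for
the partial derivatives, which stay in the class. -/
theorem lipschitz {f : E d → ℝ} (hf : GaussClass f) (R : ℝ) :
    ∃ C : ℝ, 0 ≤ C ∧ ∀ y v v', ‖v‖ ≤ R → ‖v'‖ ≤ R → |f (y + v) - f (y + v')| * wt y ≤ C * ‖v - v'‖ := by
  choose C hC h using fun i => (hf.pd i).wt_bound R
  refine ⟨∑ i, C i, Finset.sum_nonneg fun i _ => hC i, fun y v v' hv hv' => ?_⟩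
  have key := Convex.norm_image_sub_le_of_norm_hasFDerivWithin_le (f := fun v => f (y + v))
    (f' := fun v => fderiv ℝ f (y + v)) (s := Metric.closedBall 0 R) (C := (∑ i, C i) / wt y)
    (fun u _ => ((hasFDerivAt_comp_add_left y).2 (hf.differentiable (y + u)).hasFDerivAt).hasFDerivWithinAt)
    (fun u hu => by
      refine (norm_le_sum_of_apply _).trans ?_
      rw [Finset.sum_div]
      refine Finset.sum_le_sum fun i _ => ?_
      rw [le_div_iff₀ (wt_pos y)]
      exact h i y u (by simpa using hu)) (convex_closedBall 0 R)
    (x := v') (y := v) (by simpa using hv') (by simpa using hv)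
  rw [Real.norm_eq_abs, div_mul_eq_mul_div, le_div_iff₀ (wt_pos y)] at key
  exact key

/-- Mean value inequality for the first-order remainder on the ball of radius `‖h‖` about `v`, where
the derivative moves by at most a Lipschitz constant times `‖h‖`. As `‖h‖ ≤ 1`, Lipschitz bounds on
radius `R + 1` suffice. -/
theorem taylor {f : E d → ℝ} (hf : GaussClass f) (R : ℝ) :
    ∃ C : ℝ, 0 ≤ C ∧ ∀ y v h, ‖v‖ ≤ R → ‖h‖ ≤ 1 →
      |f (y + v + h) - f (y + v) - fderiv ℝ f (y + v) h| * wt y ≤ C * ‖h‖ ^ 2 := by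
  choose C hC h using fun i => (hf.pd i).lipschitz (R + 1)
  refine ⟨∑ i, C i, Finset.sum_nonneg fun i _ => hC i, fun y v k hv hk => ?_⟩
  have key := Convex.norm_image_sub_le_of_norm_hasFDerivWithin_le
    (f := fun u => f (y + u) - fderiv ℝ f (y + v) u)
    (f' := fun u => fderiv ℝ f (y + u) - fderiv ℝ f (y + v)) (s := Metric.closedBall v ‖k‖)
    (C := (∑ i, C i) * ‖k‖ / wt y)
    (fun u _ => (((hasFDerivAt_comp_add_left y).2 (hf.differentiable (y + u)).hasFDerivAt).sub
      (fderiv ℝ f (y + v)).hasFDerivAt).hasFDerivWithinAt)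
    (fun u hu => by
      have hu : ‖u - v‖ ≤ ‖k‖ := by simpa [dist_eq_norm] using hu
      refine (norm_le_sum_of_apply _).trans ?_
      rw [Finset.sum_mul, Finset.sum_div]
      refine Finset.sum_le_sum fun i _ => ?_
      rw [le_div_iff₀ (wt_pos y)]
      have hu' : ‖u‖ ≤ R + 1 := by
        calc ‖u‖ = ‖(u - v) + v‖ := by simp
          _ ≤ ‖u - v‖ + ‖v‖ := norm_add_le _ _
          _ ≤ _ := by linarith
      refine (h i y u v hu' (by linarith)).trans ?_
      gcongr
      exact hC i) (convex_closedBall v ‖k‖)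
    (x := v) (y := v + k) (by simp) (by simp)
  rw [Real.norm_eq_abs, div_mul_eq_mul_div, le_div_iff₀ (wt_pos y)] at key
  have e : f (y + (v + k)) - fderiv ℝ f (y + v) (v + k) - (f (y + v) - fderiv ℝ f (y + v) v) =
      f (y + v + k) - f (y + v) - fderiv ℝ f (y + v) k := by
    rw [map_add, add_assoc]; ring
  rw [e] at key
  calc _ ≤ _ := key
    _ = _ := by simp; ring

end GaussClass

/-- Truncation to the unit interval. -/
def clamp (ρ : ℝ) : ℝ := max 0 (min ρ 1)

theorem clamp_continuous : Continuous clamp := by unfold clamp; fun_prop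

theorem clamp_of_mem {ρ : ℝ} (h0 : 0 ≤ ρ) (h1 : ρ ≤ 1) : clamp ρ = ρ := by simp [clamp, h0, h1]

theorem clamp_one : clamp 1 = 1 := clamp_of_mem zero_le_one le_rfl

theorem abs_clamp_le (ρ : ℝ) : |clamp ρ| ≤ 1 := by
  rw [clamp, abs_of_nonneg (le_max_left _ _)]
  exact max_le zero_le_one (min_le_right _ _)

/-- Bounded continuous symbols `m(ρ, y)`. -/
abbrev Sym (d : ℕ) : Type := BoundedContinuousFunction (ℝ × E d) ℝ

theorem symbol_bound {f : E d → ℝ} (hf : GaussClass f) (j : ℕ) (ζ : E d) :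
    ∃ C, ∀ p : ℝ × E d, ‖clamp p.1 ^ j * f (p.2 + clamp p.1 • ζ) * wt p.2‖ ≤ C := by
  obtain ⟨C, hC, h⟩ := hf.wt_bound ‖ζ‖
  refine ⟨C, fun p => ?_⟩
  rw [norm_mul, norm_mul, norm_pow, Real.norm_eq_abs, Real.norm_eq_abs, Real.norm_eq_abs,
    abs_of_pos (wt_pos _)]
  have h1 : |clamp p.1| ^ j ≤ 1 := pow_le_one₀ (abs_nonneg _) (abs_clamp_le _)
  have h2 := h p.2 (clamp p.1 • ζ) (by
    rw [norm_smul]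
    exact mul_le_of_le_one_left (norm_nonneg _) (abs_clamp_le _))
  calc _ ≤ 1 * |f (p.2 + clamp p.1 • ζ)| * wt p.2 := by
        gcongr
        exact (wt_pos _).le
    _ ≤ C := by rwa [one_mul]

/-- The symbol `ρ^j f(y + ρ ζ) (1+|y|²)^{(d+3)/2}`. -/
def symbol {f : E d → ℝ} (hf : GaussClass f) (j : ℕ) (ζ : E d) : Sym d :=
  BoundedContinuousFunction.ofNormedAddCommGroup
    (fun p : ℝ × E d => clamp p.1 ^ j * f (p.2 + clamp p.1 • ζ) * wt p.2)
    (by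
      have h1 : Continuous fun p : ℝ × E d => clamp p.1 := clamp_continuous.comp continuous_fst
      have h2 : Continuous fun p : ℝ × E d => f (p.2 + clamp p.1 • ζ) :=
        hf.contDiff.continuous.comp (by fun_prop)
      have h3 : Continuous fun p : ℝ × E d => wt p.2 := wt_continuous.comp continuous_snd
      exact ((h1.pow j).mul h2).mul h3)
    (symbol_bound hf j ζ).choose (symbol_bound hf j ζ).choose_spec

theorem symbol_apply {f : E d → ℝ} (hf : GaussClass f) (j : ℕ) (ζ : E d) (p : ℝ × E d) :
    symbol hf j ζ p = clamp p.1 ^ j * f (p.2 + clamp p.1 • ζ) * wt p.2 := rfl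

/-- The derivative of `ζ ↦ symbol hf j ζ`. -/
def symbolDeriv {f : E d → ℝ} (hf : GaussClass f) (j : ℕ) (ζ : E d) : E d →L[ℝ] Sym d :=
  ∑ i, (EuclideanSpace.proj i : E d →L[ℝ] ℝ).smulRight (symbol (hf.pd i) (j + 1) ζ)

theorem symbolDeriv_apply {f : E d → ℝ} (hf : GaussClass f) (j : ℕ) (ζ h : E d) :
    symbolDeriv hf j ζ h = ∑ i, h i • symbol (hf.pd i) (j + 1) ζ := by
  simp [symbolDeriv]

/-- The Taylor estimate is uniform in `y` after multiplication by the weight, and in the first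
variable because `clamp` is bounded by one; hence differentiability in the sup norm. Differentiating
in `ζ` releases one more factor `ρ`, which is the reason for carrying the power `j`. -/
theorem symbol_hasFDerivAt {f : E d → ℝ} (hf : GaussClass f) (j : ℕ) (ζ : E d) :
    HasFDerivAt (symbol hf j) (symbolDeriv hf j ζ) ζ := by
  obtain ⟨C, hC, h⟩ := hf.taylor ‖ζ‖
  rw [hasFDerivAt_iff_isLittleO_nhds_zero]
  have hO : (fun h : E d => symbol hf j (ζ + h) - symbol hf j ζ - symbolDeriv hf j ζ h) =O[nhds 0]
      fun h => ‖h‖ ^ 2 := by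
    refine Asymptotics.IsBigO.of_bound C ?_
    filter_upwards [Metric.closedBall_mem_nhds (0 : E d) zero_lt_one] with k hk
    have hk : ‖k‖ ≤ 1 := by simpa using hk
    rw [norm_pow, norm_norm]
    refine (BoundedContinuousFunction.norm_le (by positivity)).2 fun p => ?_
    set c := clamp p.1 with hc
    have hc1 : |c| ≤ 1 := abs_clamp_le _
    have hsum : (∑ i, k i • symbol (hf.pd i) (j + 1) ζ) p =
        c ^ (j + 1) * fderiv ℝ f (p.2 + c • ζ) k * wt p.2 := by
      rw [BoundedContinuousFunction.sum_apply, fderiv_apply_eq_sum, Finset.mul_sum, Finset.sum_mul]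
      refine Finset.sum_congr rfl fun i _ => ?_
      rw [BoundedContinuousFunction.smul_apply, symbol_apply, smul_eq_mul]
      ring
    rw [symbolDeriv_apply, BoundedContinuousFunction.sub_apply, BoundedContinuousFunction.sub_apply, hsum,
      symbol_apply, symbol_apply, ← hc]
    have e : c ^ j * f (p.2 + c • (ζ + k)) * wt p.2 - c ^ j * f (p.2 + c • ζ) * wt p.2 -
        c ^ (j + 1) * fderiv ℝ f (p.2 + c • ζ) k * wt p.2 =
        c ^ j * ((f (p.2 + c • ζ + c • k) - f (p.2 + c • ζ) - fderiv ℝ f (p.2 + c • ζ) (c • k)) * wt p.2) := by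
      rw [map_smul, smul_add, add_assoc, smul_eq_mul]; ring
    rw [e, norm_mul, norm_mul, norm_pow, Real.norm_eq_abs, Real.norm_eq_abs, Real.norm_eq_abs,
      abs_of_pos (wt_pos _)]
    have n1 : ‖c • ζ‖ ≤ ‖ζ‖ := by
      rw [norm_smul]; exact mul_le_of_le_one_left (norm_nonneg _) hc1
    have n2 : ‖c • k‖ ≤ ‖k‖ := by
      rw [norm_smul]; exact mul_le_of_le_one_left (norm_nonneg _) hc1
    have h3 := h p.2 (c • ζ) (c • k) n1 (n2.trans hk)
    have h1 : |c| ^ j ≤ 1 := pow_le_one₀ (abs_nonneg _) hc1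
    calc _ ≤ 1 * (C * ‖c • k‖ ^ 2) :=
          mul_le_mul h1 h3 (mul_nonneg (abs_nonneg _) (wt_pos _).le) zero_le_one
      _ ≤ C * ‖k‖ ^ 2 := by rw [one_mul]; gcongr
  refine hO.trans_isLittleO ?_
  have : (fun h : E d => ‖h‖ ^ 2) =o[nhds 0] fun h => ‖h‖ ^ 1 :=
    Asymptotics.IsLittleO.comp_tendsto (Asymptotics.isLittleO_pow_pow (by norm_num)) tendsto_norm_zero
  simp only [pow_one] at this
  exact Asymptotics.isLittleO_norm_right.1 this

/-- The symbol depends smoothly on the shift `ζ`. -/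
theorem symbol_contDiff {f : E d → ℝ} (hf : GaussClass f) (j : ℕ) (n : ℕ) :
    ContDiff ℝ n (symbol hf j) := by
  induction n generalizing f j with
  | zero =>
    rw [Nat.cast_zero, contDiff_zero]
    exact continuous_iff_continuousAt.2 fun ζ => (symbol_hasFDerivAt hf j ζ).continuousAt
  | succ n ih =>
    rw [Nat.cast_succ, contDiff_succ_iff_fderiv_apply]
    refine ⟨fun ζ => (symbol_hasFDerivAt hf j ζ).differentiableAt, by simp, fun h => ?_⟩
    have : (fun ζ => fderiv ℝ (symbol hf j) ζ h) = fun ζ => ∑ i, h i • symbol (hf.pd i) (j + 1) ζ := by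
      funext ζ
      rw [(symbol_hasFDerivAt hf j ζ).fderiv, symbolDeriv_apply]
    rw [this]
    exact ContDiff.sum fun i _ => (ih (hf.pd i) (j + 1)).const_smul (h i)

end

/-! ### Integral operators modulated by symbols. -/

section

variable {d : ℕ}

section SymbolOperator

variable {Ω : Type*} [MeasurableSpace Ω]

/-- The integral operator with kernel `k` modulated by the symbol `m` along `θ`. -/
def symOp (ν : Measure Ω) (k : ℝ × E d → Ω → ℝ) (θ : ℝ × E d → Ω → ℝ × E d) (m : Sym d) (f : Ω → ℝ)
    (z : ℝ × E d) : ℝ := ∫ s, k z s * m (θ z s) * f s ∂ν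

/-- The majorant of `symOp` for symbols of norm one. -/
def majOp (ν : Measure Ω) (k : ℝ × E d → Ω → ℝ) (f : Ω → ℝ) (z : ℝ × E d) : ℝ≥0∞ :=
  ∫⁻ s, ‖k z s‖ₑ * ‖f s‖ₑ ∂ν

variable {ν : Measure Ω} {k : ℝ × E d → Ω → ℝ} {θ : ℝ × E d → Ω → ℝ × E d} {m m' : Sym d}
  {f g : Ω → ℝ} {z : ℝ × E d}

theorem Sym.enorm_apply_le (m : Sym d) (p : ℝ × E d) : ‖m p‖ₑ ≤ ‖m‖ₑ := by
  rw [enorm_le_iff_norm_le]; exact m.norm_coe_le_norm p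

theorem symOp_lintegral_le (ν : Measure Ω) (k : ℝ × E d → Ω → ℝ) (θ : ℝ × E d → Ω → ℝ × E d)
    (m : Sym d) (f : Ω → ℝ) (z : ℝ × E d) :
    ∫⁻ s, ‖k z s * m (θ z s) * f s‖ₑ ∂ν ≤ ‖m‖ₑ * majOp ν k f z := by
  rw [majOp, ← lintegral_const_mul' _ _ (by simp)]
  refine lintegral_mono fun s => ?_
  rw [enorm_mul, enorm_mul]
  calc _ ≤ ‖k z s‖ₑ * ‖m‖ₑ * ‖f s‖ₑ := by gcongr; exact m.enorm_apply_le _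
    _ = _ := by ring

theorem symOp_enorm_le (ν : Measure Ω) (k : ℝ × E d → Ω → ℝ) (θ : ℝ × E d → Ω → ℝ × E d)
    (m : Sym d) (f : Ω → ℝ) (z : ℝ × E d) :
    ‖symOp ν k θ m f z‖ₑ ≤ ‖m‖ₑ * majOp ν k f z :=
  (enorm_integral_le_lintegral_enorm _).trans (symOp_lintegral_le ν k θ m f z)

theorem symOp_integrable (hk : Measurable (Function.uncurry k)) (hθ : Measurable (Function.uncurry θ))
    (m : Sym d) (hf : AEStronglyMeasurable f ν) (hz : majOp ν k f z < ⊤) :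
    Integrable (fun s => k z s * m (θ z s) * f s) ν := by
  refine ⟨?_, (symOp_lintegral_le ν k θ m f z).trans_lt (ENNReal.mul_lt_top (by simp) hz)⟩
  refine AEStronglyMeasurable.mul (Measurable.aestronglyMeasurable ?_) hf
  exact (hk.comp measurable_prodMk_left).mul
    (m.continuous.measurable.comp (hθ.comp measurable_prodMk_left))

theorem symOp_add_symbol (hk : Measurable (Function.uncurry k)) (hθ : Measurable (Function.uncurry θ))
    (hf : AEStronglyMeasurable f ν) (hz : majOp ν k f z < ⊤) :
    symOp ν k θ (m + m') f z = symOp ν k θ m f z + symOp ν k θ m' f z := by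
  rw [symOp, symOp, symOp, ← integral_add (symOp_integrable hk hθ m hf hz)
    (symOp_integrable hk hθ m' hf hz)]
  refine integral_congr_ae (Filter.Eventually.of_forall fun s => ?_)
  simp only [BoundedContinuousFunction.add_apply]; ring

theorem symOp_smul_symbol (c : ℝ) : symOp ν k θ (c • m) f z = c * symOp ν k θ m f z := by
  rw [symOp, symOp, ← integral_const_mul]
  refine integral_congr_ae (Filter.Eventually.of_forall fun s => ?_)
  simp only [BoundedContinuousFunction.smul_apply, smul_eq_mul]; ring

theorem symOp_add (hk : Measurable (Function.uncurry k)) (hθ : Measurable (Function.uncurry θ))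
    (hf : AEStronglyMeasurable f ν) (hg : AEStronglyMeasurable g ν) (hz : majOp ν k f z < ⊤)
    (hz' : majOp ν k g z < ⊤) :
    symOp ν k θ m (fun s => f s + g s) z = symOp ν k θ m f z + symOp ν k θ m g z := by
  rw [symOp, symOp, symOp, ← integral_add (symOp_integrable hk hθ m hf hz)
    (symOp_integrable hk hθ m hg hz')]
  refine integral_congr_ae (Filter.Eventually.of_forall fun s => ?_)
  simp only; ring

theorem symOp_smul (c : ℝ) : symOp ν k θ m (fun s => c * f s) z = c * symOp ν k θ m f z := by
  rw [symOp, symOp, ← integral_const_mul]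
  refine integral_congr_ae (Filter.Eventually.of_forall fun s => ?_)
  simp only; ring

theorem symOp_stronglyMeasurable [SFinite ν] (hk : Measurable (Function.uncurry k))
    (hθ : Measurable (Function.uncurry θ)) (m : Sym d) (hf : Measurable f) :
    StronglyMeasurable (symOp ν k θ m f) := by
  refine StronglyMeasurable.integral_prod_right (f := fun z s => k z s * m (θ z s) * f s)
    (Measurable.stronglyMeasurable ?_)
  exact (hk.mul (m.continuous.measurable.comp hθ)).mul (hf.comp measurable_snd)

end SymbolOperator

/-- The profile `(τ + |x|²)^{-(d+3)/2}`. -/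
def prof (τ : ℝ) (x : E d) : ℝ := (τ + ‖x‖ ^ 2) ^ (-(((d : ℝ) + 3) / 2))

theorem prof_measurable : Measurable fun p : ℝ × E d => prof p.1 p.2 := by
  unfold prof; fun_prop

theorem prof_nonneg {τ : ℝ} (hτ : 0 < τ) (x : E d) : 0 ≤ prof τ x := by unfold prof; positivity

/-- By homogeneity, the weight built into `symbol` undoes the profile. Profile times symbol is thus
the exact rescaled kernel, while the profile alone serves as a majorant common to all shifts. -/
theorem prof_eq {τ : ℝ} (hτ : 0 < τ) (x : E d) :
    prof τ x * wt ((√τ)⁻¹ • x) = τ ^ (-(((d : ℝ) + 3) / 2)) := by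
  have h1 : 1 + ‖(√τ)⁻¹ • x‖ ^ 2 = τ⁻¹ * (τ + ‖x‖ ^ 2) := by
    rw [norm_smul, mul_pow, norm_inv, Real.norm_eq_abs, inv_pow, sq_abs, Real.sq_sqrt hτ.le]
    field_simp
  have h2 : 0 < τ + ‖x‖ ^ 2 := by positivity
  rw [prof, wt, h1, Real.mul_rpow (by positivity) h2.le, Real.inv_rpow hτ.le, Real.rpow_neg h2.le,
    Real.rpow_neg hτ.le]
  have := (Real.rpow_pos_of_pos h2 (((d : ℝ) + 3) / 2)).ne'
  field_simp

/-- The kernel of the heat-type operators, before modulation. -/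
def heatKer (z : ℝ × E d) (y : E d) : ℝ :=
  if 0 < z.1 then z.1 ^ (3 / 2 : ℝ) * prof z.1 (z.2 - y) else 0

/-- The phase of the heat-type operators. -/
def heatPhase (z : ℝ × E d) (y : E d) : ℝ × E d := (1, (√z.1)⁻¹ • (z.2 - y))

/-- The kernel of the Oseen-type operators, before modulation. -/
def oseenKer (z : ℝ × E d) (p : (ℝ × E d) × ℝ) : ℝ :=
  if 0 < p.1.1 ∧ p.1.1 < z.1 ∧ z.1 - p.1.1 < p.2 then prof p.2 (z.2 - p.1.2) else 0

/-- The phase of the Oseen-type operators. -/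
def oseenPhase (z : ℝ × E d) (p : (ℝ × E d) × ℝ) : ℝ × E d :=
  ((√z.1 - √p.1.1) / √p.2, (√p.2)⁻¹ • (z.2 - p.1.2))

theorem heatKer_measurable : Measurable (Function.uncurry (heatKer (d := d))) := by
  refine Measurable.ite (measurableSet_lt measurable_const measurable_fst.fst) ?_ measurable_const
  refine Measurable.mul (by fun_prop) ?_
  exact prof_measurable.comp (measurable_fst.fst.prodMk (measurable_fst.snd.sub measurable_snd))

theorem heatPhase_measurable : Measurable (Function.uncurry (heatPhase (d := d))) := by
  unfold heatPhase Function.uncurry; fun_prop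

theorem oseenKer_measurable : Measurable (Function.uncurry (oseenKer (d := d))) := by
  refine Measurable.ite ?_ ?_ measurable_const
  · refine (measurableSet_lt measurable_const measurable_snd.fst.fst).inter
      ((measurableSet_lt measurable_snd.fst.fst measurable_fst.fst).inter
      (measurableSet_lt (measurable_fst.fst.sub measurable_snd.fst.fst) measurable_snd.snd))
  · exact prof_measurable.comp (measurable_snd.snd.prodMk (measurable_fst.snd.sub measurable_snd.fst.snd))

theorem oseenPhase_measurable : Measurable (Function.uncurry (oseenPhase (d := d))) := by
  unfold oseenPhase Function.uncurry; fun_prop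

/-- The operator `a ↦ ∫ t^{3/2} (t+|x-y|²)^{-(d+3)/2} m(1, (x-y)/√t) a(y) dy`. -/
def aOp (m : Sym d) (a : E d → ℝ) : ℝ × E d → ℝ := symOp volume heatKer heatPhase m a

/-- The Oseen-type operator with symbol `m`. -/
def bOp (m : Sym d) (f : ℝ × E d → ℝ) : ℝ × E d → ℝ :=
  symOp volume oseenKer oseenPhase m (fun p => f p.1)

theorem majOp_heatKer (a : E d → ℝ) {z : ℝ × E d} (hz : 0 < z.1) :
    majOp volume heatKer a z = heatOp (fun y => ‖a y‖ₑ) z := by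
  refine lintegral_congr fun y => ?_
  rw [heatKer, if_pos hz, heatMaj, Real.enorm_of_nonneg
    (mul_nonneg (by positivity) (prof_nonneg hz _)), prof]

/-- The third variable `τ` of `oseenKer` is the auxiliary heat time; integrating it out over `τ >
z.1 - w.1` recovers the Oseen majorant. -/
theorem lintegral_oseenKer (z w : ℝ × E d) :
    ∫⁻ τ, ‖oseenKer z (w, τ)‖ₑ = if 0 < w.1 then oseenMaj (z - w) else 0 := by
  by_cases h : 0 < w.1 ∧ w.1 < z.1
  · have h1 : 0 < z.1 - w.1 := by linarith [h.2]
    rw [if_pos h.1, show z - w = (z.1 - w.1, z.2 - w.2) from rfl, ← lintegral_kernel_tail h1,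
      ← lintegral_indicator measurableSet_Ioi]
    refine lintegral_congr fun τ => ?_
    by_cases hτ : z.1 - w.1 < τ
    · rw [indicator_of_mem (mem_Ioi.2 hτ), oseenKer, if_pos ⟨h.1, h.2, hτ⟩, Real.enorm_of_nonneg
        (prof_nonneg (h1.trans hτ) _)]
      rfl
    · rw [indicator_of_notMem (by simpa using hτ), oseenKer, if_neg (by tauto), enorm_zero]
  · have : ∀ τ, ‖oseenKer z (w, τ)‖ₑ = 0 := fun τ => by
      rw [oseenKer, if_neg (by tauto), enorm_zero]
    simp only [this, lintegral_zero]
    split_ifs with h0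
    · rw [oseenMaj, indicator_of_notMem]
      have : ¬ w.1 < z.1 := fun h' => h ⟨h0, h'⟩
      simpa using this
    · rfl

/-- Causality: the kernel vanishes unless the source time lies in `(0, z.1)`, so for `z.1 ≤ δ` the
data outside the strip are irrelevant. -/
theorem majOp_oseenKer {f : ℝ × E d → ℝ} (hf : Measurable f) {δ : ℝ} {z : ℝ × E d} (hz : z.1 ≤ δ) :
    majOp volume oseenKer (fun p => f p.1) z =
      oseenOp ((strip d δ).indicator fun w => ‖f w‖ₑ) z := by
  have hm : Measurable fun p : (ℝ × E d) × ℝ => ‖oseenKer z p‖ₑ :=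
    (oseenKer_measurable.comp measurable_prodMk_left).enorm
  rw [majOp, oseenOp, Measure.volume_eq_prod,
    lintegral_prod (fun p : (ℝ × E d) × ℝ => ‖oseenKer z p‖ₑ * ‖f p.1‖ₑ)
      (hm.mul (hf.comp measurable_fst).enorm).aemeasurable]
  refine lintegral_congr fun w => ?_
  have hm' : Measurable fun τ : ℝ => ‖oseenKer z (w, τ)‖ₑ := hm.comp measurable_prodMk_left
  rw [show (fun τ : ℝ => ‖oseenKer z (w, τ)‖ₑ * ‖f (w, τ).1‖ₑ) =
    fun τ => ‖oseenKer z (w, τ)‖ₑ * ‖f w‖ₑ from rfl, lintegral_mul_const _ hm', lintegral_oseenKer]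
  by_cases h : w ∈ strip d δ
  · rw [indicator_of_mem h, if_pos h.1.1]
  · rw [indicator_of_notMem h, mul_zero]
    split_ifs with h0
    · have : ¬ w.1 < δ := fun h' => h ⟨⟨h0, h'⟩, mem_univ _⟩
      rw [oseenMaj, indicator_of_notMem, zero_mul]
      have : ¬ w.1 < z.1 := by linarith
      simpa using this
    · rw [zero_mul]

theorem bOp_enorm_le (m : Sym d) {f : ℝ × E d → ℝ} (hf : Measurable f) {δ : ℝ} {z : ℝ × E d} (hz : z.1 ≤ δ) :
    ‖bOp m f z‖ₑ ≤ ‖m‖ₑ * oseenOp ((strip d δ).indicator fun w => ‖f w‖ₑ) z := by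
  rw [← majOp_oseenKer hf hz]
  exact symOp_enorm_le _ _ _ _ _ _

theorem aOp_enorm_le (m : Sym d) (a : E d → ℝ) {z : ℝ × E d} (hz : 0 < z.1) :
    ‖aOp m a z‖ₑ ≤ ‖m‖ₑ * heatOp (fun y => ‖a y‖ₑ) z := by
  rw [← majOp_heatKer a hz]
  exact symOp_enorm_le _ _ _ _ _ _

theorem aOp_stronglyMeasurable (m : Sym d) {a : E d → ℝ} (ha : Measurable a) :
    StronglyMeasurable (aOp m a) :=
  symOp_stronglyMeasurable heatKer_measurable heatPhase_measurable m ha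

theorem bOp_stronglyMeasurable (m : Sym d) {f : ℝ × E d → ℝ} (hf : Measurable f) :
    StronglyMeasurable (bOp m f) :=
  symOp_stronglyMeasurable oseenKer_measurable oseenPhase_measurable m (hf.comp measurable_fst)

theorem bOp_congr (m : Sym d) {f g : ℝ × E d → ℝ} {δ : ℝ} (h : f =ᵐ[stripMeasure d δ] g)
    {z : ℝ × E d} (hz : z.1 ≤ δ) : bOp m f z = bOp m g z := by
  have h1 : ∀ᵐ w : ℝ × E d, w ∈ strip d δ → f w = g w := (ae_restrict_iff' measurableSet_strip).1 h
  have h2 : ∀ᵐ p : (ℝ × E d) × ℝ, p.1 ∈ strip d δ → f p.1 = g p.1 := by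
    rw [Measure.volume_eq_prod]
    exact Measure.quasiMeasurePreserving_fst.ae h1
  refine integral_congr_ae ?_
  filter_upwards [h2] with p hp
  by_cases hs : p.1 ∈ strip d δ
  · simp only [hp hs]
  · have : ¬ (0 < p.1.1 ∧ p.1.1 < z.1 ∧ z.1 - p.1.1 < p.2) := fun h' =>
      hs ⟨⟨h'.1, h'.2.1.trans_le hz⟩, mem_univ _⟩
    simp only [oseenKer, if_neg this, zero_mul]

end

/-! ### Decay spaces and construction of bounded multilinear operators. -/

section

variable {d : ℕ}

/-- The seminorm `ess sup_{0<t<1} t^σ ‖f(t, ·)‖_{L^q}` on `L^{d+2}` of the unit strip. -/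
def decaySeminorm (d : ℕ) (σ q : ℝ) (hq : 1 ≤ q) : ExtSeminorm (LpStrip d 1) :=
  supSeminorm d 1 σ (ENNReal.ofReal q) (by simpa using hq)

/-- The space of `f ∈ L^{d+2}` of the unit strip with `ess sup t^σ ‖f(t, ·)‖_{L^q} < ∞`. -/
abbrev DecaySpace (d : ℕ) (σ q : ℝ) (hq : 1 ≤ q) : Type := (decaySeminorm d σ q hq).Space

/-- A representative of an element of the decay space. -/
def DecaySpace.fn {σ q : ℝ} {hq : 1 ≤ q} (w : DecaySpace d σ q hq) : ℝ × E d → ℝ :=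
  ((decaySeminorm d σ q hq).incl w : LpStrip d 1)

open DecaySpace

section

variable {σ q : ℝ} {hq : 1 ≤ q}

theorem DecaySpace.measurable_fn (w : DecaySpace d σ q hq) : Measurable (fn w) :=
  (Lp.stronglyMeasurable _).measurable

theorem DecaySpace.fn_add (v w : DecaySpace d σ q hq) : fn (v + w) =ᵐ[stripMeasure d 1] fn v + fn w := by
  unfold fn; rw [map_add]; exact Lp.coeFn_add _ _

theorem DecaySpace.fn_smul (c : ℝ) (w : DecaySpace d σ q hq) :
    fn (c • w) =ᵐ[stripMeasure d 1] c • fn w := by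
  unfold fn; rw [map_smul]; exact Lp.coeFn_smul _ _

theorem DecaySpace.ext_ae {v w : DecaySpace d σ q hq} (h : fn v =ᵐ[stripMeasure d 1] fn w) : v = w :=
  (decaySeminorm d σ q hq).incl_injective (Lp.ext h)

theorem DecaySpace.lintegral_fn_le (w : DecaySpace d σ q hq) :
    (∫⁻ z in strip d 1, ‖fn w z‖ₑ ^ nR d) ^ (1 / nR d) ≤ ‖w‖ₑ := by
  have h := (decaySeminorm d σ q hq).norm_incl_le w
  have h2 : ‖(decaySeminorm d σ q hq).incl w‖ₑ ≤ ‖w‖ₑ := enorm_le_iff_norm_le.2 h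
  rw [Lp.enorm_def, eLpNorm_eq_lintegral_rpow_enorm_toReal nE_ne_zero nE_ne_top, nE_toReal] at h2
  exact h2

theorem DecaySpace.slice_le (w : DecaySpace d σ q hq) :
    ∀ᵐ t ∂volume.restrict (Ioo (0 : ℝ) 1),
      ENNReal.ofReal (t ^ σ) * (∫⁻ x, ‖fn w (t, x)‖ₑ ^ q) ^ (1 / q) ≤ ‖w‖ₑ := by
  filter_upwards [ae_le_supNorm σ (ENNReal.ofReal q) 1 (fn w)] with t ht
  rw [eLpNorm_eq_lintegral_rpow_enorm_toReal (by simp; linarith) (by simp),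
    ENNReal.toReal_ofReal (by linarith)] at ht
  refine ht.trans ?_
  rw [← ofReal_norm]
  exact (decaySeminorm d σ q hq).M_incl_le w

/-- `K` bounds the `L^{d+2}` norm and the weighted mixed norm of `G` on the unit strip. -/
structure MajBound (d : ℕ) (σ q : ℝ) (G : ℝ × E d → ℝ≥0∞) (K : ℝ≥0∞) : Prop where
  meas : Measurable G
  global : (∫⁻ z in strip d 1, G z ^ nR d) ^ (1 / nR d) ≤ K
  slice : ∀ᵐ t ∂volume.restrict (Ioo (0 : ℝ) 1),
    ENNReal.ofReal (t ^ σ) * (∫⁻ x, G (t, x) ^ q) ^ (1 / q) ≤ K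

theorem nR_pos : 0 < nR d := by positivity

theorem MajBound.ae_lt_top {G : ℝ × E d → ℝ≥0∞} {K : ℝ≥0∞} (h : MajBound d σ q G K) (hK : K < ⊤) :
    ∀ᵐ z ∂stripMeasure d 1, G z < ⊤ := by
  have h1 : ∫⁻ z in strip d 1, G z ^ nR d ≠ ⊤ := by
    intro h2
    have := h.global
    rw [h2, ENNReal.top_rpow_of_pos (one_div_pos.2 nR_pos)] at this
    exact (lt_of_le_of_lt this hK).ne rfl
  filter_upwards [MeasureTheory.ae_lt_top (h.meas.pow_const _) h1] with z hz
  exact (ENNReal.rpow_lt_top_iff_of_pos nR_pos).1 hz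

theorem lintegral_rpow_le_of_le {α : Type*} [MeasurableSpace α] {μ : Measure α} {g G : α → ℝ≥0∞}
    {c : ℝ≥0∞} (hc : c ≠ ⊤) {p : ℝ} (hp : 0 < p) (h : ∀ᵐ x ∂μ, g x ≤ c * G x) :
    (∫⁻ x, g x ^ p ∂μ) ^ (1 / p) ≤ c * (∫⁻ x, G x ^ p ∂μ) ^ (1 / p) := by
  calc (∫⁻ x, g x ^ p ∂μ) ^ (1 / p) ≤ (∫⁻ x, c ^ p * G x ^ p ∂μ) ^ (1 / p) := by
        refine ENNReal.rpow_le_rpow (lintegral_mono_ae ?_) (by positivity)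
        filter_upwards [h] with x hx
        rw [← ENNReal.mul_rpow_of_nonneg _ _ hp.le]
        exact ENNReal.rpow_le_rpow hx hp.le
    _ = _ := by
        rw [lintegral_const_mul' _ _ (ENNReal.rpow_ne_top_of_nonneg hp.le hc),
          ENNReal.mul_rpow_of_nonneg _ _ (by positivity), ← ENNReal.rpow_mul, mul_one_div_cancel hp.ne',
          ENNReal.rpow_one]

/-- One pointwise majorant controls both the `L^{d+2}` norm and the weighted slice norm, whose sum
is the norm; hence the factor `2`. Every operator into a decay space below is produced in this way.
-/
theorem MajBound.exists_fn_eq {G : ℝ × E d → ℝ≥0∞} {K c : ℝ≥0∞} (h : MajBound d σ q G K) (hK : K < ⊤)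
    (hc : c ≠ ⊤) {g : ℝ × E d → ℝ} (hg : AEStronglyMeasurable g (stripMeasure d 1))
    (hgG : ∀ᵐ z ∂stripMeasure d 1, ‖g z‖ₑ ≤ c * G z) :
    ∃ w : DecaySpace d σ q hq, fn w =ᵐ[stripMeasure d 1] g ∧ ‖w‖ ≤ 2 * (c * K).toReal := by
  have hcK : c * K ≠ ⊤ := (ENNReal.mul_lt_top hc.lt_top hK).ne
  have h1 : eLpNorm g (nE d) (stripMeasure d 1) ≤ c * K := by
    rw [eLpNorm_eq_lintegral_rpow_enorm_toReal nE_ne_zero nE_ne_top, nE_toReal]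
    refine (lintegral_rpow_le_of_le hc nR_pos hgG).trans ?_
    gcongr
    exact h.global
  have hmem : MemLp g (nE d) (stripMeasure d 1) := ⟨hg, h1.trans_lt hcK.lt_top⟩
  have h2 : supNorm σ (ENNReal.ofReal q) 1 g ≤ c * K := by
    refine supNorm_le ?_
    filter_upwards [ae_slice hgG, h.slice] with t ht hs
    rw [eLpNorm_eq_lintegral_rpow_enorm_toReal (by simp; linarith) (by simp),
      ENNReal.toReal_ofReal (by linarith)]
    calc _ ≤ ENNReal.ofReal (t ^ σ) * (c * (∫⁻ x, G (t, x) ^ q) ^ (1 / q)) := by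
          gcongr
          exact lintegral_rpow_le_of_le hc (by linarith) ht
      _ = c * (ENNReal.ofReal (t ^ σ) * (∫⁻ x, G (t, x) ^ q) ^ (1 / q)) := by ring
      _ ≤ _ := by gcongr
  have h3 : (decaySeminorm d σ q hq).M (hmem.toLp g) ≤ c * K := by
    change supNorm σ (ENNReal.ofReal q) 1 (hmem.toLp g) ≤ _
    rwa [supNorm_congr hmem.coeFn_toLp]
  refine ⟨(decaySeminorm d σ q hq).ofDom (hmem.toLp g) (h3.trans_lt hcK.lt_top), ?_, ?_⟩
  · exact hmem.coeFn_toLp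
  · rw [two_mul]
    refine (decaySeminorm d σ q hq).norm_le_of ENNReal.toReal_nonneg ?_ ?_
    · rw [ExtSeminorm.incl_ofDom, Lp.norm_toLp]
      exact ENNReal.toReal_mono hcK h1
    · rw [ExtSeminorm.incl_ofDom, ENNReal.ofReal_toReal hcK]
      exact h3

end

section Multilinear

variable {A B C D : Type*} [NormedAddCommGroup A] [NormedSpace ℝ A] [NormedAddCommGroup B] [NormedSpace ℝ B]
  [NormedAddCommGroup C] [NormedSpace ℝ C] [NormedAddCommGroup D] [NormedSpace ℝ D]

theorem exists_bilinear (T : A → B → D) (h1 : ∀ a a' b, T (a + a') b = T a b + T a' b)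
    (h2 : ∀ (c : ℝ) a b, T (c • a) b = c • T a b) (h3 : ∀ a b b', T a (b + b') = T a b + T a b')
    (h4 : ∀ (c : ℝ) a b, T a (c • b) = c • T a b) (K : ℝ) (hK : ∀ a b, ‖T a b‖ ≤ K * ‖a‖ * ‖b‖) :
    ∃ L : A →L[ℝ] B →L[ℝ] D, ∀ a b, L a b = T a b :=
  ⟨LinearMap.mkContinuous₂ (LinearMap.mk₂ ℝ T h1 h2 h3 h4) K hK, fun _ _ => rfl⟩

theorem exists_trilinear (T : A → B → C → D)
    (h1 : ∀ a a' b c, T (a + a') b c = T a b c + T a' b c)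
    (h2 : ∀ (r : ℝ) a b c, T (r • a) b c = r • T a b c)
    (h3 : ∀ a b b' c, T a (b + b') c = T a b c + T a b' c)
    (h4 : ∀ (r : ℝ) a b c, T a (r • b) c = r • T a b c)
    (h5 : ∀ a b c c', T a b (c + c') = T a b c + T a b c')
    (h6 : ∀ (r : ℝ) a b c, T a b (r • c) = r • T a b c)
    (K : ℝ) (hK0 : 0 ≤ K) (hK : ∀ a b c, ‖T a b c‖ ≤ K * ‖a‖ * ‖b‖ * ‖c‖) :
    ∃ L : A →L[ℝ] B →L[ℝ] C →L[ℝ] D, ∀ a b c, L a b c = T a b c := by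
  choose L hL using fun a => exists_bilinear (T a) (h3 a) (fun r => h4 r a) (h5 a) (fun r => h6 r a)
    (K * ‖a‖) (hK a)
  refine ⟨LinearMap.mkContinuous ⟨⟨L, fun a a' => ?_⟩, fun r a => ?_⟩ K fun a => ?_, fun a b c => hL a b c⟩
  · ext b c
    simp [hL, h1]
  · ext b c
    simp [hL, h2]
  · refine ContinuousLinearMap.opNorm_le_bound₂ _ (by positivity) fun b c => ?_
    change ‖L a b c‖ ≤ _
    rw [hL]
    exact hK a b c

end Multilinear

/-- The Cauchy-Schwarz inequality for `‖uv‖_{p/2}`. -/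
theorem lintegral_mul_half_le {α : Type*} [MeasurableSpace α] {μ : Measure α} {f g : α → ℝ≥0∞}
    (hf : AEMeasurable f μ) (hg : AEMeasurable g μ) {p : ℝ} (hp : 0 < p) :
    (∫⁻ x, (f x * g x) ^ (p / 2) ∂μ) ^ (2 / p) ≤
      (∫⁻ x, f x ^ p ∂μ) ^ (1 / p) * (∫⁻ x, g x ^ p ∂μ) ^ (1 / p) := by
  have h := ENNReal.lintegral_mul_le_Lp_mul_Lq μ Real.HolderConjugate.two_two
    (hf.pow_const (p / 2)) (hg.pow_const (p / 2))
  have e : ∀ a : ℝ≥0∞, (a ^ (p / 2)) ^ (2 : ℝ) = a ^ p := fun a => by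
    rw [← ENNReal.rpow_mul]; congr 1; ring
  simp only [Pi.mul_apply, e] at h
  calc _ = (∫⁻ x, f x ^ (p / 2) * g x ^ (p / 2) ∂μ) ^ (2 / p) := by
        simp_rw [ENNReal.mul_rpow_of_nonneg _ _ (by positivity : 0 ≤ p / 2)]
    _ ≤ ((∫⁻ x, f x ^ p ∂μ) ^ (1 / 2 : ℝ) * (∫⁻ x, g x ^ p ∂μ) ^ (1 / 2 : ℝ)) ^ (2 / p) := by gcongr
    _ = _ := by
        rw [ENNReal.mul_rpow_of_nonneg _ _ (by positivity), ← ENNReal.rpow_mul, ← ENNReal.rpow_mul]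
        congr 2 <;> field_simp

end

/-! ### Oseen and heat operators on scale-invariant spaces. -/

section

variable {d : ℕ}

open DecaySpace

theorem one_le_nR : 1 ≤ nR d := by
  have : (0 : ℝ) ≤ d := by positivity
  unfold nR; linarith

/-- The scale-invariant decay space with exponent `q`. -/
abbrev CritSpace (d : ℕ) (q : ℝ) (hq : 1 ≤ q) : Type := DecaySpace d (1 / 2 - d / (2 * q)) q hq

/-- The space in which the fixed-point equation is solved. -/
abbrev SolSpace (d : ℕ) : Type := CritSpace d (nR d) one_le_nR

theorem ae_strip_iff {p : ℝ → Prop} :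
    (∀ᵐ t ∂volume.restrict (Ioo (0 : ℝ) 1), p t) ↔ ∀ᵐ t : ℝ, t ∈ Ioo (0 : ℝ) 1 → p t :=
  ae_restrict_iff' measurableSet_Ioo

/-- The squared modulus entering the Oseen operator. -/
def prodMaj (u v : ℝ × E d → ℝ) : ℝ × E d → ℝ≥0∞ :=
  (strip d 1).indicator fun w => ‖u w * v w‖ₑ

theorem prodMaj_measurable {u v : ℝ × E d → ℝ} (hu : Measurable u) (hv : Measurable v) :
    Measurable (prodMaj u v) := (hu.mul hv).enorm.indicator measurableSet_strip

/-- The `L^{d+2}` bound is Hardy-Littlewood-Sobolev after Cauchy-Schwarz. For the slices, the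
product of two elements has `L^{(d+2)/2}` norm at most a multiple of `s^{-2/(d+2)}`. With Young's
exponent `r` given by `1/r = 1 + 1/q - 2/(d+2)` the beta integral yields the power `t^{-(1/2 -
d/(2q))}`, which the weight compensates exactly. This covers `q = d`, where the weight is trivial
and boundedness on `L^{d+2}` alone would not give the estimate by this route. -/
theorem oseenOp_majBound (hd : 2 ≤ d) {q : ℝ} (hq1 : (d : ℝ) ≤ q) (hq2 : q ≤ nR d) :
    ∃ C : ℝ≥0∞, C < ⊤ ∧ ∀ u v : SolSpace d,
      MajBound d (1 / 2 - d / (2 * q)) q (oseenOp (prodMaj (fn u) (fn v))) (C * (‖u‖ₑ * ‖v‖ₑ)) := by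
  have hd2 : (2 : ℝ) ≤ d := by exact_mod_cast hd
  obtain ⟨C1, -, hC1, H1⟩ := oseenOp_norm_spacetime_le (d := d) (by omega)
  have hNd : nR d = d + 2 := rfl
  set N := nR d with hN
  have hN0 : 0 < N := nR_pos
  have hq0 : 0 < q := by linarith
  set ri : ℝ := 1 + 1 / q - 2 / N with hri
  have e1 : 2 / N < 1 := by rw [div_lt_one hN0]; linarith
  have e2 : 1 / q ≤ 2 / N := by
    rw [div_le_div_iff₀ hq0 hN0]; linarith
  have hri0 : 0 < ri := by have : 0 < 1 / q := by positivity
                           linarith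
  have hri1 : ri ≤ 1 := by linarith
  have hdq : (d : ℝ) / N ≤ d / q := by gcongr
  have hdN : (d : ℝ) / N = 1 - 2 / N := by field_simp; linarith
  obtain ⟨C2, hC2, H2⟩ := oseenOp_norm_le (d := d) (p := N / 2) (q := q) (r := 1 / ri) (b := 2 / N)
    (by linarith) (by rw [le_div_iff₀ hri0]; linarith) (by linarith)
    (by rw [div_le_comm₀ hri0 hq0]; linarith)
    (by rw [one_div_one_div]; field_simp [hri]; rw [hri]; field_simp; ring)
    (by
      rw [one_div_one_div]
      have : (d : ℝ) / 2 * (1 - ri) = d / N - d / q / 2 := by rw [hri]; field_simp; ring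
      rw [this]
      have : 0 < 2 / N := by positivity
      linarith)
    (by positivity) e1
  have hexp : 1 - (1 / 2 + (d : ℝ) / 2 * (1 - 1 / (1 / ri))) - 2 / N = -(1 / 2 - d / (2 * q)) := by
    rw [one_div_one_div]
    have : (d : ℝ) / 2 * (1 - ri) = d / N - d / q / 2 := by rw [hri]; field_simp; ring
    have h2 : (d : ℝ) / (2 * q) = d / q / 2 := by field_simp
    rw [this, h2]
    linarith
  refine ⟨max C1 C2, max_lt hC1 hC2, fun u v => ?_⟩
  have hm := prodMaj_measurable (measurable_fn u) (measurable_fn v)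
  refine ⟨measurable_oseenOp hm, ?_, ?_⟩
  · calc _ ≤ (∫⁻ z, oseenOp (prodMaj (fn u) (fn v)) z ^ N) ^ (1 / N) := by
          gcongr
          exact Measure.restrict_le_self
      _ ≤ C1 * (∫⁻ z, prodMaj (fn u) (fn v) z ^ (N / 2)) ^ (2 / N) := H1 _ hm
      _ ≤ max C1 C2 * (‖u‖ₑ * ‖v‖ₑ) := by
          gcongr
          · exact le_max_left _ _
          · have : ∀ z, prodMaj (fn u) (fn v) z ^ (N / 2) =
                (strip d 1).indicator (fun w => (‖fn u w‖ₑ * ‖fn v w‖ₑ) ^ (N / 2)) z := by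
              intro z
              by_cases hz : z ∈ strip d 1
              · simp [prodMaj, hz]
              · simp [prodMaj, hz, hN0]
            simp_rw [this]
            rw [lintegral_indicator measurableSet_strip]
            refine (lintegral_mul_half_le (measurable_fn u).enorm.aemeasurable
              (measurable_fn v).enorm.aemeasurable hN0).trans ?_
            gcongr
            · exact lintegral_fn_le u
            · exact lintegral_fn_le v
  · rw [ae_strip_iff]
    refine Filter.Eventually.of_forall fun t ht => ?_
    have key := H2 (prodMaj (fn u) (fn v)) (‖u‖ₑ * ‖v‖ₑ) hm
      (fun s hs y => indicator_of_notMem (fun h => absurd h.1.1 (not_lt.2 hs)) _) ?_ t ht.1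
    · rw [hexp] at key
      calc _ ≤ ENNReal.ofReal (t ^ (1 / 2 - (d : ℝ) / (2 * q))) *
            (C2 * ENNReal.ofReal (t ^ (-(1 / 2 - (d : ℝ) / (2 * q)))) * (‖u‖ₑ * ‖v‖ₑ)) := by gcongr
        _ = (ENNReal.ofReal (t ^ (1 / 2 - (d : ℝ) / (2 * q))) *
            ENNReal.ofReal (t ^ (-(1 / 2 - (d : ℝ) / (2 * q))))) * (C2 * (‖u‖ₑ * ‖v‖ₑ)) := by ring
        _ = C2 * (‖u‖ₑ * ‖v‖ₑ) := by
            rw [← ENNReal.ofReal_mul (Real.rpow_nonneg ht.1.le _), ← Real.rpow_add ht.1]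
            simp
        _ ≤ _ := by gcongr; exact le_max_right _ _
    · filter_upwards [ae_strip_iff.1 (slice_le u), ae_strip_iff.1 (slice_le v)] with s hs1 hs2
      by_cases hs : s ∈ Ioo (0 : ℝ) 1
      · specialize hs1 hs
        specialize hs2 hs
        have hsl : ∀ y, prodMaj (fn u) (fn v) (s, y) = ‖fn u (s, y)‖ₑ * ‖fn v (s, y)‖ₑ := fun y => by
          rw [prodMaj, indicator_of_mem (show (s, y) ∈ strip d 1 from ⟨hs, mem_univ _⟩), enorm_mul]
        simp_rw [hsl]
        rw [one_div_div]
        refine (lintegral_mul_half_le ((measurable_fn u).comp measurable_prodMk_left).enorm.aemeasurable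
          ((measurable_fn v).comp measurable_prodMk_left).enorm.aemeasurable hN0).trans ?_
        have hσ : (1 / 2 - (d : ℝ) / (2 * N)) = 1 / N := by
          have : (d : ℝ) / (2 * N) = d / N / 2 := by field_simp
          rw [this, hdN]; ring
        rw [show s ^ (1 / 2 - (d : ℝ) / (2 * nR d)) = s ^ (1 / N) from congrArg (s ^ ·) hσ] at hs1 hs2
        have inv : ∀ X K : ℝ≥0∞, ENNReal.ofReal (s ^ (1 / N)) * X ≤ K →
            X ≤ ENNReal.ofReal (s ^ (-(1 / N))) * K := by
          intro X K h
          calc X = ENNReal.ofReal (s ^ (-(1 / N))) * (ENNReal.ofReal (s ^ (1 / N)) * X) := by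
                rw [← mul_assoc, ← ENNReal.ofReal_mul (Real.rpow_nonneg hs.1.le _), ← Real.rpow_add hs.1]
                simp
            _ ≤ _ := by gcongr
        calc _ ≤ (ENNReal.ofReal (s ^ (-(1 / N))) * ‖u‖ₑ) * (ENNReal.ofReal (s ^ (-(1 / N))) * ‖v‖ₑ) :=
              mul_le_mul' (inv _ _ hs1) (inv _ _ hs2)
          _ = (ENNReal.ofReal (s ^ (-(1 / N))) * ENNReal.ofReal (s ^ (-(1 / N)))) * (‖u‖ₑ * ‖v‖ₑ) := by ring
          _ = _ := by
              rw [← ENNReal.ofReal_mul (Real.rpow_nonneg hs.1.le _), ← Real.rpow_add hs.1]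
              congr 3; ring
      · have : ∀ y, prodMaj (fn u) (fn v) (s, y) = 0 := fun y =>
          indicator_of_notMem (fun h => hs h.1) _
        simp_rw [this]
        rw [ENNReal.zero_rpow_of_pos (by positivity), lintegral_zero, ENNReal.zero_rpow_of_pos (by positivity)]
        exact bot_le

/-- The bounded trilinear operator `(m, u, v) ↦ bOp m (u v)`. -/
theorem exists_oseen_operator (hd : 2 ≤ d) {q : ℝ} (hq1 : (d : ℝ) ≤ q) (hq2 : q ≤ nR d) (hq : 1 ≤ q) :
    ∃ B : Sym d →L[ℝ] SolSpace d →L[ℝ] SolSpace d →L[ℝ] CritSpace d q hq,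
      ∀ m u v, fn (B m u v) =ᵐ[stripMeasure d 1] bOp m (fun z => fn u z * fn v z) := by
  obtain ⟨C, hC, H⟩ := oseenOp_majBound hd hq1 hq2
  have hmz : ∀ u v : SolSpace d, Measurable fun z => fn u z * fn v z := fun u v =>
    (measurable_fn u).mul (measurable_fn v)
  have hK : ∀ u v : SolSpace d, C * (‖u‖ₑ * ‖v‖ₑ) < ⊤ := fun u v =>
    ENNReal.mul_lt_top hC (ENNReal.mul_lt_top (by simp) (by simp))
  have hex : ∀ (m : Sym d) (u v : SolSpace d), ∃ w : CritSpace d q hq,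
      fn w =ᵐ[stripMeasure d 1] bOp m (fun z => fn u z * fn v z) ∧
        ‖w‖ ≤ 2 * (‖m‖ₑ * (C * (‖u‖ₑ * ‖v‖ₑ))).toReal := fun m u v => by
    refine (H u v).exists_fn_eq (hK u v) (by simp)
      (bOp_stronglyMeasurable m (hmz u v)).aestronglyMeasurable ?_
    filter_upwards [ae_restrict_mem measurableSet_strip] with z hz
    exact bOp_enorm_le m (hmz u v) hz.1.2.le
  choose T hT hTb using hex
  -- Additivity of the integral operators needs convergent integrals. These are available off a null
  -- set, so the algebraic identities are proved almost everywhere and transferred by `ext_ae`.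
  have hfin : ∀ u v : SolSpace d, ∀ᵐ z ∂stripMeasure d 1,
      majOp volume oseenKer (fun p => fn u p.1 * fn v p.1) z < ⊤ := fun u v => by
    filter_upwards [(H u v).ae_lt_top (hK u v), ae_restrict_mem measurableSet_strip] with z hz hz1
    rw [majOp_oseenKer (f := fun z => fn u z * fn v z) (hmz u v) hz1.1.2.le]
    exact hz
  have hae : ∀ u v : SolSpace d, AEStronglyMeasurable (fun p : (ℝ × E d) × ℝ => fn u p.1 * fn v p.1) volume :=
    fun u v => ((hmz u v).comp measurable_fst).aestronglyMeasurable
  obtain ⟨B, hB⟩ := exists_trilinear T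
    (fun m m' u v => ext_ae (by
      filter_upwards [hT (m + m') u v, hT m u v, hT m' u v, fn_add (T m u v) (T m' u v), hfin u v]
        with z h1 h2 h3 h4 h5
      rw [h1, h4, Pi.add_apply, h2, h3]
      exact symOp_add_symbol oseenKer_measurable oseenPhase_measurable (hae u v) h5))
    (fun c m u v => ext_ae (by
      filter_upwards [hT (c • m) u v, hT m u v, fn_smul c (T m u v)] with z h1 h2 h4
      rw [h1, h4, Pi.smul_apply, h2]
      exact symOp_smul_symbol c))
    (fun m u u' v => ext_ae (by
      filter_upwards [hT m (u + u') v, hT m u v, hT m u' v, fn_add (T m u v) (T m u' v), hfin u v, hfin u' v,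
        ae_restrict_mem measurableSet_strip] with z h1 h2 h3 h4 h5 h6 hz
      rw [h1, h4, Pi.add_apply, h2, h3, bOp_congr m (g := fun z => fn u z * fn v z + fn u' z * fn v z)
        (by filter_upwards [fn_add u u'] with w hw; rw [hw, Pi.add_apply, add_mul]) hz.1.2.le]
      exact symOp_add oseenKer_measurable oseenPhase_measurable (hae u v) (hae u' v) h5 h6))
    (fun c m u v => ext_ae (by
      filter_upwards [hT m (c • u) v, hT m u v, fn_smul c (T m u v),
        ae_restrict_mem measurableSet_strip] with z h1 h2 h4 hz
      rw [h1, h4, Pi.smul_apply, h2, bOp_congr m (g := fun z => c * (fn u z * fn v z))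
        (by filter_upwards [fn_smul c u] with w hw; rw [hw, Pi.smul_apply, smul_eq_mul, mul_assoc]) hz.1.2.le]
      exact symOp_smul c))
    (fun m u v v' => ext_ae (by
      filter_upwards [hT m u (v + v'), hT m u v, hT m u v', fn_add (T m u v) (T m u v'), hfin u v, hfin u v',
        ae_restrict_mem measurableSet_strip] with z h1 h2 h3 h4 h5 h6 hz
      rw [h1, h4, Pi.add_apply, h2, h3, bOp_congr m (g := fun z => fn u z * fn v z + fn u z * fn v' z)
        (by filter_upwards [fn_add v v'] with w hw; rw [hw, Pi.add_apply, mul_add]) hz.1.2.le]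
      exact symOp_add oseenKer_measurable oseenPhase_measurable (hae u v) (hae u v') h5 h6))
    (fun c m u v => ext_ae (by
      filter_upwards [hT m u (c • v), hT m u v, fn_smul c (T m u v),
        ae_restrict_mem measurableSet_strip] with z h1 h2 h4 hz
      rw [h1, h4, Pi.smul_apply, h2, bOp_congr m (g := fun z => c * (fn u z * fn v z))
        (by filter_upwards [fn_smul c v] with w hw; rw [hw, Pi.smul_apply, smul_eq_mul, mul_left_comm])
          hz.1.2.le]
      exact symOp_smul c))
    (2 * C.toReal) (by positivity) (fun m u v => (hTb m u v).trans (le_of_eq (by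
      simp only [ENNReal.toReal_mul, toReal_enorm]; ring)))
  exact ⟨B, fun m u v => by rw [hB]; exact hT m u v⟩

/-- The heat-type operator cut off at time `δ`. -/
def aCut (δ : ℝ) (m : Sym d) (a : E d → ℝ) (z : ℝ × E d) : ℝ := if z.1 < δ then aOp m a z else 0

/-- The majorant of `aCut`. -/
def heatCut (δ : ℝ) (a : E d → ℝ) (z : ℝ × E d) : ℝ≥0∞ :=
  if z.1 < δ then heatOp (fun y => ‖a y‖ₑ) z else 0

theorem measurableSet_fst_lt {δ : ℝ} : MeasurableSet {z : ℝ × E d | z.1 < δ} :=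
  measurableSet_lt measurable_fst measurable_const

theorem heatCut_measurable (δ : ℝ) {a : E d → ℝ} (ha : Measurable a) : Measurable (heatCut δ a) :=
  Measurable.ite measurableSet_fst_lt (measurable_heatOp ha.enorm) measurable_const

/-- The operator is linear in the symbol and its norm is at most twice the bound for the data, so a
small `K` makes the initial term small for all symbols of bounded norm. -/
theorem exists_heat_operator {q δ : ℝ} (hq : 1 ≤ q) {a : E d → ℝ} (ha : Measurable a) {K : ℝ≥0∞}
    (hK : K < ⊤) (H : MajBound d (1 / 2 - d / (2 * q)) q (heatCut δ a) K) :
    ∃ A : Sym d →L[ℝ] CritSpace d q hq, ‖A‖ ≤ 2 * K.toReal ∧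
      ∀ m, fn (A m) =ᵐ[stripMeasure d 1] aCut δ m a := by
  have hex : ∀ m : Sym d, ∃ w : CritSpace d q hq, fn w =ᵐ[stripMeasure d 1] aCut δ m a ∧
      ‖w‖ ≤ 2 * (‖m‖ₑ * K).toReal := fun m => by
    refine H.exists_fn_eq hK (by simp) (StronglyMeasurable.ite measurableSet_fst_lt
      (aOp_stronglyMeasurable m ha) stronglyMeasurable_const).aestronglyMeasurable ?_
    filter_upwards [ae_restrict_mem measurableSet_strip] with z hz
    rw [aCut, heatCut]
    split_ifs
    · exact aOp_enorm_le m a hz.1.1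
    · simp
  choose T hT hTb using hex
  have hTb' : ∀ m, ‖T m‖ ≤ 2 * K.toReal * ‖m‖ := fun m => (hTb m).trans (le_of_eq (by
    simp only [ENNReal.toReal_mul, toReal_enorm]; ring))
  refine ⟨LinearMap.mkContinuous ⟨⟨T, fun m m' => ext_ae ?_⟩, fun c m => ext_ae ?_⟩ (2 * K.toReal) hTb',
    LinearMap.mkContinuous_norm_le _ (by positivity) _, hT⟩
  · filter_upwards [hT (m + m'), hT m, hT m', fn_add (T m) (T m'), H.ae_lt_top hK,
      ae_restrict_mem measurableSet_strip] with z h1 h2 h3 h4 h5 hz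
    rw [h1, h4, Pi.add_apply, h2, h3, aCut, aCut, aCut]
    rw [heatCut] at h5
    split_ifs with h
    · rw [if_pos h, ← majOp_heatKer a hz.1.1] at h5
      exact symOp_add_symbol heatKer_measurable heatPhase_measurable ha.aestronglyMeasurable h5
    · simp
  · filter_upwards [hT (c • m), hT m, fn_smul c (T m)] with z h1 h2 h4
    rw [RingHom.id_apply, h4, Pi.smul_apply, h2]
    change fn (T (c • m)) z = _
    rw [h1, aCut, aCut]
    split_ifs with h
    · exact symOp_smul_symbol c
    · simp

end

/-! ### The heat flow of critical data is small for short times. -/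

section

variable {d : ℕ}

/-- Young with `1/r = 1 + 1/q - 1/d`, the exponent for which the power of `t` lost by the kernel
equals the weight. -/
theorem heatOp_slice_le (hd : 2 ≤ d) {q : ℝ} (hq1 : (d : ℝ) ≤ q) :
    ∃ C : ℝ≥0∞, C < ⊤ ∧ ∀ b : E d → ℝ≥0∞, Measurable b → ∀ t : ℝ, 0 < t →
      ENNReal.ofReal (t ^ (1 / 2 - (d : ℝ) / (2 * q))) * (∫⁻ x, heatOp b (t, x) ^ q) ^ (1 / q) ≤
        C * (∫⁻ x, b x ^ (d : ℝ)) ^ (1 / (d : ℝ)) := by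
  have hd2 : (2 : ℝ) ≤ d := by exact_mod_cast hd
  have hd0 : (0 : ℝ) < d := by linarith
  have hq0 : 0 < q := by linarith
  set ri : ℝ := 1 + 1 / q - 1 / d with hri
  have e1 : 1 / (d : ℝ) < 1 := by rw [div_lt_one hd0]; linarith
  have e2 : 1 / q ≤ 1 / (d : ℝ) := one_div_le_one_div_of_le hd0 hq1
  have e3 : 0 < 1 / q := by positivity
  have hri0 : 0 < ri := by linarith
  have hr : 1 ≤ 1 / ri := by rw [le_div_iff₀ hri0]; linarith
  refine ⟨profileMass d (((d : ℝ) + 3) / 2 * (1 / ri)) ^ (1 / (1 / ri)),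
    ENNReal.rpow_lt_top_of_nonneg (by positivity) (profileMass_lt_top ?_).ne, fun b hb t ht => ?_⟩
  · nlinarith
  · have key := heatOp_norm_le (d := d) hd0 hr hq1 (by rw [div_le_comm₀ hri0 hq0]; linarith)
      (by rw [one_div_one_div]; linarith) hb ht
    have hexp : -((d : ℝ) / 2 * (1 - 1 / (1 / ri))) = -(1 / 2 - d / (2 * q)) := by
      rw [one_div_one_div, hri]; field_simp; ring
    rw [hexp] at key
    calc _ ≤ ENNReal.ofReal (t ^ (1 / 2 - (d : ℝ) / (2 * q))) *
          (ENNReal.ofReal (t ^ (-(1 / 2 - (d : ℝ) / (2 * q)))) *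
          profileMass d (((d : ℝ) + 3) / 2 * (1 / ri)) ^ (1 / (1 / ri)) *
          (∫⁻ x, b x ^ (d : ℝ)) ^ (1 / (d : ℝ))) := by gcongr
      _ = (ENNReal.ofReal (t ^ (1 / 2 - (d : ℝ) / (2 * q))) *
          ENNReal.ofReal (t ^ (-(1 / 2 - (d : ℝ) / (2 * q))))) *
          (profileMass d (((d : ℝ) + 3) / 2 * (1 / ri)) ^ (1 / (1 / ri)) *
          (∫⁻ x, b x ^ (d : ℝ)) ^ (1 / (d : ℝ))) := by ring
      _ = _ := by
          rw [← ENNReal.ofReal_mul (Real.rpow_nonneg ht.le _), ← Real.rpow_add ht]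
          simp

/-- Young with `r = 1`: no negative power of `t` appears, so data in `L^{d+2}` gain the whole
weight. This treats the bounded part of the data in `heatCut_small`. -/
theorem heatOp_slice_const : ∃ C : ℝ≥0∞, C < ⊤ ∧ ∀ b : E d → ℝ≥0∞, Measurable b → ∀ t : ℝ, 0 < t →
      (∫⁻ x, heatOp b (t, x) ^ nR d) ^ (1 / nR d) ≤ C * (∫⁻ x, b x ^ nR d) ^ (1 / nR d) := by
  refine ⟨profileMass d (((d : ℝ) + 3) / 2 * 1) ^ (1 / (1 : ℝ)),
    ENNReal.rpow_lt_top_of_nonneg (by positivity) (profileMass_lt_top (by linarith)).ne, fun b hb t ht => ?_⟩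
  have key := heatOp_norm_le (d := d) (p := nR d) (q := nR d) (r := 1) nR_pos le_rfl le_rfl one_le_nR
    (by ring) hb ht
  simpa using key

theorem heatCut_global_ne_top (hd : 2 ≤ d) {a : E d → ℝ} (ha : Measurable a)
    (haf : ∫⁻ x, ‖a x‖ₑ ^ (d : ℝ) ≠ ⊤) :
    ∫⁻ z in strip d 1, heatOp (fun y => ‖a y‖ₑ) z ^ nR d ≠ ⊤ := by
  obtain ⟨C, hC, H⟩ := heatOp_norm_spacetime_le (d := d) hd
  have h := H _ ha.enorm haf
  have h1 : ∫⁻ z in strip d 1, heatOp (fun y => ‖a y‖ₑ) z ^ nR d ≤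
      ∫⁻ z in {z : ℝ × E d | 0 < z.1}, heatOp (fun y => ‖a y‖ₑ) z ^ nR d :=
    lintegral_mono_set fun z hz => hz.1.1
  refine ((h1.trans h).trans_lt ?_).ne
  exact ENNReal.mul_lt_top (ENNReal.mul_lt_top hC (ENNReal.rpow_lt_top_of_nonneg (by positivity) haf)) haf.lt_top

theorem heatCut_le (δ : ℝ) (a : E d → ℝ) (z : ℝ × E d) : heatCut δ a z ≤ heatOp (fun y => ‖a y‖ₑ) z := by
  rw [heatCut]; split_ifs
  · exact le_rfl
  · exact bot_le

theorem heatCut_majBound (hd : 2 ≤ d) {q : ℝ} (hq1 : (d : ℝ) ≤ q) {a : E d → ℝ} (ha : Measurable a)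
    (haf : ∫⁻ x, ‖a x‖ₑ ^ (d : ℝ) ≠ ⊤) :
    ∃ K : ℝ≥0∞, K < ⊤ ∧ ∀ δ, MajBound d (1 / 2 - d / (2 * q)) q (heatCut δ a) K := by
  have hd2 : (2 : ℝ) ≤ d := by exact_mod_cast hd
  have hq0 : 0 < q := by linarith
  obtain ⟨C, hC, H⟩ := heatOp_slice_le hd hq1
  have h1 := heatCut_global_ne_top hd ha haf
  refine ⟨max ((∫⁻ z in strip d 1, heatOp (fun y => ‖a y‖ₑ) z ^ nR d) ^ (1 / nR d))
    (C * (∫⁻ x, ‖a x‖ₑ ^ (d : ℝ)) ^ (1 / (d : ℝ))),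
    max_lt (ENNReal.rpow_lt_top_of_nonneg (by positivity) h1)
    (ENNReal.mul_lt_top hC (ENNReal.rpow_lt_top_of_nonneg (by positivity) haf)), fun δ =>
    ⟨heatCut_measurable δ ha, ?_, ?_⟩⟩
  · refine le_trans ?_ (le_max_left _ _)
    gcongr
    exact heatCut_le _ _ _
  · rw [ae_strip_iff]
    refine Filter.Eventually.of_forall fun t ht => le_trans ?_ (le_max_right _ _)
    refine le_trans ?_ (H _ ha.enorm t ht.1)
    gcongr
    exact heatCut_le _ _ _

theorem tendsto_lintegral_large {b : E d → ℝ≥0∞} (hb : Measurable b) {p : ℝ} (hp : 0 < p)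
    (hbf : ∫⁻ x, b x ^ p ≠ ⊤) :
    Filter.Tendsto (fun n : ℕ => ∫⁻ x, (if (n : ℝ≥0∞) < b x then b x else 0) ^ p) Filter.atTop (nhds 0) := by
  suffices h : Filter.Tendsto (fun n : ℕ => ∫⁻ x, (if (n : ℝ≥0∞) < b x then b x else 0) ^ p) Filter.atTop
      (nhds (∫⁻ _ : E d, 0)) by rwa [lintegral_zero] at h
  refine tendsto_lintegral_of_dominated_convergence (fun x => b x ^ p)
    (fun n => (Measurable.ite (measurableSet_lt measurable_const hb) hb measurable_const).pow_const _)
    (fun n => Filter.Eventually.of_forall fun x => ?_) hbf ?_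
  · simp only
    split_ifs
    · exact le_rfl
    · rw [ENNReal.zero_rpow_of_pos hp]; exact bot_le
  · filter_upwards [ae_lt_top (hb.pow_const p) hbf] with x hx
    obtain ⟨n, hn⟩ := ENNReal.exists_nat_gt ((ENNReal.rpow_lt_top_iff_of_pos hp).1 hx).ne
    refine tendsto_const_nhds.congr' ?_
    filter_upwards [Filter.eventually_ge_atTop n] with m hm
    have : ¬ (m : ℝ≥0∞) < b x := not_lt.2 (hn.le.trans (by exact_mod_cast hm))
    rw [if_neg this, ENNReal.zero_rpow_of_pos hp]

theorem tendsto_heatCut_global (hd : 2 ≤ d) {a : E d → ℝ} (ha : Measurable a)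
    (haf : ∫⁻ x, ‖a x‖ₑ ^ (d : ℝ) ≠ ⊤) :
    Filter.Tendsto (fun n : ℕ => ∫⁻ z in strip d 1, heatCut (1 / (n + 1)) a z ^ nR d) Filter.atTop (nhds 0) := by
  rw [show (0 : ℝ≥0∞) = ∫⁻ _ in strip d 1, 0 by simp]
  refine tendsto_lintegral_of_dominated_convergence (fun z => heatOp (fun y => ‖a y‖ₑ) z ^ nR d)
    (fun n => (heatCut_measurable _ ha).pow_const _)
    (fun n => Filter.Eventually.of_forall fun x => ?_) (heatCut_global_ne_top hd ha haf) ?_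
  · exact ENNReal.rpow_le_rpow (heatCut_le _ _ _) nR_pos.le
  · filter_upwards [ae_restrict_mem measurableSet_strip] with z hz
    refine tendsto_const_nhds.congr' ?_
    have := (tendsto_one_div_add_atTop_nhds_zero_nat (𝕜 := ℝ)).eventually (gt_mem_nhds hz.1.1)
    filter_upwards [this] with n hn
    rw [heatCut, if_neg (not_lt.2 hn.le), ENNReal.zero_rpow_of_pos nR_pos]

theorem heatOp_add {b c : E d → ℝ≥0∞} (hb : Measurable b) (z : ℝ × E d) :
    heatOp (fun y => b y + c y) z = heatOp b z + heatOp c z := by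
  have h : Measurable fun y : E d => heatMaj z.1 (z.2 - y) * b y := by
    refine Measurable.mul ?_ hb
    exact measurable_heatMaj.comp (measurable_const.prodMk (measurable_const.sub measurable_id))
  rw [heatOp, heatOp, heatOp, ← lintegral_add_left h]
  simp_rw [mul_add]

/-- The estimate by the `L^d` norm is scale invariant and does not improve when `δ` shrinks, so the
data are split at a height `κ`. The part above `κ` is small in `L^d`. The part below lies in
`L^{d+2}` and gains `δ^{1/(d+2)}`. The space-time norm tends to zero by dominated convergence. -/
theorem heatCut_small (hd : 2 ≤ d) {a : E d → ℝ} (ha : Measurable a)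
    (haf : ∫⁻ x, ‖a x‖ₑ ^ (d : ℝ) ≠ ⊤) {ε : ℝ≥0∞} (hε : 0 < ε) :
    ∃ δ : ℝ, 0 < δ ∧ δ ≤ 1 ∧ MajBound d (1 / 2 - d / (2 * nR d)) (nR d) (heatCut δ a) ε := by
  have hd2 : (2 : ℝ) ≤ d := by exact_mod_cast hd
  have hd0 : (0 : ℝ) < d := by linarith
  have hNd : nR d = d + 2 := rfl
  have hσ : 1 / 2 - (d : ℝ) / (2 * nR d) = 1 / nR d := by
    have := nR_pos (d := d)
    field_simp; linarith
  obtain ⟨C1, hC1, H1⟩ := heatOp_slice_le hd (q := nR d) (by linarith)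
  obtain ⟨C2, hC2, H2⟩ := heatOp_slice_const (d := d)
  set b : E d → ℝ≥0∞ := fun y => ‖a y‖ₑ with hb
  have hbm : Measurable b := ha.enorm
  -- the large part of the data
  have t1 : Filter.Tendsto (fun n : ℕ => C1 * (∫⁻ x, (if (n : ℝ≥0∞) < b x then b x else 0) ^ (d : ℝ)) ^ (1 / (d : ℝ)))
      Filter.atTop (nhds 0) := by
    have := ENNReal.Tendsto.const_mul (a := C1) (((ENNReal.continuous_rpow_const (y := 1 / (d : ℝ))).tendsto 0).comp
      (tendsto_lintegral_large hbm hd0 haf)) (Or.inr hC1.ne)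
    simpa [ENNReal.zero_rpow_of_pos, hd0] using this
  have hε2 : 0 < ε / 2 := ENNReal.half_pos hε.ne'
  obtain ⟨κ, hκ⟩ := (t1.eventually (ge_mem_nhds hε2)).exists
  set b2 : E d → ℝ≥0∞ := fun x => if (κ : ℝ≥0∞) < b x then b x else 0 with hb2
  set b1 : E d → ℝ≥0∞ := fun x => if (κ : ℝ≥0∞) < b x then 0 else b x with hb1
  have hb1m : Measurable b1 := Measurable.ite (measurableSet_lt measurable_const hbm) measurable_const hbm
  have hb2m : Measurable b2 := Measurable.ite (measurableSet_lt measurable_const hbm) hbm measurable_const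
  have hsum : b = fun x => b1 x + b2 x := by
    funext x; simp only [hb1, hb2]; split_ifs <;> simp
  -- Below the height `κ` one has `b1^{d+2} ≤ κ² b^d`.
  have hb1f : (∫⁻ x, b1 x ^ nR d) ^ (1 / nR d) ≠ ⊤ := by
    refine ENNReal.rpow_ne_top_of_nonneg (by positivity) ?_
    have : ∫⁻ x, b1 x ^ nR d ≤ ∫⁻ x, (κ : ℝ≥0∞) ^ (2 : ℝ) * b x ^ (d : ℝ) := by
      refine lintegral_mono fun x => ?_
      simp only [hb1]
      split_ifs with h
      · rw [ENNReal.zero_rpow_of_pos nR_pos]; exact bot_le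
      · rw [hNd, add_comm, ENNReal.rpow_add_of_nonneg _ _ (by norm_num) hd0.le]
        gcongr
        exact not_lt.1 h
    refine (this.trans_lt ?_).ne
    rw [lintegral_const_mul' _ _ (by simp)]
    exact ENNReal.mul_lt_top (by simp) haf.lt_top
  have t2 : Filter.Tendsto (fun n : ℕ => ENNReal.ofReal ((1 / ((n : ℝ) + 1)) ^ (1 / nR d)) *
      (C2 * (∫⁻ x, b1 x ^ nR d) ^ (1 / nR d))) Filter.atTop (nhds 0) := by
    have h0 : Filter.Tendsto (fun n : ℕ => (1 / ((n : ℝ) + 1)) ^ (1 / nR d)) Filter.atTop (nhds 0) := by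
      have := (tendsto_one_div_add_atTop_nhds_zero_nat (𝕜 := ℝ)).rpow_const
        (p := 1 / nR d) (Or.inr (by positivity))
      rwa [Real.zero_rpow (one_div_pos.2 nR_pos).ne'] at this
    have := ENNReal.Tendsto.mul_const (b := C2 * (∫⁻ x, b1 x ^ nR d) ^ (1 / nR d))
      (ENNReal.tendsto_ofReal h0) (Or.inr (ENNReal.mul_lt_top hC2 hb1f.lt_top).ne)
    simpa using this
  have t3 : Filter.Tendsto (fun n : ℕ => (∫⁻ z in strip d 1, heatCut (1 / (n + 1)) a z ^ nR d) ^ (1 / nR d))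
      Filter.atTop (nhds 0) := by
    have := ((ENNReal.continuous_rpow_const (y := 1 / nR d)).tendsto 0).comp (tendsto_heatCut_global hd ha haf)
    rwa [ENNReal.zero_rpow_of_pos (one_div_pos.2 nR_pos)] at this
  obtain ⟨n, hn2, hn3⟩ := ((t2.eventually (ge_mem_nhds hε2)).and (t3.eventually (ge_mem_nhds hε))).exists
  have hn0 : (0 : ℝ) < n + 1 := by positivity
  refine ⟨1 / (n + 1), by positivity, ?_, heatCut_measurable _ ha, hn3, ?_⟩
  · rw [div_le_one hn0]; linarith [(Nat.cast_nonneg n : (0 : ℝ) ≤ n)]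
  rw [ae_strip_iff]
  refine Filter.Eventually.of_forall fun t ht => ?_
  by_cases htδ : t < 1 / (n + 1)
  · have e : ∀ x, heatCut (1 / (n + 1)) a (t, x) = heatOp b1 (t, x) + heatOp b2 (t, x) := fun x => by
      rw [heatCut, if_pos htδ, ← heatOp_add hb1m, ← hsum]
    simp_rw [e]
    have m1 : Measurable fun x => heatOp b1 (t, x) := (measurable_heatOp hb1m).comp measurable_prodMk_left
    have m2 : Measurable fun x => heatOp b2 (t, x) := (measurable_heatOp hb2m).comp measurable_prodMk_left
    have tri := ENNReal.lintegral_Lp_add_le (μ := (volume : Measure (E d))) m1.aemeasurable m2.aemeasurable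
      (one_le_nR (d := d))
    simp only [Pi.add_apply] at tri
    calc _ ≤ ENNReal.ofReal (t ^ (1 / 2 - (d : ℝ) / (2 * nR d))) *
          ((∫⁻ x, heatOp b1 (t, x) ^ nR d) ^ (1 / nR d) + (∫⁻ x, heatOp b2 (t, x) ^ nR d) ^ (1 / nR d)) := by
            gcongr
      _ = ENNReal.ofReal (t ^ (1 / nR d)) * (∫⁻ x, heatOp b1 (t, x) ^ nR d) ^ (1 / nR d) +
          ENNReal.ofReal (t ^ (1 / 2 - (d : ℝ) / (2 * nR d))) *
            (∫⁻ x, heatOp b2 (t, x) ^ nR d) ^ (1 / nR d) := by rw [mul_add, hσ]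
      _ ≤ ENNReal.ofReal ((1 / ((n : ℝ) + 1)) ^ (1 / nR d)) * (C2 * (∫⁻ x, b1 x ^ nR d) ^ (1 / nR d)) +
          C1 * (∫⁻ x, b2 x ^ (d : ℝ)) ^ (1 / (d : ℝ)) := by
            refine add_le_add (mul_le_mul' ?_ (H2 _ hb1m t ht.1)) (H1 _ hb2m t ht.1)
            gcongr
            exact ht.1.le
      _ ≤ ε / 2 + ε / 2 := add_le_add hn2 hκ
      _ = ε := ENNReal.add_halves ε
  · have : ∀ x, heatCut (1 / (n + 1)) a (t, x) = 0 := fun x => by rw [heatCut, if_neg htδ]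
    simp_rw [this]
    rw [ENNReal.zero_rpow_of_pos nR_pos, lintegral_zero, ENNReal.zero_rpow_of_pos (one_div_pos.2 nR_pos)]
    simp

end

/-! ### The parabolic shear and its action on the operators. -/

section

variable {d : ℕ}

open DecaySpace

/-- The parabolic shear `(t, x) ↦ (t, x + √t ζ)`. -/
def shear (ζ : E d) : (ℝ × E d) ≃ᵐ (ℝ × E d) where
  toFun z := (z.1, z.2 + √z.1 • ζ)
  invFun z := (z.1, z.2 - √z.1 • ζ)
  left_inv z := by simp
  right_inv z := by simp
  measurable_toFun := by
    change Measurable fun z : ℝ × E d => (z.1, z.2 + √z.1 • ζ)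
    fun_prop
  measurable_invFun := by
    change Measurable fun z : ℝ × E d => (z.1, z.2 - √z.1 • ζ)
    fun_prop

theorem shear_apply (ζ : E d) (z : ℝ × E d) : shear ζ z = (z.1, z.2 + √z.1 • ζ) := rfl

theorem shear_measurePreserving (ζ : E d) : MeasurePreserving (shear ζ) volume volume := by
  rw [Measure.volume_eq_prod]
  refine MeasurePreserving.skew_product (g := fun t x => x + √t • ζ) (MeasurePreserving.id volume)
    (by unfold Function.uncurry; fun_prop) (Filter.Eventually.of_forall fun t => ?_)
  exact (measurePreserving_add_right volume (√t • ζ)).map_eq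

theorem shear_preimage_strip (ζ : E d) (δ : ℝ) : shear ζ ⁻¹' strip d δ = strip d δ := by
  ext z; simp [strip, shear_apply]

theorem shear_measurePreserving_strip (ζ : E d) (δ : ℝ) :
    MeasurePreserving (shear ζ) (stripMeasure d δ) (stripMeasure d δ) := by
  have := (shear_measurePreserving ζ).restrict_preimage_emb (shear ζ).measurableEmbedding (strip d δ)
  rwa [shear_preimage_strip] at this

/-- `(√t - √s)² ≤ t - s < τ`. The relative displacement of source and target is thus bounded by the
width `√τ` of the kernel, and the truncation `clamp` in the symbols is never active. -/
theorem sqrt_sub_div_mem {s t τ : ℝ} (hs : 0 < s) (hst : s < t) (hτ : t - s < τ) :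
    0 ≤ (√t - √s) / √τ ∧ (√t - √s) / √τ ≤ 1 := by
  have hτ0 : 0 < τ := by linarith
  have h1 : √s ≤ √t := Real.sqrt_le_sqrt hst.le
  refine ⟨div_nonneg (by linarith) (Real.sqrt_nonneg _), ?_⟩
  rw [div_le_one (Real.sqrt_pos.2 hτ0)]
  refine Real.le_sqrt_of_sq_le ?_
  nlinarith [Real.sq_sqrt hs.le, Real.sq_sqrt (hs.trans hst).le, Real.sqrt_nonneg s, Real.sqrt_nonneg t]

theorem heatKer_mul_symbol {f : E d → ℝ} (hf : GaussClass f) (j : ℕ) (ζ : E d) {z : ℝ × E d} (hz : 0 < z.1)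
    (y : E d) : heatKer z y * symbol hf j ζ (heatPhase z y) =
      z.1 ^ (-((d : ℝ) / 2)) * f ((√z.1)⁻¹ • (z.2 - y) + ζ) := by
  rw [heatKer, if_pos hz, symbol_apply, heatPhase]
  simp only [clamp_one, one_pow, one_smul, one_mul]
  have h := prof_eq hz (z.2 - y)
  calc _ = z.1 ^ (3 / 2 : ℝ) * (prof z.1 (z.2 - y) * wt ((√z.1)⁻¹ • (z.2 - y))) *
        f ((√z.1)⁻¹ • (z.2 - y) + ζ) := by ring
    _ = _ := by
      rw [h, ← Real.rpow_add hz]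
      congr 2; ring

theorem oseenKer_mul_symbol {f : E d → ℝ} (hf : GaussClass f) (j : ℕ) (ζ : E d) {z : ℝ × E d}
    {p : (ℝ × E d) × ℝ} (h : 0 < p.1.1 ∧ p.1.1 < z.1 ∧ z.1 - p.1.1 < p.2) :
    oseenKer z p * symbol hf j ζ (oseenPhase z p) =
      p.2 ^ (-(((d : ℝ) + 3) / 2)) * ((√z.1 - √p.1.1) / √p.2) ^ j *
        f ((√p.2)⁻¹ • (z.2 - p.1.2) + ((√z.1 - √p.1.1) / √p.2) • ζ) := by
  have hρ := sqrt_sub_div_mem h.1 h.2.1 h.2.2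
  rw [oseenKer, if_pos h, symbol_apply, oseenPhase]
  simp only [clamp_of_mem hρ.1 hρ.2]
  rw [← prof_eq (by linarith [h.2.1, h.2.2] : 0 < p.2) (z.2 - p.1.2)]
  ring

/-- The shear is the identity at time zero, so only the kernel moves and the data `a` stay fixed. -/
theorem aOp_shear {f : E d → ℝ} (hf : GaussClass f) (ζ : E d) (a : E d → ℝ) {z : ℝ × E d} (hz : 0 < z.1) :
    aOp (symbol hf 0 0) a (shear ζ z) = aOp (symbol hf 0 ζ) a z := by
  refine integral_congr_ae (Filter.Eventually.of_forall fun y => ?_)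
  simp only
  rw [heatKer_mul_symbol hf 0 ζ hz, heatKer_mul_symbol hf 0 0 (show 0 < (shear ζ z).1 from hz), shear_apply]
  have : (√z.1)⁻¹ • (z.2 + √z.1 • ζ - y) + 0 = (√z.1)⁻¹ • (z.2 - y) + ζ := by
    have : √z.1 ≠ 0 := (Real.sqrt_pos.2 hz).ne'
    rw [add_zero, add_sub_right_comm, smul_add, smul_smul, inv_mul_cancel₀ this, one_smul]
  simp only [this]

/-- Shearing the integration variable as well, which preserves measure, puts the shear on `F` and
leaves the displacement `(√t - √s) ζ` in the kernel. Divided by `√τ`, this is the `ρ ζ` of the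
symbol. -/
theorem bOp_shear {f : E d → ℝ} (hf : GaussClass f) (ζ : E d) (F : ℝ × E d → ℝ) (z : ℝ × E d) :
    bOp (symbol hf 0 0) F (shear ζ z) = bOp (symbol hf 0 ζ) (F ∘ shear ζ) z := by
  have hmp : MeasurePreserving ((shear ζ).prodCongr (MeasurableEquiv.refl ℝ))
      (volume : Measure ((ℝ × E d) × ℝ)) volume := by
    rw [Measure.volume_eq_prod]
    exact (shear_measurePreserving ζ).prod (MeasurePreserving.id volume)
  rw [bOp, symOp, ← hmp.integral_comp']
  refine integral_congr_ae (Filter.Eventually.of_forall fun p => ?_)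
  simp only
  have hS : ((shear ζ).prodCongr (MeasurableEquiv.refl ℝ)) p = ((p.1.1, p.1.2 + √p.1.1 • ζ), p.2) := rfl
  rw [hS]
  have hF : (F ∘ shear ζ) p.1 = F (p.1.1, p.1.2 + √p.1.1 • ζ) := rfl
  rw [hF]
  by_cases h : 0 < p.1.1 ∧ p.1.1 < z.1 ∧ z.1 - p.1.1 < p.2
  · rw [oseenKer_mul_symbol hf 0 ζ h, oseenKer_mul_symbol hf 0 0 (z := shear ζ z)
      (p := ((p.1.1, p.1.2 + √p.1.1 • ζ), p.2)) h, shear_apply]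
    have : (√p.2)⁻¹ • (z.2 + √z.1 • ζ - (p.1.2 + √p.1.1 • ζ)) + ((√z.1 - √p.1.1) / √p.2) • (0 : E d) =
        (√p.2)⁻¹ • (z.2 - p.1.2) + ((√z.1 - √p.1.1) / √p.2) • ζ := by
      rw [div_eq_inv_mul]; module
    simp only [this]
  · have h' : oseenKer (shear ζ z) ((p.1.1, p.1.2 + √p.1.1 • ζ), p.2) = 0 := if_neg h
    have h'' : oseenKer z p = 0 := if_neg h
    rw [h', h'', zero_mul, zero_mul, zero_mul, zero_mul]

/-- On each slice the shear is a translation, so both parts of the norm are invariant. The constant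
`2` is an artefact of bounding the two parts by one majorant; the uniqueness radius in
`exists_smooth_solution` is chosen to absorb it. -/
theorem exists_fn_eq_shear {σ q : ℝ} {hq : 1 ≤ q} (ζ : E d) (w : DecaySpace d σ q hq) :
    ∃ w' : DecaySpace d σ q hq, fn w' =ᵐ[stripMeasure d 1] fn w ∘ shear ζ ∧ ‖w'‖ ≤ 2 * ‖w‖ := by
  have hm : Measurable (fn w ∘ shear ζ) := (measurable_fn w).comp (shear ζ).measurable
  have hM : MajBound d σ q (fun z => ‖fn w (shear ζ z)‖ₑ) ‖w‖ₑ := by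
    refine ⟨hm.enorm, ?_, ?_⟩
    · have : ∫⁻ z in strip d 1, ‖fn w (shear ζ z)‖ₑ ^ nR d = ∫⁻ z in strip d 1, ‖fn w z‖ₑ ^ nR d :=
        (shear_measurePreserving_strip ζ 1).lintegral_comp ((measurable_fn w).enorm.pow_const _)
      rw [this]
      exact lintegral_fn_le w
    · filter_upwards [slice_le w] with t ht
      have : ∫⁻ x, ‖fn w (shear ζ (t, x))‖ₑ ^ q = ∫⁻ x, ‖fn w (t, x)‖ₑ ^ q :=
        lintegral_add_right_eq_self (fun x => ‖fn w (t, x)‖ₑ ^ q) (√t • ζ)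
      rw [this]
      exact ht
  obtain ⟨w', h1, h2⟩ := hM.exists_fn_eq (hq := hq) (c := 1) (g := fn w ∘ shear ζ) (by simp) (by simp)
    hm.aestronglyMeasurable (Filter.Eventually.of_forall fun z => by simp)
  exact ⟨w', h1, by simpa using h2⟩

end

/-! ### Smooth dependence for the quadratic equation and existence of mild solutions. -/

section

variable {d : ℕ}

open DecaySpace Topology

/-- The quadratic equation `U = A - Q(U, U)` near `A = 0` has a unique small solution, which
depends smoothly on `A` and `Q`. -/
theorem exists_smooth_solution {W : Type*} [NormedAddCommGroup W] [NormedSpace ℝ W] [CompleteSpace W]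
    (Q₀ : W →L[ℝ] W →L[ℝ] W) {n : ℕ} (hn : n ≠ 0) :
    ∃ S : W × (W →L[ℝ] W →L[ℝ] W) → W, ∃ r > 0, ∀ᶠ p in 𝓝 ((0 : W), Q₀),
      ContDiffAt ℝ n S p ∧ S p = p.1 - p.2 (S p) (S p) ∧ ‖S p‖ < r ∧
        ∀ U, ‖U‖ < 2 * r → U = p.1 - p.2 U U → U = S p := by
  set f : (W × (W →L[ℝ] W →L[ℝ] W)) × W → W := fun v => v.2 - v.1.1 + v.1.2 v.2 v.2 with hf
  set u : (W × (W →L[ℝ] W →L[ℝ] W)) × W := ((0, Q₀), 0) with hu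
  have hfu : f u = 0 := by simp [hf, hu]
  have cdf : ContDiff ℝ n f := by
    refine (contDiff_snd.sub contDiff_fst.fst).add ?_
    exact (contDiff_fst.snd.clm_apply contDiff_snd).clm_apply contDiff_snd
  have pn : (n : ℕ∞ω) ≠ 0 := by exact_mod_cast hn
  -- The quadratic term vanishes to first order at `U = 0`, so the partial derivative is the
  -- identity and the implicit function theorem applies.
  have hd : HasFDerivAt (fun U : W => f ((0, Q₀), U)) (ContinuousLinearMap.id ℝ W) 0 := by
    have h1 : HasFDerivAt (fun U : W => Q₀ U U) (0 : W →L[ℝ] W) 0 := by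
      have := Q₀.isBoundedBilinearMap.hasFDerivAt ((0 : W), (0 : W))
      have := HasFDerivAt.comp (f := fun x : W => (x, x)) (0 : W) this ((hasFDerivAt_id (0 : W)).prodMk (hasFDerivAt_id (0 : W)))
      refine this.congr_fderiv ?_
      ext x
      simp [IsBoundedBilinearMap.deriv]
    have := (hasFDerivAt_id (0 : W)).add h1
    refine (this.congr_fderiv (by simp)).congr_of_eventuallyEq (Filter.Eventually.of_forall fun U => ?_)
    simp [hf]
  have if₂ : (fderiv ℝ f u ∘L .inr ℝ (W × (W →L[ℝ] W →L[ℝ] W)) W).IsInvertible := by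
    have h2 : HasFDerivAt (fun U : W => f ((0, Q₀), U))
        (fderiv ℝ f u ∘L .inr ℝ (W × (W →L[ℝ] W →L[ℝ] W)) W) 0 := by
      have h3 : HasFDerivAt f (fderiv ℝ f u) u := (cdf.differentiable pn u).hasFDerivAt
      exact h3.comp (0 : W) (hasFDerivAt_prodMk_right _ _)
    rw [h2.unique hd]
    exact ⟨ContinuousLinearEquiv.refl ℝ W, rfl⟩
  set S := cdf.contDiffAt.implicitFunction pn if₂ with hS
  have hS1 : ContDiffAt ℝ n S u.1 := cdf.contDiffAt.contDiffAt_implicitFunction pn if₂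
  have hS2 := cdf.contDiffAt.eventually_apply_implicitFunction pn if₂
  have hS3 := cdf.contDiffAt.eventually_apply_eq_iff_implicitFunction pn if₂
  have hS0 : S u.1 = 0 := cdf.contDiffAt.implicitFunction_apply_self pn if₂
  rw [hfu] at hS2 hS3
  obtain ⟨pa, hpa, pb, hpb, hab⟩ := Filter.eventually_prod_iff.1 (nhds_prod_eq (x := u.1) (y := u.2) ▸ hS3)
  obtain ⟨ρ, hρ, hball⟩ := Metric.eventually_nhds_iff_ball.1 hpb
  have hlim : ∀ᶠ p in 𝓝 u.1, ‖S p‖ < ρ / 2 := by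
    have := hS1.continuousAt.norm
    rw [ContinuousAt, hS0, norm_zero] at this
    exact this.eventually (gt_mem_nhds (by positivity))
  -- The solution stays below half of the uniqueness radius, which leaves room for sheared solutions
  -- of up to twice the norm.
  refine ⟨S, ρ / 2, by positivity, ?_⟩
  filter_upwards [hS1.eventually (by simp), hS2, hpa, hlim] with p h1 h2 h3 h4
  refine ⟨h1, ?_, h4, fun U hU hUe => ?_⟩
  · have : S p - p.1 + p.2 (S p) (S p) = 0 := h2
    rw [eq_sub_iff_add_eq, ← sub_eq_zero, ← this]; abel
  · have h5 := hab h3 (hball U (by simpa [hu] using (by linarith : ‖U‖ < ρ)))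
    have h6 : f (p, U) = 0 := by
      change U - p.1 + p.2 U U = 0
      rw [eq_sub_iff_add_eq] at hUe
      rw [← sub_eq_zero.2 hUe]; abel
    exact (h5.1 h6).symm

section

variable {σ q : ℝ} {hq : 1 ≤ q}

theorem DecaySpace.fn_sub (v w : DecaySpace d σ q hq) : fn (v - w) =ᵐ[stripMeasure d 1] fn v - fn w := by
  unfold fn; rw [map_sub]; exact Lp.coeFn_sub _ _

theorem DecaySpace.fn_zero : fn (0 : DecaySpace d σ q hq) =ᵐ[stripMeasure d 1] 0 := by
  unfold fn; rw [map_zero]; exact Lp.coeFn_zero _ _ _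

theorem DecaySpace.fn_sum {ι : Type*} (s : Finset ι) (w : ι → DecaySpace d σ q hq) :
    fn (∑ i ∈ s, w i) =ᵐ[stripMeasure d 1] ∑ i ∈ s, fn (w i) := by
  classical
  induction s using Finset.induction_on with
  | empty => simpa using fn_zero
  | insert i s hi ih =>
    rw [Finset.sum_insert hi, Finset.sum_insert hi]
    exact (fn_add _ _).trans (by filter_upwards [ih] with z hz; simp [hz])

theorem MajBound.mono {G G' : ℝ × E d → ℝ≥0∞} {K : ℝ≥0∞} (h : MajBound d σ q G K) (hq : 0 < q)
    (hm : Measurable G') (hle : ∀ z, G' z ≤ G z) : MajBound d σ q G' K := by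
  refine ⟨hm, le_trans ?_ h.global, ?_⟩
  · have := nR_pos (d := d)
    gcongr
    exact hle _
  · filter_upwards [h.slice] with t ht
    refine le_trans ?_ ht
    gcongr
    exact hle _

end

/-- Third derivatives of the Gaussian. -/
theorem GaussClass.third (i j k : Fin d) : GaussClass (NavierStokes.pd i (NavierStokes.pd j (NavierStokes.pd k NavierStokes.gauss))) :=
  ((GaussClass.gauss.pd k).pd j).pd i

/-- The Duhamel term of the Navier-Stokes equations with shifted kernels. -/
def duhamel (ζ : E d) (v : Fin d → ℝ × E d → ℝ) (i : Fin d) (z : ℝ × E d) : ℝ :=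
  ∑ j, ∑ k, bOp (symbol (GaussClass.third i j k) 0 ζ) (fun w => v j w * v k w) z -
    ∑ k, ∑ l, bOp (symbol (GaussClass.third l l k) 0 ζ) (fun w => v i w * v k w) z

/-- The space of vector fields in which the fixed-point equation is solved. -/
abbrev VecSpace (d : ℕ) : Type := Fin d → SolSpace d

/-- The shift enters only through the symbols, on which the operators depend linearly and
continuously; smoothness in `ζ` is therefore inherited from `symbol_contDiff`. -/
theorem exists_duhamel_operator (hd : 2 ≤ d) {q : ℝ} (hq1 : (d : ℝ) ≤ q) (hq2 : q ≤ nR d) (hq : 1 ≤ q) :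
    ∃ Q : E d → VecSpace d →L[ℝ] VecSpace d →L[ℝ] (Fin d → CritSpace d q hq),
      (∀ n : ℕ, ContDiff ℝ n Q) ∧ ∀ ζ U i,
        fn (Q ζ U U i) =ᵐ[stripMeasure d 1] duhamel ζ (fun j => fn (U j)) i := by
  obtain ⟨B, hB⟩ := exists_oseen_operator hd hq1 hq2 hq
  have hL : ∀ i j k : Fin d, ∃ L : Sym d →L[ℝ] VecSpace d →L[ℝ] VecSpace d →L[ℝ] (Fin d → CritSpace d q hq),
      ∀ m U V, L m U V = Pi.single i (B m (U j) (V k)) := fun i j k => by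
    refine exists_trilinear _ ?_ ?_ ?_ ?_ ?_ ?_ ‖B‖ (norm_nonneg _) ?_
    · intro m m' U V; simp [Pi.single_add]
    · intro c m U V; simp [Pi.single_smul]
    · intro m U U' V; simp [Pi.single_add]
    · intro c m U V; simp [Pi.single_smul]
    · intro m U V V'; simp [Pi.single_add]
    · intro c m U V; simp [Pi.single_smul]
    · intro m U V
      rw [Pi.norm_single]
      refine (B m (U j)).le_opNorm (V k) |>.trans ?_
      have h1 := (B m).le_opNorm (U j)
      have h2 := B.le_opNorm m
      calc _ ≤ ‖B‖ * ‖m‖ * ‖U j‖ * ‖V k‖ := by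
            gcongr
            exact h1.trans (by gcongr)
        _ ≤ _ := by
            gcongr
            · exact norm_le_pi_norm U j
            · exact norm_le_pi_norm V k
  choose L hL using hL
  refine ⟨fun ζ => ∑ i, ∑ j, ∑ k, L i j k (symbol (GaussClass.third i j k) 0 ζ) -
    ∑ i, ∑ k, ∑ l, L i i k (symbol (GaussClass.third l l k) 0 ζ), fun n => ?_, fun ζ U i => ?_⟩
  · refine ContDiff.sub ?_ ?_
    · refine ContDiff.sum fun i _ => ContDiff.sum fun j _ => ContDiff.sum fun k _ => ?_
      exact (L i j k).contDiff.comp (symbol_contDiff _ 0 n)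
    · refine ContDiff.sum fun i _ => ContDiff.sum fun j _ => ContDiff.sum fun k _ => ?_
      exact (L i i j).contDiff.comp (symbol_contDiff _ 0 n)
  · have e : (∑ i, ∑ j, ∑ k, L i j k (symbol (GaussClass.third i j k) 0 ζ) -
        ∑ i, ∑ k, ∑ l, L i i k (symbol (GaussClass.third l l k) 0 ζ)) U U i =
        ∑ j, ∑ k, B (symbol (GaussClass.third i j k) 0 ζ) (U j) (U k) -
        ∑ k, ∑ l, B (symbol (GaussClass.third l l k) 0 ζ) (U i) (U k) := by
      simp only [sub_apply, sum_apply, hL, Pi.sub_apply, Finset.sum_apply]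
      congr 1
      · rw [Finset.sum_eq_single i]
        · simp
        · intro i' _ hi
          simp [Ne.symm hi]
        · simp
      · rw [Finset.sum_eq_single i]
        · simp
        · intro i' _ hi
          simp [Ne.symm hi]
        · simp
    rw [e]
    have h1 : ∀ᵐ z ∂stripMeasure d 1, ∀ j, fn (∑ k, B (symbol (GaussClass.third i j k) 0 ζ) (U j) (U k)) z =
        ∑ k, bOp (symbol (GaussClass.third i j k) 0 ζ) (fun w => fn (U j) w * fn (U k) w) z := by
      refine ae_all_iff.2 fun j => ?_
      have h : ∀ᵐ z ∂stripMeasure d 1, ∀ k, fn (B (symbol (GaussClass.third i j k) 0 ζ) (U j) (U k)) z =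
        bOp (symbol (GaussClass.third i j k) 0 ζ) (fun w => fn (U j) w * fn (U k) w) z :=
        ae_all_iff.2 fun k => hB _ _ _
      filter_upwards [h, fn_sum Finset.univ fun k => B (symbol (GaussClass.third i j k) 0 ζ) (U j) (U k)]
        with z hz hz'
      rw [hz', Finset.sum_apply]
      exact Finset.sum_congr rfl fun k _ => hz k
    have h2 : ∀ᵐ z ∂stripMeasure d 1, ∀ k, fn (∑ l, B (symbol (GaussClass.third l l k) 0 ζ) (U i) (U k)) z =
        ∑ l, bOp (symbol (GaussClass.third l l k) 0 ζ) (fun w => fn (U i) w * fn (U k) w) z := by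
      refine ae_all_iff.2 fun k => ?_
      have h : ∀ᵐ z ∂stripMeasure d 1, ∀ l, fn (B (symbol (GaussClass.third l l k) 0 ζ) (U i) (U k)) z =
        bOp (symbol (GaussClass.third l l k) 0 ζ) (fun w => fn (U i) w * fn (U k) w) z :=
        ae_all_iff.2 fun k => hB _ _ _
      filter_upwards [h, fn_sum Finset.univ fun l => B (symbol (GaussClass.third l l k) 0 ζ) (U i) (U k)]
        with z hz hz'
      rw [hz', Finset.sum_apply]
      exact Finset.sum_congr rfl fun k _ => hz k
    filter_upwards [h1, h2, fn_sub (∑ j, ∑ k, B (symbol (GaussClass.third i j k) 0 ζ) (U j) (U k))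
        (∑ k, ∑ l, B (symbol (GaussClass.third l l k) 0 ζ) (U i) (U k)),
      fn_sum Finset.univ fun j => ∑ k, B (symbol (GaussClass.third i j k) 0 ζ) (U j) (U k),
      fn_sum Finset.univ fun k => ∑ l, B (symbol (GaussClass.third l l k) 0 ζ) (U i) (U k)] with z h1 h2 h3 h4 h5
    rw [h3, Pi.sub_apply, h4, h5, Finset.sum_apply, Finset.sum_apply, duhamel]
    congr 1
    · exact Finset.sum_congr rfl fun j _ => h1 j
    · exact Finset.sum_congr rfl fun j _ => h2 j

theorem exists_initial_operator {q δ : ℝ} (hq : 1 ≤ q) {a : E d → E d} (ha : Measurable a) {K : ℝ≥0∞}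
    (hK : K < ⊤) (H : MajBound d (1 / 2 - d / (2 * q)) q (heatCut δ fun y => ‖a y‖) K) :
    ∃ A : E d → Fin d → CritSpace d q hq, (∀ n : ℕ, ContDiff ℝ n A) ∧
      ‖A 0‖ ≤ 2 * K.toReal * ‖symbol (GaussClass.gauss (d := d)) 0 0‖ ∧ ∀ ζ i,
        fn (A ζ i) =ᵐ[stripMeasure d 1] aCut δ (symbol GaussClass.gauss 0 ζ) (fun y => a y i) := by
  have ham : ∀ i, Measurable fun y => a y i := fun i =>
    (EuclideanSpace.proj i : E d →L[ℝ] ℝ).continuous.measurable.comp ha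
  have hi : ∀ i, MajBound d (1 / 2 - d / (2 * q)) q (heatCut δ fun y => a y i) K := fun i => by
    refine H.mono (by linarith) (heatCut_measurable _ (ham i)) fun z => ?_
    rw [heatCut, heatCut]
    split_ifs
    · refine lintegral_mono fun y => ?_
      gcongr
      rw [enorm_le_iff_norm_le, norm_norm]
      exact PiLp.norm_apply_le (a y) i
    · exact le_rfl
  choose A hA1 hA2 using fun i => exists_heat_operator hq (ham i) hK (hi i)
  refine ⟨fun ζ i => A i (symbol GaussClass.gauss 0 ζ), fun n => ?_, ?_, fun ζ i => hA2 i _⟩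
  · exact contDiff_pi.2 fun i => (A i).contDiff.comp (symbol_contDiff _ 0 n)
  · refine (pi_norm_le_iff_of_nonneg (by positivity)).2 fun i => ?_
    exact ((A i).le_opNorm _).trans (by gcongr; exact hA1 i)

theorem ae_comp_shear {ζ : E d} {δ : ℝ} {p : ℝ × E d → Prop} (h : ∀ᵐ z ∂stripMeasure d δ, p z) :
    ∀ᵐ z ∂stripMeasure d δ, p (shear ζ z) :=
  (shear_measurePreserving_strip ζ δ).quasiMeasurePreserving.ae h

theorem duhamel_shear (ζ : E d) (v : Fin d → ℝ × E d → ℝ) (i : Fin d) (z : ℝ × E d) :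
    duhamel 0 v i (shear ζ z) = duhamel ζ (fun j => v j ∘ shear ζ) i z := by
  unfold duhamel
  simp only [bOp_shear]
  rfl

theorem duhamel_congr {ζ : E d} {δ : ℝ} {v v' : Fin d → ℝ × E d → ℝ} (h : ∀ j, v j =ᵐ[stripMeasure d δ] v' j)
    (i : Fin d) {z : ℝ × E d} (hz : z.1 ≤ δ) : duhamel ζ v i z = duhamel ζ v' i z := by
  have h2 : ∀ j k, (fun w => v j w * v k w) =ᵐ[stripMeasure d δ] fun w => v' j w * v' k w := fun j k => by
    filter_upwards [h j, h k] with w h1 h2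
    rw [h1, h2]
  unfold duhamel
  congr 1
  · exact Finset.sum_congr rfl fun j _ => Finset.sum_congr rfl fun k _ => bOp_congr _ (h2 j k) hz
  · exact Finset.sum_congr rfl fun k _ => Finset.sum_congr rfl fun l _ => bOp_congr _ (h2 i k) hz

/-- Local existence of a mild solution whose parabolic translates depend smoothly on the shift. -/
theorem exists_mild_solution (hd : 2 ≤ d) (hd1 : 1 ≤ (d : ℝ)) {a : E d → E d} (ha : Measurable a)
    (haf : ∫⁻ x, ‖a x‖ₑ ^ (d : ℝ) ≠ ⊤) {n : ℕ} (hn : n ≠ 0) :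
    ∃ δ : ℝ, 0 < δ ∧ δ ≤ 1 ∧ ∃ (U : VecSpace d) (Y : E d → Fin d → CritSpace d d hd1),
      ContDiffAt ℝ n Y 0 ∧
      (∀ᶠ ζ in 𝓝 0, ∀ i, fn (Y ζ i) =ᵐ[stripMeasure d 1] fn (U i) ∘ shear ζ) ∧
      ∀ i, ∀ᵐ z ∂stripMeasure d 1, fn (U i) z =
        aCut δ (symbol GaussClass.gauss 0 0) (fun y => a y i) z - duhamel 0 (fun j => fn (U j)) i z := by
  have hNd : nR d = d + 2 := rfl
  -- The same Duhamel term is used with two target spaces: `Q` maps into the space where the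
  -- equation is solved, `R` into the one with `L^∞_t L^d_x`.
  obtain ⟨Q, hQ1, hQ2⟩ := exists_duhamel_operator hd (q := nR d) (by linarith) le_rfl one_le_nR
  obtain ⟨R, hR1, hR2⟩ := exists_duhamel_operator hd (q := d) le_rfl (by linarith) hd1
  obtain ⟨S, r, hr, hS⟩ := exists_smooth_solution (Q 0) hn
  have hbm : Measurable fun y => ‖a y‖ := ha.norm
  have hbf : ∫⁻ x, ‖(fun y => ‖a y‖) x‖ₑ ^ (d : ℝ) ≠ ⊤ := by simpa using haf
  -- choice of the lifespan
  obtain ⟨δ, hδ0, hδ1, A, hA1, hA2, hgood⟩ : ∃ δ : ℝ, 0 < δ ∧ δ ≤ 1 ∧ ∃ A : E d → VecSpace d,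
      (∀ n : ℕ, ContDiff ℝ n A) ∧ (∀ ζ i,
        fn (A ζ i) =ᵐ[stripMeasure d 1] aCut δ (symbol GaussClass.gauss 0 ζ) (fun y => a y i)) ∧
      ∀ᶠ p in 𝓝 (A 0, Q 0), ContDiffAt ℝ n S p ∧ S p = p.1 - p.2 (S p) (S p) ∧ ‖S p‖ < r ∧
        ∀ U, ‖U‖ < 2 * r → U = p.1 - p.2 U U → U = S p := by
    obtain ⟨ρ, hρ, hball⟩ := Metric.eventually_nhds_iff_ball.1 hS.eventually_nhds
    set s := ‖symbol (GaussClass.gauss (d := d)) 0 0‖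
    -- With `s` the norm of the Gaussian symbol, this choice of `ε` gives `2 ε s ≤ ρ / 2`, so the
    -- initial term lies in the ball where the implicit function theorem is available.
    obtain ⟨δ, hδ0, hδ1, hM⟩ := heatCut_small hd hbm hbf (ε := ENNReal.ofReal (ρ / (2 * (s + 1)) / 2))
      (by rw [ENNReal.ofReal_pos]; positivity)
    obtain ⟨A, hA1, hA2, hA3⟩ := exists_initial_operator one_le_nR ha ENNReal.ofReal_lt_top hM
    refine ⟨δ, hδ0, hδ1, A, hA1, hA3, hball _ ?_⟩
    rw [mem_ball_iff_norm, Prod.mk_sub_mk, sub_zero, sub_self, Prod.norm_mk, norm_zero,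
      max_eq_left (norm_nonneg _)]
    refine hA2.trans_lt ?_
    rw [ENNReal.toReal_ofReal (by positivity)]
    have hs : 0 ≤ s := norm_nonneg _
    have : 2 * (ρ / (2 * (s + 1)) / 2) * s = ρ / 2 * (s / (s + 1)) := by field_simp
    rw [this]
    have : s / (s + 1) ≤ 1 := by rw [div_le_one (by positivity)]; linarith
    nlinarith
  obtain ⟨K, hK, hKM⟩ := heatCut_majBound hd (q := d) le_rfl hbm hbf
  obtain ⟨A', hA'1, -, hA'2⟩ := exists_initial_operator hd1 ha hK (hKM δ)
  have hp : ContDiff ℝ n fun ζ => (A ζ, Q ζ) := (hA1 n).prodMk (hQ1 n)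
  have hgoodζ := (hp.continuous.continuousAt (x := (0 : E d))).eventually hgood
  obtain ⟨hc0, hS0, hSr, -⟩ := hgood.self_of_nhds
  set U : VecSpace d := S (A 0, Q 0) with hU
  have hmild : ∀ i, ∀ᵐ z ∂stripMeasure d 1, fn (U i) z =
      aCut δ (symbol GaussClass.gauss 0 0) (fun y => a y i) z - duhamel 0 (fun j => fn (U j)) i z := by
    intro i
    have h : U i = A 0 i - Q 0 U U i := congrFun hS0 i
    rw [show fn (U i) = fn (A 0 i - Q 0 U U i) from congrArg fn h]
    filter_upwards [fn_sub (A 0 i) (Q 0 U U i), hA2 0 i, hQ2 0 U i] with z h1 h2 h3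
    rw [h1, Pi.sub_apply, h2, h3]
  choose V hV1 hV2 using fun ζ i => exists_fn_eq_shear ζ (U i)
  -- The sheared solution solves the equation with shifted kernels and has norm less than `2 r`, so
  -- local uniqueness identifies it with the smooth branch.
  have hVS : ∀ᶠ ζ in 𝓝 (0 : E d), V ζ = S (A ζ, Q ζ) := by
    filter_upwards [hgoodζ] with ζ hζ
    refine hζ.2.2.2 (V ζ) ?_ ?_
    · refine lt_of_le_of_lt ((pi_norm_le_iff_of_nonneg (by positivity)).2 fun i => ?_)
        (mul_lt_mul_of_pos_left hSr two_pos)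
      exact (hV2 ζ i).trans (by gcongr; exact norm_le_pi_norm U i)
    · funext i
      refine ext_ae ?_
      filter_upwards [hV1 ζ i, fn_sub (A ζ i) (Q ζ (V ζ) (V ζ) i), hA2 ζ i, hQ2 ζ (V ζ) i,
        ae_comp_shear (ζ := ζ) (hmild i), ae_restrict_mem measurableSet_strip] with z h1 h2 h3 h4 h5 hz
      rw [h1, Function.comp_apply, h5]
      change _ = fn (A ζ i - Q ζ (V ζ) (V ζ) i) z
      rw [h2, Pi.sub_apply, h3, h4, duhamel_shear, duhamel_congr (hV1 ζ) i hz.1.2.le]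
      congr 1
      rw [aCut, aCut, aOp_shear GaussClass.gauss ζ _ hz.1.1, shear_apply]
  -- Bootstrap: `Y` is the right-hand side of the equation, evaluated at the smooth branch in the
  -- better space.
  refine ⟨δ, hδ0, hδ1, U, fun ζ => A' ζ - R ζ (S (A ζ, Q ζ)) (S (A ζ, Q ζ)), ?_, ?_, hmild⟩
  · have hSc : ContDiffAt ℝ n (fun ζ => S (A ζ, Q ζ)) 0 := hc0.comp (0 : E d) hp.contDiffAt
    exact (hA'1 n).contDiffAt.sub (((hR1 n).contDiffAt.clm_apply hSc).clm_apply hSc)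
  · filter_upwards [hVS, hgoodζ] with ζ hζ hg
    intro i
    rw [← hζ]
    have h : V ζ i = A ζ i - Q ζ (V ζ) (V ζ) i := by
      have := congrFun hg.2.1 i
      rwa [← hζ] at this
    refine Filter.EventuallyEq.trans ?_ (hV1 ζ i)
    rw [show fn (V ζ i) = fn (A ζ i - Q ζ (V ζ) (V ζ) i) from congrArg fn h]
    filter_upwards [fn_sub (A ζ i) (Q ζ (V ζ) (V ζ) i), hA2 ζ i, hQ2 ζ (V ζ) i,
      fn_sub (A' ζ i) (R ζ (V ζ) (V ζ) i), hA'2 ζ i, hR2 ζ (V ζ) i] with z h1 h2 h3 h4 h5 h6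
    change fn (A' ζ i - R ζ (V ζ) (V ζ) i) z = _
    rw [h4, h1, Pi.sub_apply, Pi.sub_apply, h5, h6, h2, h3]

end

/-! ### Test functions and pairings with parabolic translates. -/

section

variable {d : ℕ}

open DecaySpace Topology

namespace IsTest

variable {X F : Type*} [NormedAddCommGroup X] [NormedSpace ℝ X] [NormedAddCommGroup F] [NormedSpace ℝ F]
  {Ω : Set X}

theorem mono {Ω' : Set X} {φ : X → F} (h : IsTest Ω φ) (hΩ : Ω ⊆ Ω') : IsTest Ω' φ :=
  ⟨h.smooth, h.compact, h.supp.trans hΩ⟩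

theorem fderiv_apply {φ : X → F} (h : IsTest Ω φ) (w : X) : IsTest Ω fun z => fderiv ℝ φ z w :=
  ⟨(h.smooth.fderiv_right (m := ∞) (by simp)).clm_apply contDiff_const, h.compact.fderiv_apply ℝ w,
    (tsupport_fderiv_apply_subset ℝ w).trans h.supp⟩

theorem add {φ ψ : X → F} (h : IsTest Ω φ) (h' : IsTest Ω ψ) : IsTest Ω fun z => φ z + ψ z :=
  ⟨h.smooth.add h'.smooth, h.compact.add h'.compact,
    (tsupport_add φ ψ).trans (union_subset h.supp h'.supp)⟩

theorem zero : IsTest Ω fun _ : X => (0 : F) :=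
  ⟨contDiff_const, HasCompactSupport.zero, by
    have : tsupport (fun _ : X => (0 : F)) = ∅ := by simp
    simp [this]⟩

theorem sum {ι : Type*} (s : Finset ι) {φ : ι → X → F} (h : ∀ i, IsTest Ω (φ i)) :
    IsTest Ω fun z => ∑ i ∈ s, φ i z := by
  classical
  induction s using Finset.induction_on with
  | empty => simpa using zero
  | insert i s hi ih => simpa [Finset.sum_insert hi] using (h i).add ih

/-- Smoothness of `g` is required only on `Ω`, since the product vanishes near every point outside.
This permits multiplication by powers of `√t`. -/
theorem mul_left {φ : X → ℝ} (h : IsTest Ω φ) (hΩ : IsOpen Ω) {g : X → ℝ} (hg : ContDiffOn ℝ ∞ g Ω) :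
    IsTest Ω fun z => g z * φ z := by
  refine ⟨contDiff_iff_contDiffAt.2 fun z => ?_, h.compact.mul_left, (tsupport_mul_subset_right).trans h.supp⟩
  by_cases hz : z ∈ Ω
  · exact (hg.contDiffAt (hΩ.mem_nhds hz)).mul h.smooth.contDiffAt
  · have : φ =ᶠ[𝓝 z] 0 := notMem_tsupport_iff_eventuallyEq.1 fun hz' => hz (h.supp hz')
    refine (contDiffAt_const (c := (0 : ℝ))).congr_of_eventuallyEq ?_
    filter_upwards [this] with w hw
    simp [hw]

theorem eq_zero {φ : X → F} (h : IsTest Ω φ) {z : X} (hz : z ∉ Ω) : φ z = 0 :=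
  image_eq_zero_of_notMem_tsupport fun hz' => hz (h.supp hz')

theorem bounded {φ : X → F} (h : IsTest Ω φ) : ∃ C, ∀ z, ‖φ z‖ ≤ C :=
  h.compact.exists_bound_of_continuous h.smooth.continuous

variable {φ : ℝ × E d → ℝ} {Ω : Set (ℝ × E d)}

theorem dx (h : IsTest Ω φ) (j : Fin d) : IsTest Ω (dx j φ) := h.fderiv_apply _

theorem dt (h : IsTest Ω φ) : IsTest Ω (dt φ) := h.fderiv_apply _

theorem lap (h : IsTest Ω φ) : IsTest Ω (lap φ) := IsTest.sum _ fun j => (h.dx j).dx j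

end IsTest

theorem isOpen_strip {T : ℝ} : IsOpen (strip d T) := isOpen_Ioo.prod isOpen_univ

theorem dxIter_zero (α : Fin 0 → Fin d) (φ : ℝ × E d → ℝ) : dxIter α φ = φ := by
  funext z; simp [dxIter]

theorem dxIter_succ {k : ℕ} (α : Fin (k + 1) → Fin d) {φ : ℝ × E d → ℝ} (h : ContDiff ℝ ∞ φ) :
    dxIter α φ = dx (α 0) (dxIter (Fin.tail α) φ) := by
  funext z
  unfold dxIter dx
  rw [DifferentiableAt.iteratedFDeriv_succ_apply_left']
  · rfl
  · exact (h.differentiable_iteratedFDeriv (m := k) (by exact_mod_cast ENat.natCast_lt_top k)) z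

theorem IsTest.dxIter {Ω : Set (ℝ × E d)} {φ : ℝ × E d → ℝ} (h : IsTest Ω φ) {k : ℕ} (α : Fin k → Fin d) :
    IsTest Ω (dxIter α φ) := by
  induction k with
  | zero => rwa [dxIter_zero]
  | succ k ih => rw [dxIter_succ α h.smooth]; exact (ih _).dx _

theorem dx_mul_time {T : ℝ} {φ : ℝ × E d → ℝ} (h : IsTest (strip d T) φ) {g : ℝ → ℝ}
    (hg : ContDiffOn ℝ ∞ g (Ioi 0)) (j : Fin d) :
    dx j (fun z => g z.1 * φ z) = fun z => g z.1 * dx j φ z := by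
  have hg' : ContDiffOn ℝ ∞ (fun z : ℝ × E d => g z.1) (strip d T) :=
    hg.comp contDiff_fst.contDiffOn fun z hz => hz.1.1
  have h1 := h.mul_left isOpen_strip hg'
  funext z
  have e1 := ((h1.smooth.differentiable (by simp)) z).lineDeriv_eq_fderiv (v := dir j)
  have e2 := ((h.smooth.differentiable (by simp)) z).lineDeriv_eq_fderiv (v := dir j)
  unfold dx
  rw [← e1, ← e2, lineDeriv, lineDeriv, ← deriv_const_mul_field]
  congr 1
  funext s
  simp [dir]

theorem IsTest.mul_time {T : ℝ} {φ : ℝ × E d → ℝ} (h : IsTest (strip d T) φ) {g : ℝ → ℝ}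
    (hg : ContDiffOn ℝ ∞ g (Ioi 0)) : IsTest (strip d T) fun z => g z.1 * φ z :=
  h.mul_left isOpen_strip (hg.comp contDiff_fst.contDiffOn fun _ hz => hz.1.1)

theorem dxIter_mul_time {T : ℝ} {φ : ℝ × E d → ℝ} (h : IsTest (strip d T) φ) {g : ℝ → ℝ}
    (hg : ContDiffOn ℝ ∞ g (Ioi 0)) {k : ℕ} (α : Fin k → Fin d) :
    dxIter α (fun z => g z.1 * φ z) = fun z => g z.1 * dxIter α φ z := by
  induction k with
  | zero => simp [dxIter_zero]
  | succ k ih =>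
    rw [dxIter_succ α (h.mul_time hg).smooth, ih, dx_mul_time (h.dxIter _) hg, dxIter_succ α h.smooth]

theorem contDiffOn_sqrt_pow (k : ℕ) : ContDiffOn ℝ ∞ (fun t : ℝ => √t ^ k) (Ioi 0) := by
  refine ContDiffOn.pow ?_ k
  exact contDiffOn_id.sqrt fun _ hx => (ne_of_gt hx)

theorem contDiffOn_sqrt_pow_inv (k : ℕ) : ContDiffOn ℝ ∞ (fun t : ℝ => (√t ^ k)⁻¹) (Ioi 0) :=
  (contDiffOn_sqrt_pow k).inv fun _ hx => pow_ne_zero _ (Real.sqrt_pos.2 hx).ne'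

/-- The pairing of `v` with the parabolic translates of `φ`. -/
def shiftPairing (T : ℝ) (v φ : ℝ × E d → ℝ) (ζ : E d) : ℝ :=
  ∫ z in strip d T, v z * φ (z.1, z.2 - √z.1 • ζ)

theorem shiftPairing_eq (T : ℝ) (v φ : ℝ × E d → ℝ) (ζ : E d) :
    shiftPairing T v φ ζ = ∫ z in strip d T, v (shear ζ z) * φ z := by
  rw [shiftPairing, ← (shear_measurePreserving_strip ζ T).integral_comp']
  refine integral_congr_ae (Filter.Eventually.of_forall fun z => ?_)
  simp [shear_apply]

/-- A closed slab of space-time. -/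
def box (d : ℕ) (T R : ℝ) : Set (ℝ × E d) := Icc 0 T ×ˢ Metric.closedBall 0 R

theorem measurableSet_box {T R : ℝ} : MeasurableSet (box d T R) :=
  measurableSet_Icc.prod measurableSet_closedBall

theorem box_lt_top {T R : ℝ} : (volume : Measure (ℝ × E d)) (box d T R) < ⊤ :=
  (isCompact_Icc.prod (isCompact_closedBall _ _)).measure_lt_top

theorem integrable_indicator_box {T R : ℝ} {p : ℝ≥0∞} (hp : 1 ≤ p) {v : ℝ × E d → ℝ}
    (hv : MemLp v p (stripMeasure d T)) :
    Integrable ((box d T R).indicator v) (stripMeasure d T) := by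
  rw [integrable_indicator_iff measurableSet_box, IntegrableOn]
  have : IsFiniteMeasure ((stripMeasure d T).restrict (box d T R)) := ⟨by
    rw [Measure.restrict_apply_univ]
    exact (Measure.restrict_apply_le _ _).trans_lt box_lt_top⟩
  exact (hv.mono_measure Measure.restrict_le_self).integrable hp

theorem IsTest.exists_radius {Ω : Set (ℝ × E d)} {φ : ℝ × E d → ℝ} (h : IsTest Ω φ) :
    ∃ R : ℝ, 0 ≤ R ∧ ∀ z, φ z ≠ 0 → ‖z.2‖ ≤ R := by
  obtain ⟨R, hR⟩ := h.compact.isCompact.isBounded.exists_norm_le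
  refine ⟨max R 0, le_max_right _ _, fun z hz => ?_⟩
  exact ((norm_snd_le z).trans (hR z (subset_tsupport _ hz))).trans (le_max_left _ _)

/-- The shift sits on the test function, so nothing is asked of `v` beyond integrability. For shifts
in a bounded set the displaced supports stay in one slab, where `v` is integrable, and this
dominates the difference quotients. -/
theorem hasDerivAt_shiftPairing {T : ℝ} {v φ : ℝ × E d → ℝ} (hv : MemLp v (nE d) (stripMeasure d T))
    (h : IsTest (strip d T) φ) (ζ : E d) (j : Fin d) :
    HasDerivAt (fun s : ℝ => shiftPairing T v φ (ζ + s • EuclideanSpace.single j 1))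
      (-shiftPairing T v (fun z => √z.1 * dx j φ z) ζ) 0 := by
  obtain ⟨R, hR0, hR⟩ := (h.dx j).exists_radius
  obtain ⟨R1, hR10, hR1⟩ := h.exists_radius
  obtain ⟨C, hC⟩ := (h.dx j).bounded
  obtain ⟨C1, hC1⟩ := h.bounded
  have hC10 : 0 ≤ C1 := (norm_nonneg _).trans (hC1 0)
  have hC0 : 0 ≤ C := (norm_nonneg _).trans (hC 0)
  have hmap : ∀ ξ : E d, Continuous fun z : ℝ × E d => (z.1, z.2 - √z.1 • ξ) := fun ξ => by fun_prop
  have hmeas : ∀ ξ : E d, AEStronglyMeasurable (fun z : ℝ × E d => v z * φ (z.1, z.2 - √z.1 • ξ)) (stripMeasure d T) :=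
    fun ξ => hv.1.mul (h.smooth.continuous.comp (hmap ξ)).aestronglyMeasurable
  have hbox : ∀ ξ : E d, ∀ z ∈ strip d T, ∀ R : ℝ, ‖z.2 - √z.1 • ξ‖ ≤ R → z ∈ box d T (R + √T * ‖ξ‖) := by
    intro ξ z hz R hzR
    refine ⟨⟨hz.1.1.le, hz.1.2.le⟩, ?_⟩
    rw [mem_closedBall_zero_iff]
    calc ‖z.2‖ = ‖(z.2 - √z.1 • ξ) + √z.1 • ξ‖ := by simp
      _ ≤ ‖z.2 - √z.1 • ξ‖ + ‖√z.1 • ξ‖ := norm_add_le _ _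
      _ ≤ _ := by
        rw [norm_smul, Real.norm_of_nonneg (Real.sqrt_nonneg _)]
        gcongr
        exact hz.1.2.le
  have hint : ∀ R : ℝ, Integrable (fun z => ‖(box d T R).indicator v z‖) (stripMeasure d T) := fun R =>
    (integrable_indicator_box (R := R) (p := nE d) Fact.out hv).norm
  have key := hasDerivAt_integral_of_dominated_loc_of_deriv_le (μ := stripMeasure d T)
    (F := fun (s : ℝ) (z : ℝ × E d) => v z * φ (z.1, z.2 - √z.1 • (ζ + s • EuclideanSpace.single j 1)))
    (F' := fun (s : ℝ) (z : ℝ × E d) => v z * -(√z.1 * dx j φ (z.1, z.2 - √z.1 • (ζ + s • EuclideanSpace.single j 1))))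
    (x₀ := 0) (s := Metric.ball 0 1)
    (bound := fun z => (√T * C) * ‖(box d T (R + √T * (‖ζ‖ + 1))).indicator v z‖)
    (Metric.ball_mem_nhds _ one_pos) (Filter.Eventually.of_forall fun s => hmeas _) ?_ ?_ ?_ ?_ ?_
  · have h2 := key.2
    refine h2.congr_deriv ?_
    rw [shiftPairing, ← integral_neg]
    refine integral_congr_ae (Filter.Eventually.of_forall fun z => ?_)
    simp
  · have hm0 : AEStronglyMeasurable (fun z : ℝ × E d => v z * φ (z.1, z.2 - √z.1 • (ζ + (0 : ℝ) • EuclideanSpace.single j 1)))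
        (stripMeasure d T) := hmeas _
    refine Integrable.mono' ((hint (R1 + √T * ‖ζ‖)).const_mul C1) hm0 ?_
    filter_upwards [ae_restrict_mem measurableSet_strip] with z hz
    simp only [zero_smul, add_zero]
    by_cases h0 : φ (z.1, z.2 - √z.1 • ζ) = 0
    · rw [h0, mul_zero, norm_zero]
      exact mul_nonneg hC10 (norm_nonneg _)
    · rw [indicator_of_mem (hbox ζ z hz R1 (hR1 (z.1, z.2 - √z.1 • ζ) h0)), norm_mul, mul_comm]
      exact mul_le_mul_of_nonneg_right (hC1 _) (norm_nonneg _)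
  · refine hv.1.mul (Continuous.aestronglyMeasurable ?_)
    exact ((Real.continuous_sqrt.comp continuous_fst).mul ((h.dx j).smooth.continuous.comp (hmap _))).neg
  · filter_upwards [ae_restrict_mem measurableSet_strip] with z hz
    intro s hs
    set ξ := ζ + s • EuclideanSpace.single j (1 : ℝ) with hξ
    have hs' : |s| < 1 := by simpa using hs
    have hξn : ‖ξ‖ ≤ ‖ζ‖ + 1 := by
      refine (norm_add_le _ _).trans ?_
      rw [norm_smul]
      simp
      linarith
    by_cases h0 : dx j φ (z.1, z.2 - √z.1 • ξ) = 0
    · rw [h0, mul_zero, neg_zero, mul_zero, norm_zero]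
      positivity
    · have hb := hbox ξ z hz R (hR (z.1, z.2 - √z.1 • ξ) h0)
      have hb' : z ∈ box d T (R + √T * (‖ζ‖ + 1)) :=
        ⟨hb.1, Metric.closedBall_subset_closedBall (by gcongr) hb.2⟩
      rw [indicator_of_mem hb', norm_mul, norm_neg, norm_mul, mul_comm]
      gcongr
      · rw [Real.norm_of_nonneg (Real.sqrt_nonneg _)]
        exact Real.sqrt_le_sqrt hz.1.2.le
      · exact hC _
  · exact (hint _).const_mul _
  · refine Filter.Eventually.of_forall fun z s _ => ?_
    have hc : HasDerivAt (fun s : ℝ => ((z.1, z.2 - √z.1 • (ζ + s • EuclideanSpace.single j 1)) : ℝ × E d))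
        (-√z.1 • dir j) s := by
      have h1 : HasDerivAt (fun s : ℝ => s • EuclideanSpace.single j (1 : ℝ)) ((1 : ℝ) • EuclideanSpace.single j (1 : ℝ)) s :=
        (hasDerivAt_id s).smul_const _
      have h2 := ((h1.const_add ζ).const_smul (√z.1)).const_sub z.2
      refine ((hasDerivAt_const s z.1).prodMk h2).congr_deriv ?_
      simp [dir]
    have h3 := (h.smooth.differentiable (by simp) _).hasFDerivAt.comp_hasDerivAt s hc
    refine (h3.const_mul (v z)).congr_deriv ?_
    rw [map_smul, smul_eq_mul, neg_mul]
    rfl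

end

/-! ### From smooth dependence on shifts to weak derivatives and mixed norms. -/

section

variable {d : ℕ}

open DecaySpace Topology

section

variable {σ q : ℝ} {hq : 1 ≤ q}

theorem DecaySpace.memLp_fn (w : DecaySpace d σ q hq) : MemLp (fn w) (nE d) (stripMeasure d 1) :=
  Lp.memLp _

theorem DecaySpace.exists_pairing {φ : ℝ × E d → ℝ} (hφ : IsTest (strip d 1) φ) :
    ∃ L : DecaySpace d σ q hq →L[ℝ] ℝ, ∀ w, L w = ∫ z in strip d 1, fn w z * φ z := by
  have : Fact (1 ≤ ENNReal.conjExponent (nE d)) := ⟨by rw [ENNReal.conjExponent]; exact le_self_add⟩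
  have hm : MemLp φ (ENNReal.conjExponent (nE d)) (stripMeasure d 1) :=
    hφ.smooth.continuous.memLp_of_hasCompactSupport hφ.compact
  refine ⟨((ContinuousLinearMap.mul ℝ ℝ).lpPairing (stripMeasure d 1) (nE d) (ENNReal.conjExponent (nE d))).flip
    (hm.toLp φ) ∘L (decaySeminorm d σ q hq).incl, fun w => ?_⟩
  rw [ContinuousLinearMap.comp_apply, ContinuousLinearMap.flip_apply, ContinuousLinearMap.lpPairing_eq_integral]
  refine integral_congr_ae ?_
  filter_upwards [hm.coeFn_toLp] with z hz
  rw [hz]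
  rfl

end

theorem shiftPairing_congr (T : ℝ) (v : ℝ × E d → ℝ) {φ ψ : ℝ × E d → ℝ}
    (h : ∀ z : ℝ × E d, 0 < z.1 → φ z = ψ z) (ζ : E d) : shiftPairing T v φ ζ = shiftPairing T v ψ ζ :=
  setIntegral_congr_fun measurableSet_strip fun z hz => by
    exact congrArg (v z * ·) (h _ hz.1.1)

/-- Each derivative in `ζ` brings out `-√t ∂_j`, and `√t` commutes with spatial derivatives, so the
formula iterates. Fréchet smoothness is an assumption because `hasDerivAt_shiftPairing` only gives
directional derivatives. -/
theorem iteratedFDeriv_shiftPairing {v : ℝ × E d → ℝ} (hv : MemLp v (nE d) (stripMeasure d 1)) {n : ℕ}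
    (hsm : ∀ φ, IsTest (strip d 1) φ → ContDiffAt ℝ n (shiftPairing 1 v φ) 0) {k : ℕ} (hk : k ≤ n)
    (α : Fin k → Fin d) {φ : ℝ × E d → ℝ} (hφ : IsTest (strip d 1) φ) :
    ∀ᶠ ζ in 𝓝 0, iteratedFDeriv ℝ k (shiftPairing 1 v φ) ζ (fun l => EuclideanSpace.single (α l) 1) =
      (-1) ^ k * shiftPairing 1 v (fun z => √z.1 ^ k * dxIter α φ z) ζ := by
  induction k with
  | zero => exact Filter.Eventually.of_forall fun ζ => by simp [dxIter_zero]
  | succ k ih =>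
    have hk' : k < n := by omega
    have hc : ∀ᶠ ζ in 𝓝 (0 : E d), ContDiffAt ℝ n (shiftPairing 1 v φ) ζ := (hsm φ hφ).eventually (by simp)
    filter_upwards [(ih hk'.le (Fin.tail α)).eventually_nhds, hc] with ζ hζ hcζ
    have hdiff : DifferentiableAt ℝ (iteratedFDeriv ℝ k (shiftPairing 1 v φ)) ζ :=
      hcζ.differentiableAt_iteratedFDeriv (by exact_mod_cast hk')
    rw [hdiff.iteratedFDeriv_succ_apply_left']
    set ψ : ℝ × E d → ℝ := fun z => √z.1 ^ k * dxIter (Fin.tail α) φ z with hψ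
    have hψt : IsTest (strip d 1) ψ := (hφ.dxIter _).mul_time (contDiffOn_sqrt_pow k)
    set f : E d → ℝ := fun y => iteratedFDeriv ℝ k (shiftPairing 1 v φ) y
      (Fin.tail fun l => EuclideanSpace.single (α l) 1) with hf
    have hf1 : DifferentiableAt ℝ f ζ := by
      exact ((ContinuousMultilinearMap.apply ℝ (fun _ : Fin k => E d) ℝ
        (Fin.tail fun l => EuclideanSpace.single (α l) 1)).differentiableAt).comp ζ hdiff
    have hline : HasDerivAt (fun s : ℝ => f (ζ + s • EuclideanSpace.single (α 0) 1))
        (fderiv ℝ f ζ (EuclideanSpace.single (α 0) 1)) 0 := by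
      have h1 : HasFDerivAt f (fderiv ℝ f ζ) (ζ + (0 : ℝ) • EuclideanSpace.single (α 0) 1) := by
        simpa using hf1.hasFDerivAt
      have h2 : HasDerivAt (fun s : ℝ => ζ + s • EuclideanSpace.single (α 0) (1 : ℝ))
          (EuclideanSpace.single (α 0) 1) 0 := by
        simpa using ((hasDerivAt_id (0 : ℝ)).smul_const (EuclideanSpace.single (α 0) (1 : ℝ))).const_add ζ
      exact h1.comp_hasDerivAt 0 h2
    have hline2 : HasDerivAt (fun s : ℝ => f (ζ + s • EuclideanSpace.single (α 0) 1))
        ((-1) ^ k * -shiftPairing 1 v (fun z => √z.1 * dx (α 0) ψ z) ζ) 0 := by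
      refine ((hasDerivAt_shiftPairing hv hψt ζ (α 0)).const_mul ((-1) ^ k)).congr_of_eventuallyEq ?_
      have : ContinuousAt (fun s : ℝ => ζ + s • EuclideanSpace.single (α 0) (1 : ℝ)) 0 := by fun_prop
      have ht : Filter.Tendsto (fun s : ℝ => ζ + s • EuclideanSpace.single (α 0) (1 : ℝ)) (𝓝 0) (𝓝 ζ) := by
        simpa [ContinuousAt] using this
      exact ht.eventually hζ
    rw [hline.unique hline2, pow_succ, mul_neg, mul_neg_one, neg_mul]
    congr 2
    refine shiftPairing_congr 1 v (fun z hz => ?_) ζ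
    rw [hψ, dx_mul_time (hφ.dxIter _) (contDiffOn_sqrt_pow k), dxIter_succ α hφ.smooth]
    simp only
    ring

/-- Smooth dependence on parabolic translations yields weak derivatives. -/
theorem weak_derivative_of_smooth_shift {q σ : ℝ} {hq : 1 ≤ q} {n : ℕ} {v : ℝ × E d → ℝ}
    (hv : MemLp v (nE d) (stripMeasure d 1)) {Y : E d → DecaySpace d σ q hq}
    (hY : ContDiffAt ℝ n Y 0)
    (hYv : ∀ᶠ ζ in 𝓝 0, fn (Y ζ) =ᵐ[stripMeasure d 1] v ∘ shear ζ) {k : ℕ} (hk : k ≤ n)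
    (α : Fin k → Fin d) {φ : ℝ × E d → ℝ} (hφ : IsTest (strip d 1) φ) :
    ∫ z in strip d 1, v z * dxIter α φ z = (-1) ^ k *
      ∫ z in strip d 1, (√z.1 ^ k)⁻¹ * fn (iteratedFDeriv ℝ k Y 0 fun l => EuclideanSpace.single (α l) 1) z * φ z := by
  have heq : ∀ {φ}, ∀ L : DecaySpace d σ q hq →L[ℝ] ℝ, (∀ w, L w = ∫ z in strip d 1, fn w z * φ z) →
      shiftPairing 1 v φ =ᶠ[𝓝 0] L ∘ Y := by
    intro φ L hL
    filter_upwards [hYv] with ζ hζ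
    rw [Function.comp_apply, hL, shiftPairing_eq]
    refine integral_congr_ae ?_
    filter_upwards [hζ] with z hz
    rw [hz]; rfl
  have hsm : ∀ φ, IsTest (strip d 1) φ → ContDiffAt ℝ n (shiftPairing 1 v φ) 0 := by
    intro φ hφ
    obtain ⟨L, hL⟩ := exists_pairing (σ := σ) (q := q) (hq := hq) hφ
    exact (L.contDiff.contDiffAt.comp (0 : E d) hY).congr_of_eventuallyEq (heq L hL)
  -- Testing with `t^{-k/2} φ` cancels the factor `t^{k/2}`; it is admissible because `φ` is
  -- supported in positive times.
  set φ' : ℝ × E d → ℝ := fun z => (√z.1 ^ k)⁻¹ * φ z with hφ'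
  have hφ't : IsTest (strip d 1) φ' := hφ.mul_time (contDiffOn_sqrt_pow_inv k)
  obtain ⟨L, hL⟩ := exists_pairing (σ := σ) (q := q) (hq := hq) hφ't
  have h1 := (iteratedFDeriv_shiftPairing hv hsm hk α hφ't).self_of_nhds
  rw [((heq L hL).iteratedFDeriv ℝ k).self_of_nhds, L.iteratedFDeriv_comp_left hY (by exact_mod_cast hk),
    ContinuousLinearMap.compContinuousMultilinearMap_coe, Function.comp_apply, hL] at h1
  have h2 : shiftPairing 1 v (fun z => √z.1 ^ k * dxIter α φ' z) 0 = ∫ z in strip d 1, v z * dxIter α φ z := by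
    rw [shiftPairing]
    refine setIntegral_congr_fun measurableSet_strip fun z hz => ?_
    have : √z.1 ^ k ≠ 0 := pow_ne_zero _ (Real.sqrt_pos.2 hz.1.1).ne'
    simp only [smul_zero, sub_zero]
    rw [hφ', dxIter_mul_time hφ (contDiffOn_sqrt_pow_inv k), mul_inv_cancel_left₀ this]
  rw [h2] at h1
  have h3 : ∫ z in strip d 1, (√z.1 ^ k)⁻¹ *
      fn (iteratedFDeriv ℝ k Y 0 fun l => EuclideanSpace.single (α l) 1) z * φ z =
      ∫ z in strip d 1, fn (iteratedFDeriv ℝ k Y 0 fun l => EuclideanSpace.single (α l) 1) z * φ' z :=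
    integral_congr_ae (Filter.Eventually.of_forall fun z => by simp only [hφ']; ring)
  rw [h3, h1, ← mul_assoc, ← pow_add, Even.neg_one_pow ⟨k, rfl⟩, one_mul]

/-- Interpolation of mixed norms between `L^∞_t L^d_x` and `L^{d+2}_{t,x}`. -/
theorem mixedNorm_lt_top {F : Type*} [NormedAddCommGroup F] {f : ℝ × E d → F} {δ : ℝ} (hd : 1 ≤ d)
    (hf : MemLp f (nE d) (stripMeasure d δ)) {K : ℝ≥0∞} (hK : K < ⊤)
    (hs : ∀ᵐ t ∂volume.restrict (Ioo 0 δ), eLpNorm (fun x => f (t, x)) d volume ≤ K)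
    {p q : ℝ≥0∞} (hp : (d : ℝ≥0∞) + 2 ≤ p) (hq : q ∈ Icc (d : ℝ≥0∞) ((d : ℝ≥0∞) + 2))
    (hpq : 2 / p + (d : ℝ≥0∞) / q = 1) : mixedNorm q p δ f < ⊤ := by
  have hd0 : (d : ℝ≥0∞) ≠ 0 := by simp; omega
  have hq0 : q ≠ 0 := fun h => hd0 (le_antisymm (h ▸ hq.1) bot_le)
  have hqt : q ≠ ⊤ := fun h => by
    have := hq.2; rw [h] at this; simp at this
  have hdR : (1 : ℝ) ≤ d := by exact_mod_cast hd
  rw [mixedNorm]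
  by_cases hpt : p = ⊤
  · rw [hpt] at hpq ⊢
    have : q = d := by
      rw [ENNReal.div_top, zero_add, ENNReal.div_eq_one_iff hq0 hqt] at hpq
      exact hpq.symm
    rw [this, eLpNorm_exponent_top]
    refine lt_of_le_of_lt (essSup_le_of_ae_le K ?_) hK
    filter_upwards [hs] with t ht
    simpa using ht
  · have hp0 : p ≠ 0 := fun h => by rw [h] at hp; simp at hp
    set P := p.toReal with hP
    set Q := q.toReal with hQ
    have hP0 : 0 < P := ENNReal.toReal_pos hp0 hpt
    have hQ0 : 0 < Q := ENNReal.toReal_pos hq0 hqt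
    have hPN : (d : ℝ) + 2 ≤ P := by
      have := ENNReal.toReal_mono hpt hp
      rwa [nE_toReal] at this
    have hPQ : 2 / P + d / Q = 1 := by
      have := congrArg ENNReal.toReal hpq
      rw [ENNReal.toReal_add, ENNReal.toReal_div, ENNReal.toReal_div] at this
      · simpa using this
      · exact (ENNReal.div_lt_top (by simp) hp0).ne
      · exact (ENNReal.div_lt_top (by simp) hq0).ne
    have hrel : 2 * Q + d * P = P * Q := by field_simp at hPQ; linarith
    have hmeas := aestronglyMeasurable_slice hf.1
    have hN : ∫⁻ t in Ioo 0 δ, ∫⁻ x, ‖f (t, x)‖ₑ ^ nR d < ⊤ := by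
      have h1 := (lintegral_rpow_enorm_lt_top_of_eLpNorm_lt_top nE_ne_zero nE_ne_top hf.2)
      rw [nE_toReal, stripMeasure_eq, lintegral_prod] at h1
      · exact h1
      · rw [← stripMeasure_eq]
        exact hf.1.enorm.pow_const _
    rw [eLpNorm_eq_lintegral_rpow_enorm_toReal hp0 hpt]
    refine ENNReal.rpow_lt_top_of_nonneg (by positivity) (ne_of_lt ?_)
    -- Hölder in `x` between `L^d` and `L^{d+2}` with weights `1 - Q/P` and `Q/P`. The relation `2/P
    -- + d/Q = 1` gives `d(1 - Q/P) + (d+2)Q/P = Q`, and the `P`-th power of the slice norm becomes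
    -- linear in `∫ |f|^{d+2} dx`, hence integrable in time.
    set lam : ℝ := 1 - Q / P with hlam
    have hPd : 0 < P - 2 := by linarith
    have hQv : Q * (P - 2) = d * P := by linarith
    have hlam0 : 0 ≤ lam := by
      have : Q / P ≤ 1 := by
        rw [div_le_one hP0]
        nlinarith
      linarith
    have hmix : (d : ℝ) * lam + nR d * (Q / P) = Q := by
      simp only [hlam, nR]; field_simp; linarith
    refine lt_of_le_of_lt (b := ∫⁻ t in Ioo 0 δ, (K ^ ((d : ℝ) * lam * (P / Q))) *
      ∫⁻ x, ‖f (t, x)‖ₑ ^ nR d) (lintegral_mono_ae ?_) ?_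
    · filter_upwards [hs, hmeas] with t ht hm
      rw [eLpNorm_eq_lintegral_rpow_enorm_toReal hd0 (by simp)] at ht
      rw [eLpNorm_eq_lintegral_rpow_enorm_toReal hq0 hqt, enorm_eq_self, ← hP, ← hQ, ← ENNReal.rpow_mul]
      simp only [ENNReal.toReal_natCast] at ht
      have h2 : ∫⁻ x, ‖f (t, x)‖ₑ ^ (d : ℝ) ≤ K ^ (d : ℝ) := by
        rw [one_div, ENNReal.rpow_inv_le_iff (by linarith)] at ht
        exact ht
      have h3 := ENNReal.lintegral_mul_norm_pow_le (μ := (volume : Measure (E d)))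
        (f := fun x => ‖f (t, x)‖ₑ ^ (d : ℝ)) (g := fun x => ‖f (t, x)‖ₑ ^ nR d)
        (hm.enorm.pow_const _) (hm.enorm.pow_const _) hlam0 (by positivity : 0 ≤ Q / P) (by rw [hlam]; ring)
      have h4 : ∀ x, (‖f (t, x)‖ₑ ^ (d : ℝ)) ^ lam * (‖f (t, x)‖ₑ ^ nR d) ^ (Q / P) = ‖f (t, x)‖ₑ ^ Q := fun x => by
        rw [← ENNReal.rpow_mul, ← ENNReal.rpow_mul, ← ENNReal.rpow_add_of_nonneg _ _ (by positivity) (by positivity),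
          hmix]
      simp only [h4] at h3
      calc (∫⁻ x, ‖f (t, x)‖ₑ ^ Q) ^ (1 / Q * P) ≤
            ((K ^ (d : ℝ)) ^ lam * (∫⁻ x, ‖f (t, x)‖ₑ ^ nR d) ^ (Q / P)) ^ (1 / Q * P) := by
              gcongr
              exact h3.trans (by gcongr)
        _ = _ := by
          rw [ENNReal.mul_rpow_of_nonneg _ _ (by positivity), ← ENNReal.rpow_mul, ← ENNReal.rpow_mul,
            ← ENNReal.rpow_mul]
          congr 1
          · congr 1; ring
          · rw [show Q / P * (1 / Q * P) = 1 by field_simp, ENNReal.rpow_one]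
    · rw [lintegral_const_mul' _ _ (ENNReal.rpow_ne_top_of_nonneg (by positivity) hK.ne)]
      exact ENNReal.mul_lt_top (ENNReal.rpow_lt_top_of_nonneg (by positivity) hK.ne) hN

end

/-! ### Assembling the derivative tensors. -/

section

variable {d : ℕ}

open DecaySpace Topology

theorem setIntegral_strip_eq {δ T : ℝ} (h : δ ≤ T) {f : ℝ × E d → ℝ} (hf : ∀ z ∉ strip d δ, f z = 0) :
    ∫ z in strip d δ, f z = ∫ z in strip d T, f z :=
  (setIntegral_eq_of_subset_of_forall_sdiff_eq_zero measurableSet_strip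
    (prod_mono (Ioo_subset_Ioo_right h) Subset.rfl) fun z hz => hf z hz.2).symm

theorem stripMeasure_mono {δ T : ℝ} (h : δ ≤ T) : stripMeasure d δ ≤ stripMeasure d T :=
  Measure.restrict_mono (prod_mono (Ioo_subset_Ioo_right h) Subset.rfl) le_rfl

/-- The derivative tensor assembled from scalar components. -/
def assemble {k : ℕ} (D : (Fin k → Fin d) × Fin d → ℝ × E d → ℝ) (z : ℝ × E d) : Tensor d k :=
  ∑ β, D β z • EuclideanSpace.single β (1 : ℝ)

theorem assemble_apply {k : ℕ} (D : (Fin k → Fin d) × Fin d → ℝ × E d → ℝ) (z : ℝ × E d)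
    (β : (Fin k → Fin d) × Fin d) : assemble D z β = D β z := by
  simp [assemble, Finset.sum_apply, Pi.single_apply]

theorem assemble_memLp {k : ℕ} {D : (Fin k → Fin d) × Fin d → ℝ × E d → ℝ} {p : ℝ≥0∞}
    {μ : Measure (ℝ × E d)} (h : ∀ β, MemLp (D β) p μ) : MemLp (assemble D) p μ :=
  memLp_finsetSum _ fun β _ =>
    ((ContinuousLinearMap.id ℝ ℝ).smulRight (EuclideanSpace.single β (1 : ℝ) : Tensor d k)).comp_memLp' (h β)

theorem DecaySpace.eLpNorm_slice_le {hd1 : 1 ≤ (d : ℝ)} (w : CritSpace d d hd1) :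
    ∀ᵐ t ∂volume.restrict (Ioo (0 : ℝ) 1), eLpNorm (fun x => fn w (t, x)) d volume ≤ ‖w‖ₑ := by
  filter_upwards [slice_le w] with t ht
  have h0 : (d : ℝ) ≠ 0 := by linarith
  have hd0 : (d : ℝ≥0∞) ≠ 0 := by
    simp only [ne_eq, Nat.cast_eq_zero]
    exact fun h => h0 (by simp [h])
  rw [eLpNorm_eq_lintegral_rpow_enorm_toReal hd0 (by simp)]
  have : 1 / 2 - (d : ℝ) / (2 * d) = 0 := by field_simp; ring
  rw [show t ^ (1 / 2 - (d : ℝ) / (2 * d)) = t ^ (0 : ℝ) from congrArg (t ^ ·) this, Real.rpow_zero,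
    ENNReal.ofReal_one, one_mul] at ht
  simpa using ht

/-- The tensor of order `k` is `t^{-k/2}` times the `k`-th derivative of `Y` at `0`, in coordinates.
The weight `t^{k/2}` cancels this factor, so the mixed norms to be bounded are those of elements of
`L^∞_t L^d_x ∩ L^{d+2}`. -/
theorem exists_weakGrad (hd : 1 ≤ d) {hd1 : 1 ≤ (d : ℝ)} {n : ℕ} {U : VecSpace d}
    {Y : E d → Fin d → CritSpace d d hd1} (hY : ContDiffAt ℝ n Y 0)
    (hYU : ∀ᶠ ζ in 𝓝 0, ∀ i, fn (Y ζ i) =ᵐ[stripMeasure d 1] fn (U i) ∘ shear ζ)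
    {δ : ℝ} (hδ1 : δ ≤ 1) {u : ℝ × E d → E d} (hu : ∀ᵐ z ∂stripMeasure d δ, ∀ i, u z i = fn (U i) z)
    {p q : ℝ≥0∞} (hp : (d : ℝ≥0∞) + 2 ≤ p) (hq : q ∈ Icc (d : ℝ≥0∞) ((d : ℝ≥0∞) + 2))
    (hpq : 2 / p + (d : ℝ≥0∞) / q = 1) :
    ∃ w : (k : ℕ) → ℝ × E d → Tensor d k, (∀ k ≤ n, IsWeakGrad δ k u (w k)) ∧
      ∑ k ∈ Finset.range (n + 1), mixedNorm q p δ (fun z => z.1 ^ ((k : ℝ) / 2) • w k z) < ⊤ := by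
  set D : (k : ℕ) → (Fin k → Fin d) × Fin d → CritSpace d d hd1 := fun k β =>
    iteratedFDeriv ℝ k (fun ζ => Y ζ β.2) 0 fun l => EuclideanSpace.single (β.1 l) 1 with hD
  set W : (k : ℕ) → ℝ × E d → Tensor d k := fun k => assemble fun β => fn (D k β) with hW
  have hWm : ∀ k, MemLp (W k) (nE d) (stripMeasure d 1) := fun k => assemble_memLp fun β => memLp_fn _
  have hWmδ : ∀ k, MemLp (W k) (nE d) (stripMeasure d δ) := fun k =>
    (hWm k).mono_measure (stripMeasure_mono hδ1)
  refine ⟨fun k z => (√z.1 ^ k)⁻¹ • W k z, fun k hk => ⟨?_, fun α i φ hφ => ?_⟩, ?_⟩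
  · have h1 : LocallyIntegrableOn (W k) (strip d δ) volume :=
      locallyIntegrableOn_of_locallyIntegrable_restrict
        ((hWmδ k).locallyIntegrable (Fact.out : 1 ≤ nE d))
    refine h1.continuousOn_smul isOpen_strip.isLocallyClosed ?_
    refine ContinuousOn.inv₀ (by fun_prop) fun z hz => pow_ne_zero _ (Real.sqrt_pos.2 hz.1.1).ne'
  · have hφ1 : IsTest (strip d 1) φ := hφ.mono (prod_mono (Ioo_subset_Ioo_right hδ1) Subset.rfl)
    have hYi : ContDiffAt ℝ n (fun ζ => Y ζ i) 0 := contDiffAt_pi.1 hY i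
    have key := weak_derivative_of_smooth_shift (memLp_fn (U i)) hYi
      (by filter_upwards [hYU] with ζ hζ using hζ i) hk α hφ1
    have e1 : ∫ z in strip d δ, u z i * dxIter α φ z = ∫ z in strip d δ, fn (U i) z * dxIter α φ z := by
      refine integral_congr_ae ?_
      filter_upwards [hu] with z hz
      rw [hz]
    rw [e1, setIntegral_strip_eq hδ1 fun z hz => by rw [(hφ.dxIter α).eq_zero hz, mul_zero], key,
      ← setIntegral_strip_eq hδ1 fun z hz => by rw [hφ.eq_zero hz, mul_zero]]
    congr 2
    funext z
    simp only [PiLp.smul_apply, hW, assemble_apply, smul_eq_mul, hD]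
  · refine ENNReal.sum_lt_top.2 fun k _ => ?_
    have e : mixedNorm q p δ (fun z => z.1 ^ ((k : ℝ) / 2) • (√z.1 ^ k)⁻¹ • W k z) = mixedNorm q p δ (W k) := by
      refine eLpNorm_congr_ae ?_
      filter_upwards [ae_restrict_mem measurableSet_Ioo] with t ht
      have h1 : t ^ ((k : ℝ) / 2) = √t ^ k := by
        rw [Real.sqrt_eq_rpow, ← Real.rpow_natCast, ← Real.rpow_mul ht.1.le]
        congr 1; ring
      have h2 : √t ^ k ≠ 0 := pow_ne_zero _ (Real.sqrt_pos.2 ht.1).ne'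
      simp only [h1, smul_smul, mul_inv_cancel₀ h2, one_smul]
    rw [e]
    refine mixedNorm_lt_top hd (hWmδ k) (K := ∑ β, ‖D k β‖ₑ) (ENNReal.sum_lt_top.2 fun _ _ => by simp) ?_
      hp hq hpq
    have h1 : ∀ᵐ t ∂volume.restrict (Ioo (0 : ℝ) 1), ∀ β,
        eLpNorm (fun x => fn (D k β) (t, x)) d volume ≤ ‖D k β‖ₑ := ae_all_iff.2 fun β => eLpNorm_slice_le _
    have h2 : ∀ᵐ t ∂volume.restrict (Ioo (0 : ℝ) δ), ∀ β,
        eLpNorm (fun x => fn (D k β) (t, x)) d volume ≤ ‖D k β‖ₑ :=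
      ae_mono (Measure.restrict_mono (Ioo_subset_Ioo_right hδ1) le_rfl) h1
    filter_upwards [h2] with t ht
    have hm : ∀ β, AEStronglyMeasurable (fun x : E d => fn (D k β) (t, x) •
        (EuclideanSpace.single β (1 : ℝ) : Tensor d k)) volume := fun β =>
      (((measurable_fn _).comp measurable_prodMk_left).stronglyMeasurable.smul_const _).aestronglyMeasurable
    have h3 := eLpNorm_sum_le (μ := (volume : Measure (E d))) (p := (d : ℝ≥0∞)) (s := Finset.univ)
      (f := fun β x => fn (D k β) (t, x) • (EuclideanSpace.single β (1 : ℝ) : Tensor d k))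
      (fun β _ => hm β) (by exact_mod_cast hd)
    have h4 : (fun x : E d => W k (t, x)) =
        ∑ β, fun x => fn (D k β) (t, x) • (EuclideanSpace.single β (1 : ℝ) : Tensor d k) := by
      funext x
      simp [hW, assemble, Finset.sum_apply]
    rw [h4]
    refine h3.trans (Finset.sum_le_sum fun β _ => le_trans (le_of_eq ?_) (ht β))
    refine eLpNorm_congr_norm_ae (Filter.Eventually.of_forall fun x => ?_)
    rw [norm_smul]
    simp

end

/-! ### Uniqueness of mild solutions. -/

section

variable {d : ℕ}

open DecaySpace Topology

theorem symOp_sub {Ω : Type*} [MeasurableSpace Ω] {ν : Measure Ω} {k : ℝ × E d → Ω → ℝ}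
    {θ : ℝ × E d → Ω → ℝ × E d} {m : Sym d} {f g : Ω → ℝ} {z : ℝ × E d}
    (hk : Measurable (Function.uncurry k)) (hθ : Measurable (Function.uncurry θ))
    (hf : AEStronglyMeasurable f ν) (hg : AEStronglyMeasurable g ν) (hz : majOp ν k f z < ⊤)
    (hz' : majOp ν k g z < ⊤) :
    symOp ν k θ m (fun s => f s - g s) z = symOp ν k θ m f z - symOp ν k θ m g z := by
  rw [symOp, symOp, symOp, ← integral_sub (symOp_integrable hk hθ m hf hz)
    (symOp_integrable hk hθ m hg hz')]
  refine integral_congr_ae (Filter.Eventually.of_forall fun s => ?_)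
  simp only; ring

/-- The `L^{(d+2)/2} → L^{d+2}` bound for the Oseen majorant, localized to a strip. -/
theorem oseenOp_strip_le (hd : 1 ≤ d) : ∃ C : ℝ≥0∞, C < ⊤ ∧ ∀ (δ : ℝ) (f g : ℝ × E d → ℝ≥0∞),
    Measurable f → Measurable g →
    (∫⁻ z, oseenOp ((strip d δ).indicator fun w => f w * g w) z ^ nR d) ^ (1 / nR d) ≤
      C * ((∫⁻ z in strip d δ, f z ^ nR d) ^ (1 / nR d) * (∫⁻ z in strip d δ, g z ^ nR d) ^ (1 / nR d)) := by
  obtain ⟨C, -, hC, H⟩ := oseenOp_norm_spacetime_le hd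
  refine ⟨C, hC, fun δ f g hf hg => ?_⟩
  refine (H ((strip d δ).indicator fun w => f w * g w) ((hf.mul hg).indicator measurableSet_strip)).trans ?_
  gcongr
  have : ∀ z, (strip d δ).indicator (fun w => f w * g w) z ^ (nR d / 2) =
      (strip d δ).indicator (fun w => (f w * g w) ^ (nR d / 2)) z := by
    intro z
    have := nR_pos (d := d)
    by_cases hz : z ∈ strip d δ
    · rw [indicator_of_mem hz, indicator_of_mem hz]
    · rw [indicator_of_notMem hz, indicator_of_notMem hz, ENNReal.zero_rpow_of_pos (by positivity)]
  rw [lintegral_congr this, lintegral_indicator measurableSet_strip]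
  exact lintegral_mul_half_le hf.aemeasurable hg.aemeasurable nR_pos

theorem lintegral_lt_top_of_memLp {δ : ℝ} {f : ℝ × E d → ℝ} (hf : MemLp f (nE d) (stripMeasure d δ)) :
    ∫⁻ z in strip d δ, ‖f z‖ₑ ^ nR d < ⊤ := by
  have := lintegral_rpow_enorm_lt_top_of_eLpNorm_lt_top nE_ne_zero nE_ne_top hf.2
  rwa [nE_toReal] at this

theorem ae_majOp_oseenKer_lt_top (hd : 1 ≤ d) {δ : ℝ} {f g : ℝ × E d → ℝ} (hfm : Measurable f)
    (hgm : Measurable g) (hf : MemLp f (nE d) (stripMeasure d δ)) (hg : MemLp g (nE d) (stripMeasure d δ)) :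
    ∀ᵐ z ∂stripMeasure d δ, majOp volume oseenKer (fun p => f p.1 * g p.1) z < ⊤ := by
  obtain ⟨C, hC, H⟩ := oseenOp_strip_le hd
  have h := H δ _ _ hfm.enorm hgm.enorm
  have h1 : ∫⁻ z, oseenOp ((strip d δ).indicator fun w => ‖f w‖ₑ * ‖g w‖ₑ) z ^ nR d ≠ ⊤ := by
    intro htop
    rw [htop, ENNReal.top_rpow_of_pos (one_div_pos.2 nR_pos)] at h
    refine absurd h (not_le.2 (ENNReal.mul_lt_top hC (ENNReal.mul_lt_top ?_ ?_)))
    · exact ENNReal.rpow_lt_top_of_nonneg (by positivity) (lintegral_lt_top_of_memLp hf).ne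
    · exact ENNReal.rpow_lt_top_of_nonneg (by positivity) (lintegral_lt_top_of_memLp hg).ne
  have hm : Measurable (oseenOp ((strip d δ).indicator fun w => ‖f w‖ₑ * ‖g w‖ₑ)) :=
    measurable_oseenOp ((hfm.enorm.mul hgm.enorm).indicator measurableSet_strip)
  filter_upwards [ae_restrict_of_ae (ae_lt_top (hm.pow_const (nR d)) h1),
    ae_restrict_mem measurableSet_strip] with z hz hzs
  rw [majOp_oseenKer (f := fun w => f w * g w) (hfm.mul hgm) hzs.1.2.le]
  simp_rw [enorm_mul]
  exact (ENNReal.rpow_lt_top_iff_of_pos nR_pos).1 hz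

theorem oseenOp_mono {f g : ℝ × E d → ℝ≥0∞} (h : ∀ z, f z ≤ g z) (z : ℝ × E d) : oseenOp f z ≤ oseenOp g z :=
  lintegral_mono fun p => by gcongr; exact h p

theorem bOp_sub_enorm_le (m : Sym d) {s : ℝ} {f g : ℝ × E d → ℝ} (hf : Measurable f) (hg : Measurable g)
    {z : ℝ × E d} (hz : z.1 ≤ s) (hf' : majOp volume oseenKer (fun p => f p.1) z < ⊤)
    (hg' : majOp volume oseenKer (fun p => g p.1) z < ⊤) {G : ℝ × E d → ℝ≥0∞}
    (hG : ∀ w, ‖f w - g w‖ₑ ≤ G w) :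
    ‖bOp m f z - bOp m g z‖ₑ ≤ ‖m‖ₑ * oseenOp ((strip d s).indicator G) z := by
  have : bOp m f z - bOp m g z = bOp m (fun w => f w - g w) z :=
    (symOp_sub oseenKer_measurable oseenPhase_measurable (hf.comp measurable_fst).aestronglyMeasurable
      (hg.comp measurable_fst).aestronglyMeasurable hf' hg').symm
  rw [this]
  refine (bOp_enorm_le m (hf.sub hg) hz).trans ?_
  gcongr
  refine oseenOp_mono (fun w => ?_) z
  by_cases hw : w ∈ strip d s
  · simpa [hw] using hG w
  · simp [hw]

/-- The pointwise distance between two vector fields. -/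
def fieldDist (u v : Fin d → ℝ × E d → ℝ) (z : ℝ × E d) : ℝ≥0∞ := ∑ i, ‖u i z - v i z‖ₑ

/-- The pointwise size of two vector fields. -/
def fieldSize (u v : Fin d → ℝ × E d → ℝ) (z : ℝ × E d) : ℝ≥0∞ := ∑ i, (‖u i z‖ₑ + ‖v i z‖ₑ)

theorem enorm_mul_sub_mul_le (u v : Fin d → ℝ × E d → ℝ) (j k : Fin d) (w : ℝ × E d) :
    ‖u j w * u k w - v j w * v k w‖ₑ ≤ 2 * (fieldDist u v w * fieldSize u v w) := by
  have hD : ∀ i, ‖u i w - v i w‖ₑ ≤ fieldDist u v w := fun i =>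
    Finset.single_le_sum (f := fun i => ‖u i w - v i w‖ₑ) (fun _ _ => bot_le) (Finset.mem_univ i)
  have hS : ∀ i, ‖u i w‖ₑ + ‖v i w‖ₑ ≤ fieldSize u v w := fun i =>
    Finset.single_le_sum (f := fun i => ‖u i w‖ₑ + ‖v i w‖ₑ) (fun _ _ => bot_le) (Finset.mem_univ i)
  have e : u j w * u k w - v j w * v k w = (u j w - v j w) * u k w + (u k w - v k w) * v j w := by ring
  rw [e, two_mul]
  refine (enorm_add_le _ _).trans (add_le_add ?_ ?_)
  · rw [enorm_mul]
    exact mul_le_mul' (hD j) (le_self_add.trans (hS k))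
  · rw [enorm_mul]
    exact mul_le_mul' (hD k) (le_add_self.trans (hS j))

theorem enorm_sum_sub_sum_le {ι : Type*} (s : Finset ι) (f g : ι → ℝ) :
    ‖∑ i ∈ s, f i - ∑ i ∈ s, g i‖ₑ ≤ ∑ i ∈ s, ‖f i - g i‖ₑ := by
  rw [← Finset.sum_sub_distrib]
  exact enorm_sum_le _ _

/-- The Duhamel term is locally Lipschitz. -/
theorem exists_duhamel_sub_le (hd : 1 ≤ d) : ∃ C : ℝ≥0∞, C < ⊤ ∧ ∀ (δ : ℝ) (u v : Fin d → ℝ × E d → ℝ),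
    (∀ i, Measurable (u i)) → (∀ i, Measurable (v i)) → (∀ i, MemLp (u i) (nE d) (stripMeasure d δ)) →
    (∀ i, MemLp (v i) (nE d) (stripMeasure d δ)) → ∀ᵐ z ∂stripMeasure d δ, ∀ s, z.1 ≤ s → ∀ i,
      ‖duhamel 0 u i z - duhamel 0 v i z‖ₑ ≤
        C * oseenOp ((strip d s).indicator fun w => fieldDist u v w * fieldSize u v w) z := by
  set M : ℝ≥0∞ := ∑ i : Fin d, ∑ j : Fin d, ∑ k : Fin d, ‖symbol (GaussClass.third i j k) 0 0‖ₑ with hM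
  have hMt : M < ⊤ := ENNReal.sum_lt_top.2 fun _ _ => ENNReal.sum_lt_top.2 fun _ _ =>
    ENNReal.sum_lt_top.2 fun _ _ => by simp
  have hMle : ∀ i j k : Fin d, ‖symbol (GaussClass.third i j k) 0 0‖ₑ ≤ M := fun i j k =>
    (Finset.single_le_sum (f := fun k => ‖symbol (GaussClass.third i j k) 0 0‖ₑ) (fun _ _ => bot_le)
      (Finset.mem_univ k)).trans ((Finset.single_le_sum
      (f := fun j => ∑ k, ‖symbol (GaussClass.third i j k) 0 0‖ₑ) (fun _ _ => bot_le)
      (Finset.mem_univ j)).trans (Finset.single_le_sum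
      (f := fun i => ∑ j, ∑ k, ‖symbol (GaussClass.third i j k) 0 0‖ₑ) (fun _ _ => bot_le)
      (Finset.mem_univ i)))
  refine ⟨(d * (d * (M * 2)) + d * (d * (M * 2)) : ℝ≥0∞), ?_, fun δ u v hum hvm hu hv => ?_⟩
  · have h1 : M * 2 < ⊤ := ENNReal.mul_lt_top hMt (by simp)
    have h2 : (d : ℝ≥0∞) * (d * (M * 2)) < ⊤ := ENNReal.mul_lt_top (by simp) (ENNReal.mul_lt_top (by simp) h1)
    exact ENNReal.add_lt_top.2 ⟨h2, h2⟩
  have hfu : ∀ᵐ z ∂stripMeasure d δ, ∀ j k, majOp volume oseenKer (fun p => u j p.1 * u k p.1) z < ⊤ :=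
    ae_all_iff.2 fun j => ae_all_iff.2 fun k => ae_majOp_oseenKer_lt_top hd (hum j) (hum k) (hu j) (hu k)
  have hfv : ∀ᵐ z ∂stripMeasure d δ, ∀ j k, majOp volume oseenKer (fun p => v j p.1 * v k p.1) z < ⊤ :=
    ae_all_iff.2 fun j => ae_all_iff.2 fun k => ae_majOp_oseenKer_lt_top hd (hvm j) (hvm k) (hv j) (hv k)
  filter_upwards [hfu, hfv] with z hzu hzv s hs i
  set O := oseenOp ((strip d s).indicator fun w => fieldDist u v w * fieldSize u v w) z with hO
  have hterm : ∀ i j k l m : Fin d, ‖bOp (symbol (GaussClass.third i j k) 0 0) (fun w => u l w * u m w) z -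
      bOp (symbol (GaussClass.third i j k) 0 0) (fun w => v l w * v m w) z‖ₑ ≤ M * 2 * O := by
    intro i j k l m
    refine (bOp_sub_enorm_le _ ((hum l).mul (hum m)) ((hvm l).mul (hvm m)) hs (hzu l m) (hzv l m)
      (enorm_mul_sub_mul_le u v l m)).trans ?_
    have e : oseenOp ((strip d s).indicator fun w => 2 * (fieldDist u v w * fieldSize u v w)) z = 2 * O := by
      rw [hO, oseenOp, oseenOp, ← lintegral_const_mul' _ _ (by simp)]
      refine lintegral_congr fun w => ?_
      by_cases hw : w ∈ strip d s
      · simp only [indicator_of_mem hw]; ring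
      · simp only [indicator_of_notMem hw]; simp
    rw [e, mul_assoc]
    gcongr
    exact hMle i j k
  have hsum : ∀ f g : Fin d → Fin d → ℝ, (∀ j k, ‖f j k - g j k‖ₑ ≤ M * 2 * O) →
      ‖∑ j, ∑ k, f j k - ∑ j, ∑ k, g j k‖ₑ ≤ d * (d * (M * 2 * O)) := by
    intro f g h
    refine (enorm_sum_sub_sum_le _ _ _).trans ?_
    refine (Finset.sum_le_card_nsmul _ _ (d * (M * 2 * O)) fun j _ => ?_).trans (by simp)
    refine (enorm_sum_sub_sum_le _ _ _).trans ?_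
    exact (Finset.sum_le_card_nsmul _ _ (M * 2 * O) fun k _ => h j k).trans (by simp)
  unfold duhamel
  rw [sub_sub_sub_comm]
  refine (enorm_sub_le).trans ?_
  refine (add_le_add (hsum _ _ fun j k => hterm i j k j k) (hsum _ _ fun k l => hterm l l k i k)).trans ?_
  refine le_of_eq ?_
  ring

theorem fieldDist_measurable {u v : Fin d → ℝ × E d → ℝ} (hu : ∀ i, Measurable (u i))
    (hv : ∀ i, Measurable (v i)) : Measurable (fieldDist u v) :=
  Finset.measurable_fun_sum _ fun i _ => ((hu i).sub (hv i)).enorm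

theorem fieldSize_measurable {u v : Fin d → ℝ × E d → ℝ} (hu : ∀ i, Measurable (u i))
    (hv : ∀ i, Measurable (v i)) : Measurable (fieldSize u v) :=
  Finset.measurable_fun_sum _ fun i _ => (hu i).enorm.add (hv i).enorm

theorem lintegral_fieldSize_lt_top {δ : ℝ} {u v : Fin d → ℝ × E d → ℝ}
    (hu : ∀ i, MemLp (u i) (nE d) (stripMeasure d δ)) (hv : ∀ i, MemLp (v i) (nE d) (stripMeasure d δ)) :
    ∫⁻ z in strip d δ, fieldSize u v z ^ nR d < ⊤ := by
  have h : MemLp (fun z => ∑ i, (‖u i z‖ + ‖v i z‖)) (nE d) (stripMeasure d δ) :=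
    memLp_finsetSum _ fun i _ => (hu i).norm.add (hv i).norm
  refine lt_of_le_of_lt (lintegral_mono fun z => ?_) (lintegral_lt_top_of_memLp h)
  refine ENNReal.rpow_le_rpow (le_of_eq ?_) nR_pos.le
  rw [Real.enorm_of_nonneg (Finset.sum_nonneg fun i _ => by positivity), fieldSize,
    ENNReal.ofReal_sum_of_nonneg fun i _ => by positivity]
  refine Finset.sum_congr rfl fun i _ => ?_
  rw [ENNReal.ofReal_add (norm_nonneg _) (norm_nonneg _), ofReal_norm, ofReal_norm]

theorem lintegral_strip_eq {δ : ℝ} {f : ℝ × E d → ℝ≥0∞} (hf : Measurable f) :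
    ∫⁻ z in strip d δ, f z = ∫⁻ t in Ioo 0 δ, ∫⁻ x, f (t, x) := by
  rw [show volume.restrict (strip d δ) = stripMeasure d δ from rfl, stripMeasure_eq, lintegral_prod _ hf.aemeasurable]

/-- Uniqueness of mild solutions in `L^{d+2}`. -/
theorem mild_unique (hd : 1 ≤ d) {δ : ℝ} {u v : Fin d → ℝ × E d → ℝ}
    (hum : ∀ i, Measurable (u i)) (hvm : ∀ i, Measurable (v i))
    (hu : ∀ i, MemLp (u i) (nE d) (stripMeasure d δ)) (hv : ∀ i, MemLp (v i) (nE d) (stripMeasure d δ))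
    (h : ∀ i, ∀ᵐ z ∂stripMeasure d δ, u i z - v i z = duhamel 0 v i z - duhamel 0 u i z) :
    ∀ᵐ z ∂stripMeasure d δ, ∀ i, u i z = v i z := by
  obtain ⟨C1, hC1, H1⟩ := exists_duhamel_sub_le hd
  obtain ⟨C2, hC2, H2⟩ := oseenOp_strip_le hd
  set h' := fieldDist u v with hh'
  set e := fieldSize u v with he
  have hm := fieldDist_measurable hum hvm
  have em := fieldSize_measurable hum hvm
  have hfin := lintegral_fieldSize_lt_top hu hv
  have hle : ∀ z, h' z ≤ e z := fun z => Finset.sum_le_sum fun i _ => enorm_sub_le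
  set K : ℝ≥0∞ := d * C1 with hK
  have hKt : K < ⊤ := ENNReal.mul_lt_top (by simp) hC1
  -- By causality the estimate holds with the source cut off at any later time `s`, which makes the
  -- argument local in time.
  have hpt : ∀ᵐ z ∂stripMeasure d δ, ∀ s, z.1 ≤ s →
      h' z ≤ K * oseenOp ((strip d s).indicator fun w => h' w * e w) z := by
    filter_upwards [H1 δ u v hum hvm hu hv, ae_all_iff.2 h] with z h1 h2 s hs
    refine (Finset.sum_le_card_nsmul _ _ (C1 * oseenOp ((strip d s).indicator fun w => h' w * e w) z)
      fun i _ => ?_).trans (by simp [hK, mul_assoc])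
    rw [h2 i, ← enorm_neg, neg_sub]
    exact h1 s hs i
  -- A size bound below which the Lipschitz constant of the Duhamel term is at most `1/2`.
  obtain ⟨ε, hε0, hεK⟩ : ∃ ε : ℝ≥0∞, ε ≠ 0 ∧ K * C2 * ε ^ (1 / nR d) ≤ 1 / 2 := by
    have hKC : K * C2 ≠ ⊤ := (ENNReal.mul_lt_top hKt hC2).ne
    have h0 := nR_pos (d := d)
    refine ⟨((2 * (K * C2 + 1))⁻¹) ^ nR d, ?_, ?_⟩
    · refine (ENNReal.rpow_pos (ENNReal.inv_pos.2 ?_) ?_).ne'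
      · exact ENNReal.mul_ne_top (by simp) (by simp [hKC])
      · simp
    · rw [← ENNReal.rpow_mul, mul_one_div_cancel h0.ne', ENNReal.rpow_one,
        ENNReal.mul_inv (by simp) (by simp), mul_left_comm, one_div]
      calc (2 : ℝ≥0∞)⁻¹ * (K * C2 * (K * C2 + 1)⁻¹) ≤ 2⁻¹ * ((K * C2 + 1) * (K * C2 + 1)⁻¹) := by
            gcongr; exact le_self_add
        _ = 2⁻¹ := by rw [ENNReal.mul_inv_cancel (by simp) (by simp [hKC]), mul_one]
  have emN : Measurable fun z => e z ^ nR d := em.pow_const _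
  have hsl : ∫⁻ t in Ioo 0 δ, ∫⁻ x, e (t, x) ^ nR d ≠ ⊤ := by
    rw [← lintegral_strip_eq emN]; exact hfin.ne
  -- Absolute continuity of the time integral gives one step length for which every time interval of
  -- that length carries little of the `L^{d+2}` norm. A uniform step reaches `δ` after finitely
  -- many repetitions.
  obtain ⟨η, hη0, hη⟩ := exists_pos_setLIntegral_lt_of_measure_lt hsl hε0
  obtain ⟨η', hη'0, hη'⟩ : ∃ η' : ℝ, 0 < η' ∧ ENNReal.ofReal η' < η := by
    obtain ⟨r, hr0, hr⟩ := ENNReal.lt_iff_exists_nnreal_btwn.1 hη0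
    exact ⟨r, by exact_mod_cast hr0, by simpa using hr⟩
  have step : ∀ s0 s1 : ℝ, s0 ≤ s1 → s1 ≤ s0 + η' → s1 ≤ δ → (∀ᵐ z ∂stripMeasure d s0, h' z = 0) →
      ∀ᵐ z ∂stripMeasure d s1, h' z = 0 := by
    intro s0 s1 h01 h10 h1δ hz
    set X := (∫⁻ z in strip d s1, h' z ^ nR d) ^ (1 / nR d) with hX
    have hXt : X ≠ ⊤ := by
      refine ENNReal.rpow_ne_top_of_nonneg (by positivity) (lt_of_le_of_lt ?_ hfin).ne
      refine (lintegral_mono' (stripMeasure_mono h1δ) fun z => ?_)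
      exact ENNReal.rpow_le_rpow (hle z) nR_pos.le
    set e1 : ℝ × E d → ℝ≥0∞ := (Ici s0 ×ˢ univ).indicator e with he1
    have hslabm : MeasurableSet (Ici s0 ×ˢ (univ : Set (E d))) := measurableSet_Ici.prod MeasurableSet.univ
    have e1m : Measurable e1 := em.indicator hslabm
    have hz' : ∀ᵐ w : ℝ × E d, w ∈ strip d s0 → h' w = 0 := (ae_restrict_iff' measurableSet_strip).1 hz
    -- The difference already vanishes before `s0`, so only the size of the fields after `s0`
    -- enters.
    have hop : ∀ z, oseenOp ((strip d s1).indicator fun w => h' w * e w) z =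
        oseenOp ((strip d s1).indicator fun w => h' w * e1 w) z := by
      intro z
      refine lintegral_congr_ae ?_
      filter_upwards [hz'] with w hw
      by_cases hw1 : w ∈ strip d s1
      · simp only [indicator_of_mem hw1]
        by_cases hw0 : w ∈ Ici s0 ×ˢ (univ : Set (E d))
        · rw [he1, indicator_of_mem hw0]
        · have : h' w = 0 := hw ⟨⟨hw1.1.1, by
            by_contra hc
            exact hw0 ⟨not_lt.1 hc, mem_univ _⟩⟩, mem_univ _⟩
          rw [this, zero_mul, zero_mul]
      · simp only [indicator_of_notMem hw1]
    have he1s : (∫⁻ z in strip d s1, e1 z ^ nR d) ≤ ε := by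
      have hmeas1 : Measurable fun z => e1 z ^ nR d := e1m.pow_const _
      rw [lintegral_strip_eq hmeas1]
      have hI : ∫⁻ t in Ioo 0 s1, ∫⁻ x, e1 (t, x) ^ nR d =
          ∫⁻ t in Ioo 0 s1, (Ici s0).indicator (fun t => ∫⁻ x, e (t, x) ^ nR d) t := by
        refine lintegral_congr fun t => ?_
        by_cases ht : t ∈ Ici s0
        · rw [indicator_of_mem ht]
          refine lintegral_congr fun x => ?_
          rw [he1, indicator_of_mem (show (t, x) ∈ Ici s0 ×ˢ univ from ⟨ht, mem_univ _⟩)]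
        · rw [indicator_of_notMem ht]
          have : ∀ x, e1 (t, x) ^ nR d = 0 := fun x => by
            rw [he1, indicator_of_notMem (fun hc => ht hc.1), ENNReal.zero_rpow_of_pos nR_pos]
          simp only [this, lintegral_zero]
      rw [hI, lintegral_indicator measurableSet_Ici]
      have hsub : (volume.restrict (Ioo 0 s1)).restrict (Ici s0) ≤
          (volume.restrict (Ioo 0 δ)).restrict (Icc s0 s1) := by
        rw [Measure.restrict_restrict measurableSet_Ici, Measure.restrict_restrict measurableSet_Icc]
        have hsubset : Ici s0 ∩ Ioo 0 s1 ⊆ Icc s0 s1 ∩ Ioo 0 δ :=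
          fun t ht => ⟨⟨ht.1, ht.2.2.le⟩, ht.2.1, ht.2.2.trans_le h1δ⟩
        exact Measure.restrict_mono hsubset le_rfl
      refine (lintegral_mono' hsub fun t => le_rfl).trans (hη _ ?_).le
      refine lt_of_le_of_lt (Measure.restrict_apply_le _ _) (lt_of_le_of_lt ?_ hη')
      rw [Real.volume_Icc]
      exact ENNReal.ofReal_le_ofReal (by linarith)
    have hbound : X ≤ X / 2 := by
      have h2 : ∀ᵐ z ∂stripMeasure d s1, h' z ≤ K * oseenOp ((strip d s1).indicator fun w => h' w * e1 w) z := by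
        filter_upwards [ae_mono (stripMeasure_mono h1δ) hpt, ae_restrict_mem measurableSet_strip] with z hz hzs
        rw [← hop]
        exact hz s1 hzs.1.2.le
      calc X ≤ K * (∫⁻ z in strip d s1, oseenOp ((strip d s1).indicator fun w => h' w * e1 w) z ^ nR d) ^ (1 / nR d) :=
            lintegral_rpow_le_of_le hKt.ne nR_pos h2
        _ ≤ K * (∫⁻ z, oseenOp ((strip d s1).indicator fun w => h' w * e1 w) z ^ nR d) ^ (1 / nR d) := by
            have := nR_pos (d := d)
            gcongr
            exact Measure.restrict_le_self
        _ ≤ K * (C2 * (X * (∫⁻ z in strip d s1, e1 z ^ nR d) ^ (1 / nR d))) := by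
            gcongr
            exact H2 s1 h' e1 hm e1m
        _ ≤ K * (C2 * (X * ε ^ (1 / nR d))) := by
            have := nR_pos (d := d)
            gcongr
        _ = (K * C2 * ε ^ (1 / nR d)) * X := by ring
        _ ≤ 1 / 2 * X := by gcongr
        _ = X / 2 := by rw [one_div, ENNReal.div_eq_inv_mul]
    -- Absorption of `X ≤ X / 2` is legitimate because `X` is finite.
    have hX0 : X = 0 := by
      by_contra hne
      exact absurd hbound (not_le.2 (ENNReal.half_lt_self hne hXt))
    rw [hX, ENNReal.rpow_eq_zero_iff_of_pos (one_div_pos.2 nR_pos),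
      lintegral_eq_zero_iff (hm.pow_const _)] at hX0
    filter_upwards [hX0] with z hz
    exact (ENNReal.rpow_eq_zero_iff_of_pos nR_pos).1 hz
  have hind : ∀ n : ℕ, ∀ᵐ z ∂stripMeasure d (min δ (n * η')), h' z = 0 := by
    intro n
    induction n with
    | zero =>
      have : strip d (min δ ((0 : ℕ) * η')) = ∅ := by
        rw [strip, Ioo_eq_empty (by simp), empty_prod]
      rw [stripMeasure, this]
      simp
    | succ n ih =>
      refine step _ _ ?_ ?_ (min_le_left _ _) ih
      · gcongr
        simp
      · push_cast
        rcases le_total δ (n * η') with hc | hc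
        · rw [min_eq_left hc]
          exact (min_le_left _ _).trans (by linarith)
        · rw [min_eq_right hc]
          exact (min_le_right _ _).trans (by linarith)
  obtain ⟨n, hn⟩ := exists_nat_gt (δ / η')
  have hfinal := hind n
  rw [min_eq_left (by rw [div_lt_iff₀ hη'0] at hn; exact hn.le)] at hfinal
  filter_upwards [hfinal] with z hz i
  have : ‖u i z - v i z‖ₑ = 0 := (Finset.sum_eq_zero_iff.1 hz) i (Finset.mem_univ i)
  exact sub_eq_zero.1 (enorm_eq_zero.1 this)

end

/-! ### Pairings with translated test functions. -/

section

variable {d : ℕ}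

open DecaySpace Topology Filter

section Pairing

variable {X : Type*} [NormedAddCommGroup X] [MeasurableSpace X] {μ : Measure X}

theorem norm_translate_le {A : ℝ≥0∞} (hA : A < ⊤) {f g : X → ℝ} {c : X}
    (h : ∫⁻ x, ‖f x * g (x + c)‖ₑ ∂μ ≤ A) : ‖∫ x, f x * g (x + c) ∂μ‖ ≤ A.toReal := by
  have := ENNReal.toReal_mono hA.ne ((enorm_integral_le_lintegral_enorm _).trans h)
  rwa [toReal_enorm] at this

/-- Balls of equal radius have uniformly bounded mass. -/
def UnifLocFinite (μ : Measure X) : Prop :=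
  ∀ ρ : ℝ, ∃ B : ℝ≥0∞, B < ⊤ ∧ ∀ c, μ (Metric.closedBall c ρ) ≤ B

variable [BorelSpace X]

/-- The translate of `g` lives on a ball about `-c` of fixed radius, and Hölder on that ball costs
only its uniformly bounded mass. Keeping the local norm of `f` on the right makes decay for `c → ∞`
accessible. -/
theorem lintegral_translate_le (hμ : UnifLocFinite μ) {p : ℝ≥0∞} (hp : 1 ≤ p) {f : X → ℝ}
    (hf : MemLp f p μ) {g : X → ℝ} (hg : Continuous g) (hgs : HasCompactSupport g) :
    ∃ A : ℝ≥0∞, A < ⊤ ∧ ∃ ρ : ℝ, ∀ c,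
      ∫⁻ x, ‖f x * g (x + c)‖ₑ ∂μ ≤ A * eLpNorm f p (μ.restrict (Metric.closedBall (-c) ρ)) := by
  obtain ⟨C, hC⟩ := hgs.exists_bound_of_continuous hg
  obtain ⟨ρ, hρ⟩ := hgs.isCompact.isBounded.exists_norm_le
  obtain ⟨B, hB, hBμ⟩ := hμ ρ
  have he : 0 ≤ 1 / (1 : ℝ≥0∞).toReal - 1 / p.toReal := by
    rcases eq_or_ne p ⊤ with rfl | hpt
    · simp
    · have : 1 ≤ p.toReal := by
        rw [← ENNReal.toReal_one]; exact ENNReal.toReal_mono hpt hp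
      have : 1 / p.toReal ≤ 1 := by rw [div_le_one (by linarith)]; exact this
      simpa using this
  refine ⟨ENNReal.ofReal C * B ^ (1 / (1 : ℝ≥0∞).toReal - 1 / p.toReal),
    ENNReal.mul_lt_top (by simp) (ENNReal.rpow_lt_top_of_nonneg he hB.ne), ρ, fun c => ?_⟩
  have h1 : ∀ x, ‖f x * g (x + c)‖ₑ ≤
      (Metric.closedBall (-c) ρ).indicator (fun x => ENNReal.ofReal C * ‖f x‖ₑ) x := fun x => by
    by_cases hx : g (x + c) = 0
    · simp [hx]
    · have hx' : x ∈ Metric.closedBall (-c) ρ := by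
        rw [mem_closedBall_iff_norm, sub_neg_eq_add]
        exact hρ _ (subset_tsupport _ hx)
      rw [indicator_of_mem hx', enorm_mul, mul_comm]
      gcongr
      rw [← ofReal_norm]
      exact ENNReal.ofReal_le_ofReal (hC _)
  calc ∫⁻ x, ‖f x * g (x + c)‖ₑ ∂μ
      ≤ ∫⁻ x, (Metric.closedBall (-c) ρ).indicator (fun x => ENNReal.ofReal C * ‖f x‖ₑ) x ∂μ := lintegral_mono h1
    _ = ENNReal.ofReal C * eLpNorm f 1 (μ.restrict (Metric.closedBall (-c) ρ)) := by
        rw [lintegral_indicator measurableSet_closedBall, lintegral_const_mul' _ _ (by simp),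
          eLpNorm_one_eq_lintegral_enorm]
    _ ≤ ENNReal.ofReal C * (eLpNorm f p (μ.restrict (Metric.closedBall (-c) ρ)) *
          (μ.restrict (Metric.closedBall (-c) ρ)) univ ^ (1 / (1 : ℝ≥0∞).toReal - 1 / p.toReal)) := by
        gcongr
        exact eLpNorm_le_eLpNorm_mul_rpow_measure_univ hp hf.1.restrict
    _ ≤ ENNReal.ofReal C * (eLpNorm f p (μ.restrict (Metric.closedBall (-c) ρ)) *
          B ^ (1 / (1 : ℝ≥0∞).toReal - 1 / p.toReal)) := by
        gcongr
        rw [Measure.restrict_apply_univ]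
        exact hBμ _
    _ = _ := by ring

theorem exists_lintegral_translate_le (hμ : UnifLocFinite μ) {p : ℝ≥0∞} (hp : 1 ≤ p) {f : X → ℝ}
    (hf : MemLp f p μ) {g : X → ℝ} (hg : Continuous g) (hgs : HasCompactSupport g) :
    ∃ A : ℝ≥0∞, A < ⊤ ∧ ∀ c, ∫⁻ x, ‖f x * g (x + c)‖ₑ ∂μ ≤ A := by
  obtain ⟨A, hA, ρ, h⟩ := lintegral_translate_le hμ hp hf hg hgs
  refine ⟨A * eLpNorm f p μ, ENNReal.mul_lt_top hA hf.2, fun c => (h c).trans ?_⟩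
  gcongr
  exact Measure.restrict_le_self

/-- The `L^p` mass of `f` on balls drifting to infinity tends to zero by dominated convergence; this
is where `p < ∞` matters. -/
theorem tendsto_translate (hμ : UnifLocFinite μ) {p : ℝ≥0∞} (hp : 1 ≤ p) (hpt : p ≠ ⊤)
    {f : X → ℝ} (hf : MemLp f p μ) {g : X → ℝ} (hg : Continuous g) (hgs : HasCompactSupport g)
    {c : ℕ → X} (hc : Tendsto c atTop (Bornology.cobounded X)) :
    Tendsto (fun n => ∫ x, f x * g (x + c n) ∂μ) atTop (𝓝 0) := by
  obtain ⟨A, hA, ρ, h⟩ := lintegral_translate_le hμ hp hf hg hgs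
  have hp0 : p ≠ 0 := (zero_lt_one.trans_le hp).ne'
  have hpr : 0 < p.toReal := ENNReal.toReal_pos hp0 hpt
  have hl : Tendsto (fun n => ∫⁻ x in Metric.closedBall (-c n) ρ, ‖f x‖ₑ ^ p.toReal ∂μ) atTop (𝓝 0) := by
    have hm : AEMeasurable (fun x => ‖f x‖ₑ ^ p.toReal) μ := hf.1.enorm.pow_const _
    have := tendsto_lintegral_of_dominated_convergence' (μ := μ)
      (F := fun n x => (Metric.closedBall (-c n) ρ).indicator (fun x => ‖f x‖ₑ ^ p.toReal) x)
      (f := fun _ => 0) (fun x => ‖f x‖ₑ ^ p.toReal) (fun n => hm.indicator measurableSet_closedBall)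
      (fun n => Eventually.of_forall fun x => indicator_le_self _ _ x)
      (lintegral_rpow_enorm_lt_top_of_eLpNorm_lt_top hp0 hpt hf.2).ne
      (Eventually.of_forall fun x => by
        refine tendsto_const_nhds.congr' ?_
        have h2 : ∀ᶠ n in atTop, ρ + ‖x‖ < ‖c n‖ :=
          (tendsto_norm_atTop_iff_cobounded.2 hc).eventually_gt_atTop _
        filter_upwards [h2] with n hn
        rw [indicator_of_notMem]
        rw [mem_closedBall_iff_norm, sub_neg_eq_add, not_le]
        have : ‖c n‖ ≤ ‖x + c n‖ + ‖x‖ := by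
          calc ‖c n‖ = ‖(x + c n) - x‖ := by simp
            _ ≤ _ := norm_sub_le _ _
        linarith)
    simpa only [lintegral_indicator measurableSet_closedBall, lintegral_zero] using this
  have hl2 : Tendsto (fun n => A * eLpNorm f p (μ.restrict (Metric.closedBall (-c n) ρ))) atTop (𝓝 0) := by
    have := ENNReal.Tendsto.const_mul (a := A)
      (ENNReal.continuous_rpow_const.tendsto 0 |>.comp hl : Tendsto _ _ (𝓝 ((0 : ℝ≥0∞) ^ (1 / p.toReal)))) (Or.inr hA.ne)
    rw [ENNReal.zero_rpow_of_pos (by positivity), mul_zero] at this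
    refine this.congr fun n => ?_
    rw [eLpNorm_eq_lintegral_rpow_enorm_toReal hp0 hpt]
    rfl
  rw [tendsto_zero_iff_enorm_tendsto_zero]
  exact tendsto_of_tendsto_of_tendsto_of_le_of_le tendsto_const_nhds hl2 (fun _ => bot_le)
    fun n => (enorm_integral_le_lintegral_enorm _).trans (h _)

variable [SecondCountableTopology X] {Ω : Type*} [MeasurableSpace Ω] {ν : Measure Ω}

theorem integrable_translate (hμ : UnifLocFinite μ) [SFinite μ] [SFinite ν] {p : ℝ≥0∞} (hp : 1 ≤ p)
    {f : X → ℝ} (hf : MemLp f p μ) {g : X → ℝ} (hg : Continuous g) (hgs : HasCompactSupport g)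
    {w : Ω → ℝ} (hw : Integrable w ν) {Φ : Ω → X} (hΦ : Measurable Φ) :
    Integrable (fun q : Ω × X => w q.1 * (f q.2 * g (q.2 + Φ q.1))) (ν.prod μ) := by
  obtain ⟨A, hA, h⟩ := exists_lintegral_translate_le hμ hp hf hg hgs
  have hm : AEStronglyMeasurable (fun q : Ω × X => w q.1 * (f q.2 * g (q.2 + Φ q.1))) (ν.prod μ) := by
    refine hw.1.comp_fst.mul (hf.1.comp_snd.mul ?_)
    have : Measurable fun q : Ω × X => g (q.2 + Φ q.1) :=
      hg.measurable.comp (measurable_snd.add (hΦ.comp measurable_fst))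
    exact this.aestronglyMeasurable
  refine ⟨hm, ?_⟩
  rw [HasFiniteIntegral, lintegral_prod _ hm.enorm]
  calc ∫⁻ o, ∫⁻ x, ‖w o * (f x * g (x + Φ o))‖ₑ ∂μ ∂ν
      ≤ ∫⁻ o, ‖w o‖ₑ * A ∂ν := by
        refine lintegral_mono fun o => ?_
        simp only [enorm_mul (w o)]
        rw [lintegral_const_mul' _ _ (by simp)]
        gcongr
        exact h _
    _ = (∫⁻ o, ‖w o‖ₑ ∂ν) * A := lintegral_mul_const' _ _ hA.ne
    _ < ⊤ := ENNReal.mul_lt_top hw.2 hA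

theorem integral_translate_swap (hμ : UnifLocFinite μ) [SFinite μ] [SFinite ν] {p : ℝ≥0∞} (hp : 1 ≤ p)
    {f : X → ℝ} (hf : MemLp f p μ) {g : X → ℝ} (hg : Continuous g) (hgs : HasCompactSupport g)
    {w : Ω → ℝ} (hw : Integrable w ν) {Φ : Ω → X} (hΦ : Measurable Φ) :
    ∫ o, w o * ∫ x, f x * g (x + Φ o) ∂μ ∂ν = ∫ x, f x * ∫ o, w o * g (x + Φ o) ∂ν ∂μ := by
  have h := integral_integral_swap (f := fun o x => w o * (f x * g (x + Φ o)))
    (integrable_translate hμ hp hf hg hgs hw hΦ)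
  simp only [integral_const_mul] at h
  rw [h]
  refine integral_congr_ae (Eventually.of_forall fun x => ?_)
  simp only
  rw [← integral_const_mul]
  congr 1
  funext o
  ring

theorem integrable_mul_translate (hμ : UnifLocFinite μ) [SFinite μ] [SFinite ν] {p : ℝ≥0∞} (hp : 1 ≤ p)
    {f : X → ℝ} (hf : MemLp f p μ) {g : X → ℝ} (hg : Continuous g) (hgs : HasCompactSupport g)
    {w : Ω → ℝ} (hw : Integrable w ν) {Φ : Ω → X} (hΦ : Measurable Φ) :
    Integrable (fun o => w o * ∫ x, f x * g (x + Φ o) ∂μ) ν := by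
  have := (integrable_translate hμ hp hf hg hgs hw hΦ).integral_prod_left
  simpa only [integral_const_mul] using this

theorem integrable_mul_integral_translate (hμ : UnifLocFinite μ) [SFinite μ] [SFinite ν] {p : ℝ≥0∞} (hp : 1 ≤ p)
    {f : X → ℝ} (hf : MemLp f p μ) {g : X → ℝ} (hg : Continuous g) (hgs : HasCompactSupport g)
    {w : Ω → ℝ} (hw : Integrable w ν) {Φ : Ω → X} (hΦ : Measurable Φ) :
    Integrable (fun x => f x * ∫ o, w o * g (x + Φ o) ∂ν) μ := by
  have := (integrable_translate hμ hp hf hg hgs hw hΦ).integral_prod_right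
  refine this.congr (Eventually.of_forall fun x => ?_)
  simp only
  rw [← integral_const_mul]
  congr 1
  funext o
  ring

theorem tendsto_integral_translate (hμ : UnifLocFinite μ) [SFinite μ] [SFinite ν] {p : ℝ≥0∞} (hp : 1 ≤ p)
    (hpt : p ≠ ⊤) {f : X → ℝ} (hf : MemLp f p μ) {g : X → ℝ} (hg : Continuous g) (hgs : HasCompactSupport g)
    {w : Ω → ℝ} (hw : Integrable w ν) {Φ : ℕ → Ω → X} (hΦ : ∀ n, Measurable (Φ n))
    (hc : ∀ᵐ o ∂ν, Tendsto (fun n => Φ n o) atTop (Bornology.cobounded X)) :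
    Tendsto (fun n => ∫ o, w o * ∫ x, f x * g (x + Φ n o) ∂μ ∂ν) atTop (𝓝 0) := by
  obtain ⟨A, hA, h⟩ := exists_lintegral_translate_le hμ hp hf hg hgs
  have := tendsto_integral_of_dominated_convergence (μ := ν)
    (F := fun n o => w o * ∫ x, f x * g (x + Φ n o) ∂μ) (f := fun _ => 0) (fun o => ‖w o‖ * A.toReal)
    (fun n => (integrable_mul_translate hμ hp hf hg hgs hw (hΦ n)).1) (hw.norm.mul_const _)
    (fun n => Eventually.of_forall fun o => by
      rw [norm_mul]
      gcongr
      exact norm_translate_le hA (h _))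
    (by
      filter_upwards [hc] with o ho
      simpa using (tendsto_translate hμ hp hpt hf hg hgs ho).const_mul (w o))
  simpa using this

/-- Moving the translation from the test function to the integrand. -/
theorem integral_translate_comm (hμ : UnifLocFinite μ) [SFinite μ] [SFinite ν] [μ.IsAddRightInvariant]
    {p : ℝ≥0∞} (hp : 1 ≤ p) {f : X → ℝ} (hf : MemLp f p μ) {g : X → ℝ} (hg : Continuous g)
    (hgs : HasCompactSupport g) {w : Ω → ℝ} (hw : Integrable w ν) {Φ : Ω → X} (hΦ : Measurable Φ) :
    Integrable (fun q : Ω × X => w q.1 * (f (q.2 - Φ q.1) * g q.2)) (ν.prod μ) ∧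
      ∫ o, w o * ∫ x, f x * g (x + Φ o) ∂μ ∂ν = ∫ x, g x * ∫ o, w o * f (x - Φ o) ∂ν ∂μ := by
  have hmp : MeasurePreserving (fun q : Ω × X => (q.1, q.2 - Φ q.1)) (ν.prod μ) (ν.prod μ) := by
    refine MeasurePreserving.skew_product (g := fun o x => x - Φ o) (MeasurePreserving.id ν)
      (measurable_snd.sub (hΦ.comp measurable_fst)) (Eventually.of_forall fun o => ?_)
    simp only [sub_eq_add_neg]
    exact (measurePreserving_add_right μ (-Φ o)).map_eq
  have hi : Integrable (fun q : Ω × X => w q.1 * (f (q.2 - Φ q.1) * g q.2)) (ν.prod μ) := by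
    have := hmp.integrable_comp_of_integrable (integrable_translate hμ hp hf hg hgs hw hΦ)
    refine this.congr (Eventually.of_forall fun q => ?_)
    simp
  refine ⟨hi, ?_⟩
  have h := integral_integral_swap (f := fun o x => w o * (f (x - Φ o) * g x)) hi
  simp only [integral_const_mul] at h
  have h1 : ∀ o, ∫ x, f x * g (x + Φ o) ∂μ = ∫ x, f (x - Φ o) * g x ∂μ := fun o => by
    rw [← integral_sub_right_eq_self (fun x => f x * g (x + Φ o)) (Φ o)]
    simp
  simp only [h1, h]
  refine integral_congr_ae (Eventually.of_forall fun x => ?_)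
  simp only
  rw [← integral_const_mul]
  congr 1
  funext o
  ring

end Pairing

end

/-! ### Gaussian averages of a test function along parabolic displacements. -/

section

variable {d : ℕ}

open DecaySpace Topology Filter

theorem GaussClass.integrable {f : E d → ℝ} (hf : GaussClass f) : Integrable f := by
  obtain ⟨C, -, h⟩ := hf.decay (d + 1)
  have h1 : Integrable fun y : E d => (1 + ‖y‖ ^ 2) ^ (-(2 * (d + 1 : ℝ)) / 2) :=
    integrable_rpow_neg_one_add_norm_sq (by
      rw [finrank_euclideanSpace_fin]
      linarith [(Nat.cast_nonneg d : (0 : ℝ) ≤ d)])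
  refine (h1.const_mul C).mono' hf.contDiff.continuous.aestronglyMeasurable (Eventually.of_forall fun y => ?_)
  have h2 : 0 < (1 + ‖y‖ ^ 2) ^ (d + 1) := by positivity
  rw [show -(2 * (d + 1 : ℝ)) / 2 = -((d + 1 : ℕ) : ℝ) by push_cast; ring, Real.rpow_neg (by positivity),
    Real.rpow_natCast, ← div_eq_mul_inv, le_div_iff₀ h2]
  exact h y

theorem integral_gauss : ∫ y : E d, gauss y = 1 := by
  have h := GaussianFourier.integral_rexp_neg_mul_sq_norm (V := E d) (b := 1 / 4) (by norm_num)
  have h2 : ∀ y : E d, gauss y = (4 * Real.pi) ^ (-((d : ℝ) / 2)) * Real.exp (-(1 / 4) * ‖y‖ ^ 2) := fun y => by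
    rw [gauss]; congr 2; ring
  simp only [h2]
  rw [integral_const_mul, h, finrank_euclideanSpace_fin, show Real.pi / (1 / 4) = 4 * Real.pi by ring,
    ← Real.rpow_add (by positivity)]
  simp

theorem gauss_neg (y : E d) : gauss (-y) = gauss y := by simp [gauss]

theorem pd_neg {f : E d → ℝ} {c : ℝ} (h : ∀ y, f (-y) = c * f y) (hf : Differentiable ℝ f) (j : Fin d) (y : E d) :
    pd j f (-y) = -c * pd j f y := by
  have h1 : fderiv ℝ (fun y => f (-y)) y = fderiv ℝ (fun y => c * f y) y := by
    congr 1; funext y; exact h y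
  have h2 : HasFDerivAt (fun y => f (-y)) (-fderiv ℝ f (-y)) y := by
    have := HasFDerivAt.comp (f := fun y : E d => -y) y (hf (-y)).hasFDerivAt (hasFDerivAt_id y).neg
    refine this.congr_fderiv ?_
    ext z
    simp
  rw [h2.fderiv, fderiv_const_mul (hf y)] at h1
  have h3 := congrArg (fun L => L (EuclideanSpace.single j 1)) h1
  simp only [neg_apply, smul_apply, smul_eq_mul] at h3
  unfold pd
  linarith

/-- Three derivatives of an even function. This is the source of the sign in `bOp_third_eq`. -/
theorem third_neg (i j k : Fin d) (y : E d) :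
    pd i (pd j (pd k gauss)) (-y) = -pd i (pd j (pd k gauss)) y := by
  have h1 := pd_neg (c := 1) (fun y => by rw [gauss_neg, one_mul]) GaussClass.gauss.differentiable k
  have h2 := pd_neg h1 (GaussClass.gauss.pd k).differentiable j
  have h3 := pd_neg h2 ((GaussClass.gauss.pd k).pd j).differentiable i y
  rw [h3]; ring

/-- Parabolic displacement. -/
def disp (r τ : ℝ) (z : E d) : ℝ × E d := (r, -(√τ • z))

theorem continuous_disp {A : Type*} [TopologicalSpace A] {r τ : A → ℝ} {z : A → E d} (hr : Continuous r)
    (hτ : Continuous τ) (hz : Continuous z) : Continuous fun q => disp (r q) (τ q) (z q) := by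
  unfold disp
  exact hr.prodMk ((Real.continuous_sqrt.comp hτ).smul hz).neg

theorem IsTest.integrable_mul {Ω : Set (ℝ × E d)} {φ : ℝ × E d → ℝ} (h : IsTest Ω φ) {A : Type*}
    [MeasurableSpace A] {ν : Measure A} {w : A → ℝ} (hw : Integrable w ν) {m : A → ℝ × E d} (hm : Measurable m) :
    Integrable (fun q => w q * φ (m q)) ν := by
  obtain ⟨C, hC⟩ := h.bounded
  exact hw.mul_bdd (c := C) (h.smooth.continuous.measurable.comp hm).aestronglyMeasurable
    (Eventually.of_forall fun q => hC _)

variable {Ω : Set (ℝ × E d)} {ψ : ℝ × E d → ℝ}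

theorem fderiv_disp (h : IsTest Ω ψ) (j : Fin d) (x : ℝ × E d) (r τ : ℝ) (z : E d) :
    fderiv ℝ (fun z => ψ (x + disp r τ z)) z (EuclideanSpace.single j 1) = -√τ * dx j ψ (x + disp r τ z) := by
  have h1 : HasFDerivAt (fun z : E d => x + disp r τ z)
      ((0 : E d →L[ℝ] ℝ).prod (-(√τ • ContinuousLinearMap.id ℝ (E d)))) z :=
    ((hasFDerivAt_const r z).prodMk ((hasFDerivAt_id z).const_smul √τ).neg).const_add x
  have h2 := HasFDerivAt.comp (f := fun z : E d => x + disp r τ z) z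
    (h.smooth.differentiable (by simp) (x + disp r τ z)).hasFDerivAt h1
  have h3 : fderiv ℝ (fun z => ψ (x + disp r τ z)) z = _ := h2.fderiv
  rw [h3, dx, ← smul_eq_mul, ← map_smul]
  simp [dir]

theorem measurable_disp_right (x : ℝ × E d) (r τ : ℝ) : Measurable fun z : E d => x + disp r τ z :=
  (continuous_const.add (continuous_disp continuous_const continuous_const continuous_id)).measurable

/-- Integration by parts in `z`: differentiating `ψ(x + (r, -√τ z))` in `z_j` produces `-√τ ∂_jψ`.
-/
theorem integral_mul_dx {κ : E d → ℝ} (hκ : GaussClass κ) (h : IsTest Ω ψ) (j : Fin d) (x : ℝ × E d) (r τ : ℝ) :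
    √τ * ∫ z, κ z * dx j ψ (x + disp r τ z) = ∫ z, pd j κ z * ψ (x + disp r τ z) := by
  have hm := measurable_disp_right x r τ
  have hi := (h.dx j).integrable_mul hκ.integrable hm
  have hd : Differentiable ℝ fun z : E d => ψ (x + disp r τ z) := by
    have := h.smooth.differentiable (by simp)
    unfold disp
    fun_prop
  have key := integral_mul_fderiv_eq_neg_fderiv_mul_of_integrable (μ := (volume : Measure (E d)))
    (f := κ) (g := fun z => ψ (x + disp r τ z)) (v := EuclideanSpace.single j 1)
    (h.integrable_mul (hκ.pd j).integrable hm)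
    (by
      simp only [fderiv_disp h]
      refine (hi.const_mul (-√τ)).congr (Eventually.of_forall fun z => ?_)
      simp only; ring)
    (h.integrable_mul hκ.integrable hm) (fun z _ => hκ.differentiable z) (fun z _ => hd z)
  simp only [fderiv_disp h] at key
  have e : ∀ z, κ z * (-√τ * dx j ψ (x + disp r τ z)) = -√τ * (κ z * dx j ψ (x + disp r τ z)) := fun z => by ring
  simp only [e, integral_const_mul] at key
  unfold pd
  linarith

/-- The derivative of a function along the curve `τ ↦ x + (s + ατ, -√τ z)`. -/
def curveDeriv (ψ : ℝ × E d → ℝ) (α : ℝ) (x : ℝ × E d) (s : ℝ) (z : E d) (τ : ℝ) : ℝ :=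
  α * dt ψ (x + disp (s + α * τ) τ z) -
    2⁻¹ * τ ^ (-(1 / 2) : ℝ) * ∑ j, z j * dx j ψ (x + disp (s + α * τ) τ z)

theorem hasDerivAt_disp (h : IsTest Ω ψ) (α : ℝ) (x : ℝ × E d) (s : ℝ) (z : E d) {τ : ℝ} (hτ : 0 < τ) :
    HasDerivAt (fun τ => ψ (x + disp (s + α * τ) τ z)) (curveDeriv ψ α x s z τ) τ := by
  have h1 : HasDerivAt (fun τ => x + disp (s + α * τ) τ z) (α, -((1 / (2 * √τ)) • z)) τ := by
    have e1 : HasDerivAt (fun τ => s + α * τ) α τ := by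
      simpa using ((hasDerivAt_id τ).const_mul α).const_add s
    exact (e1.prodMk ((Real.hasDerivAt_sqrt hτ.ne').smul_const z).neg).const_add x
  have h2 := (h.smooth.differentiable (by simp) (x + disp (s + α * τ) τ z)).hasFDerivAt.comp_hasDerivAt τ h1
  refine h2.congr_deriv ?_
  set L := fderiv ℝ ψ (x + disp (s + α * τ) τ z) with hL
  have hz : (0, z) = ∑ j, z j • (dir j : ℝ × E d) := by
    refine Prod.ext ?_ ?_
    · simp [Prod.fst_sum, dir]
    · rw [Prod.snd_sum]
      ext j
      simp [dir, Finset.sum_apply, Pi.single_apply]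
  have e3 : ((α, -((1 / (2 * √τ)) • z)) : ℝ × E d) = α • (1, 0) - (1 / (2 * √τ)) • (0, z) := by
    simp [Prod.smul_mk]
  rw [e3, map_sub, map_smul, map_smul, hz, map_sum]
  simp only [map_smul, smul_eq_mul]
  rw [curveDeriv]
  have e4 : (1 / (2 * √τ)) = 2⁻¹ * τ ^ (-(1 / 2) : ℝ) := by
    rw [Real.rpow_neg hτ.le, ← Real.sqrt_eq_rpow]
    field_simp
  rw [e4]
  rfl

/-- Since `∂_j gauss = -z_j gauss / 2`, integration by parts turns the transport term `-z·∇ψ/(2√τ)`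
into the Laplacian under the Gaussian average. This is the heat equation for the Gaussian mean of
width `√τ`. -/
theorem integral_gauss_curveDeriv (h : IsTest Ω ψ) (α : ℝ) (x : ℝ × E d) (s : ℝ) {τ : ℝ} (hτ : 0 < τ) :
    ∫ z, gauss z * (α * dt ψ (x + disp (s + α * τ) τ z) + lap ψ (x + disp (s + α * τ) τ z)) =
      ∫ z, gauss z * curveDeriv ψ α x s z τ := by
  have hm := measurable_disp_right x (s + α * τ) τ
  have hg : GaussClass (gauss (d := d)) := .gauss
  have i1 := (h.dt.integrable_mul hg.integrable hm).const_mul α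
  have i2 : ∀ j, Integrable fun z => gauss z * dx j (dx j ψ) (x + disp (s + α * τ) τ z) := fun j =>
    ((h.dx j).dx j).integrable_mul hg.integrable hm
  have i3 : ∀ j, Integrable fun z => (z j * gauss z) * dx j ψ (x + disp (s + α * τ) τ z) := fun j =>
    (h.dx j).integrable_mul (GaussClass.coord j _ hg).integrable hm
  have e1 : ∀ z, gauss z * (α * dt ψ (x + disp (s + α * τ) τ z) + lap ψ (x + disp (s + α * τ) τ z)) =
      α * (gauss z * dt ψ (x + disp (s + α * τ) τ z)) +
        ∑ j, gauss z * dx j (dx j ψ) (x + disp (s + α * τ) τ z) := fun z => by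
    rw [lap, mul_add, Finset.mul_sum]; ring
  have e2 : ∀ z, gauss z * curveDeriv ψ α x s z τ =
      α * (gauss z * dt ψ (x + disp (s + α * τ) τ z)) +
        ∑ j, (-(2⁻¹ * τ ^ (-(1 / 2) : ℝ))) * ((z j * gauss z) * dx j ψ (x + disp (s + α * τ) τ z)) := fun z => by
    rw [curveDeriv, ← Finset.mul_sum, mul_sub, sub_eq_add_neg, Finset.mul_sum, Finset.mul_sum, Finset.mul_sum,
      ← Finset.sum_neg_distrib]
    congr 1
    · ring
    · refine Finset.sum_congr rfl fun j _ => by ring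
  simp only [e1, e2]
  rw [integral_add i1 (integrable_finsetSum _ fun j _ => i2 j),
    integral_add i1 (integrable_finsetSum _ fun j _ => (i3 j).const_mul _),
    integral_finsetSum _ fun j _ => i2 j, integral_finsetSum _ fun j _ => (i3 j).const_mul _]
  congr 1
  refine Finset.sum_congr rfl fun j _ => ?_
  have key := integral_mul_dx hg (h.dx j) j x (s + α * τ) τ
  simp only [pd_gauss] at key
  have e3 : ∀ z : E d, -(1 / 2) * (z j * gauss z) * dx j ψ (x + disp (s + α * τ) τ z) =
      -(1 / 2) * ((z j * gauss z) * dx j ψ (x + disp (s + α * τ) τ z)) := fun z => by ring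
  simp only [e3, integral_const_mul] at key
  rw [integral_const_mul]
  have e4 : τ ^ (-(1 / 2) : ℝ) = (√τ)⁻¹ := by rw [Real.rpow_neg hτ.le, ← Real.sqrt_eq_rpow]
  have hs : 0 < √τ := Real.sqrt_pos.2 hτ
  rw [e4]
  field_simp
  linarith

theorem intervalIntegrable_curve_weight {a b : ℝ} : IntervalIntegrable (fun τ : ℝ => τ ^ (-(1 / 2) : ℝ)) volume a b :=
  intervalIntegral.intervalIntegrable_rpow' (by norm_num)

/-- Fundamental theorem of calculus along the curve, then averaging. The derivative is only as
singular as `τ^{-1/2}`, so `a = 0` is allowed. The case `α = 0` is the heat flow at frozen time, and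
`α = 1` the backward heat equation. -/
theorem integral_heat (h : IsTest Ω ψ) (α : ℝ) {a b : ℝ} (ha : 0 ≤ a) (hab : a ≤ b) (x : ℝ × E d) (s : ℝ) :
    ∫ τ in Ioc a b, ∫ z, gauss z * (α * dt ψ (x + disp (s + α * τ) τ z) + lap ψ (x + disp (s + α * τ) τ z)) =
      (∫ z, gauss z * ψ (x + disp (s + α * b) b z)) - ∫ z, gauss z * ψ (x + disp (s + α * a) a z) := by
  have hg : GaussClass (gauss (d := d)) := .gauss
  have e1 : ∫ τ in Ioc a b, ∫ z, gauss z * (α * dt ψ (x + disp (s + α * τ) τ z) + lap ψ (x + disp (s + α * τ) τ z)) =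
      ∫ τ in Ioc a b, ∫ z, gauss z * curveDeriv ψ α x s z τ :=
    setIntegral_congr_fun measurableSet_Ioc fun τ hτ =>
      integral_gauss_curveDeriv h α x s (ha.trans_lt hτ.1)
  have hcd : ∀ z : E d, Continuous fun τ => x + disp (s + α * τ) τ z := fun z =>
    continuous_const.add (continuous_disp (by fun_prop) continuous_id continuous_const)
  have hjm : Measurable fun q : ℝ × E d => x + disp (s + α * q.1) q.1 q.2 :=
    (continuous_const.add (continuous_disp (by fun_prop) continuous_fst continuous_snd)).measurable
  have hwi : Integrable (fun τ : ℝ => τ ^ (-(1 / 2) : ℝ)) (volume.restrict (Ioc a b)) :=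
    (intervalIntegrable_iff_integrableOn_Ioc_of_le hab).1 intervalIntegrable_curve_weight
  have h1i : Integrable (fun _ : ℝ => (1 : ℝ)) (volume.restrict (Ioc a b)) := by simp
  have hint : Integrable (Function.uncurry fun (τ : ℝ) (z : E d) => gauss z * curveDeriv ψ α x s z τ)
      ((volume.restrict (Ioc a b)).prod volume) := by
    have i1 := (h.dt.integrable_mul (h1i.mul_prod hg.integrable) hjm).const_mul α
    have i2 : ∀ j, Integrable (fun q : ℝ × E d => (q.1 ^ (-(1 / 2) : ℝ) * (q.2 j * gauss q.2)) *
        dx j ψ (x + disp (s + α * q.1) q.1 q.2)) ((volume.restrict (Ioc a b)).prod volume) := fun j =>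
      (h.dx j).integrable_mul (hwi.mul_prod (GaussClass.coord j _ hg).integrable) hjm
    refine (i1.add ((integrable_finsetSum Finset.univ fun j _ => i2 j).const_mul (-2⁻¹))).congr
      (Eventually.of_forall fun q => ?_)
    have e : ∑ j, q.1 ^ (-(1 / 2) : ℝ) * (q.2 j * gauss q.2) * dx j ψ (x + disp (s + α * q.1) q.1 q.2) =
        q.1 ^ (-(1 / 2) : ℝ) * gauss q.2 * ∑ j, q.2 j * dx j ψ (x + disp (s + α * q.1) q.1 q.2) := by
      rw [Finset.mul_sum]
      exact Finset.sum_congr rfl fun j _ => by ring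
    simp only [Function.uncurry, Pi.add_apply, curveDeriv, e]
    ring
  have e2 : ∀ z, ∫ τ in Ioc a b, gauss z * curveDeriv ψ α x s z τ =
      gauss z * (ψ (x + disp (s + α * b) b z) - ψ (x + disp (s + α * a) a z)) := fun z => by
    rw [integral_const_mul, ← intervalIntegral.integral_of_le hab,
      intervalIntegral.integral_eq_sub_of_hasDerivAt_of_le hab
        (f := fun τ => ψ (x + disp (s + α * τ) τ z))
        (h.smooth.continuous.comp (hcd z)).continuousOn
        (fun τ hτ => hasDerivAt_disp h α x s z (ha.trans_lt hτ.1))]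
    have c1 : Continuous fun τ => α * dt ψ (x + disp (s + α * τ) τ z) :=
      continuous_const.mul (h.dt.smooth.continuous.comp (hcd z))
    have c2 : Continuous fun τ => ∑ j, z j * dx j ψ (x + disp (s + α * τ) τ z) :=
      continuous_finsetSum _ fun j _ => continuous_const.mul ((h.dx j).smooth.continuous.comp (hcd z))
    exact (c1.intervalIntegrable _ _).sub
      ((intervalIntegrable_curve_weight.const_mul _).mul_continuousOn c2.continuousOn)
  rw [e1, integral_integral_swap hint]
  simp only [e2, mul_sub]
  exact integral_sub (h.integrable_mul hg.integrable (measurable_disp_right _ _ _))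
    (h.integrable_mul hg.integrable (measurable_disp_right _ _ _))

end

/-! ### Averaging over the region `0 < r ≤ T`, `r < τ ≤ R`. -/

section

variable {d : ℕ}

open DecaySpace Topology Filter

/-- The region `0 < r ≤ T`, `r < τ ≤ R`. -/
def tri (T R : ℝ) : Set (ℝ × ℝ) := {q | q.1 ∈ Ioc 0 T ∧ q.2 ∈ Ioc q.1 R}

theorem measurableSet_tri {T R : ℝ} : MeasurableSet (tri T R) := by
  have h1 : MeasurableSet {q : ℝ × ℝ | q.1 ∈ Ioc 0 T} := measurable_fst measurableSet_Ioc
  have h2 : MeasurableSet {q : ℝ × ℝ | q.1 < q.2} := measurableSet_lt measurable_fst measurable_snd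
  have h3 : MeasurableSet {q : ℝ × ℝ | q.2 ≤ R} := measurableSet_le measurable_snd measurable_const
  exact h1.inter (h2.inter h3)

instance {T R : ℝ} : IsFiniteMeasure ((volume : Measure (ℝ × ℝ)).restrict (tri T R)) := ⟨by
  rw [Measure.restrict_apply_univ]
  have : tri T R ⊆ Icc 0 T ×ˢ Icc 0 R := fun q hq =>
    ⟨⟨hq.1.1.le, hq.1.2⟩, (hq.1.1.trans hq.2.1).le, hq.2.2⟩
  exact (measure_mono this).trans_lt (isCompact_Icc.prod isCompact_Icc).measure_lt_top⟩

theorem integral_tri {T R : ℝ} {G : (ℝ × ℝ) × E d → ℝ}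
    (hG : Integrable G ((volume.restrict (tri T R)).prod volume)) :
    ∫ o, G o ∂((volume.restrict (tri T R)).prod volume) =
      ∫ r in Ioc 0 T, ∫ τ in Ioc r R, ∫ z, G ((r, τ), z) := by
  have h1 := hG.integral_prod_left
  rw [integral_prod _ hG, ← integral_indicator measurableSet_tri, Measure.volume_eq_prod, integral_prod,
    ← integral_indicator measurableSet_Ioc]
  · refine integral_congr_ae (Eventually.of_forall fun r => ?_)
    simp only
    by_cases hr : r ∈ Ioc 0 T
    · rw [indicator_of_mem hr, ← integral_indicator measurableSet_Ioc]
      refine integral_congr_ae (Eventually.of_forall fun τ => ?_)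
      simp only
      by_cases hτ : τ ∈ Ioc r R
      · rw [indicator_of_mem hτ, indicator_of_mem (show (r, τ) ∈ tri T R from ⟨hr, hτ⟩)]
      · rw [indicator_of_notMem hτ, indicator_of_notMem (fun h => hτ h.2)]
    · rw [indicator_of_notMem hr]
      have : ∀ τ, (tri T R).indicator (fun q => ∫ z, G (q, z)) (r, τ) = 0 := fun τ =>
        indicator_of_notMem (fun h => hr h.1) _
      simp only [this, integral_zero]
  · rw [← Measure.volume_eq_prod]
    exact (integrable_indicator_iff measurableSet_tri).2 h1

theorem integrable_gauss_snd {A : Type*} [MeasurableSpace A] (ν : Measure A) [IsFiniteMeasure ν] :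
    Integrable (fun o : A × E d => gauss o.2) (ν.prod volume) := by
  have h : Integrable (fun _ : A => (1 : ℝ)) ν := integrable_const 1
  simpa using h.mul_prod GaussClass.gauss.integrable

theorem measurable_disp_tri : Measurable fun o : (ℝ × ℝ) × E d => disp o.1.1 o.1.2 o.2 :=
  (continuous_disp (by fun_prop) (by fun_prop) (by fun_prop)).measurable

theorem measurable_add_disp_tri (x : ℝ × E d) :
    Measurable fun o : (ℝ × ℝ) × E d => x + disp o.1.1 o.1.2 o.2 := measurable_disp_tri.const_add x

theorem tendsto_disp {r : ℝ} {z : E d} (hz : z ≠ 0) :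
    Tendsto (fun n : ℕ => disp r n z) atTop (Bornology.cobounded (ℝ × E d)) := by
  rw [← tendsto_norm_atTop_iff_cobounded]
  have h1 : Tendsto (fun n : ℕ => √(n : ℝ) * ‖z‖) atTop atTop :=
    (Real.tendsto_sqrt_atTop.comp tendsto_natCast_atTop_atTop).atTop_mul_const (norm_pos_iff.2 hz)
  refine tendsto_atTop_mono (fun n => ?_) h1
  have := norm_snd_le (disp r (n : ℝ) z)
  rwa [disp, norm_neg, norm_smul, Real.norm_of_nonneg (Real.sqrt_nonneg _)] at this

theorem ae_ne_zero (hd : 1 ≤ d) : ∀ᵐ z : E d, z ≠ 0 := by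
  have : Nonempty (Fin d) := ⟨⟨0, hd⟩⟩
  have : Nontrivial (E d) := inferInstance
  rw [ae_iff]
  simp

section FDerivComm

variable {X : Type*} [NormedAddCommGroup X] [NormedSpace ℝ X] {Ω : Set X} {φ : X → ℝ}

theorem IsTest.fderiv_comm (h : IsTest Ω φ) (v w z : X) :
    fderiv ℝ (fun y => fderiv ℝ φ y v) z w = fderiv ℝ (fun y => fderiv ℝ φ y w) z v := by
  have h1 : DifferentiableAt ℝ (fderiv ℝ φ) z :=
    ((h.smooth.fderiv_right (m := 1) (by norm_cast)).differentiable (by simp)) z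
  have e : ∀ v w, fderiv ℝ (fun y => fderiv ℝ φ y v) z w = fderiv ℝ (fderiv ℝ φ) z w v := fun v w => by
    have := (h1.hasFDerivAt.clm_apply (hasFDerivAt_const v z)).fderiv
    rw [this]; simp
  have hs : IsSymmSndFDerivAt ℝ φ z := h.smooth.contDiffAt.isSymmSndFDerivAt (by
    simp only [minSmoothness_of_isRCLikeNormedField]
    exact WithTop.coe_le_coe.2 (le_top : (2 : ℕ∞) ≤ ⊤))
  rw [e, e, hs.eq]

end FDerivComm

variable {Ω : Set (ℝ × E d)} {ψ : ℝ × E d → ℝ}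

theorem IsTest.dx_comm (h : IsTest Ω ψ) (i j : Fin d) : NavierStokes.dx i (NavierStokes.dx j ψ) = NavierStokes.dx j (NavierStokes.dx i ψ) :=
  funext fun z => h.fderiv_comm _ _ z

theorem IsTest.dx_dt (h : IsTest Ω ψ) (i : Fin d) : NavierStokes.dx i (NavierStokes.dt ψ) = NavierStokes.dt (NavierStokes.dx i ψ) :=
  funext fun z => h.fderiv_comm _ _ z

theorem IsTest.translate {T : ℝ} (h : IsTest (strip d T) ψ) {c : ℝ × E d} (hc : 0 ≤ c.1) :
    IsTest (Iio T ×ˢ univ) fun z => ψ (z + c) := by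
  refine ⟨h.smooth.comp (contDiff_id.add contDiff_const), h.compact.comp_homeomorph (Homeomorph.addRight c), ?_⟩
  have : tsupport (fun z => ψ (z + c)) = (fun z => z + c) ⁻¹' tsupport ψ :=
    tsupport_comp_eq_preimage ψ (Homeomorph.addRight c)
  rw [this]
  intro z hz
  have h1 := (h.supp hz).1.2
  refine ⟨?_, mem_univ _⟩
  have h2 : (z + c).1 = z.1 + c.1 := rfl
  rw [h2] at h1
  exact mem_Iio.2 (by linarith)

theorem dx_translate (j : Fin d) (ψ : ℝ × E d → ℝ) (c : ℝ × E d) :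
    dx j (fun z => ψ (z + c)) = fun z => dx j ψ (z + c) := by
  funext z; unfold dx; rw [fderiv_comp_add_right]

theorem dt_translate (ψ : ℝ × E d → ℝ) (c : ℝ × E d) :
    dt (fun z => ψ (z + c)) = fun z => dt ψ (z + c) := by
  funext z; unfold dt; rw [fderiv_comp_add_right]

theorem lap_translate (ψ : ℝ × E d → ℝ) (c : ℝ × E d) :
    lap (fun z => ψ (z + c)) = fun z => lap ψ (z + c) := by
  funext z; unfold lap; simp only [dx_translate]

theorem integral_gauss_mul_const (c : ℝ) : ∫ z : E d, gauss z * c = c := by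
  rw [integral_mul_const, integral_gauss, one_mul]

/-- Integrating first in `τ` removes the outer Laplacian and leaves `(∂_t + Δ)ψ` at `τ = R` and,
with a minus sign, at `τ = r`. Along the diagonal `τ = r` the flow with `α = 1` integrates this to
`-ψ(x)`, because `ψ` vanishes from time `T` on. At `τ = R` the time derivative integrates out,
leaving the averages that disappear as `R → ∞`. -/
theorem integral_tri_heat {R T : ℝ} (hT : 0 < T) (hTR : T ≤ R) (h : IsTest (strip d T) ψ)
    {x : ℝ × E d} (hx : x ∈ strip d T) :
    ∫ o, gauss o.2 * lap (fun z => dt ψ z + lap ψ z) (x + disp o.1.1 o.1.2 o.2)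
        ∂((volume.restrict (tri T R)).prod (volume : Measure (E d))) =
      ψ x - (∫ z, gauss z * ψ (x + disp 0 R z)) +
        ∫ o, gauss o.2 * lap ψ (x + disp o.1 R o.2) ∂((volume.restrict (Ioc 0 T)).prod (volume : Measure (E d))) := by
  have hχ : IsTest (strip d T) fun z => dt ψ z + lap ψ z := h.dt.add h.lap
  have hg : GaussClass (gauss (d := d)) := .gauss
  have hgi := integrable_gauss_snd (d := d) (volume.restrict (Ioc (0 : ℝ) T))
  have hmR : Measurable fun o : ℝ × E d => x + disp o.1 R o.2 :=
    (continuous_const.add (continuous_disp (by fun_prop) (by fun_prop) (by fun_prop))).measurable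
  have hmr : Measurable fun o : ℝ × E d => x + disp o.1 o.1 o.2 :=
    (continuous_const.add (continuous_disp (by fun_prop) (by fun_prop) (by fun_prop))).measurable
  have hzero : ∀ τ z, ψ (x + disp T τ z) = 0 := fun τ z => h.eq_zero fun hc => by
    have := hc.1.2
    have h2 : (x + disp T τ z).1 = x.1 + T := rfl
    rw [h2] at this
    linarith [hx.1.1]
  rw [integral_tri (hχ.lap.integrable_mul (integrable_gauss_snd _) (measurable_add_disp_tri x))]
  have e1 : ∀ r ∈ Ioc 0 T, ∫ τ in Ioc r R, ∫ z, gauss z * lap (fun z => dt ψ z + lap ψ z) (x + disp r τ z) =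
      (∫ z, gauss z * (dt ψ (x + disp r R z) + lap ψ (x + disp r R z))) -
        ∫ z, gauss z * (dt ψ (x + disp r r z) + lap ψ (x + disp r r z)) := fun r hr => by
    simpa using integral_heat hχ 0 hr.1.le (hr.2.trans hTR) x r
  rw [setIntegral_congr_fun measurableSet_Ioc e1]
  have iR : Integrable (fun o : ℝ × E d => gauss o.2 * (dt ψ (x + disp o.1 R o.2) + lap ψ (x + disp o.1 R o.2)))
      ((volume.restrict (Ioc 0 T)).prod volume) := hχ.integrable_mul hgi hmR
  have ir : Integrable (fun o : ℝ × E d => gauss o.2 * (dt ψ (x + disp o.1 o.1 o.2) + lap ψ (x + disp o.1 o.1 o.2)))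
      ((volume.restrict (Ioc 0 T)).prod volume) := hχ.integrable_mul hgi hmr
  rw [integral_sub iR.integral_prod_left ir.integral_prod_left]
  have e2 : ∫ r in Ioc 0 T, ∫ z, gauss z * (dt ψ (x + disp r r z) + lap ψ (x + disp r r z)) = -ψ x := by
    have := integral_heat h 1 le_rfl hT.le x 0
    simp only [one_mul, zero_add, hzero, mul_zero, integral_zero] at this
    rw [this]
    have e : ∀ z : E d, x + disp 0 0 z = x := fun z => by simp [disp]
    simp only [e, integral_gauss_mul_const]
    ring
  have iR1 := h.dt.integrable_mul hgi hmR
  have iR2 := h.lap.integrable_mul hgi hmR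
  have e3 : ∫ r in Ioc 0 T, ∫ z, gauss z * (dt ψ (x + disp r R z) + lap ψ (x + disp r R z)) =
      (∫ o, gauss o.2 * dt ψ (x + disp o.1 R o.2) ∂((volume.restrict (Ioc 0 T)).prod (volume : Measure (E d)))) +
      ∫ o, gauss o.2 * lap ψ (x + disp o.1 R o.2) ∂((volume.restrict (Ioc 0 T)).prod (volume : Measure (E d))) := by
    rw [← integral_add iR1 iR2, ← integral_prod _ iR]
    simp only [mul_add]
  have e4 : ∫ o, gauss o.2 * dt ψ (x + disp o.1 R o.2) ∂((volume.restrict (Ioc 0 T)).prod (volume : Measure (E d))) =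
      -∫ z, gauss z * ψ (x + disp 0 R z) := by
    rw [integral_prod_symm _ iR1, ← integral_neg]
    refine integral_congr_ae (Eventually.of_forall fun z => ?_)
    simp only
    have hc : Continuous fun r => x + disp r R z :=
      continuous_const.add (continuous_disp continuous_id continuous_const continuous_const)
    rw [integral_const_mul, ← intervalIntegral.integral_of_le hT.le,
      intervalIntegral.integral_eq_sub_of_hasDerivAt (f := fun r => ψ (x + disp r R z)), hzero]
    · ring
    · intro r _
      have h1 : HasDerivAt (fun r => x + disp r R z) ((1, 0) : ℝ × E d) r :=
        ((hasDerivAt_id r).prodMk (hasDerivAt_const r _)).const_add x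
      exact (h.smooth.differentiable (by simp) (x + disp r R z)).hasFDerivAt.comp_hasDerivAt r h1
    · exact (h.dt.smooth.continuous.comp hc).intervalIntegrable _ _
  rw [e2, e3, e4]
  ring

theorem integral_tri_lap {R T : ℝ} (hTR : T ≤ R) (h : IsTest Ω ψ) (x : ℝ × E d) :
    ∫ o, gauss o.2 * lap ψ (x + disp o.1.1 o.1.2 o.2) ∂((volume.restrict (tri T R)).prod (volume : Measure (E d))) =
      (∫ o, gauss o.2 * ψ (x + disp o.1 R o.2) ∂((volume.restrict (Ioc 0 T)).prod (volume : Measure (E d)))) -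
        ∫ o, gauss o.2 * ψ (x + disp o.1 o.1 o.2) ∂((volume.restrict (Ioc 0 T)).prod (volume : Measure (E d))) := by
  have hgi := integrable_gauss_snd (d := d) (volume.restrict (Ioc (0 : ℝ) T))
  have hmR : Measurable fun o : ℝ × E d => x + disp o.1 R o.2 :=
    (continuous_const.add (continuous_disp (by fun_prop) (by fun_prop) (by fun_prop))).measurable
  have hmr : Measurable fun o : ℝ × E d => x + disp o.1 o.1 o.2 :=
    (continuous_const.add (continuous_disp (by fun_prop) (by fun_prop) (by fun_prop))).measurable
  have iR := h.integrable_mul hgi hmR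
  have ir := h.integrable_mul hgi hmr
  rw [integral_tri (h.lap.integrable_mul (integrable_gauss_snd _) (measurable_add_disp_tri x)),
    integral_prod _ iR, integral_prod _ ir, ← integral_sub iR.integral_prod_left ir.integral_prod_left]
  refine setIntegral_congr_fun measurableSet_Ioc fun r hr => ?_
  simpa using integral_heat h 0 hr.1.le (hr.2.trans hTR) x r

/-- Three integrations by parts, each costing `τ^{-1/2}`. -/
theorem integral_gauss_dx_dx_dx (h : IsTest Ω ψ) (i j k : Fin d) (x : ℝ × E d) (r : ℝ) {τ : ℝ} (hτ : 0 < τ) :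
    ∫ z, gauss z * dx k (dx j (dx i ψ)) (x + disp r τ z) =
      τ ^ (-(3 / 2) : ℝ) * ∫ z, pd i (pd j (pd k gauss)) z * ψ (x + disp r τ z) := by
  have h1 := integral_mul_dx .gauss ((h.dx i).dx j) k x r τ
  have h2 := integral_mul_dx (GaussClass.gauss.pd k) (h.dx i) j x r τ
  have h3 := integral_mul_dx ((GaussClass.gauss.pd k).pd j) h i x r τ
  have hs : 0 < √τ := Real.sqrt_pos.2 hτ
  have e : τ ^ (-(3 / 2) : ℝ) = (√τ)⁻¹ ^ 3 := by
    rw [Real.sqrt_eq_rpow, ← Real.rpow_neg hτ.le, ← Real.rpow_natCast, ← Real.rpow_mul hτ.le]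
    norm_num
  rw [e, ← h3, ← h2, ← h1]
  field_simp

end

/-! ### The limit of infinite averaging width. -/

section

variable {d : ℕ}

open DecaySpace Topology Filter

theorem unifLocFinite_stripMeasure (T : ℝ) : UnifLocFinite (stripMeasure d T) := by
  intro ρ
  refine ⟨volume (Metric.closedBall (0 : ℝ × E d) ρ), (isCompact_closedBall _ _).measure_lt_top, fun c => ?_⟩
  refine (Measure.restrict_apply_le _ _).trans (le_of_eq ?_)
  have := measure_preimage_add_right (volume : Measure (ℝ × E d)) (-c) (Metric.closedBall 0 ρ)
  rw [← this]
  congr 1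
  ext x
  simp [← sub_eq_add_neg, dist_eq_norm]

/-- The spatial measure on the initial slice. -/
def initMeasure (d : ℕ) : Measure (ℝ × E d) := (volume : Measure (E d)).map fun y => ((0 : ℝ), y)

theorem measurableEmbedding_init : MeasurableEmbedding fun y : E d => ((0 : ℝ), y) :=
  measurableEmbedding_prodMk_left 0

instance : SFinite (initMeasure d) := by unfold initMeasure; infer_instance

theorem unifLocFinite_initMeasure : UnifLocFinite (initMeasure d) := by
  intro ρ
  refine ⟨volume (Metric.closedBall (0 : E d) ρ), (isCompact_closedBall _ _).measure_lt_top, fun c => ?_⟩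
  rw [initMeasure, measurableEmbedding_init.map_apply]
  have := measure_preimage_add_right (volume : Measure (E d)) (-c.2) (Metric.closedBall 0 ρ)
  rw [← this]
  refine measure_mono fun y hy => ?_
  have h1 := norm_snd_le (((0 : ℝ), y) - c)
  have h2 : ‖((0 : ℝ), y) - c‖ ≤ ρ := mem_closedBall_iff_norm.1 hy
  simp only [mem_preimage, mem_closedBall_iff_norm, sub_zero, ← sub_eq_add_neg]
  exact h1.trans h2

theorem integral_initMeasure (f : ℝ × E d → ℝ) : ∫ x, f x ∂initMeasure d = ∫ y, f (0, y) :=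
  measurableEmbedding_init.integral_map f

theorem memLp_initMeasure {p : ℝ≥0∞} {a : E d → ℝ} (ha : MemLp a p) :
    MemLp (fun x : ℝ × E d => a x.2) p (initMeasure d) := by
  rw [initMeasure, measurableEmbedding_init.memLp_map_measure_iff]
  exact ha

instance {T : ℝ} : SFinite (stripMeasure d T) := by unfold stripMeasure; infer_instance

section Limits

variable {T : ℝ} {ψ : ℝ × E d → ℝ} {p : ℝ≥0∞}

/-- By `integral_tri_heat` the error consists of averages of pairings with test functions displaced
by `√n z`. For `z ≠ 0` these escape to infinity, so they vanish by `tendsto_integral_translate`. -/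
theorem tendsto_pairing_heat (hd : 1 ≤ d) (hT : 0 < T) (hp : 1 ≤ p) (hpt : p ≠ ⊤) {u : ℝ × E d → ℝ}
    (hu : MemLp u p (stripMeasure d T)) (h : IsTest (strip d T) ψ) :
    Tendsto (fun n : ℕ => ∫ o, gauss o.2 * ∫ x, u x * lap (fun z => dt ψ z + lap ψ z) (x + disp o.1.1 o.1.2 o.2)
        ∂stripMeasure d T ∂((volume.restrict (tri T n)).prod (volume : Measure (E d)))) atTop
      (𝓝 (∫ x, u x * ψ x ∂stripMeasure d T)) := by
  have hμ := unifLocFinite_stripMeasure (d := d) T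
  have hχ : IsTest (strip d T) (lap fun z => dt ψ z + lap ψ z) := (h.dt.add h.lap).lap
  have hgi := integrable_gauss_snd (d := d) (volume.restrict (Ioc (0 : ℝ) T))
  have hg : GaussClass (gauss (d := d)) := .gauss
  have m1 : ∀ n : ℕ, Measurable fun z : E d => disp 0 n z := fun n =>
    (continuous_disp (by fun_prop) (by fun_prop) (by fun_prop)).measurable
  have m2 : ∀ n : ℕ, Measurable fun o : ℝ × E d => disp o.1 n o.2 := fun n =>
    (continuous_disp (by fun_prop) (by fun_prop) (by fun_prop)).measurable
  have hz : ∀ᵐ o ∂((volume.restrict (Ioc 0 T)).prod (volume : Measure (E d))), o.2 ≠ 0 :=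
    Measure.quasiMeasurePreserving_snd.ae (ae_ne_zero hd)
  have l1 := tendsto_integral_translate hμ hp hpt hu h.smooth.continuous h.compact hg.integrable m1
    (by filter_upwards [ae_ne_zero hd] with z hz using tendsto_disp hz)
  have l2 := tendsto_integral_translate hμ hp hpt hu h.lap.smooth.continuous h.lap.compact hgi m2
    (by filter_upwards [hz] with z hz using tendsto_disp hz)
  have l3 := (tendsto_const_nhds (x := ∫ x, u x * ψ x ∂stripMeasure d T)).sub l1 |>.add l2
  rw [sub_zero, add_zero] at l3
  refine l3.congr' ?_
  filter_upwards [(tendsto_natCast_atTop_atTop (R := ℝ)).eventually_ge_atTop T] with n hn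
  have hui : Integrable (fun x => u x * ψ x) (stripMeasure d T) := by
    obtain ⟨A, hA, hb⟩ := exists_lintegral_translate_le hμ hp hu h.smooth.continuous h.compact
    refine ⟨hu.1.mul h.smooth.continuous.aestronglyMeasurable, ?_⟩
    have := hb 0
    simp only [add_zero] at this
    exact this.trans_lt hA
  have i1 := integrable_mul_integral_translate hμ hp hu h.smooth.continuous h.compact hg.integrable (m1 n)
  have i01 : Integrable (fun x => u x * ψ x - u x * ∫ z, gauss z * ψ (x + disp 0 n z)) (stripMeasure d T) := hui.sub i1
  have i2 := integrable_mul_integral_translate hμ hp hu h.lap.smooth.continuous h.lap.compact hgi (m2 n)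
  rw [integral_translate_swap hμ hp hu h.smooth.continuous h.compact hg.integrable (m1 n),
    integral_translate_swap hμ hp hu h.lap.smooth.continuous h.lap.compact hgi (m2 n),
    integral_translate_swap hμ hp hu hχ.smooth.continuous hχ.compact (integrable_gauss_snd _) measurable_disp_tri,
    ← integral_sub hui i1, ← integral_add i01 i2]
  refine integral_congr_ae ?_
  filter_upwards [ae_restrict_mem measurableSet_strip] with x hx
  rw [integral_tri_heat hT hn h hx]
  ring

theorem tendsto_pairing_initial (hd : 1 ≤ d) (hp : 1 ≤ p) (hpt : p ≠ ⊤) {a : E d → ℝ}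
    (ha : MemLp a p) {Ω : Set (ℝ × E d)} (h : IsTest Ω ψ) :
    Tendsto (fun n : ℕ => ∫ o, gauss o.2 * ∫ x, a x.2 * lap ψ (x + disp o.1.1 o.1.2 o.2)
        ∂initMeasure d ∂((volume.restrict (tri T n)).prod (volume : Measure (E d)))) atTop
      (𝓝 (-∫ o, gauss o.2 * ∫ x, a x.2 * ψ (x + disp o.1 o.1 o.2) ∂initMeasure d
        ∂((volume.restrict (Ioc 0 T)).prod (volume : Measure (E d))))) := by
  have hμ := unifLocFinite_initMeasure (d := d)
  have hu := memLp_initMeasure ha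
  have hgi := integrable_gauss_snd (d := d) (volume.restrict (Ioc (0 : ℝ) T))
  have m1 : Measurable fun o : ℝ × E d => disp o.1 o.1 o.2 :=
    (continuous_disp (by fun_prop) (by fun_prop) (by fun_prop)).measurable
  have m2 : ∀ n : ℕ, Measurable fun o : ℝ × E d => disp o.1 n o.2 := fun n =>
    (continuous_disp (by fun_prop) (by fun_prop) (by fun_prop)).measurable
  have hz : ∀ᵐ o ∂((volume.restrict (Ioc 0 T)).prod (volume : Measure (E d))), o.2 ≠ 0 :=
    Measure.quasiMeasurePreserving_snd.ae (ae_ne_zero hd)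
  have l2 := tendsto_integral_translate hμ hp hpt hu h.smooth.continuous h.compact hgi m2
    (by filter_upwards [hz] with z hz using tendsto_disp hz)
  have l3 := l2.sub_const (∫ o, gauss o.2 * ∫ x, a x.2 * ψ (x + disp o.1 o.1 o.2) ∂initMeasure d
        ∂((volume.restrict (Ioc 0 T)).prod (volume : Measure (E d))))
  rw [zero_sub] at l3
  refine l3.congr' ?_
  filter_upwards [(tendsto_natCast_atTop_atTop (R := ℝ)).eventually_ge_atTop T] with n hn
  have i1 := integrable_mul_integral_translate hμ hp hu h.smooth.continuous h.compact hgi m1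
  have i2 := integrable_mul_integral_translate hμ hp hu h.smooth.continuous h.compact hgi (m2 n)
  rw [integral_translate_swap hμ hp hu h.smooth.continuous h.compact hgi m1,
    integral_translate_swap hμ hp hu h.smooth.continuous h.compact hgi (m2 n),
    integral_translate_swap hμ hp hu h.lap.smooth.continuous h.lap.compact (integrable_gauss_snd _) measurable_disp_tri,
    ← integral_sub i2 i1]
  refine integral_congr_ae (Eventually.of_forall fun x => ?_)
  simp only
  rw [integral_tri_lap hn h]
  ring

/-- The union of the regions `tri T R`. -/
def cone (T : ℝ) : Set (ℝ × ℝ) := {q | q.1 ∈ Ioc 0 T ∧ q.1 < q.2}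

theorem measurableSet_cone : MeasurableSet (cone T) := by
  have h1 : MeasurableSet {q : ℝ × ℝ | q.1 ∈ Ioc 0 T} := measurable_fst measurableSet_Ioc
  exact h1.inter (measurableSet_lt measurable_fst measurable_snd)

theorem iUnion_tri : ⋃ n : ℕ, tri T n = cone T := by
  ext q
  simp only [mem_iUnion, tri, cone]
  constructor
  · rintro ⟨n, h1, h2⟩
    exact ⟨h1, h2.1⟩
  · rintro ⟨h1, h2⟩
    obtain ⟨n, hn⟩ := exists_nat_ge q.2
    exact ⟨n, h1, h2, hn⟩

/-- The inner integral is `∫_r^∞ τ^{-3/2} dτ = 2 r^{-1/2}`, integrable on `(0, T]`. -/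
theorem integrable_cone_weight : Integrable (fun q : ℝ × ℝ => q.2 ^ (-(3 / 2) : ℝ)) (volume.restrict (cone T)) := by
  have hm : Measurable fun q : ℝ × ℝ => (cone T).indicator (fun q : ℝ × ℝ => q.2 ^ (-(3 / 2) : ℝ)) q :=
    (measurable_snd.pow_const _).indicator measurableSet_cone
  rw [← IntegrableOn, ← integrable_indicator_iff measurableSet_cone, Measure.volume_eq_prod,
    integrable_prod_iff hm.aestronglyMeasurable]
  have e : ∀ r, (fun τ => (cone T).indicator (fun q : ℝ × ℝ => q.2 ^ (-(3 / 2) : ℝ)) (r, τ)) =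
      if r ∈ Ioc 0 T then (Ioi r).indicator (fun τ => τ ^ (-(3 / 2) : ℝ)) else 0 := fun r => by
    funext τ
    by_cases hr : r ∈ Ioc 0 T
    · rw [if_pos hr]
      by_cases hτ : τ ∈ Ioi r
      · rw [indicator_of_mem hτ, indicator_of_mem (show (r, τ) ∈ cone T from ⟨hr, hτ⟩)]
      · rw [indicator_of_notMem hτ, indicator_of_notMem (fun h => hτ h.2)]
    · rw [if_neg hr, indicator_of_notMem (fun h => hr h.1)]
      rfl
  constructor
  · refine Eventually.of_forall fun r => ?_
    rw [e]
    split_ifs with hr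
    · rw [integrable_indicator_iff measurableSet_Ioi]
      exact integrableOn_Ioi_rpow_of_lt (by norm_num) hr.1
    · exact integrable_zero _ _ _
  · have e2 : ∀ r, ∫ τ, ‖(cone T).indicator (fun q : ℝ × ℝ => q.2 ^ (-(3 / 2) : ℝ)) (r, τ)‖ =
        (Ioc 0 T).indicator (fun r => 2 * r ^ (-(1 / 2) : ℝ)) r := fun r => by
      by_cases hr : r ∈ Ioc 0 T
      · have e3 : ∀ τ, ‖(cone T).indicator (fun q : ℝ × ℝ => q.2 ^ (-(3 / 2) : ℝ)) (r, τ)‖ =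
            (Ioi r).indicator (fun τ => τ ^ (-(3 / 2) : ℝ)) τ := fun τ => by
          have := congrFun (e r) τ
          simp only [if_pos hr] at this
          rw [this, Real.norm_of_nonneg]
          exact indicator_nonneg (fun τ hτ => Real.rpow_nonneg (hr.1.trans hτ).le _) _
        simp only [e3]
        rw [integral_indicator measurableSet_Ioi, integral_Ioi_rpow_of_lt (by norm_num) hr.1,
          indicator_of_mem hr]
        norm_num
        ring
      · have := e r
        rw [if_neg hr] at this
        rw [indicator_of_notMem hr]
        have e3 : ∀ τ, (cone T).indicator (fun q : ℝ × ℝ => q.2 ^ (-(3 / 2) : ℝ)) (r, τ) = 0 := fun τ => congrFun this τ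
        simp [e3]
    simp only [e2]
    rw [integrable_indicator_iff measurableSet_Ioc]
    have h1 : IntegrableOn (fun r : ℝ => r ^ (-(1 / 2) : ℝ)) (Ioc 0 T) := by
      rcases le_total 0 T with hT | hT
      · exact (intervalIntegrable_iff_integrableOn_Ioc_of_le hT).1 intervalIntegrable_curve_weight
      · simp [Ioc_eq_empty (not_lt.2 hT)]
    exact h1.const_mul 2

/-- With all three derivatives moved onto the Gaussian, the weight is integrable over the whole
unbounded region, so the limit is taken by monotone exhaustion. -/
theorem tendsto_pairing_third (hp : 1 ≤ p) {F : ℝ × E d → ℝ}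
    (hF : MemLp F p (stripMeasure d T)) {Ω : Set (ℝ × E d)} (h : IsTest Ω ψ) (i j k : Fin d) :
    Tendsto (fun n : ℕ => ∫ o, gauss o.2 * ∫ x, F x * dx k (dx j (dx i ψ)) (x + disp o.1.1 o.1.2 o.2)
        ∂stripMeasure d T ∂((volume.restrict (tri T n)).prod (volume : Measure (E d)))) atTop
      (𝓝 (∫ o, o.1.2 ^ (-(3 / 2) : ℝ) * pd i (pd j (pd k gauss)) o.2 * ∫ x, F x * ψ (x + disp o.1.1 o.1.2 o.2)
        ∂stripMeasure d T ∂((volume.restrict (cone T)).prod (volume : Measure (E d))))) := by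
  have hμ := unifLocFinite_stripMeasure (d := d) T
  have hw : Integrable (fun o : (ℝ × ℝ) × E d => o.1.2 ^ (-(3 / 2) : ℝ) * pd i (pd j (pd k gauss)) o.2)
      ((volume.restrict (cone T)).prod volume) := integrable_cone_weight.mul_prod (GaussClass.third i j k).integrable
  have hres : ∀ s : Set (ℝ × ℝ), (volume.restrict s).prod (volume : Measure (E d)) =
      (volume : Measure ((ℝ × ℝ) × E d)).restrict (s ×ˢ univ) := fun s => by
    rw [Measure.volume_eq_prod (ℝ × ℝ) (E d), ← Measure.prod_restrict, Measure.restrict_univ]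
  have hsub : ∀ n : ℕ, tri T n ⊆ cone T := fun n => by rw [← iUnion_tri]; exact subset_iUnion (fun n : ℕ => tri T n) n
  have hwn : ∀ n : ℕ, Integrable (fun o : (ℝ × ℝ) × E d => o.1.2 ^ (-(3 / 2) : ℝ) * pd i (pd j (pd k gauss)) o.2)
      ((volume.restrict (tri T n)).prod volume) := fun n => by
    rw [hres]
    rw [hres] at hw
    exact hw.mono_measure (Measure.restrict_mono (prod_mono (hsub n) Subset.rfl) le_rfl)
  have h3 := (h.dx i).dx j |>.dx k
  have key : ∀ n : ℕ, ∫ o, gauss o.2 * ∫ x, F x * dx k (dx j (dx i ψ)) (x + disp o.1.1 o.1.2 o.2)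
        ∂stripMeasure d T ∂((volume.restrict (tri T n)).prod (volume : Measure (E d))) =
      ∫ o, o.1.2 ^ (-(3 / 2) : ℝ) * pd i (pd j (pd k gauss)) o.2 * ∫ x, F x * ψ (x + disp o.1.1 o.1.2 o.2)
        ∂stripMeasure d T ∂((volume.restrict (tri T n)).prod (volume : Measure (E d))) := fun n => by
    rw [integral_translate_swap hμ hp hF h3.smooth.continuous h3.compact (integrable_gauss_snd _) measurable_disp_tri,
      integral_translate_swap hμ hp hF h.smooth.continuous h.compact (hwn n) measurable_disp_tri]
    refine integral_congr_ae (Eventually.of_forall fun x => ?_)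
    simp only
    congr 1
    rw [integral_prod _ (h3.integrable_mul (integrable_gauss_snd _) (measurable_add_disp_tri x)),
      integral_prod _ (h.integrable_mul (hwn n) (measurable_add_disp_tri x))]
    refine setIntegral_congr_fun measurableSet_tri fun q hq => ?_
    simp only
    rw [integral_gauss_dx_dx_dx h i j k x q.1 (hq.1.1.trans hq.2.1), ← integral_const_mul]
    simp only [mul_assoc]
  simp only [key]
  have hi := integrable_mul_translate hμ hp hF h.smooth.continuous h.compact hw measurable_disp_tri
  have hun : ⋃ n : ℕ, tri T n ×ˢ (univ : Set (E d)) = cone T ×ˢ univ := by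
    rw [← iUnion_tri, iUnion_prod_const]
  rw [hres, ← hun] at hi
  have := tendsto_setIntegral_of_monotone (fun n : ℕ => (measurableSet_tri (T := T) (R := n)).prod MeasurableSet.univ)
    (fun m n hmn => prod_mono (fun q hq => ⟨hq.1, hq.2.1, hq.2.2.trans (by exact_mod_cast hmn)⟩) Subset.rfl) hi
  simp only [hres]
  rw [hun] at this
  exact this

end Limits

end

/-! ### Identification of the limits with the kernel operators. -/

section

variable {d : ℕ}

open DecaySpace Topology Filter

theorem integral_comp_affine {c : ℝ} (hc : 0 < c) (x : E d) (G : E d → ℝ) :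
    ∫ z, G (x + c • z) = (c ^ d)⁻¹ * ∫ y, G y := by
  rw [Measure.integral_comp_smul volume (fun y => G (x + y)) c, integral_add_left_eq_self G x,
    finrank_euclideanSpace_fin, smul_eq_mul, abs_of_pos (by positivity)]

theorem sqrt_pow_inv {τ : ℝ} (hτ : 0 < τ) : (√τ ^ d)⁻¹ = τ ^ (-((d : ℝ) / 2)) := by
  rw [Real.sqrt_eq_rpow, ← Real.rpow_natCast, ← Real.rpow_mul hτ.le, ← Real.rpow_neg hτ.le]
  congr 1; ring

theorem integral_mul_comp_affine {τ : ℝ} (hτ : 0 < τ) (x : E d) (κ G : E d → ℝ) :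
    ∫ z, κ z * G (x + √τ • z) = τ ^ (-((d : ℝ) / 2)) * ∫ y, κ ((√τ)⁻¹ • (y - x)) * G y := by
  have hs : 0 < √τ := Real.sqrt_pos.2 hτ
  rw [← sqrt_pow_inv hτ, ← integral_comp_affine hs x fun y => κ ((√τ)⁻¹ • (y - x)) * G y]
  refine integral_congr_ae (Eventually.of_forall fun z => ?_)
  simp only [add_sub_cancel_left, smul_smul, inv_mul_cancel₀ hs.ne', one_smul]

theorem aOp_gauss_eq {a : E d → ℝ} {z : ℝ × E d} (hz : 0 < z.1) :
    aOp (symbol GaussClass.gauss 0 0) a z = ∫ y, gauss y * a (z.2 + √z.1 • y) := by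
  rw [integral_mul_comp_affine hz, ← integral_const_mul]
  refine integral_congr_ae (Eventually.of_forall fun y => ?_)
  simp only
  rw [heatKer_mul_symbol .gauss 0 0 hz, add_zero, ← gauss_neg, ← smul_neg, neg_sub, mul_assoc]

variable {T : ℝ} {ψ : ℝ × E d → ℝ} {p : ℝ≥0∞} {Ω : Set (ℝ × E d)}

theorem IsTest.slice_hasCompactSupport (h : IsTest Ω ψ) (r : ℝ) : HasCompactSupport fun y => ψ (r, y) := by
  obtain ⟨R, -, hR⟩ := h.exists_radius
  refine HasCompactSupport.intro (isCompact_closedBall (0 : E d) R) fun y hy => ?_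
  by_contra hne
  exact hy (mem_closedBall_zero_iff.2 (hR (r, y) hne))

theorem IsTest.integrable_mul_memLp (h : IsTest Ω ψ) (hp : 1 ≤ p) {f : ℝ × E d → ℝ}
    (hf : MemLp f p (stripMeasure d T)) : Integrable (fun x => f x * ψ x) (stripMeasure d T) := by
  obtain ⟨A, hA, hb⟩ := exists_lintegral_translate_le (unifLocFinite_stripMeasure T) hp hf h.smooth.continuous h.compact
  refine ⟨hf.1.mul h.smooth.continuous.aestronglyMeasurable, ?_⟩
  have := hb 0
  simp only [add_zero] at this
  exact this.trans_lt hA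

/-- On the diagonal `τ = r` the displaced pairing is the dual heat flow at time `r`; moving the
displacement onto `a` gives the heat operator, slice by slice. -/
theorem integral_initial_eq (hp : 1 ≤ p) {a : E d → ℝ} (ha : MemLp a p) (h : IsTest Ω ψ)
    (hA : MemLp (aOp (symbol GaussClass.gauss 0 0) a) (nE d) (stripMeasure d T)) :
    ∫ o, gauss o.2 * ∫ x, a x.2 * ψ (x + disp o.1 o.1 o.2) ∂initMeasure d
        ∂((volume.restrict (Ioc 0 T)).prod (volume : Measure (E d))) =
      ∫ x, aOp (symbol GaussClass.gauss 0 0) a x * ψ x ∂stripMeasure d T := by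
  have hgi := integrable_gauss_snd (d := d) (volume.restrict (Ioc (0 : ℝ) T))
  have m1 : Measurable fun o : ℝ × E d => disp o.1 o.1 o.2 :=
    (continuous_disp (by fun_prop) (by fun_prop) (by fun_prop)).measurable
  have hvol : UnifLocFinite (volume : Measure (E d)) := fun ρ =>
    ⟨volume (Metric.closedBall (0 : E d) ρ), (isCompact_closedBall _ _).measure_lt_top, fun c => by
      rw [Measure.addHaar_closedBall_center]⟩
  have hi := h.integrable_mul_memLp (T := T) Fact.out hA
  rw [integral_prod _ (integrable_mul_translate unifLocFinite_initMeasure hp (memLp_initMeasure ha)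
    h.smooth.continuous h.compact hgi m1), integral_Ioc_eq_integral_Ioo]
  have e : ∫ x, aOp (symbol GaussClass.gauss 0 0) a x * ψ x ∂stripMeasure d T =
      ∫ r in Ioo 0 T, ∫ y, aOp (symbol GaussClass.gauss 0 0) a (r, y) * ψ (r, y) := by
    rw [stripMeasure_eq] at hi ⊢
    exact integral_prod _ hi
  rw [e]
  refine setIntegral_congr_fun measurableSet_Ioo fun r hr => ?_
  simp only
  have m2 : Measurable fun z : E d => -(√r • z) := (measurable_const_smul _).neg
  have hc : Continuous fun y : E d => ψ (r, y) := h.smooth.continuous.comp (Continuous.prodMk_right r)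
  have key := (integral_translate_comm hvol hp ha hc (h.slice_hasCompactSupport r)
    GaussClass.gauss.integrable m2).2
  have e2 : ∀ z : E d, ∫ x, a x.2 * ψ (x + disp r r z) ∂initMeasure d =
      ∫ y, a y * ψ (r, y + -(√r • z)) := fun z => by
    rw [integral_initMeasure]
    simp [disp]
  simp only [e2]
  rw [key]
  refine integral_congr_ae (Eventually.of_forall fun y => ?_)
  simp only
  rw [aOp_gauss_eq (show 0 < ((r, y) : ℝ × E d).1 from hr.1), mul_comm]
  simp

/-- The substitutions `y = x + √τ z` in space and `s = t - r` in time match the two integrals: `0 <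
r < t`, `r < τ` becomes `0 < s < t`, `t - s < τ`. The minus sign appears because `z` points from
target to source, opposite to the argument of the kernel, and the third derivatives are odd. -/
theorem bOp_third_eq (i j k : Fin d) {F : ℝ × E d → ℝ} (hFm : Measurable F) {x : ℝ × E d} (hx : x ∈ strip d T)
    (hmaj : majOp volume oseenKer (fun p => F p.1) x < ⊤)
    (hint : Integrable (fun o : (ℝ × ℝ) × E d => o.1.2 ^ (-(3 / 2) : ℝ) * pd i (pd j (pd k gauss)) o.2 *
      (strip d T).indicator F (x - disp o.1.1 o.1.2 o.2)) ((volume.restrict (cone T)).prod volume)) :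
    ∫ o, o.1.2 ^ (-(3 / 2) : ℝ) * pd i (pd j (pd k gauss)) o.2 *
      (strip d T).indicator F (x - disp o.1.1 o.1.2 o.2) ∂((volume.restrict (cone T)).prod (volume : Measure (E d))) =
    -bOp (symbol (GaussClass.third i j k) 0 0) F x := by
  set κ : E d → ℝ := pd i (pd j (pd k gauss)) with hκ
  set K : (ℝ × E d) × ℝ → ℝ := fun s => oseenKer x s * symbol (GaussClass.third i j k) 0 0 (oseenPhase x s) * F s.1 with hK
  have hKi : Integrable K volume := symOp_integrable oseenKer_measurable oseenPhase_measurable _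
    (hFm.comp measurable_fst).aestronglyMeasurable hmaj
  set H : ℝ → ℝ → ℝ := fun τ s => ∫ y, K ((s, y), τ) with hH
  have e1 : bOp (symbol (GaussClass.third i j k) 0 0) F x = ∫ τ, ∫ s, H τ s := by
    have h1 : bOp (symbol (GaussClass.third i j k) 0 0) F x = ∫ τ : ℝ, ∫ q : ℝ × E d, K (q, τ) := by
      rw [Measure.volume_eq_prod] at hKi
      exact integral_prod_symm _ hKi
    rw [h1]
    refine integral_congr_ae ?_
    have h2 : ∀ᵐ τ : ℝ, Integrable fun q : ℝ × E d => K (q, τ) := by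
      rw [Measure.volume_eq_prod] at hKi
      exact hKi.prod_left_ae
    filter_upwards [h2] with τ hτ
    rw [Measure.volume_eq_prod] at hτ
    exact integral_prod _ hτ
  set L : ℝ × ℝ → ℝ := (cone T).indicator fun q => ∫ z, q.2 ^ (-(3 / 2) : ℝ) * κ z *
    (strip d T).indicator F (x - disp q.1 q.2 z) with hL
  have hLi : Integrable L := (integrable_indicator_iff measurableSet_cone).2 hint.integral_prod_left
  have e2 : ∫ o, o.1.2 ^ (-(3 / 2) : ℝ) * κ o.2 *
      (strip d T).indicator F (x - disp o.1.1 o.1.2 o.2) ∂((volume.restrict (cone T)).prod (volume : Measure (E d))) =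
      ∫ τ, ∫ r, L (r, τ) := by
    rw [integral_prod _ hint, ← integral_indicator measurableSet_cone]
    rw [Measure.volume_eq_prod] at hLi
    exact integral_prod_symm _ hLi
  rw [e2, e1, ← integral_neg]
  refine integral_congr_ae (Eventually.of_forall fun τ => ?_)
  simp only
  rw [← integral_sub_left_eq_self (fun s => H τ s) volume x.1, ← integral_neg]
  refine integral_congr_ae (Eventually.of_forall fun r => ?_)
  simp only
  have hx1 := hx.1.1
  have hx2 := hx.1.2
  by_cases hr : 0 < r ∧ r < x.1 ∧ r < τ
  · have hτ : 0 < τ := hr.1.trans hr.2.2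
    have hq : (r, τ) ∈ cone T := ⟨⟨hr.1, (hr.2.1.trans hx2).le⟩, hr.2.2⟩
    rw [hL, indicator_of_mem hq, hH]
    have hs : ∀ y : E d, ((x.1 - r, y) : ℝ × E d) ∈ strip d T := fun y =>
      ⟨⟨by simpa using hr.2.1, by simpa using (by linarith : x.1 - r < T)⟩, mem_univ _⟩
    have e3 : ∀ z, τ ^ (-(3 / 2) : ℝ) * κ z * (strip d T).indicator F (x - disp r τ z) =
        τ ^ (-(3 / 2) : ℝ) * (κ z * F (x.1 - r, x.2 + √τ • z)) := fun z => by
      have : x - disp r τ z = (x.1 - r, x.2 + √τ • z) := by simp [disp, Prod.ext_iff]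
      rw [this, indicator_of_mem (hs _), mul_assoc]
    have e4 : ∀ y, K ((x.1 - r, y), τ) = -(τ ^ (-(3 / 2) : ℝ) * (τ ^ (-((d : ℝ) / 2)) *
        (κ ((√τ)⁻¹ • (y - x.2)) * F (x.1 - r, y)))) := fun y => by
      have hc : 0 < (((x.1 - r, y), τ) : (ℝ × E d) × ℝ).1.1 ∧ (((x.1 - r, y), τ) : (ℝ × E d) × ℝ).1.1 < x.1 ∧
          x.1 - (((x.1 - r, y), τ) : (ℝ × E d) × ℝ).1.1 < (((x.1 - r, y), τ) : (ℝ × E d) × ℝ).2 :=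
        ⟨by simpa using hr.2.1, by simpa using hr.1, by simpa using hr.2.2⟩
      rw [hK]
      simp only
      rw [oseenKer_mul_symbol (GaussClass.third i j k) 0 0 hc]
      simp only [pow_zero, smul_zero, add_zero, mul_one]
      rw [show (√τ)⁻¹ • (x.2 - y) = -((√τ)⁻¹ • (y - x.2)) by rw [← smul_neg, neg_sub], third_neg,
        show -(((d : ℝ) + 3) / 2) = -(3 / 2) + -((d : ℝ) / 2) by ring, Real.rpow_add hτ]
      ring
    simp only [e3, e4]
    rw [integral_const_mul, integral_mul_comp_affine hτ x.2 κ fun y => F (x.1 - r, y), integral_neg,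
      integral_const_mul, integral_const_mul, neg_neg]
  · have e5 : H τ (x.1 - r) = 0 := by
      have : ∀ y, K ((x.1 - r, y), τ) = 0 := fun y => by
        rw [hK]
        simp only
        rw [oseenKer, if_neg, zero_mul, zero_mul]
        simp only
        intro hc
        exact hr ⟨by linarith [hc.2.1], by linarith [hc.1], by linarith [hc.2.2]⟩
      rw [hH]
      simp only [this, integral_zero]
    rw [e5, neg_zero, hL]
    by_cases hq : (r, τ) ∈ cone T
    · rw [indicator_of_mem hq]
      have hrx : x.1 ≤ r := by
        by_contra hc
        exact hr ⟨hq.1.1, not_le.1 hc, hq.2⟩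
      have : ∀ z, (strip d T).indicator F (x - disp r τ z) = 0 := fun z => indicator_of_notMem (fun hc => by
        have h1 := hc.1.1
        have h2 : (x - disp r τ z).1 = x.1 - r := rfl
        rw [h2] at h1
        linarith) _
      simp only [this, mul_zero, integral_zero]
    · exact indicator_of_notMem hq _

/-- Extending `F` by zero outside the strip gives access to the translation invariance of Lebesgue
measure, so the displacement passes from `ψ` to `F`. -/
theorem integral_third_eq (hp : 1 ≤ p) {F : ℝ × E d → ℝ} (hFm : Measurable F)
    (hF : MemLp F p (stripMeasure d T)) (h : IsTest (strip d T) ψ) (i j k : Fin d)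
    (hmaj : ∀ᵐ z ∂stripMeasure d T, majOp volume oseenKer (fun p => F p.1) z < ⊤) :
    ∫ o, o.1.2 ^ (-(3 / 2) : ℝ) * pd i (pd j (pd k gauss)) o.2 * ∫ x, F x * ψ (x + disp o.1.1 o.1.2 o.2)
        ∂stripMeasure d T ∂((volume.restrict (cone T)).prod (volume : Measure (E d))) =
      -∫ x, bOp (symbol (GaussClass.third i j k) 0 0) F x * ψ x ∂stripMeasure d T := by
  have hvol : UnifLocFinite (volume : Measure (ℝ × E d)) := fun ρ =>
    ⟨volume (Metric.closedBall (0 : ℝ × E d) ρ), (isCompact_closedBall _ _).measure_lt_top, fun c => by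
      rw [Measure.addHaar_closedBall_center]⟩
  have hw : Integrable (fun o : (ℝ × ℝ) × E d => o.1.2 ^ (-(3 / 2) : ℝ) * pd i (pd j (pd k gauss)) o.2)
      ((volume.restrict (cone T)).prod volume) := integrable_cone_weight.mul_prod (GaussClass.third i j k).integrable
  have hf : MemLp ((strip d T).indicator F) p volume := (memLp_indicator_iff_restrict measurableSet_strip).2 hF
  obtain ⟨hi, key⟩ := integral_translate_comm hvol hp hf h.smooth.continuous h.compact hw measurable_disp_tri
  have e1 : ∀ c, ∫ x, F x * ψ (x + c) ∂stripMeasure d T = ∫ x, (strip d T).indicator F x * ψ (x + c) := fun c => by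
    rw [stripMeasure, ← integral_indicator measurableSet_strip]
    congr 1
    funext x
    by_cases hx : x ∈ strip d T
    · rw [indicator_of_mem hx, indicator_of_mem hx]
    · rw [indicator_of_notMem hx, indicator_of_notMem hx, zero_mul]
  simp only [e1]
  rw [key, ← integral_neg, stripMeasure, ← setIntegral_eq_integral_of_forall_compl_eq_zero (s := strip d T)
    fun x hx => by rw [h.eq_zero hx, zero_mul]]
  refine integral_congr_ae ?_
  have hae : ∀ᵐ x : ℝ × E d, Integrable (fun o : (ℝ × ℝ) × E d => o.1.2 ^ (-(3 / 2) : ℝ) * pd i (pd j (pd k gauss)) o.2 *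
      ((strip d T).indicator F (x - disp o.1.1 o.1.2 o.2) * ψ x)) ((volume.restrict (cone T)).prod volume) :=
    hi.prod_left_ae
  filter_upwards [ae_restrict_of_ae hae, hmaj, ae_restrict_mem measurableSet_strip] with x h1 h2 h3
  -- Fubini yields integrability only of the product with `ψ x`, so points where `ψ` vanishes are
  -- separated before dividing.
  by_cases h0 : ψ x = 0
  · simp [h0]
  · rw [bOp_third_eq i j k hFm h3 h2]
    · ring
    · refine (h1.mul_const (ψ x)⁻¹).congr (Eventually.of_forall fun o => ?_)
      simp only
      field_simp

end

/-! ### Weak solutions of a scalar heat equation are mild. -/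

section

variable {d : ℕ}

open DecaySpace Topology Filter

variable {T : ℝ}

theorem memLp_of_lintegral {f : ℝ × E d → ℝ} (hm : AEStronglyMeasurable f (stripMeasure d T))
    (h : ∫⁻ z in strip d T, ‖f z‖ₑ ^ nR d < ⊤) : MemLp f (nE d) (stripMeasure d T) := by
  refine ⟨hm, (eLpNorm_lt_top_iff_lintegral_rpow_enorm_lt_top nE_ne_zero nE_ne_top).2 ?_⟩
  rwa [nE_toReal]

theorem memLp_bOp (hd : 1 ≤ d) (m : Sym d) {v w : ℝ × E d → ℝ} (hvm : Measurable v) (hwm : Measurable w)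
    (hv : MemLp v (nE d) (stripMeasure d T)) (hw : MemLp w (nE d) (stripMeasure d T)) :
    MemLp (bOp m fun z => v z * w z) (nE d) (stripMeasure d T) := by
  refine memLp_of_lintegral (bOp_stronglyMeasurable m (hvm.mul hwm)).aestronglyMeasurable ?_
  obtain ⟨C, hC, H⟩ := oseenOp_strip_le hd
  have h := H T _ _ hvm.enorm hwm.enorm
  have hm : Measurable (oseenOp ((strip d T).indicator fun w' => ‖v w'‖ₑ * ‖w w'‖ₑ)) :=
    measurable_oseenOp ((hvm.enorm.mul hwm.enorm).indicator measurableSet_strip)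
  have h1 : ∫⁻ z, oseenOp ((strip d T).indicator fun w' => ‖v w'‖ₑ * ‖w w'‖ₑ) z ^ nR d < ⊤ := by
    rw [lt_top_iff_ne_top]
    intro htop
    rw [htop, ENNReal.top_rpow_of_pos (one_div_pos.2 nR_pos)] at h
    refine absurd h (not_le.2 (ENNReal.mul_lt_top hC (ENNReal.mul_lt_top ?_ ?_)))
    · exact ENNReal.rpow_lt_top_of_nonneg (by positivity) (lintegral_lt_top_of_memLp hv).ne
    · exact ENNReal.rpow_lt_top_of_nonneg (by positivity) (lintegral_lt_top_of_memLp hw).ne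
  calc ∫⁻ z in strip d T, ‖bOp m (fun z => v z * w z) z‖ₑ ^ nR d
      ≤ ∫⁻ z in strip d T, ‖m‖ₑ ^ nR d *
          oseenOp ((strip d T).indicator fun w' => ‖v w'‖ₑ * ‖w w'‖ₑ) z ^ nR d := by
        refine setLIntegral_mono' measurableSet_strip fun z hz => ?_
        rw [← ENNReal.mul_rpow_of_nonneg _ _ nR_pos.le]
        refine ENNReal.rpow_le_rpow ?_ nR_pos.le
        have := bOp_enorm_le m (f := fun z => v z * w z) (hvm.mul hwm) hz.1.2.le
        simpa only [enorm_mul] using this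
    _ = ‖m‖ₑ ^ nR d * ∫⁻ z in strip d T, oseenOp ((strip d T).indicator fun w' => ‖v w'‖ₑ * ‖w w'‖ₑ) z ^ nR d :=
        lintegral_const_mul _ (hm.pow_const _)
    _ < ⊤ := by
        refine ENNReal.mul_lt_top (ENNReal.rpow_lt_top_of_nonneg nR_pos.le (by simp)) ?_
        exact (setLIntegral_le_lintegral _ _).trans_lt h1

theorem memLp_aOp (hd : 2 ≤ d) (m : Sym d) {a : E d → ℝ} (ha : Measurable a)
    (haf : ∫⁻ x, ‖a x‖ₑ ^ (d : ℝ) ≠ ⊤) : MemLp (aOp m a) (nE d) (stripMeasure d T) := by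
  refine memLp_of_lintegral (aOp_stronglyMeasurable m ha).aestronglyMeasurable ?_
  obtain ⟨C, hC, H⟩ := heatOp_norm_spacetime_le (d := d) hd
  have h := H _ ha.enorm haf
  have hd0 : (0 : ℝ) < d := by
    have : (2 : ℝ) ≤ d := by exact_mod_cast hd
    linarith
  have hm : Measurable (heatOp fun y => ‖a y‖ₑ) := measurable_heatOp ha.enorm
  calc ∫⁻ z in strip d T, ‖aOp m a z‖ₑ ^ nR d
      ≤ ∫⁻ z in strip d T, ‖m‖ₑ ^ nR d * heatOp (fun y => ‖a y‖ₑ) z ^ nR d := by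
        refine setLIntegral_mono' measurableSet_strip fun z hz => ?_
        rw [← ENNReal.mul_rpow_of_nonneg _ _ nR_pos.le]
        exact ENNReal.rpow_le_rpow (aOp_enorm_le m a hz.1.1) nR_pos.le
    _ = ‖m‖ₑ ^ nR d * ∫⁻ z in strip d T, heatOp (fun y => ‖a y‖ₑ) z ^ nR d :=
        lintegral_const_mul _ (hm.pow_const _)
    _ ≤ ‖m‖ₑ ^ nR d * ∫⁻ z in {z : ℝ × E d | 0 < z.1}, heatOp (fun y => ‖a y‖ₑ) z ^ nR d := by
        gcongr
        exact fun z hz => hz.1.1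
    _ < ⊤ := by
        refine ENNReal.mul_lt_top (ENNReal.rpow_lt_top_of_nonneg nR_pos.le (by simp)) (h.trans_lt ?_)
        exact ENNReal.mul_lt_top (ENNReal.mul_lt_top hC (ENNReal.rpow_lt_top_of_nonneg (by positivity) haf))
          haf.lt_top

theorem holder_half : ENNReal.HolderTriple (nE d) (nE d) (nE d / 2) := ⟨by
  rw [ENNReal.inv_div (by simp) (by simp), ← two_mul, div_eq_mul_inv]⟩

theorem one_le_half : (1 : ℝ≥0∞) ≤ (nE d : ℝ≥0∞) / 2 := by
  rw [ENNReal.le_div_iff_mul_le (by simp) (by simp), one_mul]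
  unfold nE
  exact le_add_self

/-- Weak solutions of a linear heat equation with third-order forcing are mild solutions. -/
theorem mild_of_weak (hd : 1 ≤ d) (hT : 0 < T) {u : ℝ × E d → ℝ} (hu : MemLp u (nE d) (stripMeasure d T))
    {p : ℝ≥0∞} (hp : 1 ≤ p) (hpt : p ≠ ⊤) {a : E d → ℝ} (ha : MemLp a p)
    (hA : MemLp (aOp (symbol GaussClass.gauss 0 0) a) (nE d) (stripMeasure d T))
    {ι : Type*} [Fintype ι] (i j k : ι → Fin d) (c : ι → ℝ) {v w : ι → ℝ × E d → ℝ}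
    (hvm : ∀ l, Measurable (v l)) (hwm : ∀ l, Measurable (w l))
    (hv : ∀ l, MemLp (v l) (nE d) (stripMeasure d T)) (hw : ∀ l, MemLp (w l) (nE d) (stripMeasure d T))
    (H : ∀ ψ : ℝ × E d → ℝ, IsTest (Iio T ×ˢ univ) ψ →
      (∫ z in strip d T, u z * lap (fun z => dt ψ z + lap ψ z) z) -
        (∑ l, c l * ∫ z in strip d T, v l z * w l z * dx (k l) (dx (j l) (dx (i l) ψ)) z) +
        ∫ y, a y * lap ψ (0, y) = 0) :
    ∀ᵐ z ∂stripMeasure d T, u z = aOp (symbol GaussClass.gauss 0 0) a z -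
      ∑ l, c l * bOp (symbol (GaussClass.third (i l) (j l) (k l)) 0 0) (fun x => v l x * w l x) z := by
  have hF : ∀ l, MemLp (fun x => v l x * w l x) (nE d / 2) (stripMeasure d T) := fun l => by
    have := holder_half (d := d)
    exact (hw l).mul' (hv l)
  have hB : ∀ l, MemLp (bOp (symbol (GaussClass.third (i l) (j l) (k l)) 0 0) fun x => v l x * w l x) (nE d)
      (stripMeasure d T) := fun l => memLp_bOp hd _ (hvm l) (hwm l) (hv l) (hw l)
  set B : ι → ℝ × E d → ℝ := fun l => bOp (symbol (GaussClass.third (i l) (j l) (k l)) 0 0) fun x => v l x * w l x with hBdef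
  have hS : MemLp (fun z => ∑ l, c l * B l z) (nE d) (stripMeasure d T) :=
    memLp_finsetSum _ fun l _ => (hB l).const_mul (c l)
  have hμ := unifLocFinite_stripMeasure (d := d) T
  have key : ∀ ψ, IsTest (strip d T) ψ →
      ∫ z, (u z - (aOp (symbol GaussClass.gauss 0 0) a z - ∑ l, c l * B l z)) * ψ z ∂stripMeasure d T = 0 := by
    intro ψ h
    have hχ : IsTest (strip d T) (lap fun z => dt ψ z + lap ψ z) := (h.dt.add h.lap).lap
    have hl : ∀ l, IsTest (strip d T) (dx (k l) (dx (j l) (dx (i l) ψ))) := fun l => ((h.dx _).dx _).dx _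
    -- Averaging the weak identity over translates of `ψ` gives zero for every `n`; the three limits
    -- identify what the terms converge to.
    have t1 := tendsto_pairing_heat hd hT Fact.out nE_ne_top hu h
    have t2 := fun l => (tendsto_pairing_third one_le_half (hF l) h (i l) (j l) (k l)).const_mul (c l)
    have t3 := tendsto_pairing_initial (T := T) hd hp hpt ha h
    have t4 := (t1.sub (tendsto_finsetSum Finset.univ fun l _ => t2 l)).add t3
    rw [integral_initial_eq hp ha h hA] at t4
    have e2 : ∀ l, _ := fun l => integral_third_eq one_le_half ((hvm l).mul (hwm l)) (hF l) h (i l) (j l) (k l)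
      (ae_majOp_oseenKer_lt_top hd (hvm l) (hwm l) (hv l) (hw l))
    have hlim : (∫ x, u x * ψ x ∂stripMeasure d T) - (∑ l, c l * -∫ x, B l x * ψ x ∂stripMeasure d T) +
        -∫ x, aOp (symbol GaussClass.gauss 0 0) a x * ψ x ∂stripMeasure d T = 0 := by
      have e3 : ∀ l, ∫ o, o.1.2 ^ (-(3 / 2) : ℝ) * pd (i l) (pd (j l) (pd (k l) gauss)) o.2 *
          ∫ x, v l x * w l x * ψ (x + disp o.1.1 o.1.2 o.2)
          ∂stripMeasure d T ∂((volume.restrict (cone T)).prod (volume : Measure (E d))) =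
          -∫ x, B l x * ψ x ∂stripMeasure d T := e2
      simp only [e3] at t4
      refine tendsto_nhds_unique t4 (tendsto_const_nhds.congr fun n => ?_)
      have i1 := integrable_mul_translate hμ Fact.out hu hχ.smooth.continuous hχ.compact
        (integrable_gauss_snd (volume.restrict (tri T n))) measurable_disp_tri
      have i2 := fun l => integrable_mul_translate hμ one_le_half (hF l) (hl l).smooth.continuous (hl l).compact
        (integrable_gauss_snd (volume.restrict (tri T n))) measurable_disp_tri
      have i3 := integrable_mul_translate unifLocFinite_initMeasure hp (memLp_initMeasure ha)
        h.lap.smooth.continuous h.lap.compact (integrable_gauss_snd (volume.restrict (tri T n))) measurable_disp_tri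
      have i4 := integrable_finsetSum Finset.univ fun l _ => (i2 l).const_mul (c l)
      simp only [← integral_const_mul (c _)]
      rw [← integral_finsetSum _ fun l _ => (i2 l).const_mul (c l), ← integral_sub i1 i4, ← integral_add]
      · rw [← integral_zero ((ℝ × ℝ) × E d) ℝ (μ := (volume.restrict (tri T n)).prod volume)]
        refine integral_congr_ae ?_
        have hmem : ∀ᵐ o ∂((volume.restrict (tri T n)).prod (volume : Measure (E d))), o.1 ∈ tri T n :=
          Measure.quasiMeasurePreserving_fst.ae (ae_restrict_mem measurableSet_tri)
        filter_upwards [hmem] with o ho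
        set e := disp o.1.1 o.1.2 o.2 with he
        -- The time displacement is nonnegative, so the translate is still supported in `t < T`. It
        -- need not vanish at `t = 0`, which is how the initial value enters.
        have hh := H (fun z => ψ (z + e)) (h.translate ho.1.1.le)
        have e5 : (lap fun z => dt (fun z => ψ (z + e)) z + lap (fun z => ψ (z + e)) z) =
            fun z => lap (fun z => dt ψ z + lap ψ z) (z + e) := by
          rw [dt_translate, lap_translate]
          exact lap_translate (fun z => dt ψ z + lap ψ z) e
        rw [e5] at hh
        simp only [dx_translate, lap_translate] at hh
        rw [integral_initMeasure]
        have hg := congrArg (fun x : ℝ => gauss o.2 * x) hh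
        simp only [mul_zero, mul_add, mul_sub, Finset.mul_sum] at hg
        simp only [stripMeasure]
        refine hg.symm.trans ?_
        congr 2
        refine Finset.sum_congr rfl fun l _ => ?_
        ring
      · exact i1.sub i4
      · exact i3
    have iu := h.integrable_mul_memLp (T := T) Fact.out hu
    have iA := h.integrable_mul_memLp (T := T) Fact.out hA
    have iB := fun l => h.integrable_mul_memLp (T := T) Fact.out (hB l)
    have iS := integrable_finsetSum Finset.univ fun l _ => (iB l).const_mul (c l)
    have e7 : ∀ z, (u z - (aOp (symbol GaussClass.gauss 0 0) a z - ∑ l, c l * B l z)) * ψ z =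
        u z * ψ z + (∑ l, c l * (B l z * ψ z)) - aOp (symbol GaussClass.gauss 0 0) a z * ψ z := fun z => by
      have : ∑ l, c l * (B l z * ψ z) = (∑ l, c l * B l z) * ψ z := by
        rw [Finset.sum_mul]; exact Finset.sum_congr rfl fun l _ => by ring
      rw [this]; ring
    simp only [e7]
    have i8 : Integrable (fun z => u z * ψ z + ∑ l, c l * (B l z * ψ z)) (stripMeasure d T) := iu.add iS
    rw [integral_sub i8 iA, integral_add iu iS, integral_finsetSum _ fun l _ => (iB l).const_mul (c l)]
    simp only [integral_const_mul, mul_neg, Finset.sum_neg_distrib] at hlim ⊢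
    linarith
  have hG : MemLp (fun z => u z - (aOp (symbol GaussClass.gauss 0 0) a z - ∑ l, c l * B l z)) (nE d)
      (stripMeasure d T) := hu.sub (hA.sub hS)
  have hloc : LocallyIntegrableOn (fun z => u z - (aOp (symbol GaussClass.gauss 0 0) a z - ∑ l, c l * B l z))
      (strip d T) volume := by
    have : LocallyIntegrable (fun z => u z - (aOp (symbol GaussClass.gauss 0 0) a z - ∑ l, c l * B l z))
        (stripMeasure d T) := hG.locallyIntegrable Fact.out
    exact locallyIntegrableOn_of_locallyIntegrable_restrict this
  have := isOpen_strip.ae_eq_zero_of_integral_contDiff_smul_eq_zero hloc fun g h1 h2 h3 => by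
    have hk := key g ⟨h1, h2, h3⟩
    rw [stripMeasure, setIntegral_eq_integral_of_forall_compl_eq_zero] at hk
    · rw [← hk]
      congr 1
      funext z
      rw [smul_eq_mul, mul_comm]
    · intro z hz
      rw [(⟨h1, h2, h3⟩ : IsTest (strip d T) g).eq_zero hz, mul_zero]
  rw [stripMeasure, ae_restrict_iff' measurableSet_strip]
  filter_upwards [this] with z hz hzs
  linarith [hz hzs]

end

/-! ### Elimination of the pressure by divergence-free test fields. -/

section

variable {d : ℕ}

open DecaySpace Topology Filter

/-- The vector field with given components. -/
def vec (g : Fin d → ℝ × E d → ℝ) (z : ℝ × E d) : E d := ∑ k, g k z • EuclideanSpace.single k 1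

theorem vec_apply (g : Fin d → ℝ × E d → ℝ) (z : ℝ × E d) (k : Fin d) : vec g z k = g k z := by
  simp [vec, Finset.sum_apply, Pi.single_apply]

theorem isTest_vec {Ω : Set (ℝ × E d)} {g : Fin d → ℝ × E d → ℝ} (h : ∀ k, IsTest Ω (g k)) : IsTest Ω (vec g) := by
  refine IsTest.sum (φ := fun k z => g k z • EuclideanSpace.single k (1 : ℝ)) Finset.univ fun k =>
    ⟨(h k).smooth.smul contDiff_const, (h k).compact.smul_right, ?_⟩
  exact (closure_mono (Function.support_smul_subset_left _ _)).trans (h k).supp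

theorem fderiv_vec {g : Fin d → ℝ × E d → ℝ} (h : ∀ k, Differentiable ℝ (g k)) (z v : ℝ × E d) :
    fderiv ℝ (vec g) z v = vec (fun k z => fderiv ℝ (g k) z v) z := by
  have h1 : HasFDerivAt (vec g)
      (∑ k, (fderiv ℝ (g k) z).smulRight (EuclideanSpace.single k (1 : ℝ) : E d)) z := by
    have := HasFDerivAt.fun_sum (u := Finset.univ) fun k _ =>
      ((h k z).hasFDerivAt.smul_const (EuclideanSpace.single k (1 : ℝ) : E d))
    exact this
  rw [h1.fderiv]
  simp [vec]

theorem dx_vec {g : Fin d → ℝ × E d → ℝ} (h : ∀ k, Differentiable ℝ (g k)) (j : Fin d) :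
    dx j (vec g) = vec fun k => dx j (g k) := funext fun z => fderiv_vec h z _

theorem dt_vec {g : Fin d → ℝ × E d → ℝ} (h : ∀ k, Differentiable ℝ (g k)) :
    dt (vec g) = vec fun k => dt (g k) := funext fun z => fderiv_vec h z _

theorem IsTest.differentiable {Ω : Set (ℝ × E d)} {ψ : ℝ × E d → ℝ} (h : IsTest Ω ψ) : Differentiable ℝ ψ :=
  h.smooth.differentiable (by simp)

section Linearity

variable {Ω : Set (ℝ × E d)} {f f' : ℝ × E d → ℝ}

theorem IsTest.sub {X : Type*} [NormedAddCommGroup X] [NormedSpace ℝ X] {Ω : Set X} {f f' : X → ℝ}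
    (hf : IsTest Ω f) (hf' : IsTest Ω f') : IsTest Ω fun z => f z - f' z :=
  ⟨hf.smooth.sub hf'.smooth, hf.compact.sub hf'.compact,
    (tsupport_sub f f').trans (union_subset hf.supp hf'.supp)⟩

theorem IsTest.dx_add (hf : IsTest Ω f) (hf' : IsTest Ω f') (j : Fin d) :
    NavierStokes.dx j (fun z => f z + f' z) = fun z => NavierStokes.dx j f z + NavierStokes.dx j f' z := by
  funext z
  unfold NavierStokes.dx
  rw [fderiv_fun_add (hf.differentiable z) (hf'.differentiable z)]
  rfl

theorem IsTest.dx_sub (hf : IsTest Ω f) (hf' : IsTest Ω f') (j : Fin d) :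
    NavierStokes.dx j (fun z => f z - f' z) = fun z => NavierStokes.dx j f z - NavierStokes.dx j f' z := by
  funext z
  unfold NavierStokes.dx
  rw [fderiv_fun_sub (hf.differentiable z) (hf'.differentiable z)]
  rfl

theorem IsTest.dt_sub (hf : IsTest Ω f) (hf' : IsTest Ω f') :
    NavierStokes.dt (fun z => f z - f' z) = fun z => NavierStokes.dt f z - NavierStokes.dt f' z := by
  funext z
  unfold NavierStokes.dt
  rw [fderiv_fun_sub (hf.differentiable z) (hf'.differentiable z)]
  rfl

theorem IsTest.dx_sum {g : Fin d → ℝ × E d → ℝ} (h : ∀ l, IsTest Ω (g l)) (j : Fin d) :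
    NavierStokes.dx j (fun z => ∑ l, g l z) = fun z => ∑ l, NavierStokes.dx j (g l) z := by
  funext z
  unfold NavierStokes.dx
  rw [fderiv_fun_sum fun l _ => (h l).differentiable z]
  simp

theorem IsTest.dt_sum {g : Fin d → ℝ × E d → ℝ} (h : ∀ l, IsTest Ω (g l)) :
    NavierStokes.dt (fun z => ∑ l, g l z) = fun z => ∑ l, NavierStokes.dt (g l) z := by
  funext z
  unfold NavierStokes.dt
  rw [fderiv_fun_sum fun l _ => (h l).differentiable z]
  simp

theorem lap_eq (f : ℝ × E d → ℝ) : lap f = fun z => ∑ l, dx l (dx l f) z := rfl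

theorem IsTest.lap_add (hf : IsTest Ω f) (hf' : IsTest Ω f') :
    NavierStokes.lap (fun z => f z + f' z) = fun z => NavierStokes.lap f z + NavierStokes.lap f' z := by
  simp only [lap_eq, ← Finset.sum_add_distrib]
  funext z
  refine Finset.sum_congr rfl fun l _ => ?_
  rw [hf.dx_add hf', (hf.dx l).dx_add (hf'.dx l)]

theorem IsTest.lap_sub (hf : IsTest Ω f) (hf' : IsTest Ω f') :
    NavierStokes.lap (fun z => f z - f' z) = fun z => NavierStokes.lap f z - NavierStokes.lap f' z := by
  simp only [lap_eq, ← Finset.sum_sub_distrib]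
  funext z
  refine Finset.sum_congr rfl fun l _ => ?_
  rw [hf.dx_sub hf', (hf.dx l).dx_sub (hf'.dx l)]

theorem IsTest.dt_lap (hf : IsTest Ω f) : NavierStokes.dt (NavierStokes.lap f) = NavierStokes.lap (NavierStokes.dt f) := by
  rw [lap_eq, lap_eq, IsTest.dt_sum fun l => (hf.dx l).dx l]
  funext z
  refine Finset.sum_congr rfl fun l _ => ?_
  rw [hf.dx_dt, (hf.dx l).dx_dt]

theorem IsTest.dx_lap (hf : IsTest Ω f) (i : Fin d) :
    NavierStokes.dx i (NavierStokes.lap f) = NavierStokes.lap (NavierStokes.dx i f) := by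
  rw [lap_eq, lap_eq, IsTest.dx_sum (fun l => (hf.dx l).dx l) i]
  funext z
  refine Finset.sum_congr rfl fun l _ => ?_
  rw [(hf.dx l).dx_comm i l, hf.dx_comm i l]

end Linearity

theorem lap_vec {Ω : Set (ℝ × E d)} {g : Fin d → ℝ × E d → ℝ} (h : ∀ k, IsTest Ω (g k)) (z : ℝ × E d) (k : Fin d) :
    lap (vec g) z k = lap (g k) z := by
  unfold lap
  have : ∀ j, dx j (dx j (vec g)) = vec fun k => dx j (dx j (g k)) := fun j => by
    rw [dx_vec fun k => (h k).differentiable, dx_vec fun k => ((h k).dx j).differentiable]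
  simp only [this]
  have e : ∀ s : Finset (Fin d), (∑ j ∈ s, vec (fun k => dx j (dx j (g k))) z) k = ∑ j ∈ s, dx j (dx j (g k)) z := fun s => by
    rw [WithLp.ofLp_sum, Finset.sum_apply]
    exact Finset.sum_congr rfl fun j _ => vec_apply _ _ _
  exact e _

section SmallTimes

variable {T : ℝ} {ψ : ℝ × E d → ℝ}

/-- A smooth cutoff vanishing near `t ≤ 0`. -/
def timeCut (n : ℕ) (t : ℝ) : ℝ := Real.smoothTransition ((n + 1) * t - 1)

theorem timeCut_contDiff (n : ℕ) : ContDiff ℝ ∞ (timeCut n) :=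
  Real.smoothTransition.contDiff.comp ((contDiff_const.mul contDiff_id).sub contDiff_const)

theorem timeCut_tendsto {t : ℝ} (ht : 0 < t) : Tendsto (fun n => timeCut n t) atTop (𝓝 1) := by
  refine tendsto_const_nhds.congr' ?_
  filter_upwards [(tendsto_natCast_atTop_atTop (R := ℝ)).eventually_ge_atTop (2 / t)] with n hn
  rw [div_le_iff₀ ht] at hn
  exact (Real.smoothTransition.one_of_one_le (by nlinarith)).symm

theorem norm_timeCut_le (n : ℕ) (t : ℝ) : ‖timeCut n t‖ ≤ 1 := by
  rw [timeCut, Real.norm_of_nonneg (Real.smoothTransition.nonneg _)]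
  exact Real.smoothTransition.le_one _

theorem isTest_timeCut (h : IsTest (Iio T ×ˢ univ) ψ) (n : ℕ) : IsTest (strip d T) fun z => timeCut n z.1 * ψ z := by
  refine ⟨((timeCut_contDiff n).comp contDiff_fst).mul h.smooth, h.compact.mul_left, ?_⟩
  have hcl : IsClosed {z : ℝ × E d | 1 / ((n : ℝ) + 1) ≤ z.1} := isClosed_le continuous_const continuous_fst
  have hsub : tsupport (fun z : ℝ × E d => timeCut n z.1 * ψ z) ⊆ {z : ℝ × E d | 1 / ((n : ℝ) + 1) ≤ z.1} := by
    refine closure_minimal (fun z hz => ?_) hcl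
    by_contra hc
    refine hz ?_
    have hc : z.1 < 1 / ((n : ℝ) + 1) := not_le.1 hc
    rw [lt_div_iff₀ (by positivity)] at hc
    have : timeCut n z.1 = 0 := Real.smoothTransition.zero_of_nonpos (by linarith)
    simp only [this, zero_mul]
  intro z hz
  have h1 : 1 / ((n : ℝ) + 1) ≤ z.1 := hsub hz
  exact ⟨⟨lt_of_lt_of_le (by positivity) h1, (h.supp (tsupport_mul_subset_right hz)).1⟩, mem_univ _⟩

theorem dx_timeCut (h : IsTest (Iio T ×ˢ univ) ψ) (n : ℕ) (j : Fin d) (z : ℝ × E d) :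
    dx j (fun z => timeCut n z.1 * ψ z) z = timeCut n z.1 * dx j ψ z := by
  have e1 := ((isTest_timeCut h n).differentiable z).lineDeriv_eq_fderiv (v := dir j)
  have e2 := (h.differentiable z).lineDeriv_eq_fderiv (v := dir j)
  unfold dx
  rw [← e1, ← e2, lineDeriv, lineDeriv, ← deriv_const_mul_field]
  congr 1
  funext s
  simp [dir]

/-- A divergence-free field is orthogonal to gradients of test functions not vanishing at `t = 0`. -/
theorem div_free_extend {u : ℝ × E d → E d} (hu : ∀ j, MemLp (fun z => u z j) (nE d) (stripMeasure d T))
    (hdiv : ∀ ψ : ℝ × E d → ℝ, IsTest (strip d T) ψ → ∫ z in strip d T, ∑ j, u z j * dx j ψ z = 0)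
    (h : IsTest (Iio T ×ˢ univ) ψ) : ∫ z in strip d T, ∑ j, u z j * dx j ψ z = 0 := by
  have hi : Integrable (fun z => ∑ j, u z j * dx j ψ z) (stripMeasure d T) :=
    integrable_finsetSum _ fun j _ => (h.dx j).integrable_mul_memLp Fact.out (hu j)
  have key := tendsto_integral_of_dominated_convergence (μ := stripMeasure d T)
    (F := fun n z => timeCut n z.1 * ∑ j, u z j * dx j ψ z) (f := fun z => ∑ j, u z j * dx j ψ z)
    (fun z => ‖∑ j, u z j * dx j ψ z‖)
    (fun n => ((timeCut_contDiff n).continuous.comp continuous_fst).aestronglyMeasurable.mul hi.1) hi.norm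
    (fun n => Eventually.of_forall fun z => by
      rw [norm_mul]
      exact mul_le_of_le_one_left (norm_nonneg _) (norm_timeCut_le _ _))
    (by
      filter_upwards [ae_restrict_mem measurableSet_strip] with z hz
      simpa using (timeCut_tendsto hz.1.1).mul_const (∑ j, u z j * dx j ψ z))
  refine tendsto_nhds_unique key (tendsto_const_nhds.congr fun n => ?_)
  rw [← hdiv _ (isTest_timeCut h n), stripMeasure]
  congr 1
  funext z
  rw [Finset.mul_sum]
  refine Finset.sum_congr rfl fun j _ => ?_
  rw [dx_timeCut h]
  ring

end SmallTimes

/-- For every scalar `ψ` the field `Δψ e_i - ∇∂_iψ` is divergence free. In the linear and initial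
terms its gradient part pairs to zero, since `u` and `a` are divergence free; in the quadratic term
third derivatives of `ψ` remain, which encode the Leray projection. -/
theorem IsSolution.scalar_weak {T : ℝ} {a : E d → E d} {u : ℝ × E d → E d} (h : IsSolution T a u)
    {pa : ℝ≥0∞} (hpa : 1 ≤ pa) (ha : MemLp a pa) (hdiv : DivFree a) (i : Fin d) (ψ : ℝ × E d → ℝ)
    (hψ : IsTest (Iio T ×ˢ univ) ψ) :
    (∫ z in strip d T, u z i * lap (fun z => dt ψ z + lap ψ z) z) -
      ((∑ j, ∑ k, ∫ z in strip d T, u z j * u z k * dx k (dx j (dx i ψ)) z) -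
        ∑ k, ∑ l, ∫ z in strip d T, u z i * u z k * dx k (dx l (dx l ψ)) z) +
      ∫ y, a y i * lap ψ (0, y) = 0 := by
  have hu : ∀ j, MemLp (fun z => u z j) (nE d) (stripMeasure d T) := fun j =>
    h.memLp.continuousLinearMap_comp (EuclideanSpace.proj j : E d →L[ℝ] ℝ)
  have haj : ∀ j, MemLp (fun y => a y j) pa := fun j =>
    ha.continuousLinearMap_comp (EuclideanSpace.proj j : E d →L[ℝ] ℝ)
  have huu : ∀ j k, MemLp (fun z => u z j * u z k) (nE d / 2) (stripMeasure d T) := fun j k => by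
    have := holder_half (d := d)
    exact (hu k).mul' (hu j)
  have hχ : IsTest (Iio T ×ˢ univ) fun z => dt ψ z + lap ψ z := hψ.dt.add hψ.lap
  set b : Fin d → ℝ × E d → ℝ := fun k z => if k = i then lap ψ z else 0 with hb
  set g : Fin d → ℝ × E d → ℝ := fun k z => b k z - dx k (dx i ψ) z with hg
  have hbi : b i = lap ψ := by simp [hb]
  have hbk : ∀ k, k ≠ i → b k = fun _ => 0 := fun k hk => by simp [hb, hk]
  have hbt : ∀ k, IsTest (Iio T ×ˢ univ) (b k) := fun k => by
    by_cases hk : k = i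
    · rw [hk, hbi]; exact hψ.lap
    · rw [hbk k hk]; exact IsTest.zero
  have hdd : ∀ k, IsTest (Iio T ×ˢ univ) (dx k (dx i ψ)) := fun k => (hψ.dx i).dx k
  have hgt : ∀ k, IsTest (Iio T ×ˢ univ) (g k) := fun k => (hbt k).sub (hdd k)
  have hb0 : ∀ v z : ℝ × E d, fderiv ℝ (fun _ : ℝ × E d => (0 : ℝ)) z v = 0 := fun v z => by simp
  have hdxg : ∀ j k z, dx j (g k) z = (if k = i then dx j (lap ψ) z else 0) - dx j (dx k (dx i ψ)) z := by
    intro j k z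
    rw [hg]
    simp only [(hbt k).dx_sub (hdd k) j]
    by_cases hk : k = i
    · simp only [hk, hbi, if_true]
    · simp only [hbk k hk, hk, if_false, dx, hb0]
  have hheat : ∀ k z, dt (g k) z + lap (g k) z =
      (if k = i then lap (fun z => dt ψ z + lap ψ z) z else 0) - dx k (dx i fun z => dt ψ z + lap ψ z) z := by
    intro k z
    have hcomm : dx k (dx i fun z => dt ψ z + lap ψ z) z = dt (dx k (dx i ψ)) z + lap (dx k (dx i ψ)) z := by
      rw [hψ.dt.dx_add hψ.lap i, (hψ.dt.dx i).dx_add (hψ.lap.dx i) k, hψ.dx_dt, (hψ.dx i).dx_dt, hψ.dx_lap,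
        (hψ.dx i).dx_lap]
    rw [hcomm, hg]
    simp only [(hbt k).lap_sub (hdd k), (hbt k).dt_sub (hdd k), hψ.dt.lap_add hψ.lap, ← hψ.dt_lap]
    by_cases hk : k = i
    · simp only [hk, hbi, if_true]; ring
    · have z0 : ∀ l, dx l (fun _ : ℝ × E d => (0 : ℝ)) = fun _ => 0 := fun l => funext fun z => hb0 _ z
      simp only [hbk k hk, hk, if_false, lap_eq (fun _ : ℝ × E d => (0 : ℝ)), z0, dt, hb0, Finset.sum_const_zero]
      ring
  have hdivg : ∀ z, ∑ j, dx j (vec g) z j = 0 := fun z => by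
    simp only [dx_vec fun k => (hgt k).differentiable, vec_apply, hdxg, Finset.sum_sub_distrib, Finset.sum_ite_eq',
      Finset.mem_univ, if_true]
    rw [hψ.dx_lap, lap_eq, sub_self]
  have hmom := h.momentum (vec g) (isTest_vec hgt) hdivg
  have hdivu := div_free_extend hu h.div_free (hχ.dx i)
  have hdiva : ∫ y, ∑ k, a y k * dx k (dx i ψ) (0, y) = 0 := by
    have hs : IsTest univ fun y : E d => dx i ψ (0, y) :=
      ⟨(hψ.dx i).smooth.comp (contDiff_const.prodMk contDiff_id), (hψ.dx i).slice_hasCompactSupport 0, subset_univ _⟩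
    refine Eq.trans ?_ (hdiv _ hs)
    congr 1
    funext y
    refine Finset.sum_congr rfl fun k _ => ?_
    congr 1
    have h1 : HasFDerivAt (fun y : E d => ((0 : ℝ), y)) (ContinuousLinearMap.inr ℝ ℝ (E d)) y :=
      (hasFDerivAt_const (0 : ℝ) y).prodMk (hasFDerivAt_id y)
    have h2 := HasFDerivAt.comp (f := fun y : E d => ((0 : ℝ), y)) y ((hψ.dx i).differentiable (0, y)).hasFDerivAt h1
    have h3 : fderiv ℝ (fun y : E d => dx i ψ (0, y)) y = _ := h2.fderiv
    rw [h3]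
    rfl
  have iχ := hχ.lap.integrable_mul_memLp (T := T) Fact.out (hu i)
  have iD : ∀ k, Integrable (fun z => u z k * dx k (dx i fun z => dt ψ z + lap ψ z) z) (stripMeasure d T) := fun k =>
    ((hχ.dx i).dx k).integrable_mul_memLp Fact.out (hu k)
  have iN1 : ∀ j k, Integrable (fun z => u z j * u z k * dx k (dx j (dx i ψ)) z) (stripMeasure d T) := fun j k =>
    (((hψ.dx i).dx j).dx k).integrable_mul_memLp one_le_half (huu j k)
  have iN2 : ∀ k l, Integrable (fun z => u z i * u z k * dx k (dx l (dx l ψ)) z) (stripMeasure d T) := fun k l =>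
    (((hψ.dx l).dx l).dx k).integrable_mul_memLp one_le_half (huu i k)
  have iA : ∀ {φ : ℝ × E d → ℝ}, IsTest (Iio T ×ˢ univ) φ → ∀ k, Integrable fun y => a y k * φ (0, y) := fun {φ} hφ k => by
    obtain ⟨A, hA, hb⟩ := exists_lintegral_translate_le unifLocFinite_initMeasure hpa (memLp_initMeasure (haj k))
      hφ.smooth.continuous hφ.compact
    have hb0 := hb 0
    have hm : AEStronglyMeasurable (fun y => a y k * φ (0, y)) volume :=
      (haj k).1.mul (hφ.smooth.continuous.comp (Continuous.prodMk_right 0)).aestronglyMeasurable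
    refine ⟨hm, ?_⟩
    rw [initMeasure, measurableEmbedding_init.lintegral_map] at hb0
    simp only [add_zero] at hb0
    exact hb0.trans_lt hA
  have e1 : ∫ z in strip d T, (∑ k, u z k * (dt (vec g) z k + lap (vec g) z k) +
        ∑ k, ∑ j, u z k * u z j * dx j (vec g) z k) =
      (∫ z in strip d T, u z i * lap (fun z => dt ψ z + lap ψ z) z) -
        ((∑ j, ∑ k, ∫ z in strip d T, u z j * u z k * dx k (dx j (dx i ψ)) z) -
        ∑ k, ∑ l, ∫ z in strip d T, u z i * u z k * dx k (dx l (dx l ψ)) z) := by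
    have e2 : ∀ z, (∑ k, u z k * (dt (vec g) z k + lap (vec g) z k) +
        ∑ k, ∑ j, u z k * u z j * dx j (vec g) z k) =
        (u z i * lap (fun z => dt ψ z + lap ψ z) z - ∑ k, u z k * dx k (dx i fun z => dt ψ z + lap ψ z) z) -
        ((∑ j, ∑ k, u z j * u z k * dx k (dx j (dx i ψ)) z) - ∑ k, ∑ l, u z i * u z k * dx k (dx l (dx l ψ)) z) := by
      intro z
      simp only [dx_vec fun k => (hgt k).differentiable, dt_vec fun k => (hgt k).differentiable, vec_apply,
        lap_vec hgt, hheat, hdxg, mul_sub, Finset.sum_sub_distrib, mul_ite, mul_zero]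
      have e3 : ∑ k, ∑ j, (if k = i then u z k * u z j * dx j (lap ψ) z else 0) =
          ∑ k, ∑ l, u z i * u z k * dx k (dx l (dx l ψ)) z := by
        rw [Finset.sum_comm]
        refine Finset.sum_congr rfl fun k _ => ?_
        rw [Finset.sum_ite_eq' Finset.univ i, if_pos (Finset.mem_univ _), ← Finset.mul_sum]
        congr 1
        rw [lap_eq, IsTest.dx_sum (fun l => (hψ.dx l).dx l) k]
      rw [e3, Finset.sum_ite_eq' Finset.univ i, if_pos (Finset.mem_univ _)]
      ring
    have hdivu' : ∫ z in strip d T, ∑ k, u z k * dx k (dx i fun z => dt ψ z + lap ψ z) z = 0 := hdivu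
    have i1 : Integrable (fun z => ∑ k, u z k * dx k (dx i fun z => dt ψ z + lap ψ z) z) (volume.restrict (strip d T)) :=
      integrable_finsetSum _ fun k _ => iD k
    have i2 : Integrable (fun z => ∑ j, ∑ k, u z j * u z k * dx k (dx j (dx i ψ)) z) (volume.restrict (strip d T)) :=
      integrable_finsetSum _ fun j _ => integrable_finsetSum _ fun k _ => iN1 j k
    have i3 : Integrable (fun z => ∑ k, ∑ l, u z i * u z k * dx k (dx l (dx l ψ)) z) (volume.restrict (strip d T)) :=
      integrable_finsetSum _ fun j _ => integrable_finsetSum _ fun k _ => iN2 j k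
    have i4 : Integrable (fun z => u z i * lap (fun z => dt ψ z + lap ψ z) z -
        ∑ k, u z k * dx k (dx i fun z => dt ψ z + lap ψ z) z) (volume.restrict (strip d T)) := iχ.sub i1
    have i5 : Integrable (fun z => (∑ j, ∑ k, u z j * u z k * dx k (dx j (dx i ψ)) z) -
        ∑ k, ∑ l, u z i * u z k * dx k (dx l (dx l ψ)) z) (volume.restrict (strip d T)) := i2.sub i3
    simp only [e2]
    rw [integral_sub i4 i5, integral_sub iχ i1, hdivu', sub_zero, integral_sub i2 i3,
      integral_finsetSum _ fun j _ => integrable_finsetSum _ fun k _ => iN1 j k,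
      integral_finsetSum _ fun j _ => integrable_finsetSum _ fun k _ => iN2 j k]
    congr 2
    · exact Finset.sum_congr rfl fun j _ => integral_finsetSum _ fun k _ => iN1 j k
    · exact Finset.sum_congr rfl fun j _ => integral_finsetSum _ fun k _ => iN2 j k
  have e5 : ∫ y, ∑ k, a y k * vec g (0, y) k = ∫ y, a y i * lap ψ (0, y) := by
    have e6 : ∀ y, ∑ k, a y k * vec g (0, y) k = a y i * lap ψ (0, y) - ∑ k, a y k * dx k (dx i ψ) (0, y) := fun y => by
      simp only [vec_apply, hg, hb, mul_sub, Finset.sum_sub_distrib, mul_ite, mul_zero]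
      rw [Finset.sum_ite_eq' Finset.univ i, if_pos (Finset.mem_univ _)]
    simp only [e6]
    rw [integral_sub (iA hψ.lap i) (integrable_finsetSum _ fun k _ => iA ((hψ.dx i).dx k) k), hdiva, sub_zero]
  rw [e1, e5] at hmom
  exact hmom

end

/-! ### Identification of weak and mild solutions, and the conclusion. -/

section

variable {d : ℕ}

open DecaySpace Topology Filter

theorem IsSolution.congr {T : ℝ} {a b : E d → E d} {u v : ℝ × E d → E d} (h : IsSolution T a u)
    (ha : a =ᵐ[volume] b) (hu : u =ᵐ[stripMeasure d T] v) : IsSolution T b v := by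
  refine ⟨(memLp_congr_ae hu).1 h.memLp, fun ψ hψ => ?_, fun φ hφ hdiv => ?_⟩
  · rw [← h.div_free ψ hψ]
    refine integral_congr_ae ?_
    filter_upwards [hu] with z hz
    rw [hz]
  · refine Eq.trans ?_ (h.momentum φ hφ hdiv)
    congr 1
    · refine integral_congr_ae ?_
      filter_upwards [hu] with z hz
      rw [hz]
    · refine integral_congr_ae ?_
      filter_upwards [ha] with z hz
      rw [hz]

theorem DivFree.congr {a b : E d → E d} (h : DivFree a) (ha : a =ᵐ[volume] b) : DivFree b := fun ψ hψ => by
  rw [← h ψ hψ]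
  refine integral_congr_ae ?_
  filter_upwards [ha] with z hz
  rw [hz]

theorem IsSolution.memLp_apply {T : ℝ} {a : E d → E d} {u : ℝ × E d → E d} (h : IsSolution T a u) (j : Fin d) :
    MemLp (fun z => u z j) (nE d) (stripMeasure d T) :=
  h.memLp.continuousLinearMap_comp (EuclideanSpace.proj j : E d →L[ℝ] ℝ)

theorem measurable_apply {A : Type*} [MeasurableSpace A] {u : A → E d} (hu : Measurable u) (j : Fin d) :
    Measurable fun z => u z j :=
  (EuclideanSpace.proj j : E d →L[ℝ] ℝ).continuous.measurable.comp hu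

/-- Weak solutions of the Navier-Stokes equations are mild solutions. -/
theorem IsSolution.mild (hd : 2 ≤ d) {T : ℝ} (hT : 0 < T) {a : E d → E d} {u : ℝ × E d → E d}
    (h : IsSolution T a u) (ham : Measurable a) (ha : MemLp a (d : ℝ≥0∞)) (hdiv : DivFree a)
    (hum : Measurable u) (i : Fin d) :
    ∀ᵐ z ∂stripMeasure d T, u z i = aOp (symbol GaussClass.gauss 0 0) (fun y => a y i) z -
      duhamel 0 (fun j z => u z j) i z := by
  have hd0 : (d : ℝ≥0∞) ≠ 0 := by simp; omega
  have hd1 : (1 : ℝ≥0∞) ≤ d := by exact_mod_cast (by omega : 1 ≤ d)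
  have hai : MemLp (fun y => a y i) (d : ℝ≥0∞) :=
    ha.continuousLinearMap_comp (EuclideanSpace.proj i : E d →L[ℝ] ℝ)
  have haf : ∫⁻ x, ‖a x i‖ₑ ^ (d : ℝ) ≠ ⊤ := by
    have := lintegral_rpow_enorm_lt_top_of_eLpNorm_lt_top hd0 (by simp) hai.2
    rw [ENNReal.toReal_natCast] at this
    exact this.ne
  have hm := measurable_apply hum
  -- The left summand of the index type carries `∂_i∂_j∂_k` with `u_j u_k` for the pair `(j, k)`;
  -- the right one carries `∂_l∂_l∂_k` with `u_i u_k` and coefficient `-1` for the pair `(k, l)`.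
  have key := mild_of_weak (by omega) hT (h.memLp_apply i) hd1 (by simp) hai
    (memLp_aOp hd _ (measurable_apply ham i) haf)
    (Sum.elim (fun _ => i) fun q => q.2) (Sum.elim (fun q => q.1) fun q => q.2)
    (Sum.elim (fun q => q.2) fun q => q.1 : (Fin d × Fin d) ⊕ (Fin d × Fin d) → Fin d)
    (Sum.elim (fun _ => 1) fun _ => -1)
    (v := fun l z => u z (Sum.elim (fun q => q.1) (fun _ => i) l))
    (w := fun l z => u z (Sum.elim (fun q => q.2) (fun q => q.1) l))
    (fun l => hm _) (fun l => hm _) (fun l => h.memLp_apply _) (fun l => h.memLp_apply _) (fun ψ hψ => by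
      have := h.scalar_weak hd1 ha hdiv i ψ hψ
      simp only [Fintype.sum_sum_type, Sum.elim_inl, Sum.elim_inr, Fintype.sum_prod_type, one_mul, neg_one_mul,
        Finset.sum_neg_distrib, ← sub_eq_add_neg]
      exact this)
  filter_upwards [key] with z hz
  rw [hz, duhamel]
  simp only [Fintype.sum_sum_type, Sum.elim_inl, Sum.elim_inr, Fintype.sum_prod_type, one_mul, neg_one_mul,
    Finset.sum_neg_distrib, ← sub_eq_add_neg]

/-- In one space dimension divergence-free fields of class `L^3` vanish. -/
theorem IsSolution.eq_zero_of_one {T : ℝ} (hT : 0 < T) {a : E 1 → E 1} {u : ℝ × E 1 → E 1}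
    (h : IsSolution T a u) : ∀ᵐ z ∂stripMeasure 1 T, ∀ i, u z i = 0 := by
  have hA : aOp (symbol GaussClass.gauss 0 0) (fun _ : E 1 => 0) = fun _ => 0 := by
    funext z; simp [aOp, symOp]
  -- In one dimension the divergence condition tested with `∂_x` of the heat expression already is
  -- the weak equation with zero data and no forcing, so the mild representation forces `u = 0`.
  have key := mild_of_weak (d := 1) le_rfl hT (h.memLp_apply 0) le_rfl ENNReal.one_ne_top
    (a := fun _ => 0) MemLp.zero' (by rw [hA]; exact MemLp.zero')
    (ι := Empty) (fun _ => 0) (fun _ => 0) (fun _ => 0) (fun _ => 0)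
    (v := fun _ _ => 0) (w := fun _ _ => 0) (fun l => l.elim) (fun l => l.elim) (fun l => l.elim) (fun l => l.elim)
    (fun ψ hψ => by
      have := div_free_extend h.memLp_apply h.div_free ((hψ.dt.add hψ.lap).dx 0)
      simpa [lap_eq (fun z => dt ψ z + lap ψ z)] using this)
  filter_upwards [key] with z hz i
  rw [Subsingleton.elim i 0, hz, hA]
  simp

/-- The solution vanishes, so the regularity statement is applied to the zero field. The lifespan
`1` is the length of the strip on which the spaces are defined. -/
theorem lower_dimensional_case {n : ℕ} {a : E 1 → E 1} {p q : ℝ≥0∞} (hp : ((1 : ℕ) : ℝ≥0∞) + 2 ≤ p)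
    (hq : q ∈ Icc ((1 : ℕ) : ℝ≥0∞) (((1 : ℕ) : ℝ≥0∞) + 2)) (hpq : 2 / p + ((1 : ℕ) : ℝ≥0∞) / q = 1)
    {T : ℝ} (hT : 0 < T) {u : ℝ × E 1 → E 1} (h : IsSolution T a u) :
    ∃ w : (k : ℕ) → ℝ × E 1 → Tensor 1 k, (∀ k ≤ n, IsWeakGrad (min 1 T) k u (w k)) ∧
      ∑ k ∈ Finset.range (n + 1), mixedNorm q p (min 1 T) (fun z => z.1 ^ ((k : ℝ) / 2) • w k z) < ⊤ := by
  have hd1 : (1 : ℝ) ≤ ((1 : ℕ) : ℝ) := by simp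
  refine exists_weakGrad le_rfl (hd1 := hd1) (n := n) (U := 0) (Y := fun _ => 0) contDiffAt_const ?_
    (min_le_left _ _) ?_ hp hq hpq
  · refine Eventually.of_forall fun ζ i => ?_
    have h1 : fn ((0 : Fin 1 → CritSpace 1 (1 : ℕ) hd1) i) =ᵐ[stripMeasure 1 1] 0 := fn_zero
    have h2 : fn ((0 : VecSpace 1) i) =ᵐ[stripMeasure 1 1] 0 := fn_zero
    have h3 := (shear_measurePreserving_strip ζ 1).quasiMeasurePreserving.ae h2
    filter_upwards [h1, h3] with z hz1 hz3
    rw [hz1]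
    exact hz3.symm
  · have h2 : ∀ᵐ z ∂stripMeasure 1 (min 1 T), ∀ i, fn ((0 : VecSpace 1) i) z = 0 :=
      ae_mono (stripMeasure_mono (min_le_left _ _)) (ae_all_iff.2 fun i => fn_zero)
    have h3 := ae_mono (stripMeasure_mono (min_le_right 1 T)) (h.eq_zero_of_one hT)
    filter_upwards [h2, h3] with z hz2 hz3 i
    rw [hz3, hz2]

/-- The constructed solution depends only on `a`. On `(0, min δ T)` a given weak solution satisfies
the same mild equation, so uniqueness transfers the smooth dependence on shifts to it. -/
theorem exists_smoothing_time (hd : 2 ≤ d) {a : E d → E d} (ha : MemLp a (d : ℝ≥0∞)) (hdiv : DivFree a) {n : ℕ}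
    (hn : 1 ≤ n) {p q : ℝ≥0∞} (hp : (d : ℝ≥0∞) + 2 ≤ p) (hq : q ∈ Icc (d : ℝ≥0∞) ((d : ℝ≥0∞) + 2))
    (hpq : 2 / p + (d : ℝ≥0∞) / q = 1) :
    ∃ δ : ℝ, 0 < δ ∧ ∀ (T : ℝ) (u : ℝ × E d → E d), 0 < T → IsSolution T a u →
      ∃ w : (k : ℕ) → ℝ × E d → Tensor d k, (∀ k ≤ n, IsWeakGrad (min δ T) k u (w k)) ∧
        ∑ k ∈ Finset.range (n + 1), mixedNorm q p (min δ T) (fun z => z.1 ^ ((k : ℝ) / 2) • w k z) < ⊤ := by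
  have hd1 : (1 : ℝ) ≤ d := by exact_mod_cast (by omega : 1 ≤ d)
  have hd0 : (d : ℝ≥0∞) ≠ 0 := by simp; omega
  set b := ha.1.mk a with hb
  have hbm : Measurable b := ha.1.stronglyMeasurable_mk.measurable
  have hab : a =ᵐ[volume] b := ha.1.ae_eq_mk
  have hbL : MemLp b (d : ℝ≥0∞) := (memLp_congr_ae hab).1 ha
  have hbf : ∫⁻ x, ‖b x‖ₑ ^ (d : ℝ) ≠ ⊤ := by
    have := lintegral_rpow_enorm_lt_top_of_eLpNorm_lt_top hd0 (by simp) hbL.2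
    rw [ENNReal.toReal_natCast] at this
    exact this.ne
  obtain ⟨δ, hδ, hδ1, U, Y, hY, hYU, hU⟩ := exists_mild_solution hd hd1 hbm hbf (n := n) (by omega)
  refine ⟨δ, hδ, fun T u hT hu => ?_⟩
  set v := hu.memLp.1.mk u with hv
  have hvm : Measurable v := hu.memLp.1.stronglyMeasurable_mk.measurable
  have huv : u =ᵐ[stripMeasure d T] v := hu.memLp.1.ae_eq_mk
  have hvS : IsSolution T b v := hu.congr hab huv
  have hle1 : min δ T ≤ 1 := (min_le_left _ _).trans hδ1
  have heq := mild_unique (d := d) (by omega) (δ := min δ T) (u := fun j z => v z j) (v := fun j => fn (U j))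
    (measurable_apply hvm) (fun j => measurable_fn _)
    (fun j => (hvS.memLp_apply j).mono_measure (stripMeasure_mono (min_le_right _ _)))
    (fun j => (memLp_fn _).mono_measure (stripMeasure_mono hle1)) (fun i => by
      filter_upwards [ae_mono (stripMeasure_mono (min_le_right δ T)) (hvS.mild hd hT hbm hbL (hdiv.congr hab) hvm i),
        ae_mono (stripMeasure_mono hle1) (hU i), ae_restrict_mem measurableSet_strip] with z h1 h2 h3
      rw [h1, h2, aCut, if_pos (lt_of_lt_of_le h3.1.2 (min_le_left _ _))]
      ring)
  refine exists_weakGrad (by omega) hY hYU hle1 ?_ hp hq hpq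
  filter_upwards [heq, ae_mono (stripMeasure_mono (min_le_right δ T)) huv] with z h1 h2 i
  rw [h2]
  exact h1 i

end

end NavierStokes

end

theorem lemma1 (d : ℕ) (hd : 1 ≤ d)
    (a : NavierStokes.E d → NavierStokes.E d)
    (ha : MemLp a (d : ℝ≥0∞) volume) (hdiv : NavierStokes.DivFree a)
    (n : ℕ) (hn : 1 ≤ n)
    (p q : ℝ≥0∞) (hp : (d : ℝ≥0∞) + 2 ≤ p)
    (hq : q ∈ Icc (d : ℝ≥0∞) ((d : ℝ≥0∞) + 2))
    (hpq : 2 / p + (d : ℝ≥0∞) / q = 1) :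
    ∃ δ : ℝ, 0 < δ ∧
      ∀ (T : ℝ) (u : ℝ × NavierStokes.E d → NavierStokes.E d), 0 < T →
        NavierStokes.IsSolution T a u →
        ∃ w : (k : ℕ) → ℝ × NavierStokes.E d → NavierStokes.Tensor d k,
          (∀ k ≤ n, NavierStokes.IsWeakGrad (min δ T) k u (w k)) ∧
          ∑ k ∈ Finset.range (n + 1),
            NavierStokes.mixedNorm q p (min δ T)
              (fun z => z.1 ^ ((k : ℝ) / 2) • w k z) < ⊤ := by
  -- The heat estimate in space-time uses the conjugate exponent `d/(d-1)` and needs `d ≥ 2`.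
  rcases hd.eq_or_lt with rfl | hd2
  · exact ⟨1, one_pos, fun T u hT hu => NavierStokes.lower_dimensional_case hp hq hpq hT hu⟩
  · exact NavierStokes.exists_smoothing_time hd2 ha hdiv hn hp hq hpq
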